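/- Let $\mathbb F$ be an algebraically closed field of characteristic $p\neq 2$, let $\ell\ge 1$ and $d\ge 0$ be integers with $d<p$ or $p=0$, and let $J=\{0,1,\dots,\ell-1\}$. Let ${\sf A}_\ell$ be the path algebra over $\mathbb F$ of the quiver with vertex set $J$, a loop ${\sf u}$ at the vertex $0$, and arrows ${\sf a}^{k+1,k}\colon k\to k+1$ and ${\sf a}^{k,k+1}\colon k+1\to k$ for $0\le k\le \ell-2$ (paths are composed from right to left; ${\sf e}_j$ is the path of length $0$ at $j$), modulo the relations: all paths of length three are zero; all paths of length two that are not cycles are zero; all cycles of length two based at the same vertex $i\in\{1,\dots,\ell-2\}$ are equal; ${\sf u}^2={\sf a}^{0,1}{\sf a}^{1,0}$ if $\ell\ge2$. It is a superalgebra with ${\sf u}$ odd and all other generators even. Let $L_j$ be the ${\sf A}_\ell$-supermodule spanned by one even vector $v_j$ with ${\sf e}_jv_j=v_j$ on which all other generators act as $0$, and let $P_j={\sf A}_\ell{\sf e}_j$. For $n\ge0$ let ${\sf W}_n={\sf A}_\ell\wr\mathfrak S_n$ be the wreath superproduct: ${\sf W}_n={\sf A}_\ell^{\otimes n}\otimes\mathbb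 F\mathfrak S_n$ as a superspace ($\mathfrak S_n$ is even), ${\sf A}_\ell^{\otimes n}$ (the tensor product of superalgebras) and $\mathbb F\mathfrak S_n$ are subalgebras, and $w z={}^{w}z\,w$ for $w\in\mathfrak S_n$, $z\in{\sf A}_\ell^{\otimes n}$, where ${}^w(z_1\otimes\dots\otimes z_n)=(-1)^{\sum_{a<c,\,w(a)>w(c)}|z_a||z_c|}z_{w^{-1}(1)}\otimes\dots\otimes z_{w^{-1}(n)}$. For an ${\sf A}_\ell$-supermodule $V$ and a partition $\lambda$ of $n$ with Specht module $S^\lambda$ over $\mathbb F$, let $V(\lambda)=V^{\otimes n}\otimes S^\lambda$, a ${\sf W}_n$-supermodule via $z(v\otimes y)=zv\otimes y$ and $w(v\otimes y)={}^wv\otimes wy$. For ${\sf W}_{\delta_i}$-supermodules $M_i$ with $\sum_i\delta_i=d$ let $M_1\circ\dots\circ M_k$ be the supermodule induced from the parabolic subalgebra ${\sf W}_{\delta_1}\otimes\dots\otimes{\sf W}_{\delta_k}\subseteq{\sf W}_d$ to ${\sf W}_d$ of $M_1\boxtimes\dots\boxtimes M_k$. For a $J$-multipartition $\boldsymbol\lambda=(\lambda^{(0)},\dots,\lambda^{(\ell-1)})$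 of $d$ put $$L(\boldsymbol\lambda)=L_0(\lambda^{(0)})\circ\dots\circ L_{\ell-1}(\lambda^{(\ell-1)}),\qquad P(\boldsymbol\lambda)=P_0(\lambda^{(0)})\circ\dots\circ P_{\ell-1}(\lambda^{(\ell-1)}).$$ For a supermodule $V$ and an irreducible supermodule $L$, let $[V:L]$ be the number of factors isomorphic to $L$, by a not necessarily even isomorphism, in a composition series of $V$ by subsupermodules. Let $c^{\lambda}_{\mu_1,\dots,\mu_k}$ be the Littlewood--Richardson coefficient, that is, the multiplicity of $S^{\mu_1}\boxtimes\dots\boxtimes S^{\mu_k}$ in the restriction of $S^\lambda$ to $\mathfrak S_{|\mu_1|}\times\dots\times\mathfrak S_{|\mu_k|}$ over $\mathbb C$ if $|\lambda|=\sum_i|\mu_i|$, and $0$ otherwise. Then for all $J$-multipartitions $\boldsymbol\lambda,\boldsymbol\mu$ of $d$, $$[P(\boldsymbol\lambda):L(\boldsymbol\mu)]=\sum\prod_{j\in J}c^{\mu^{(j)}}_{\alpha^{(j)},\beta^{(j+1)},\gamma^{(j-1)},\delta^{(j)}}\;c^{\lambda^{(j)}}_{\alpha^{(j)},\beta^{(j)},\gamma^{(j)},\delta^{(j)}},$$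 where the sum is over all partitions $\alpha^{(i)},\beta^{(i)},\gamma^{(i)},\delta^{(i)}$ with $i\in J$ such that $\gamma^{(\ell-1)}=\varnothing$, and where $\beta^{(\ell)}=\varnothing$ and $\gamma^{(-1)}$ is the conjugate partition of $\beta^{(0)}$. (In particular $P(\boldsymbol\lambda)$ has a composition series, and the number is the same for each of them. For $\ell=1$ the formula reads $\sum_{\alpha,\beta,\delta}c^{\mu}_{\alpha,\beta',\delta}\,c^{\lambda}_{\alpha,\beta,\delta}$.) -/

import Mathlib

open scoped TensorProduct BigOperators

set_option linter.unusedSectionVars false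

noncomputable section

namespace WreathSuper

/-! ### Superspaces, superalgebras, supermodules -/

/-- A `ℤ/2`-grading `V = V₀ ⊕ V₁` on a vector space, given by the projections `proj 0`, `proj 1`
onto the two summands; the homogeneous component of parity `i` is `{v | proj i v = v}`. -/
class SuperSpace (F V : Type*) [Field F] [AddCommGroup V] [Module F V] where
  proj : ZMod 2 → V →ₗ[F] V
  proj_proj : ∀ i j v, proj i (proj j v) = if i = j then proj j v else 0
  proj_add : ∀ v, proj 0 v + proj 1 v = v

section Basic

variable (F : Type*) [Field F]

/-- The projection onto the homogeneous component of parity `i`. -/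
abbrev pr {V : Type*} [AddCommGroup V] [Module F V] [SuperSpace F V] (i : ZMod 2) : V →ₗ[F] V :=
  SuperSpace.proj i

/-- The sign `(-1)^x`. -/
def sg (x : ZMod 2) : F := if x = 0 then 1 else -1

/-- A superalgebra: the product of elements of parities `i` and `j` has parity `i + j`. -/
class SuperAlgebra (A : Type*) [Ring A] [Algebra F A] extends SuperSpace F A where
  proj_mul : ∀ i (a b : A),
    proj i (a * b) = proj 0 a * proj i b + proj 1 a * proj (i + 1) b

/-- A supermodule over a superalgebra: if `a` has parity `i` and `v` has parity `j`, then `a • v`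
has parity `i + j`. -/
class SuperModule (A V : Type*) [Ring A] [Algebra F A] [SuperAlgebra F A]
    [AddCommGroup V] [Module F V] [Module A V] [IsScalarTower F A V] [SuperSpace F V] :
    Prop where
  proj_smul : ∀ i (a : A) (v : V),
    pr F i (a • v) = pr F 0 a • pr F i v + pr F 1 a • pr F (i + 1) v

variable {F}

lemma sg_add (x y : ZMod 2) : sg F (x + y) = sg F x * sg F y := by
  have h : (1 + 1 : ZMod 2) = 0 := rfl
  rcases (show x = 0 ∨ x = 1 by revert x; decide) with rfl | rfl <;>
    rcases (show y = 0 ∨ y = 1 by revert y; decide) with rfl | rfl <;> simp [sg, h]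

@[simp] lemma sg_zero : sg F 0 = 1 := by simp [sg]

section
variable {V : Type*} [AddCommGroup V] [Module F V] [SuperSpace F V]

lemma pr_pr (i j : ZMod 2) (v : V) : pr F i (pr F j v) = if i = j then pr F j v else 0 :=
  SuperSpace.proj_proj i j v

lemma sum_zmod {M : Type*} [AddCommMonoid M] (f : ZMod 2 → M) : ∑ i, f i = f 0 + f 1 :=
  Fin.sum_univ_two f

lemma sum_pr (v : V) : ∑ i : ZMod 2, pr F i v = v := by
  rw [sum_zmod]; exact SuperSpace.proj_add v

lemma pr_of_homog {i : ZMod 2} {v : V} (h : pr F i v = v) (j : ZMod 2) :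
    pr F j v = if j = i then v else 0 := by
  rw [← h, pr_pr]

end

lemma zmod_cases (i : ZMod 2) : i = 0 ∨ i = 1 := by
  revert i; decide

section
variable {A : Type*} [Ring A] [Algebra F A] [SuperAlgebra F A]
  {V : Type*} [AddCommGroup V] [Module F V] [Module A V] [IsScalarTower F A V] [SuperSpace F V]

instance : SuperModule F A A := ⟨SuperAlgebra.proj_mul⟩

lemma smul_homog [SuperModule F A V] {i j : ZMod 2} {a : A} {v : V}
    (ha : pr F i a = a) (hv : pr F j v = v) : pr F (i + j) (a • v) = a • v := by
  rw [SuperModule.proj_smul (F := F), pr_of_homog ha, pr_of_homog ha, pr_of_homog hv,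
    pr_of_homog hv]
  rcases zmod_cases i with rfl | rfl <;> rcases zmod_cases j with rfl | rfl <;> simp <;>
    simp [show (1 + 1 : ZMod 2) = 0 from rfl]

/-- It is enough to check the compatibility of a bilinear map with gradings on homogeneous
elements. -/
lemma proj_bilin {U V X : Type*} [AddCommGroup U] [Module F U] [SuperSpace F U]
    [AddCommGroup V] [Module F V] [SuperSpace F V]
    [AddCommGroup X] [Module F X] [SuperSpace F X] (m : U →ₗ[F] V →ₗ[F] X)
    (h : ∀ (i j : ZMod 2) (a : U) (v : V), pr F i a = a → pr F j v = v →
      pr F (i + j) (m a v) = m a v) (k : ZMod 2) (a : U) (v : V) :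
    pr F k (m a v) = m (pr F 0 a) (pr F k v) + m (pr F 1 a) (pr F (k + 1) v) := by
  have key : ∀ i j, pr F k (m (pr F i a) (pr F j v)) =
      if k = i + j then m (pr F i a) (pr F j v) else 0 := fun i j =>
    pr_of_homog (h i j _ _ (by simp [pr_pr]) (by simp [pr_pr])) k
  have ha := sum_pr (F := F) a
  have hv := sum_pr (F := F) v
  rw [sum_zmod] at ha hv
  conv_lhs => rw [← ha, ← hv]
  simp only [map_add, LinearMap.add_apply]
  have e := key 0 0
  have e1 := key 0 1
  have e2 := key 1 0
  have e3 := key 1 1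
  rcases zmod_cases k with rfl | rfl
  · simp [show (1 + 1 : ZMod 2) = 0 from rfl] at e e1 e2 e3 ⊢
    simp [e, e1, e2, e3]
  · simp [show (1 + 1 : ZMod 2) = 0 from rfl] at e e1 e2 e3 ⊢
    simp [e, e1, e2, e3, add_comm]

lemma superModule_of_homog
    (h : ∀ (i j : ZMod 2) (a : A) (v : V), pr F i a = a → pr F j v = v →
      pr F (i + j) (a • v) = a • v) : SuperModule F A V where
  proj_smul k a v := proj_bilin
    (Algebra.lsmul F F V : A →ₐ[F] Module.End F V).toLinearMap h k a v

end

end Basic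

/-! ### Tensor products of superspaces -/

section Tensor

variable {F : Type*} [Field F]

section Dep

variable {ι : Type*} [Fintype ι] [DecidableEq ι] {s : ι → Type*} [∀ i, AddCommGroup (s i)]
  [∀ i, Module F (s i)] [∀ i, SuperSpace F (s i)]

/-- The projection of a tensor product of superspaces onto the span of the pure tensors `⨂ vᵢ`
with `|vᵢ| = x i`. -/
def prT (x : ι → ZMod 2) : (⨂[F] i, s i) →ₗ[F] ⨂[F] i, s i :=
  PiTensorProduct.map fun i => pr F (x i)

lemma prT_homog {x : ι → ZMod 2} {v : ∀ i, s i} (h : ∀ i, pr F (x i) (v i) = v i)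
    (y : ι → ZMod 2) :
    prT y (PiTensorProduct.tprod F v) = if y = x then PiTensorProduct.tprod F v else 0 := by
  rw [prT, PiTensorProduct.map_tprod]
  split_ifs with hy
  · subst hy; simp only [h]
  · obtain ⟨i, hi⟩ := Function.ne_iff.1 hy
    refine MultilinearMap.map_coord_zero _ i ?_
    rw [pr_of_homog (h i), if_neg hi]

lemma tprod_eq_sum (v : ∀ i, s i) :
    PiTensorProduct.tprod F v =
      ∑ x : ι → ZMod 2, PiTensorProduct.tprod F fun i => pr F (x i) (v i) := by
  have h := MultilinearMap.map_sum (PiTensorProduct.tprod F) fun i (j : ZMod 2) => pr F j (v i)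
  simpa only [sum_pr] using h

lemma ext_homog {E : Type*} [AddCommGroup E] [Module F E] {f g : (⨂[F] i, s i) →ₗ[F] E}
    (h : ∀ (x : ι → ZMod 2) (v : ∀ i, s i), (∀ i, pr F (x i) (v i) = v i) →
      f (PiTensorProduct.tprod F v) = g (PiTensorProduct.tprod F v)) : f = g := by
  refine PiTensorProduct.ext (MultilinearMap.ext fun v => ?_)
  simp only [LinearMap.compMultilinearMap_apply]
  rw [tprod_eq_sum, map_sum, map_sum]
  exact Finset.sum_congr rfl fun x _ => h x _ fun i => by simp [pr_pr]

/-- The projections defining the grading of a tensor product: `|⨂ vᵢ| = ∑ |vᵢ|`. -/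
def prTensor (k : ZMod 2) : (⨂[F] i, s i) →ₗ[F] ⨂[F] i, s i :=
  ∑ x : ι → ZMod 2, if ∑ i, x i = k then prT x else 0

lemma prTensor_homog {x : ι → ZMod 2} {v : ∀ i, s i} (h : ∀ i, pr F (x i) (v i) = v i)
    (k : ZMod 2) :
    prTensor k (PiTensorProduct.tprod F v) =
      if k = ∑ i, x i then PiTensorProduct.tprod F v else 0 := by
  rw [prTensor, LinearMap.sum_apply, Finset.sum_eq_single x]
  · by_cases hk : ∑ i, x i = k
    · rw [if_pos hk, if_pos hk.symm, prT_homog h, if_pos rfl]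
    · rw [if_neg hk, if_neg (Ne.symm hk), LinearMap.zero_apply]
  · intro y _ hy
    split_ifs
    · rw [prT_homog h, if_neg hy]
    · rfl
  · simp

instance : SuperSpace F (⨂[F] i, s i) where
  proj := prTensor
  proj_proj i j v := by
    have : prTensor i ∘ₗ prTensor j = if i = j then prTensor (F := F) (s := s) j else 0 := by
      refine ext_homog fun x v h => ?_
      simp only [LinearMap.comp_apply]
      rw [prTensor_homog h]
      by_cases hj : j = ∑ i, x i <;> by_cases hi : i = j <;> simp [hj, hi, prTensor_homog h]
      rw [← hj, if_neg hi, if_neg hi, LinearMap.zero_apply]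
    have h2 := LinearMap.congr_fun this v
    rw [LinearMap.comp_apply] at h2
    rw [h2]
    split_ifs <;> rfl
  proj_add v := by
    have : prTensor 0 + prTensor 1 = (LinearMap.id : (⨂[F] i, s i) →ₗ[F] _) := by
      refine ext_homog fun x v h => ?_
      rw [LinearMap.add_apply, prTensor_homog h, prTensor_homog h]
      rcases zmod_cases (∑ i, x i) with e | e <;> simp [e]
    exact LinearMap.congr_fun this v

lemma pr_tprod {x : ι → ZMod 2} {v : ∀ i, s i} (h : ∀ i, pr F (x i) (v i) = v i) :
    pr F (∑ i, x i) (PiTensorProduct.tprod F v) = PiTensorProduct.tprod F v := by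
  change prTensor _ _ = _
  rw [prTensor_homog h, if_pos rfl]

end Dep

/-- `V ⊗ W` is graded by `|v ⊗ w| = |v| + |w|`. -/
instance {V W : Type*} [AddCommGroup V] [Module F V] [SuperSpace F V]
    [AddCommGroup W] [Module F W] [SuperSpace F W] : SuperSpace F (V ⊗[F] W) where
  proj k := TensorProduct.map (pr F 0) (pr F k) + TensorProduct.map (pr F 1) (pr F (k + 1))
  proj_proj i j v := by
    induction v with
    | zero => simp
    | add a b ha hb => simp only [map_add] at ha hb ⊢; rw [ha, hb]; split_ifs <;> simp
    | tmul v w =>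
      rcases zmod_cases i with rfl | rfl <;> rcases zmod_cases j with rfl | rfl <;>
      simp [pr_pr, show (1 + 1 : ZMod 2) = 0 from rfl]
  proj_add v := by
    induction v with
    | zero => simp
    | add a b ha hb =>
      simp only [map_add] at ha hb ⊢
      nth_rw 3 [← ha]; nth_rw 3 [← hb]; abel
    | tmul v w =>
      have hv := sum_pr (F := F) v
      have hw := sum_pr (F := F) w
      rw [sum_zmod] at hv hw
      conv_rhs => rw [← hv, ← hw]
      simp only [LinearMap.add_apply, TensorProduct.map_tmul, TensorProduct.add_tmul,
        TensorProduct.tmul_add, zero_add, show (1 + 1 : ZMod 2) = 0 from rfl]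
      abel

lemma pr_tmul {V W : Type*} [AddCommGroup V] [Module F V] [SuperSpace F V]
    [AddCommGroup W] [Module F W] [SuperSpace F W] {i j : ZMod 2} {v : V} {w : W}
    (hv : pr F i v = v) (hw : pr F j w = w) :
    pr F (i + j) (v ⊗ₜ[F] w) = v ⊗ₜ[F] w := by
  change (TensorProduct.map (pr F 0) (pr F (i + j)) +
    TensorProduct.map (pr F 1) (pr F (i + j + 1)) : V ⊗[F] W →ₗ[F] V ⊗[F] W) (v ⊗ₜ[F] w) = _
  simp only [LinearMap.add_apply, TensorProduct.map_tmul]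
  rw [pr_of_homog hv, pr_of_homog hv, pr_of_homog hw, pr_of_homog hw]
  rcases zmod_cases i with rfl | rfl <;> rcases zmod_cases j with rfl | rfl <;>
    simp [show (1 + 1 : ZMod 2) = 0 from rfl]

end Tensor

/-! ### Signs -/

section Signs

variable {n : ℕ}

/-- The exponent `∑_{r<s} x_s y_r` of the sign rule for `⨂ a_r` acting on `⨂ v_r`. -/
def chi (x y : Fin n → ZMod 2) : ZMod 2 := ∑ r, ∑ s, if r < s then x s * y r else 0

/-- The exponent `[w; x] = ∑_{a < c, w(a) > w(c)} x_a x_c` of the sign rule for permutations. -/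
def invExp (w : Equiv.Perm (Fin n)) (x : Fin n → ZMod 2) : ZMod 2 :=
  ∑ a, ∑ c, if a < c ∧ w c < w a then x a * x c else 0

lemma chi_add_left (x x' y : Fin n → ZMod 2) : chi (x + x') y = chi x y + chi x' y := by
  simp only [chi, ← Finset.sum_add_distrib]
  refine Finset.sum_congr rfl fun r _ => Finset.sum_congr rfl fun s _ => ?_
  split_ifs
  · simp [add_mul]
  · simp

lemma chi_add_right (x y y' : Fin n → ZMod 2) : chi x (y + y') = chi x y + chi x y' := by
  simp only [chi, ← Finset.sum_add_distrib]
  refine Finset.sum_congr rfl fun r _ => Finset.sum_congr rfl fun s _ => ?_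
  split_ifs
  · simp [mul_add]
  · simp

lemma sum_pairs (f : Fin n → Fin n → ZMod 2) (hf : ∀ a, f a a = 0) :
    ∑ a, ∑ c, f a c = ∑ a, ∑ c, if a < c then f a c + f c a else 0 := by
  have h1 : ∀ a c, f a c = (if a < c then f a c else 0) + (if c < a then f a c else 0) := by
    intro a c
    rcases lt_trichotomy a c with h | h | h
    · simp [h, h.not_gt]
    · subst h; simp [hf]
    · simp [h, h.not_gt]
  have h2 : ∑ a, ∑ c, (if c < a then f a c else 0) = ∑ a, ∑ c, if a < c then f c a else 0 :=
    Finset.sum_comm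
  calc ∑ a, ∑ c, f a c
      = ∑ a, ∑ c, ((if a < c then f a c else 0) + (if c < a then f a c else 0)) :=
        Finset.sum_congr rfl fun a _ => Finset.sum_congr rfl fun c _ => h1 a c
    _ = _ := by
        simp only [Finset.sum_add_distrib]
        rw [h2]
        simp only [← Finset.sum_add_distrib]
        refine Finset.sum_congr rfl fun a _ => Finset.sum_congr rfl fun c _ => ?_
        split_ifs <;> simp

lemma two_zmod (a : ZMod 2) : a + a = 0 := CharTwo.add_self_eq_zero a

lemma invExp_mul (w v : Equiv.Perm (Fin n)) (x : Fin n → ZMod 2) :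
    invExp (w * v) x = invExp v x + invExp w (x ∘ v.symm) := by
  have h : invExp w (x ∘ v.symm) =
      ∑ a, ∑ c, if v a < v c ∧ w (v c) < w (v a) then x a * x c else 0 := by
    rw [invExp, ← Equiv.sum_comp v]
    refine Finset.sum_congr rfl fun a _ => ?_
    rw [← Equiv.sum_comp v]
    simp
  rw [h, sum_pairs _ (by simp), invExp, invExp, ← Finset.sum_add_distrib]
  refine Finset.sum_congr rfl fun a _ => ?_
  rw [← Finset.sum_add_distrib]
  refine Finset.sum_congr rfl fun c _ => ?_
  by_cases hac : a < c
  · have hv : v a ≠ v c := fun e => hac.ne (v.injective e)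
    have hw : w (v a) ≠ w (v c) := fun e => hv (w.injective e)
    have h2 := two_zmod (x a * x c)
    rcases hv.lt_or_gt with h1 | h1 <;> rcases hw.lt_or_gt with h3 | h3 <;>
      simp [hac, h1, h3, h1.not_gt, h3.not_gt, mul_comm (x c), h2]
  · simp [hac]

lemma invExp_one (x : Fin n → ZMod 2) : invExp 1 x = 0 := by
  refine Finset.sum_eq_zero fun a _ => Finset.sum_eq_zero fun c _ => if_neg ?_
  rintro ⟨h1, h2⟩
  exact absurd h1 h2.not_gt

lemma invExp_add (w : Equiv.Perm (Fin n)) (x y : Fin n → ZMod 2) :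
    chi x y + invExp w (x + y) =
      invExp w x + invExp w y + chi (x ∘ w.symm) (y ∘ w.symm) := by
  have h : chi (x ∘ w.symm) (y ∘ w.symm) =
      ∑ a, ∑ c, if w a < w c then x c * y a else 0 := by
    rw [chi, ← Equiv.sum_comp w]
    refine Finset.sum_congr rfl fun a _ => ?_
    rw [← Equiv.sum_comp w]
    simp
  rw [h, sum_pairs _ (by simp), chi, invExp, invExp, invExp]
  simp only [← Finset.sum_add_distrib]
  refine Finset.sum_congr rfl fun a _ => Finset.sum_congr rfl fun c _ => ?_
  by_cases hac : a < c
  · have hw : w a ≠ w c := fun e => hac.ne (w.injective e)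
    rcases hw.lt_or_gt with h1 | h1
    · simp [hac, h1, h1.not_gt]
    · simp only [hac, h1, h1.not_gt, if_true, if_false, and_self, Pi.add_apply, zero_add]
      have h2 := two_zmod (x c * y a)
      linear_combination h2
  · simp [hac]

end Signs

/-! ### The superalgebra `A^{⊗n}`, its supermodules `V^{⊗n}` and the action of `𝔖_n` -/

section Power

variable {F : Type*} [Field F] {n : ℕ}

section Action

variable {A : Type*} [Ring A] [Algebra F A] [SuperAlgebra F A]
  {V : Type*} [AddCommGroup V] [Module F V] [Module A V] [IsScalarTower F A V] [SuperSpace F V]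

/-- The bilinear map `A^{⊗n} × V^{⊗n} → V^{⊗n}` determined by
`(a₁ ⊗ ⋯ ⊗ a_n)(v₁ ⊗ ⋯ ⊗ v_n) = (-1)^{∑_{r<s} |a_s||v_r|} a₁v₁ ⊗ ⋯ ⊗ a_nv_n`
for homogeneous `a_r`, `v_r`. -/
def sact : (⨂[F] _ : Fin n, A) →ₗ[F] (⨂[F] _ : Fin n, V) →ₗ[F] ⨂[F] _ : Fin n, V :=
  ∑ x : Fin n → ZMod 2, ∑ y : Fin n → ZMod 2, sg F (chi x y) •
    (PiTensorProduct.map₂ fun _ : Fin n =>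
      (Algebra.lsmul F F V : A →ₐ[F] Module.End F V).toLinearMap).compl₁₂ (prT x) (prT y)

lemma sact_tprod {x y : Fin n → ZMod 2} {a : Fin n → A} {v : Fin n → V}
    (ha : ∀ i, pr F (x i) (a i) = a i) (hv : ∀ i, pr F (y i) (v i) = v i) :
    sact (PiTensorProduct.tprod F a) (PiTensorProduct.tprod F v) =
      sg F (chi x y) • PiTensorProduct.tprod F fun i => a i • v i := by
  simp only [sact, LinearMap.sum_apply, LinearMap.smul_apply, LinearMap.compl₁₂_apply]
  rw [Finset.sum_eq_single x, Finset.sum_eq_single y]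
  · rw [prT_homog ha, prT_homog hv, if_pos rfl, if_pos rfl, PiTensorProduct.map₂_tprod_tprod]
    simp
  · intro z _ hz
    rw [prT_homog hv, if_neg hz, map_zero, smul_zero]
  · simp
  · intro z _ hz
    refine Finset.sum_eq_zero fun z' _ => ?_
    rw [prT_homog ha, if_neg hz, map_zero, LinearMap.zero_apply, smul_zero]
  · simp

lemma sact_sact [SuperModule F A V] (a b : ⨂[F] _ : Fin n, A) (v : ⨂[F] _ : Fin n, V) :
    sact (sact a b) v = sact a (sact b v) := by
  -- three successive reductions to homogeneous pure tensors
  have key : ∀ (x y z : Fin n → ZMod 2) (a b : Fin n → A) (v : Fin n → V),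
      (∀ i, pr F (x i) (a i) = a i) → (∀ i, pr F (y i) (b i) = b i) →
      (∀ i, pr F (z i) (v i) = v i) →
      sact (sact (PiTensorProduct.tprod F a) (PiTensorProduct.tprod F b))
          (PiTensorProduct.tprod F v) =
        sact (PiTensorProduct.tprod F a)
          (sact (PiTensorProduct.tprod F b) (PiTensorProduct.tprod F v)) := by
    intro x y z a b v ha hb hv
    rw [sact_tprod ha hb, sact_tprod hb hv, map_smul, LinearMap.smul_apply, map_smul,
      sact_tprod (x := x + y) (fun i => smul_homog (ha i) (hb i)) hv,
      sact_tprod (y := y + z) ha (fun i => smul_homog (hb i) (hv i)), smul_smul, smul_smul,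
      ← sg_add, ← sg_add, chi_add_left, chi_add_right]
    simp only [smul_eq_mul, mul_smul]
    congr 2
    abel
  have k1 : ∀ (x y : Fin n → ZMod 2) (a b : Fin n → A),
      (∀ i, pr F (x i) (a i) = a i) → (∀ i, pr F (y i) (b i) = b i) →
      sact (V := V) (sact (PiTensorProduct.tprod F a) (PiTensorProduct.tprod F b)) =
        sact (PiTensorProduct.tprod F a) ∘ₗ sact (PiTensorProduct.tprod F b) :=
    fun x y a b ha hb => ext_homog fun z v hv => key x y z a b v ha hb hv
  have k2 : ∀ (x : Fin n → ZMod 2) (a : Fin n → A) (v : ⨂[F] _ : Fin n, V),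
      (∀ i, pr F (x i) (a i) = a i) →
      (sact (V := V)).flip v ∘ₗ sact (PiTensorProduct.tprod F a) =
        sact (PiTensorProduct.tprod F a) ∘ₗ (sact (A := A)).flip v :=
    fun x a v ha => ext_homog fun y b hb => LinearMap.congr_fun (k1 x y a b ha hb) v
  have k3 : (sact (V := V)).flip v ∘ₗ (sact (A := A) (V := A)).flip b =
      (sact (A := A)).flip (sact b v) :=
    ext_homog fun x a ha => LinearMap.congr_fun (k2 x a v ha) b
  exact LinearMap.congr_fun k3 a

lemma one_homog : pr F 0 (1 : A) = 1 := by
  have h : ∀ a : A, pr F 1 (1 : A) * pr F 0 a = 0 := by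
    intro a
    have h1 := SuperAlgebra.proj_mul (F := F) 1 (1 : A) (pr F 0 a)
    change pr F 1 ((1 : A) * pr F 0 a) = pr F 0 (1 : A) * pr F 1 (pr F 0 a) +
      pr F 1 (1 : A) * pr F (1 + 1) (pr F 0 a) at h1
    rw [one_mul, pr_pr, pr_pr] at h1
    simpa [show (1 + 1 : ZMod 2) = 0 from rfl] using h1.symm
  have h' : ∀ a : A, pr F 1 (1 : A) * pr F 1 a = 0 := by
    intro a
    have h1 := SuperAlgebra.proj_mul (F := F) 0 (1 : A) (pr F 1 a)
    change pr F 0 ((1 : A) * pr F 1 a) = pr F 0 (1 : A) * pr F 0 (pr F 1 a) +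
      pr F 1 (1 : A) * pr F (0 + 1) (pr F 1 a) at h1
    rw [one_mul, pr_pr, pr_pr] at h1
    simpa using h1.symm
  have h1 := sum_pr (F := F) (1 : A)
  rw [sum_zmod] at h1
  have h2 : pr F 1 (1 : A) = 0 := by
    have := congrArg (fun t => pr F 1 (1 : A) * t) h1
    simp only [mul_add, h, h', add_zero, mul_one] at this
    exact this.symm
  rw [h2, add_zero] at h1
  exact h1

lemma chi_zero_left (y : Fin n → ZMod 2) : chi 0 y = 0 := by simp [chi]

lemma chi_zero_right (y : Fin n → ZMod 2) : chi y 0 = 0 := by simp [chi]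

lemma sact_one (v : ⨂[F] _ : Fin n, V) :
    sact (PiTensorProduct.tprod F fun _ => (1 : A)) v = v := by
  have : sact (V := V) (PiTensorProduct.tprod F fun _ : Fin n => (1 : A)) = LinearMap.id :=
    ext_homog fun x v hv => by
      rw [sact_tprod (x := 0) (fun _ => one_homog) hv, chi_zero_left]; simp
  exact LinearMap.congr_fun this v

lemma sact_tprod_one (a : ⨂[F] _ : Fin n, A) :
    sact a (PiTensorProduct.tprod F fun _ => (1 : A)) = a := by
  have : (sact (V := A)).flip (PiTensorProduct.tprod F fun _ : Fin n => (1 : A)) =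
      LinearMap.id :=
    ext_homog fun x a ha => by
      rw [LinearMap.flip_apply, sact_tprod (y := 0) ha (fun _ => one_homog), chi_zero_right]
      simp
  exact LinearMap.congr_fun this a

lemma sact_homog [SuperModule F A V] {i j : ZMod 2} {a : ⨂[F] _ : Fin n, A}
    {v : ⨂[F] _ : Fin n, V} (ha : pr F i a = a) (hv : pr F j v = v) :
    pr F (i + j) (sact a v) = sact a v := by
  have k : ∀ (x y : Fin n → ZMod 2) (a : Fin n → A) (v : Fin n → V),
      (∀ i, pr F (x i) (a i) = a i) → (∀ i, pr F (y i) (v i) = v i) →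
      pr F (i + j) (sact (pr F i (PiTensorProduct.tprod F a))
        (pr F j (PiTensorProduct.tprod F v))) =
      sact (pr F i (PiTensorProduct.tprod F a)) (pr F j (PiTensorProduct.tprod F v)) := by
    intro x y a v ha hv
    rw [pr_of_homog (pr_tprod ha), pr_of_homog (pr_tprod hv)]
    split_ifs with h1 h2
    · rw [sact_tprod ha hv, map_smul, h1, h2, ← Finset.sum_add_distrib]
      exact congrArg _ (pr_tprod (x := x + y) fun r => smul_homog (ha r) (hv r))
    all_goals simp
  have k1 : ∀ (x : Fin n → ZMod 2) (a : Fin n → A), (∀ i, pr F (x i) (a i) = a i) →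
      pr F (i + j) ∘ₗ sact (pr F i (PiTensorProduct.tprod F a)) ∘ₗ pr F j =
      sact (V := V) (pr F i (PiTensorProduct.tprod F a)) ∘ₗ pr F j :=
    fun x a ha => ext_homog fun y v hv => k x y a v ha hv
  have k2 : pr F (i + j) ∘ₗ (sact (V := V)).flip (pr F j v) ∘ₗ pr F i =
      (sact (V := V)).flip (pr F j v) ∘ₗ pr F (V := ⨂[F] _ : Fin n, A) i :=
    ext_homog fun x a ha => LinearMap.congr_fun (k1 x a ha) v
  have := LinearMap.congr_fun k2 a
  simp only [LinearMap.comp_apply, LinearMap.flip_apply, ha, hv] at this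
  exact this

end Action

section Perm

variable {V : Type*} [AddCommGroup V] [Module F V] [SuperSpace F V]

/-- The signed action of `𝔖_n` on `V^{⊗n}`:
`ʷ(v₁ ⊗ ⋯ ⊗ v_n) = (-1)^{[w; v₁, …, v_n]} v_{w⁻¹(1)} ⊗ ⋯ ⊗ v_{w⁻¹(n)}`. -/
def sperm (w : Equiv.Perm (Fin n)) : (⨂[F] _ : Fin n, V) →ₗ[F] ⨂[F] _ : Fin n, V :=
  ∑ x : Fin n → ZMod 2, sg F (invExp w x) •
    ((PiTensorProduct.reindex F (fun _ : Fin n => V) w).toLinearMap ∘ₗ prT x)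

lemma sperm_tprod (w : Equiv.Perm (Fin n)) {x : Fin n → ZMod 2} {v : Fin n → V}
    (hv : ∀ i, pr F (x i) (v i) = v i) :
    sperm w (PiTensorProduct.tprod F v) =
      sg F (invExp w x) • PiTensorProduct.tprod F fun i => v (w.symm i) := by
  rw [sperm, LinearMap.sum_apply, Finset.sum_eq_single x]
  · rw [LinearMap.smul_apply, LinearMap.comp_apply, prT_homog hv, if_pos rfl]
    congr 1
    exact PiTensorProduct.reindex_tprod (s := fun _ => V) w v
  · intro z _ hz
    rw [LinearMap.smul_apply, LinearMap.comp_apply, prT_homog hv, if_neg hz, map_zero, smul_zero]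
  · simp

lemma sperm_one : sperm (1 : Equiv.Perm (Fin n)) = (LinearMap.id : (⨂[F] _ : Fin n, V) →ₗ[F] _) :=
  ext_homog fun x v hv => by
    rw [sperm_tprod _ hv, invExp_one, sg_zero, one_smul]; rfl

lemma sperm_mul (w u : Equiv.Perm (Fin n)) :
    sperm (w * u) = sperm (F := F) (V := V) w ∘ₗ sperm u :=
  ext_homog fun x v hv => by
    rw [sperm_tprod _ hv, LinearMap.comp_apply, sperm_tprod _ hv, map_smul,
      sperm_tprod (x := x ∘ u.symm) w (fun i => hv _), smul_smul, ← sg_add, invExp_mul]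
    rfl

lemma pr_sperm (w : Equiv.Perm (Fin n)) (i : ZMod 2) (v : ⨂[F] _ : Fin n, V) :
    pr F i (sperm w v) = sperm w (pr F i v) := by
  have : pr F i ∘ₗ sperm (F := F) (V := V) w = sperm w ∘ₗ pr F i :=
    ext_homog fun x v hv => by
      simp only [LinearMap.comp_apply]
      have h2 := pr_tprod (F := F) (x := x ∘ w.symm) (v := fun i => v (w.symm i)) fun i => hv _
      rw [pr_of_homog (pr_tprod hv), sperm_tprod _ hv, map_smul, pr_of_homog h2]
      rw [show ∑ i, (x ∘ w.symm) i = ∑ i, x i from Equiv.sum_comp w.symm x]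
      split_ifs
      · rw [sperm_tprod _ hv]
      · simp
  exact LinearMap.congr_fun this v

lemma sperm_sact {A : Type*} [Ring A] [Algebra F A] [SuperAlgebra F A] [Module A V]
    [IsScalarTower F A V] [SuperModule F A V]
    (w : Equiv.Perm (Fin n)) (a : ⨂[F] _ : Fin n, A) (v : ⨂[F] _ : Fin n, V) :
    sperm w (sact a v) = sact (sperm w a) (sperm w v) := by
  have k : ∀ (x y : Fin n → ZMod 2) (a : Fin n → A) (v : Fin n → V),
      (∀ i, pr F (x i) (a i) = a i) → (∀ i, pr F (y i) (v i) = v i) →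
      sperm w (sact (PiTensorProduct.tprod F a) (PiTensorProduct.tprod F v)) =
      sact (sperm w (PiTensorProduct.tprod F a)) (sperm w (PiTensorProduct.tprod F v)) := by
    intro x y a v ha hv
    rw [sact_tprod ha hv, sperm_tprod w ha, sperm_tprod w hv, map_smul, map_smul, map_smul,
      LinearMap.smul_apply,
      sperm_tprod (x := x + y) w (fun r => smul_homog (ha r) (hv r)),
      sact_tprod (x := x ∘ w.symm) (y := y ∘ w.symm) (fun r => ha _) (fun r => hv _),
      smul_smul, smul_smul, smul_smul, ← sg_add, ← sg_add, ← sg_add, invExp_add]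
    congr 2
    abel
  have k1 : ∀ (x : Fin n → ZMod 2) (a : Fin n → A), (∀ i, pr F (x i) (a i) = a i) →
      sperm w ∘ₗ sact (V := V) (PiTensorProduct.tprod F a) =
      sact (sperm w (PiTensorProduct.tprod F a)) ∘ₗ sperm w :=
    fun x a ha => ext_homog fun y v hv => k x y a v ha hv
  have k2 : sperm w ∘ₗ (sact (A := A) (V := V)).flip v =
      (sact (V := V)).flip (sperm w v) ∘ₗ sperm w :=
    ext_homog fun x a ha => LinearMap.congr_fun (k1 x a ha) v
  exact LinearMap.congr_fun k2 a

end Perm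

end Power

/-! ### The wreath superproduct `W_n = A ≀ 𝔖_n` -/

section Wreath

variable (F : Type*) [Field F]

/-- The superalgebra `A^{⊗n}`, with product
`(a₁ ⊗ ⋯ ⊗ a_n)(b₁ ⊗ ⋯ ⊗ b_n) = (-1)^{∑_{r<s} |a_s||b_r|} a₁b₁ ⊗ ⋯ ⊗ a_nb_n`. -/
def SAlg (A : Type*) [Ring A] [Algebra F A] (n : ℕ) : Type _ := ⨂[F] _ : Fin n, A

variable {A : Type*} [Ring A] [Algebra F A] {n : ℕ}

instance : AddCommGroup (SAlg F A n) := inferInstanceAs (AddCommGroup (⨂[F] _ : Fin n, A))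
instance : Module F (SAlg F A n) := inferInstanceAs (Module F (⨂[F] _ : Fin n, A))

variable [SuperAlgebra F A]

instance : SuperSpace F (SAlg F A n) := inferInstanceAs (SuperSpace F (⨂[F] _ : Fin n, A))

/-- The element `a₁ ⊗ ⋯ ⊗ a_n` of `A^{⊗n}`. -/
def pten (a : Fin n → A) : SAlg F A n := PiTensorProduct.tprod F a

instance : Ring (SAlg F A n) where
  __ := (inferInstance : AddCommGroup (SAlg F A n))
  mul a b := sact (F := F) (A := A) (V := A) a b
  one := pten F fun _ => 1
  mul_assoc a b c := sact_sact a b c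
  one_mul a := sact_one a
  mul_one a := sact_tprod_one a
  left_distrib a b c := map_add _ b c
  right_distrib a b c := LinearMap.congr_fun (map_add (sact (F := F) (A := A) (V := A)) a b) c
  zero_mul a := LinearMap.congr_fun (map_zero (sact (F := F) (A := A) (V := A) (n := n))) a
  mul_zero a := map_zero _

instance : Algebra F (SAlg F A n) :=
  Algebra.ofModule
    (fun r x y => LinearMap.congr_fun (map_smul (sact (F := F) (A := A) (V := A)) r x) y)
    (fun r x y => map_smul (sact (F := F) (A := A) (V := A) x) r y)

lemma mul_homog {i j : ZMod 2} {a b : SAlg F A n} (ha : pr F i a = a) (hb : pr F j b = b) :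
    pr F (i + j) (a * b) = a * b :=
  sact_homog (A := A) (V := A) (a := a) (v := b) ha hb

instance : MulSemiringAction (Equiv.Perm (Fin n)) (SAlg F A n) where
  smul w a := sperm (F := F) (V := A) w a
  one_smul a := LinearMap.congr_fun (sperm_one (F := F) (V := A)) a
  mul_smul w u a := LinearMap.congr_fun (sperm_mul (F := F) (V := A) w u) a
  smul_zero w := map_zero _
  smul_add w a b := map_add _ a b
  smul_one w := by
    change sperm (F := F) w (PiTensorProduct.tprod F fun _ => (1 : A)) = _
    rw [sperm_tprod (x := 0) w fun _ => one_homog]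
    simp [invExp]; rfl
  smul_mul w a b := sperm_sact (F := F) (A := A) (V := A) w a b

instance : SMulCommClass (Equiv.Perm (Fin n)) F (SAlg F A n) where
  smul_comm w r a := map_smul (sperm (F := F) (V := A) w) r a

variable (A n) in
/-- The wreath superproduct `A ≀ 𝔖_n`: the elements are the sums `∑_w z_w w` with
`z_w ∈ A^{⊗n}`, `w ∈ 𝔖_n`, and the product is determined by `w z = ʷz w`. -/
abbrev Wr : Type _ := SkewMonoidAlgebra (SAlg F A n) (Equiv.Perm (Fin n))

/-- The element `(a₁ ⊗ ⋯ ⊗ a_n) w` of `A ≀ 𝔖_n`. -/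
def wr (a : Fin n → A) (w : Equiv.Perm (Fin n)) : Wr F A n := SkewMonoidAlgebra.single w (pten F a)

/-- The grading of `A ≀ 𝔖_n`, with `𝔖_n` in parity `0`. -/
def wrProj (i : ZMod 2) : Wr F A n →ₗ[F] Wr F A n where
  toFun f := ⟨f.coeff.mapRange (pr F i) (map_zero _)⟩
  map_add' f g := by ext; simp
  map_smul' r f := by ext; simp

lemma coeff_wrProj (i : ZMod 2) (f : Wr F A n) (w : Equiv.Perm (Fin n)) :
    (wrProj F i f).coeff w = pr F i (f.coeff w) := rfl

lemma wrProj_single (i : ZMod 2) (w : Equiv.Perm (Fin n)) (z : SAlg F A n) :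
    wrProj F i (SkewMonoidAlgebra.single w z) = SkewMonoidAlgebra.single w (pr F i z) := by
  classical
  ext u
  rw [coeff_wrProj, SkewMonoidAlgebra.coeff_single_apply, SkewMonoidAlgebra.coeff_single_apply]
  split_ifs <;> simp

instance : SuperSpace F (Wr F A n) where
  proj := wrProj F
  proj_proj i j f := by
    ext w
    rw [coeff_wrProj, coeff_wrProj, pr_pr]
    split_ifs <;> rfl
  proj_add f := by
    ext w
    rw [SkewMonoidAlgebra.coeff_add, Finsupp.add_apply, coeff_wrProj, coeff_wrProj]
    exact SuperSpace.proj_add _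

lemma pr_single (i : ZMod 2) (w : Equiv.Perm (Fin n)) (z : SAlg F A n) :
    pr F i (SkewMonoidAlgebra.single w z : Wr F A n) =
      SkewMonoidAlgebra.single w (pr F i z) := wrProj_single F i w z

/-- Linear induction over the elements `z w`. -/
lemma wr_induction {p : Wr F A n → Prop} (f : Wr F A n) (h0 : p 0)
    (ha : ∀ f g, p f → p g → p (f + g))
    (hs : ∀ w z, p (SkewMonoidAlgebra.single w z)) : p f :=
  SkewMonoidAlgebra.induction_on f h0 hs ha

lemma pr_smul_perm (i : ZMod 2) (w : Equiv.Perm (Fin n)) (z : SAlg F A n) :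
    pr F i (w • z) = w • pr F i z :=
  pr_sperm (F := F) (V := A) w i z

instance : SuperAlgebra F (SAlg F A n) where
  proj_mul := proj_bilin (LinearMap.mul F (SAlg F A n)) fun _ _ _ _ => mul_homog F

lemma single_mul_homog (i j : ZMod 2) (w u : Equiv.Perm (Fin n)) (z y : SAlg F A n) :
    pr F (i + j) (pr F i (SkewMonoidAlgebra.single w z : Wr F A n) *
      pr F j (SkewMonoidAlgebra.single u y : Wr F A n)) =
    pr F i (SkewMonoidAlgebra.single w z : Wr F A n) *
      pr F j (SkewMonoidAlgebra.single u y : Wr F A n) := by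
  rw [pr_single, pr_single, SkewMonoidAlgebra.single_mul_single, pr_single]
  congr 1
  refine mul_homog F (by rw [pr_pr, if_pos rfl]) ?_
  rw [pr_smul_perm, pr_pr, if_pos rfl]

lemma wr_mul_homog (i j : ZMod 2) (f g : Wr F A n) :
    pr F (i + j) (pr F i f * pr F j g) = pr F i f * pr F j g := by
  induction f using wr_induction F with
  | h0 => rw [map_zero, zero_mul, map_zero]
  | ha f f' h h' => rw [map_add, add_mul, map_add, h, h']
  | hs w z =>
    induction g using wr_induction F with
    | h0 => rw [map_zero, mul_zero, map_zero]
    | ha f f' h h' => rw [map_add, mul_add, map_add, h, h']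
    | hs u y => exact single_mul_homog F i j w u z y

instance : SuperAlgebra F (Wr F A n) where
  proj_mul := proj_bilin (LinearMap.mul F (Wr F A n)) fun i j f g hf hg => by
    have := wr_mul_homog F i j f g
    rw [hf, hg] at this
    exact this

lemma pr_wr {x : Fin n → ZMod 2} {a : Fin n → A} (ha : ∀ i, pr F (x i) (a i) = a i)
    (w : Equiv.Perm (Fin n)) : pr F (∑ i, x i) (wr F a w) = wr F a w := by
  rw [wr, pr_single]
  congr 1
  exact pr_tprod ha

end Wreath

/-! ### The supermodules `V^{⊗n} ⊗ S` -/

section Twist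

variable (F : Type*) [Field F]

/-- `V^{⊗n} ⊗ S` for a superspace `V` and a representation `S` of `𝔖_n`, the latter being
concentrated in parity `0`. -/
def Twist (V : Type*) [AddCommGroup V] [Module F V] {n : ℕ} {S : Type*} [AddCommGroup S]
    [Module F S] (_ρ : Representation F (Equiv.Perm (Fin n)) S) : Type _ :=
  (⨂[F] _ : Fin n, V) ⊗[F] S

variable {V : Type*} [AddCommGroup V] [Module F V] {n : ℕ} {S : Type*} [AddCommGroup S]
    [Module F S] {ρ : Representation F (Equiv.Perm (Fin n)) S}

instance : AddCommGroup (Twist F V ρ) :=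
  inferInstanceAs (AddCommGroup ((⨂[F] _ : Fin n, V) ⊗[F] S))
instance : Module F (Twist F V ρ) :=
  inferInstanceAs (Module F ((⨂[F] _ : Fin n, V) ⊗[F] S))

variable [SuperSpace F V]

instance : SuperSpace F (Twist F V ρ) where
  proj i := (TensorProduct.map (pr F i) LinearMap.id :
    (⨂[F] _ : Fin n, V) ⊗[F] S →ₗ[F] (⨂[F] _ : Fin n, V) ⊗[F] S)
  proj_proj i j v := by
    have : (TensorProduct.map (pr F i) LinearMap.id :
        (⨂[F] _ : Fin n, V) ⊗[F] S →ₗ[F] (⨂[F] _ : Fin n, V) ⊗[F] S) ∘ₗ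
          TensorProduct.map (pr F j) LinearMap.id =
        if i = j then TensorProduct.map (pr F j) LinearMap.id else 0 := by
      refine TensorProduct.ext' fun x y => ?_
      rw [LinearMap.comp_apply, TensorProduct.map_tmul, TensorProduct.map_tmul, pr_pr]
      split_ifs <;> simp
    have h2 := LinearMap.congr_fun this v
    refine h2.trans ?_
    split_ifs <;> rfl
  proj_add v := by
    have : (TensorProduct.map (pr F 0) LinearMap.id :
        (⨂[F] _ : Fin n, V) ⊗[F] S →ₗ[F] (⨂[F] _ : Fin n, V) ⊗[F] S) +
          TensorProduct.map (pr F 1) LinearMap.id = LinearMap.id := by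
      refine TensorProduct.ext' fun x y => ?_
      rw [LinearMap.add_apply, TensorProduct.map_tmul, TensorProduct.map_tmul,
        ← TensorProduct.add_tmul]
      congr 1
      have := sum_pr (F := F) x
      rwa [sum_zmod] at this
    exact LinearMap.congr_fun this v

variable {A : Type*} [Ring A] [Algebra F A] [SuperAlgebra F A] [Module A V] [IsScalarTower F A V]
  [SuperModule F A V]

/-- The action of `A^{⊗n}` on `V^{⊗n} ⊗ S`, `z (v ⊗ y) = (z v) ⊗ y`. -/
def twistAlg : SAlg F A n →+* Module.End F ((⨂[F] _ : Fin n, V) ⊗[F] S) where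
  toFun z := TensorProduct.map (sact (F := F) (A := A) (V := V) z) LinearMap.id
  map_one' := TensorProduct.ext' fun x y => by
    rw [TensorProduct.map_tmul]
    exact congrArg (· ⊗ₜ[F] y) (sact_one (F := F) (A := A) x)
  map_mul' a b := TensorProduct.ext' fun x y => by
    exact congrArg (· ⊗ₜ[F] y) (sact_sact (F := F) (A := A) a b x)
  map_zero' := TensorProduct.ext' fun x y => by
    have := LinearMap.congr_fun (map_zero (sact (F := F) (A := A) (V := V) (n := n))) x
    refine (congrArg (· ⊗ₜ[F] y) this).trans ?_
    simp
  map_add' a b := TensorProduct.ext' fun x y => by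
    have := LinearMap.congr_fun (map_add (sact (F := F) (A := A) (V := V) (n := n)) a b) x
    refine (congrArg (· ⊗ₜ[F] y) this).trans ?_
    rw [LinearMap.add_apply, TensorProduct.add_tmul]
    rfl

variable (ρ) in
/-- The action of `𝔖_n` on `V^{⊗n} ⊗ S`, `w (v ⊗ y) = ʷv ⊗ w y`. -/
def twistPerm : Equiv.Perm (Fin n) →* Module.End F ((⨂[F] _ : Fin n, V) ⊗[F] S) where
  toFun w := TensorProduct.map (sperm w) (ρ w)
  map_one' := by rw [sperm_one, map_one]; exact TensorProduct.map_id
  map_mul' w u := by rw [sperm_mul, map_mul]; exact TensorProduct.map_mul _ _ _ _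

variable (V A ρ) in
/-- The action of `A ≀ 𝔖_n` on `V^{⊗n} ⊗ S`. -/
def twistHom : Wr F A n →+* Module.End F ((⨂[F] _ : Fin n, V) ⊗[F] S) :=
  SkewMonoidAlgebra.liftNCRingHom (twistAlg F) (twistPerm F ρ) fun {z w} =>
    TensorProduct.ext' fun x y =>
      congrArg (· ⊗ₜ[F] ρ w y) (sperm_sact (F := F) (A := A) w z x).symm

instance : Module (Wr F A n) (Twist F V ρ) :=
  Module.compHom ((⨂[F] _ : Fin n, V) ⊗[F] S) (twistHom F V ρ A)

lemma single_smul_twist (w : Equiv.Perm (Fin n)) (z : SAlg F A n) (m : Twist F V ρ) :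
    (SkewMonoidAlgebra.single w z : Wr F A n) • m = twistAlg F z (twistPerm F ρ w m) := by
  have h : twistHom F V ρ A (SkewMonoidAlgebra.single w z) = twistAlg F z * twistPerm F ρ w :=
    SkewMonoidAlgebra.liftNC_single _ _ _ _
  exact LinearMap.congr_fun h m

instance : IsScalarTower F (Wr F A n) (Twist F V ρ) where
  smul_assoc r f m := by
    induction f using wr_induction F with
    | h0 => rw [smul_zero, zero_smul, smul_zero]
    | ha f g hf hg => rw [smul_add, add_smul, add_smul, smul_add, hf, hg]
    | hs w z =>
      rw [SkewMonoidAlgebra.smul_single, single_smul_twist, single_smul_twist]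
      have : twistAlg (V := V) (S := S) F (r • z) = r • twistAlg F z :=
        TensorProduct.ext' fun x y => by
          have := LinearMap.congr_fun
            (map_smul (sact (F := F) (A := A) (V := V) (n := n)) r z) x
          exact congrArg (· ⊗ₜ[F] y) this
      rw [this]; rfl

instance : SuperModule F (Wr F A n) (Twist F V ρ) := by
  refine superModule_of_homog fun i j f m hf hm => ?_
  have key : ∀ (w : Equiv.Perm (Fin n)) (z : SAlg F A n) (m : Twist F V ρ),
      pr F (i + j) (pr F i (SkewMonoidAlgebra.single w z : Wr F A n) • pr F j m) =
      pr F i (SkewMonoidAlgebra.single w z : Wr F A n) • pr F j m := by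
    intro w z m
    rw [pr_single, single_smul_twist]
    have : (TensorProduct.map (pr F (i + j)) LinearMap.id ∘ₗ twistAlg F (pr F i z) ∘ₗ
        twistPerm F ρ w ∘ₗ TensorProduct.map (pr F j) LinearMap.id :
        (⨂[F] _ : Fin n, V) ⊗[F] S →ₗ[F] (⨂[F] _ : Fin n, V) ⊗[F] S) =
        twistAlg F (pr F i z) ∘ₗ
        twistPerm F ρ w ∘ₗ TensorProduct.map (pr F j) LinearMap.id :=
      TensorProduct.ext' fun x y => by
        refine congrArg (· ⊗ₜ[F] ρ w y) (sact_homog (F := F) (A := A) (V := V)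
          (a := pr F i z) (v := sperm w (pr F j x)) ?_ ?_)
        · exact (pr_pr (F := F) i i z).trans (if_pos rfl)
        · rw [pr_sperm, pr_pr, if_pos rfl]
    exact LinearMap.congr_fun this m
  have key2 : ∀ f : Wr F A n, pr F (i + j) (pr F i f • pr F j m) = pr F i f • pr F j m := by
    intro f
    induction f using wr_induction F with
    | h0 => rw [map_zero, zero_smul, map_zero]
    | ha f f' h h' => rw [map_add, add_smul, map_add, h, h']
    | hs w z => exact key w z m
  have := key2 f
  rwa [hf, hm] at this

end Twist

/-! ### Subsupermodules and quotients -/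

section Sub

variable (F A V : Type*) [Field F] [Ring A] [Algebra F A]
  [AddCommGroup V] [Module F V] [Module A V] [SuperSpace F V]

/-- A subsupermodule: a submodule `N` with `N = (N ∩ V₀) ⊕ (N ∩ V₁)`. -/
structure SubSM extends Submodule A V where
  pr_mem : ∀ (i : ZMod 2) (v : V), v ∈ carrier → pr F i v ∈ carrier

variable {F A V}

lemma SubSM.pr_mem' (N : SubSM F A V) (i : ZMod 2) {v : V} (hv : v ∈ N.toSubmodule) :
    pr F i v ∈ N.toSubmodule := N.pr_mem i v hv

variable [IsScalarTower F A V]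

instance (N : SubSM F A V) : SuperSpace F N.toSubmodule where
  proj i := (pr F i).restrict (p := N.toSubmodule.restrictScalars F)
    (q := N.toSubmodule.restrictScalars F) fun _ hv => N.pr_mem' i hv
  proj_proj i j v := by
    refine Subtype.ext ((pr_pr (F := F) i j (v : V)).trans ?_)
    split_ifs <;> rfl
  proj_add v := Subtype.ext (SuperSpace.proj_add (v : V))

instance (N : SubSM F A V) : SuperSpace F (V ⧸ N.toSubmodule) where
  proj i := (N.toSubmodule.restrictScalars F).mapQ (N.toSubmodule.restrictScalars F) (pr F i)
    fun _ hv => N.pr_mem' i hv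
  proj_proj i j v := by
    induction v using Submodule.Quotient.induction_on with | _ v => ?_
    refine (congrArg (Submodule.Quotient.mk (p := N.toSubmodule)) (pr_pr (F := F) i j v)).trans ?_
    split_ifs <;> rfl
  proj_add v := by
    induction v using Submodule.Quotient.induction_on with | _ v => ?_
    exact congrArg (Submodule.Quotient.mk (p := N.toSubmodule)) (SuperSpace.proj_add (F := F) v)

lemma pr_mk (N : SubSM F A V) (i : ZMod 2) (v : V) :
    pr F i (Submodule.Quotient.mk v : V ⧸ N.toSubmodule) = Submodule.Quotient.mk (pr F i v) := rfl

lemma coe_pr (N : SubSM F A V) (i : ZMod 2) (v : N.toSubmodule) :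
    ((pr F i v : N.toSubmodule) : V) = pr F i (v : V) := rfl

variable [SuperAlgebra F A] [SuperModule F A V]

instance (N : SubSM F A V) : SuperModule F A N.toSubmodule where
  proj_smul i a v := Subtype.ext (SuperModule.proj_smul (F := F) i a (v : V))

instance (N : SubSM F A V) : SuperModule F A (V ⧸ N.toSubmodule) where
  proj_smul i a v := by
    induction v using Submodule.Quotient.induction_on with | _ v => ?_
    exact congrArg (Submodule.Quotient.mk (p := N.toSubmodule))
      (SuperModule.proj_smul (F := F) i a v)

end Sub

/-! ### Isomorphisms, irreducibility, composition multiplicities -/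

section Multiplicity

variable (F A : Type*) [Field F] [Ring A] [Algebra F A] [SuperAlgebra F A]

section Hom

variable {V W : Type*} [AddCommGroup V] [Module F V] [Module A V] [SuperSpace F V]
  [AddCommGroup W] [Module F W] [Module A W] [SuperSpace F W]

/-- `f` is a homogeneous homomorphism of supermodules of parity `ε`: it maps `V_δ` into
`W_{δ + ε}` and `f (a v) = (-1)^{ε|a|} a (f v)`. -/
def IsHomogHom (ε : ZMod 2) (f : V →ₗ[F] W) : Prop :=
  (∀ (δ : ZMod 2) (v : V), pr F δ v = v → pr F (δ + ε) (f v) = f v) ∧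
  ∀ (α : ZMod 2) (a : A) (v : V), pr F α a = a → f (a • v) = sg F (ε * α) • a • f v

/-- `f` is a homomorphism of supermodules: a sum of homogeneous homomorphisms of both parities. -/
def IsSuperHom (f : V →ₗ[F] W) : Prop :=
  ∃ f₀ f₁ : V →ₗ[F] W, f = f₀ + f₁ ∧ IsHomogHom F A 0 f₀ ∧ IsHomogHom F A 1 f₁

variable (V W)

/-- `V ≅ W`: there is a (not necessarily even) isomorphism of supermodules. -/
def SuperIso : Prop :=
  ∃ e : V ≃ₗ[F] W, IsSuperHom F A e.toLinearMap ∧ IsSuperHom F A e.symm.toLinearMap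

end Hom

variable (V : Type*) [AddCommGroup V] [Module F V] [Module A V] [IsScalarTower F A V]
  [SuperSpace F V]

/-- `V` is irreducible: it has exactly two subsupermodules. -/
def IsIrred : Prop := Nat.card (SubSM F A V) = 2

variable {F A V} in
/-- The intersection `N ∩ N'` as a subsupermodule of `N'` (this is `N` if `N ⊆ N'`). -/
def SubSM.within (N N' : SubSM F A V) : SubSM F A N'.toSubmodule where
  __ := N.toSubmodule.comap N'.toSubmodule.subtype
  pr_mem i _ hv := N.pr_mem i _ hv

variable {F A V} in
/-- The subquotient `N' / N` for subsupermodules `N ⊆ N'`. -/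
abbrev SubSM.factor (N N' : SubSM F A V) : Type _ :=
  N'.toSubmodule ⧸ (N.within N').toSubmodule

/-- A composition series `0 = V₀ ⊂ V₁ ⊂ ⋯ ⊂ V_m = V` of a supermodule `V`. -/
structure CompSeries where
  length : ℕ
  term : Fin (length + 1) → SubSM F A V
  bot : (term 0).toSubmodule = ⊥
  top : (term (Fin.last length)).toSubmodule = ⊤
  le : ∀ k : Fin length, (term k.castSucc).toSubmodule ≤ (term k.succ).toSubmodule
  irred : ∀ k : Fin length, IsIrred F A ((term k.castSucc).factor (term k.succ))

variable (L : Type*) [AddCommGroup L] [Module F L] [Module A L] [SuperSpace F L]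

variable {F A V} in
/-- The number of composition factors that are isomorphic to `L`. -/
def CompSeries.mult (s : CompSeries F A V) : ℕ :=
  Nat.card {k : Fin s.length // SuperIso F A ((s.term k.castSucc).factor (s.term k.succ)) L}

/-- `[V : L] = m`: the supermodule `V` has a composition series, and in every composition series
of `V` exactly `m` factors are isomorphic to `L`. -/
def HasMultiplicity (m : ℕ) : Prop :=
  Nonempty (CompSeries F A V) ∧ ∀ s : CompSeries F A V, s.mult L = m

end Multiplicity

/-! ### The induction product `M₁ ∘ ⋯ ∘ M_k` -/

section Induction

variable {F : Type*} [Field F]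

/-- The blocks of consecutive elements of `{1, …, d}` of sizes `δ₁, …, δ_k`. -/
def blockEquiv {k d : ℕ} (δ : Fin k → ℕ) (hδ : ∑ j, δ j = d) : (Σ j, Fin (δ j)) ≃ Fin d :=
  finSigmaFinEquiv.trans (finCongr hδ)

/-- The embedding of the Young subgroup `𝔖_{δ₁} × ⋯ × 𝔖_{δ_k}` into `𝔖_d`. -/
def blockPerm {k d : ℕ} (δ : Fin k → ℕ) (hδ : ∑ j, δ j = d)
    (w : ∀ j, Equiv.Perm (Fin (δ j))) : Equiv.Perm (Fin d) :=
  (blockEquiv δ hδ).permCongr (Equiv.sigmaCongrRight w)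

lemma span_pr_mem {B V : Type*} [Ring B] [Algebra F B] [SuperAlgebra F B]
    [AddCommGroup V] [Module F V] [Module B V] [IsScalarTower F B V] [SuperSpace F V]
    [SuperModule F B V] {X : Set V} (hX : ∀ t ∈ X, ∃ i, pr F i t = t)
    (i : ZMod 2) (v : V) (hv : v ∈ Submodule.span B X) : pr F i v ∈ Submodule.span B X := by
  induction hv using Submodule.span_induction generalizing i with
  | mem t ht =>
    obtain ⟨j, hj⟩ := hX t ht
    rw [pr_of_homog hj]
    split_ifs
    · exact Submodule.subset_span ht
    · exact Submodule.zero_mem _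
  | zero => rw [map_zero]; exact Submodule.zero_mem _
  | add x y _ _ hx hy => rw [map_add]; exact Submodule.add_mem _ (hx i) (hy i)
  | smul a x _ hx =>
    rw [SuperModule.proj_smul (F := F)]
    exact Submodule.add_mem _ (Submodule.smul_mem _ _ (hx _)) (Submodule.smul_mem _ _ (hx _))

instance {B N : Type*} [Ring B] [Algebra F B] [SuperAlgebra F B]
    [AddCommGroup N] [Module F N] [SuperSpace F N] : SuperModule F B (B ⊗[F] N) where
  proj_smul i a t := by
    induction t with
    | zero => simp
    | add x y hx hy =>
      rw [smul_add, map_add, hx, hy]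
      simp only [map_add, smul_add]
      abel
    | tmul b m =>
      have h : ∀ (k : ZMod 2) (c : B), pr F k (c ⊗ₜ[F] m) =
          pr F 0 c ⊗ₜ[F] pr F k m + pr F 1 c ⊗ₜ[F] pr F (k + 1) m := fun _ _ => rfl
      have hm : ∀ (k : ZMod 2) (c : B), pr F k (a * c) =
          pr F 0 a * pr F k c + pr F 1 a * pr F (k + 1) c := fun k c =>
        SuperAlgebra.proj_mul k a c
      rw [TensorProduct.smul_tmul', smul_eq_mul, h, h, h, hm, hm]
      simp only [smul_add, TensorProduct.smul_tmul', smul_eq_mul, TensorProduct.add_tmul]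
      rcases zmod_cases i with rfl | rfl <;>
        simp only [zero_add, show (1 + 1 : ZMod 2) = 0 from rfl] <;> abel

variable (F) (A : Type*) [Ring A] [Algebra F A] [SuperAlgebra F A]
  {k d : ℕ} (δ : Fin k → ℕ) (hδ : ∑ j, δ j = d)
  (M : Fin k → Type*) [∀ j, AddCommGroup (M j)] [∀ j, Module F (M j)]
  [∀ j, Module (Wr F A (δ j)) (M j)] [∀ j, SuperSpace F (M j)]

/-- The relations `g ⊗ m - 1 ⊗ g m` in `W_d ⊗ (M₁ ⊠ ⋯ ⊠ M_k)`, where `m = v₁ ⊗ ⋯ ⊗ v_k` and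
`g = (z₁ ⊗ ⋯ ⊗ z_d)(w₁, …, w_k)` run through spanning sets of homogeneous elements of
`M₁ ⊠ ⋯ ⊠ M_k` and of `W_δ = W_{δ₁} ⊗ ⋯ ⊗ W_{δ_k} ⊆ W_d`. If `g_j ∈ W_{δ_j}` is the `j`th factor
of `g`, then `g m = (-1)^{∑_{r<s} |g_s||v_r|} g₁v₁ ⊗ ⋯ ⊗ g_kv_k`. -/
def circRel : Set (Wr F A d ⊗[F] (⨂[F] j, M j)) :=
  {t | ∃ (x : Fin d → ZMod 2) (z : Fin d → A) (w : ∀ j, Equiv.Perm (Fin (δ j)))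
      (y : Fin k → ZMod 2) (v : ∀ j, M j),
    (∀ i, pr F (x i) (z i) = z i) ∧ (∀ j, pr F (y j) (v j) = v j) ∧
    t = wr F z (blockPerm δ hδ w) ⊗ₜ[F] PiTensorProduct.tprod F v -
      1 ⊗ₜ[F] (sg F (chi (fun s => ∑ m, x (blockEquiv δ hδ ⟨s, m⟩)) y) •
        PiTensorProduct.tprod F fun j =>
          wr F (fun m => z (blockEquiv δ hδ ⟨j, m⟩)) (w j) • v j)}

variable [∀ j, IsScalarTower F (Wr F A (δ j)) (M j)] [∀ j, SuperModule F (Wr F A (δ j)) (M j)]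

lemma circRel_homog (t : Wr F A d ⊗[F] (⨂[F] j, M j)) (ht : t ∈ circRel F A δ hδ M) :
    ∃ i, pr F i t = t := by
  obtain ⟨x, z, w, y, v, hz, hv, rfl⟩ := ht
  refine ⟨∑ i, x i + ∑ j, y j, ?_⟩
  rw [map_sub, pr_tmul (pr_wr F hz _) (pr_tprod hv)]
  congr 1
  rw [TensorProduct.tmul_smul, map_smul]
  congr 1
  have h : ∑ i, x i + ∑ j, y j = 0 + ∑ j, (∑ m, x (blockEquiv δ hδ ⟨j, m⟩) + y j) := by
    rw [zero_add, Finset.sum_add_distrib, ← Equiv.sum_comp (blockEquiv δ hδ) x,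
      Fintype.sum_sigma]
  rw [h]
  exact pr_tmul one_homog (pr_tprod fun j => smul_homog (pr_wr F (fun m => hz _) _) (hv j))

/-- The subsupermodule of `W_d ⊗ (M₁ ⊠ ⋯ ⊠ M_k)` generated by the relations. -/
def circSub : SubSM F (Wr F A d) (Wr F A d ⊗[F] (⨂[F] j, M j)) where
  __ := Submodule.span (Wr F A d) (circRel F A δ hδ M)
  pr_mem := span_pr_mem (circRel_homog F A δ hδ M)

/-- The induction product
`M₁ ∘ ⋯ ∘ M_k = Ind_{W_δ}^{W_d} (M₁ ⊠ ⋯ ⊠ M_k) = W_d ⊗_{W_δ} (M₁ ⊠ ⋯ ⊠ M_k)`. -/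
abbrev Circ : Type _ := (Wr F A d ⊗[F] (⨂[F] j, M j)) ⧸ (circSub F A δ hδ M).toSubmodule

end Induction

/-! ### The Brauer tree superalgebra `A_ℓ` -/

section BrauerTree

/-- The arrows of the quiver with vertices `0, …, ℓ-1`: the loop `u` at `0`, and
`up k = a^{k+1,k} : k → k+1`, `down k = a^{k,k+1} : k+1 → k`. -/
inductive Arrow (ℓ : ℕ) : Type
  | u : Arrow ℓ
  | up (k : ℕ) (h : k + 1 < ℓ) : Arrow ℓ
  | down (k : ℕ) (h : k + 1 < ℓ) : Arrow ℓ

/-- The starting vertex of an arrow. -/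
def Arrow.src {ℓ : ℕ} [NeZero ℓ] : Arrow ℓ → Fin ℓ
  | u => 0
  | up k h => ⟨k, Nat.lt_of_succ_lt h⟩
  | down k h => ⟨k + 1, h⟩

/-- The end vertex of an arrow. -/
def Arrow.tgt {ℓ : ℕ} [NeZero ℓ] : Arrow ℓ → Fin ℓ
  | u => 0
  | up k h => ⟨k + 1, h⟩
  | down k h => ⟨k, Nat.lt_of_succ_lt h⟩

/-- The generators: the paths `e^j` of length `0` and the arrows. -/
inductive Gen (ℓ : ℕ) : Type
  | e (j : Fin ℓ) : Gen ℓ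
  | arr (x : Arrow ℓ) : Gen ℓ

/-- The parity of the generators: `u` is odd, all others are even. -/
def Gen.parity {ℓ : ℕ} : Gen ℓ → ZMod 2
  | e _ => 0
  | arr .u => 1
  | arr (.up _ _) => 0
  | arr (.down _ _) => 0

variable (F : Type*) [Field F] (ℓ : ℕ) [NeZero ℓ]

/-- A length `0` path in the free algebra. -/
abbrev fe (j : Fin ℓ) : FreeAlgebra F (Gen ℓ) := FreeAlgebra.ι F (Gen.e j)

/-- An arrow in the free algebra. -/
abbrev fa (x : Arrow ℓ) : FreeAlgebra F (Gen ℓ) := FreeAlgebra.ι F (Gen.arr x)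

/-- The relations of `A_ℓ`. The first five are those of the path algebra, with paths composed from
right to left; in particular a product of arrows that is not a path vanishes. -/
inductive Rel : FreeAlgebra F (Gen ℓ) → FreeAlgebra F (Gen ℓ) → Prop
  | idem (i : Fin ℓ) : Rel (fe F ℓ i * fe F ℓ i) (fe F ℓ i)
  | orth (i j : Fin ℓ) (h : i ≠ j) : Rel (fe F ℓ i * fe F ℓ j) 0
  | one : Rel (∑ i, fe F ℓ i) 1
  | tgt (x : Arrow ℓ) : Rel (fe F ℓ x.tgt * fa F ℓ x) (fa F ℓ x)
  | src (x : Arrow ℓ) : Rel (fa F ℓ x * fe F ℓ x.src) (fa F ℓ x)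
  /-- all paths of length three are zero -/
  | three (x y z : Arrow ℓ) (hxy : x.src = y.tgt) (hyz : y.src = z.tgt) :
      Rel (fa F ℓ x * fa F ℓ y * fa F ℓ z) 0
  /-- all paths of length two that are not cycles are zero -/
  | noncycle (x y : Arrow ℓ) (hxy : x.src = y.tgt) (h : x.tgt ≠ y.src) :
      Rel (fa F ℓ x * fa F ℓ y) 0
  /-- the length-two cycles based at a vertex `i ∈ {1, …, ℓ-2}` are equal -/
  | cycle (i : Fin ℓ) (h₁ : 1 ≤ (i : ℕ)) (h₂ : (i : ℕ) + 2 ≤ ℓ) (x y x' y' : Arrow ℓ)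
      (hxy : x.src = y.tgt) (hx : x.tgt = i) (hy : y.src = i)
      (hxy' : x'.src = y'.tgt) (hx' : x'.tgt = i) (hy' : y'.src = i) :
      Rel (fa F ℓ x * fa F ℓ y) (fa F ℓ x' * fa F ℓ y')
  /-- `u² = a^{0,1} a^{1,0}` if `ℓ ≥ 2` -/
  | usq (h : 0 + 1 < ℓ) :
      Rel (fa F ℓ .u * fa F ℓ .u) (fa F ℓ (.down 0 h) * fa F ℓ (.up 0 h))

/-- The Brauer tree algebra `A_ℓ`. -/
def BA : Type _ := RingQuot (Rel F ℓ)

instance : Ring (BA F ℓ) := inferInstanceAs (Ring (RingQuot (Rel F ℓ)))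
instance : Algebra F (BA F ℓ) := inferInstanceAs (Algebra F (RingQuot (Rel F ℓ)))

/-- The quotient map from the free algebra. -/
def baMk : FreeAlgebra F (Gen ℓ) →ₐ[F] BA F ℓ := RingQuot.mkAlgHom F (Rel F ℓ)

variable {ℓ} in
/-- The image of a generator in `A_ℓ`. -/
def gen (x : Gen ℓ) : BA F ℓ := baMk F ℓ (FreeAlgebra.ι F x)

lemma baMk_rel {x y : FreeAlgebra F (Gen ℓ)} (h : Rel F ℓ x y) : baMk F ℓ x = baMk F ℓ y :=
  RingQuot.mkAlgHom_rel F h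

/-- Maps out of `A_ℓ`. -/
def baLift {B : Type*} [Ring B] [Algebra F B] (f : Gen ℓ → B)
    (h : ∀ ⦃x y⦄, Rel F ℓ x y → FreeAlgebra.lift F f x = FreeAlgebra.lift F f y) :
    BA F ℓ →ₐ[F] B :=
  RingQuot.liftAlgHom F ⟨FreeAlgebra.lift F f, h⟩

lemma baLift_gen {B : Type*} [Ring B] [Algebra F B] (f : Gen ℓ → B)
    (h : ∀ ⦃x y⦄, Rel F ℓ x y → FreeAlgebra.lift F f x = FreeAlgebra.lift F f y) (x : Gen ℓ) :
    baLift F ℓ f h (gen F x) = f x := by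
  refine (RingQuot.liftAlgHom_mkAlgHom_apply F _ h _).trans ?_
  simp

lemma ba_induction {p : BA F ℓ → Prop} (hc : ∀ r, p (algebraMap F _ r)) (hg : ∀ x, p (gen F x))
    (ha : ∀ a b, p a → p b → p (a + b)) (hm : ∀ a b, p a → p b → p (a * b)) (a : BA F ℓ) :
    p a := by
  obtain ⟨x, rfl⟩ := RingQuot.mkAlgHom_surjective F (Rel F ℓ) a
  change p (baMk F ℓ x)
  induction x using FreeAlgebra.induction with
  | grade0 r => rw [AlgHom.commutes]; exact hc r
  | grade1 x => exact hg x
  | add a b h h' => rw [map_add]; exact ha _ _ h h'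
  | mul a b h h' => rw [map_mul]; exact hm _ _ h h'

/-- The parity of the generators as a map to the group algebra `A_ℓ[ℤ/2]`. -/
def grGen (x : Gen ℓ) : AddMonoidAlgebra (BA F ℓ) (ZMod 2) :=
  AddMonoidAlgebra.single x.parity (gen F x)

lemma grGen_rel ⦃x y : FreeAlgebra F (Gen ℓ)⦄ (h : Rel F ℓ x y) :
    FreeAlgebra.lift F (grGen F ℓ) x = FreeAlgebra.lift F (grGen F ℓ) y := by
  have h' := baMk_rel F ℓ h
  have hpar : ∀ x y : Arrow ℓ, x.src = y.tgt → x.tgt = y.src →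
      (Gen.arr x).parity + (Gen.arr y).parity = 0 := by
    intro x y h1 h2
    cases x <;> cases y <;> simp_all [Arrow.src, Arrow.tgt, Gen.parity]; rfl
  induction h with
  | idem i =>
    simp only [map_mul, FreeAlgebra.lift_ι_apply, grGen, AddMonoidAlgebra.single_mul_single] at h' ⊢
    exact congrArg₂ AddMonoidAlgebra.single rfl h'
  | orth i j hij =>
    simp only [map_mul, map_zero, FreeAlgebra.lift_ι_apply, grGen,
      AddMonoidAlgebra.single_mul_single] at h' ⊢
    rw [gen, gen, h', AddMonoidAlgebra.single_zero]
  | one =>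
    simp only [map_sum, map_one, FreeAlgebra.lift_ι_apply, grGen] at h' ⊢
    rw [AddMonoidAlgebra.one_def, ← h']
    exact (map_sum (AddMonoidAlgebra.singleAddHom (R := BA F ℓ) (0 : ZMod 2)) _ _).symm
  | tgt x =>
    simp only [map_mul, FreeAlgebra.lift_ι_apply, grGen, AddMonoidAlgebra.single_mul_single] at h' ⊢
    exact congrArg₂ AddMonoidAlgebra.single (zero_add _) h'
  | src x =>
    simp only [map_mul, FreeAlgebra.lift_ι_apply, grGen, AddMonoidAlgebra.single_mul_single] at h' ⊢
    exact congrArg₂ AddMonoidAlgebra.single (add_zero _) h'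
  | three x y z _ _ =>
    simp only [map_mul, map_zero, FreeAlgebra.lift_ι_apply, grGen,
      AddMonoidAlgebra.single_mul_single] at h' ⊢
    rw [gen, gen, gen, h', AddMonoidAlgebra.single_zero]
  | noncycle x y _ _ =>
    simp only [map_mul, map_zero, FreeAlgebra.lift_ι_apply, grGen,
      AddMonoidAlgebra.single_mul_single] at h' ⊢
    rw [gen, gen, h', AddMonoidAlgebra.single_zero]
  | cycle i _ _ x y x' y' h1 h2 h3 h4 h5 h6 =>
    simp only [map_mul, FreeAlgebra.lift_ι_apply, grGen, AddMonoidAlgebra.single_mul_single] at h' ⊢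
    refine congrArg₂ AddMonoidAlgebra.single ?_ h'
    rw [hpar x y h1 (h2.trans h3.symm), hpar x' y' h4 (h5.trans h6.symm)]
  | usq h =>
    simp only [map_mul, FreeAlgebra.lift_ι_apply, grGen, AddMonoidAlgebra.single_mul_single] at h' ⊢
    exact congrArg₂ AddMonoidAlgebra.single rfl h'

/-- The algebra homomorphism `A_ℓ → A_ℓ[ℤ/2]`, `a ↦ ∑ᵢ aᵢ [i]`, where `aᵢ` is the component of
parity `i` of `a`. -/
def grHom : BA F ℓ →ₐ[F] AddMonoidAlgebra (BA F ℓ) (ZMod 2) := baLift F ℓ (grGen F ℓ) (grGen_rel F ℓ)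

/-- The projections for the grading of `A_ℓ` for which `u` is odd and all other generators are
even. -/
def baProj (i : ZMod 2) : BA F ℓ →ₗ[F] BA F ℓ where
  toFun a := (grHom F ℓ a).coeff i
  map_add' a b := by rw [map_add]; rfl
  map_smul' r a := by rw [map_smul]; rfl

lemma grHom_eq (a : BA F ℓ) : grHom F ℓ a =
    AddMonoidAlgebra.single 0 (baProj F ℓ 0 a) + AddMonoidAlgebra.single 1 (baProj F ℓ 1 a) := by
  ext i
  rcases zmod_cases i with rfl | rfl <;> simp [baProj]

lemma baProj_gen (x : Gen ℓ) (i : ZMod 2) :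
    baProj F ℓ i (gen F x) = if i = x.parity then gen F x else 0 := by
  change (grHom F ℓ (gen F x)).coeff i = _
  rw [grHom, baLift_gen, grGen]
  simp [Finsupp.single_apply, eq_comm]

lemma baProj_mul (i : ZMod 2) (a b : BA F ℓ) : baProj F ℓ i (a * b) =
    baProj F ℓ 0 a * baProj F ℓ i b + baProj F ℓ 1 a * baProj F ℓ (i + 1) b := by
  change (grHom F ℓ (a * b)).coeff i = _
  rw [map_mul, grHom_eq, grHom_eq]
  simp only [add_mul, mul_add, AddMonoidAlgebra.single_mul_single, AddMonoidAlgebra.coeff_add,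
    AddMonoidAlgebra.coeff_single, Finsupp.add_apply]
  rcases zmod_cases i with rfl | rfl <;>
    simp [show (1 + 1 : ZMod 2) = 0 from rfl, add_comm]

lemma baProj_algebraMap (i : ZMod 2) (r : F) :
    baProj F ℓ i (algebraMap F _ r) = if i = 0 then algebraMap F _ r else 0 := by
  change (grHom F ℓ (algebraMap F _ r)).coeff i = _
  rw [AlgHom.commutes, AddMonoidAlgebra.coe_algebraMap]
  simp [Finsupp.single_apply, eq_comm]

instance : SuperSpace F (BA F ℓ) where
  proj := baProj F ℓ
  proj_proj i j a := by
    induction a using ba_induction F ℓ generalizing i j with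
    | hc r => rw [baProj_algebraMap]; split_ifs <;> simp_all [baProj_algebraMap]
    | hg x => rw [baProj_gen]; split_ifs <;> simp_all [baProj_gen]
    | ha a b h h' => rw [map_add, map_add, h, h']; split_ifs <;> simp
    | hm a b h h' =>
      rw [baProj_mul F ℓ j, map_add, baProj_mul, baProj_mul]
      simp only [h, h']
      rcases zmod_cases i with rfl | rfl <;> rcases zmod_cases j with rfl | rfl <;>
        simp [show (1 + 1 : ZMod 2) = 0 from rfl]
  proj_add a := by
    induction a using ba_induction F ℓ with
    | hc r => simp [baProj_algebraMap]
    | hg x => rcases zmod_cases x.parity with h | h <;> simp [baProj_gen, h]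
    | ha a b h h' =>
      rw [map_add, map_add]
      nth_rw 3 [← h]; nth_rw 3 [← h']; abel
    | hm a b h h' =>
      rw [baProj_mul, baProj_mul]
      conv_rhs => rw [← h, ← h']
      simp only [zero_add, show (1 + 1 : ZMod 2) = 0 from rfl, add_mul, mul_add]
      abel

instance : SuperAlgebra F (BA F ℓ) where
  proj_mul := baProj_mul F ℓ

lemma pr_gen (x : Gen ℓ) : pr F x.parity (gen F x) = gen F x :=
  (baProj_gen F ℓ x _).trans (if_pos rfl)

/-! The irreducible supermodules `L_j` and their projective covers `P_j`. -/

variable {ℓ}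

/-- `P_j = A_ℓ e_j`. -/
def projSub (j : Fin ℓ) : SubSM F (BA F ℓ) (BA F ℓ) where
  __ := Submodule.span (BA F ℓ) {gen F (Gen.e j)}
  pr_mem := span_pr_mem fun t ht => ⟨0, by
    rw [Set.mem_singleton_iff.1 ht]; exact pr_gen F ℓ (Gen.e j)⟩

/-- `P_j = A_ℓ e_j`. -/
abbrev PMod (j : Fin ℓ) : Type _ := (projSub F j).toSubmodule

/-- The values on the generators of the character `A_ℓ → F` of `L_j`. -/
def charGen (j : Fin ℓ) : Gen ℓ → F
  | Gen.e i => if i = j then 1 else 0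
  | Gen.arr _ => 0

lemma charGen_rel (j : Fin ℓ) ⦃x y : FreeAlgebra F (Gen ℓ)⦄ (h : Rel F ℓ x y) :
    FreeAlgebra.lift F (charGen F j) x = FreeAlgebra.lift F (charGen F j) y := by
  induction h <;> simp [charGen]
  case orth i j' h => rintro rfl; exact fun e => h e

/-- The character `A_ℓ → F` with `e_j ↦ 1` and all other generators mapped to `0`. -/
def charHom (j : Fin ℓ) : BA F ℓ →ₐ[F] F := baLift F ℓ (charGen F j) (charGen_rel F j)

lemma charHom_proj (j : Fin ℓ) (i : ZMod 2) (a : BA F ℓ) :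
    charHom F j (baProj F ℓ i a) = if i = 0 then charHom F j a else 0 := by
  induction a using ba_induction F ℓ generalizing i with
  | hc r => rw [baProj_algebraMap]; split_ifs <;> simp
  | hg x =>
    rw [baProj_gen]
    rcases x with i' | (_ | _ | _) <;>
      rcases zmod_cases i with rfl | rfl <;> simp [Gen.parity, charHom, baLift_gen, charGen]
  | ha a b h h' => rw [map_add, map_add, h, h', map_add]; split_ifs <;> simp
  | hm a b h h' =>
    rw [baProj_mul, map_add, map_mul, map_mul, h, h, h', h', map_mul]
    rcases zmod_cases i with rfl | rfl <;> simp

/-- `L_j`, spanned by one even vector `v_j` with `e_j v_j = v_j` on which all other generators act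
as zero. -/
def LMod (_j : Fin ℓ) : Type _ := F

instance (j : Fin ℓ) : AddCommGroup (LMod F j) := inferInstanceAs (AddCommGroup F)
instance (j : Fin ℓ) : Module F (LMod F j) := inferInstanceAs (Module F F)
instance (j : Fin ℓ) : Module (BA F ℓ) (LMod F j) := Module.compHom F (charHom F j).toRingHom
instance (j : Fin ℓ) : IsScalarTower F (BA F ℓ) (LMod F j) where
  smul_assoc r a v := by
    have h : ∀ v : F, charHom F j (r • a) * v = r * (charHom F j a * v) := fun v => by
      rw [map_smul, smul_eq_mul, mul_assoc]
    exact h v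
instance (j : Fin ℓ) : SuperSpace F (LMod F j) where
  proj i := if i = 0 then LinearMap.id else 0
  proj_proj i j v := by
    rcases zmod_cases i with rfl | rfl <;> rcases zmod_cases j with rfl | rfl <;> simp
  proj_add v := by simp
instance (j : Fin ℓ) : SuperModule F (BA F ℓ) (LMod F j) := by
  refine superModule_of_homog fun i i' a v ha hv => ?_
  have h : ∀ v : F, (if i' = 0 then LinearMap.id else (0 : F →ₗ[F] F)) v = v →
      (if i + i' = 0 then LinearMap.id else (0 : F →ₗ[F] F)) (charHom F j a * v) =
        charHom F j a * v := by
    intro v hv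
    have h := charHom_proj F j i a
    rw [show baProj F ℓ i a = a from ha] at h
    rcases zmod_cases i with rfl | rfl <;> rcases zmod_cases i' with rfl | rfl <;>
      simp at h hv ⊢
    · exact Or.inr hv.symm
    · exact Or.inl h
    · rw [h]; simp
  exact h v hv

end BrauerTree

/-! ### Specht modules and Littlewood–Richardson coefficients -/

section Specht

variable (F : Type*) [Field F] (lam : YoungDiagram)

/-- A tableau: a bijection from `{1, …, n}` to the nodes of a Young diagram with `n` nodes. -/
def tableau : Fin lam.card ≃ lam.cells := (lam.cells.equivFinOfCardEq rfl).symm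

/-- The row stabilizer of the tableau. -/
def rowStab : Finset (Equiv.Perm (Fin lam.card)) :=
  Finset.univ.filter fun w => ∀ i, (tableau lam (w i)).1.1 = (tableau lam i).1.1

/-- The column stabilizer of the tableau. -/
def colStab : Finset (Equiv.Perm (Fin lam.card)) :=
  Finset.univ.filter fun w => ∀ i, (tableau lam (w i)).1.2 = (tableau lam i).1.2

/-- The element `(∑_{w in column stabilizer} sgn(w) w) (∑_{w in row stabilizer} w)` of the group
algebra. -/
def youngElt : MonoidAlgebra F (Equiv.Perm (Fin lam.card)) :=
  (∑ w ∈ colStab lam, MonoidAlgebra.single w (((Equiv.Perm.sign w : ℤˣ) : ℤ) : F)) *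
    ∑ w ∈ rowStab lam, MonoidAlgebra.single w (1 : F)

/-- The Specht module `S^λ`: the left ideal of `F 𝔖_n` generated by the element above. (The left
ideal generated by the row sum is the permutation module on tabloids, and the element above is
the polytabloid of the tableau.) -/
abbrev Specht : Type _ :=
  Submodule.span (MonoidAlgebra F (Equiv.Perm (Fin lam.card))) {youngElt F lam}

/-- The Specht module as a representation of `𝔖_n`. -/
def spechtRep : Representation F (Equiv.Perm (Fin lam.card)) (Specht F lam) :=
  ((Algebra.lsmul F F (Specht F lam) :
    MonoidAlgebra F (Equiv.Perm (Fin lam.card)) →ₐ[F] Module.End F (Specht F lam)) :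
    MonoidAlgebra F (Equiv.Perm (Fin lam.card)) →* Module.End F (Specht F lam)).comp
    (MonoidAlgebra.of F _)

/-- The space of homomorphisms of `S^{α₁} ⊠ ⋯ ⊠ S^{α_k}` to the restriction of `S^λ` to the Young
subgroup, over the complex numbers. -/
def lrHom {k : ℕ} (alpha : Fin k → YoungDiagram) (h : ∑ j, (alpha j).card = lam.card) :
    Submodule ℂ ((⨂[ℂ] j, Specht ℂ (alpha j)) →ₗ[ℂ] Specht ℂ lam) where
  carrier := {f | ∀ w : ∀ j, Equiv.Perm (Fin (alpha j).card),
    f ∘ₗ PiTensorProduct.map (fun j => spechtRep ℂ (alpha j) (w j)) =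
      spechtRep ℂ lam (blockPerm (fun j => (alpha j).card) h w) ∘ₗ f}
  add_mem' {f g} hf hg w := by rw [LinearMap.add_comp, LinearMap.comp_add, hf w, hg w]
  zero_mem' w := by rw [LinearMap.zero_comp, LinearMap.comp_zero]
  smul_mem' r f hf w := by rw [LinearMap.smul_comp, LinearMap.comp_smul, hf w]

/-- The Littlewood–Richardson coefficient `c^λ_{α₁, …, α_k}`: the multiplicity of
`S^{α₁} ⊠ ⋯ ⊠ S^{α_k}` in the restriction of the complex Specht module `S^λ` to the Young subgroup
`𝔖_{|α₁|} × ⋯ × 𝔖_{|α_k|}`, and `0` unless `|λ| = |α₁| + ⋯ + |α_k|`. -/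
def lr {k : ℕ} (alpha : Fin k → YoungDiagram) : ℕ :=
  if h : ∑ j, (alpha j).card = lam.card then Module.finrank ℂ (lrHom lam alpha h) else 0

end Specht

/-! ### The supermodules `L(λ)` and `P(λ)` and the Cartan sum -/

section Main

/-- `J`-multipartitions of `d`, where `J = {0, …, ℓ-1}`. -/
structure Multipartition (ℓ d : ℕ) where
  part : Fin ℓ → YoungDiagram
  sum_card : ∑ j, (part j).card = d

variable (F : Type*) [Field F] {ℓ : ℕ} [NeZero ℓ] {d : ℕ}

/-- The wreath superproduct `W_d = A_ℓ ≀ 𝔖_d`. -/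
abbrev Wd (ℓ : ℕ) [NeZero ℓ] (d : ℕ) : Type _ := Wr F (BA F ℓ) d

/-- `L(λ) = L_0(λ⁽⁰⁾) ∘ ⋯ ∘ L_{ℓ-1}(λ⁽ℓ⁻¹⁾)`, where `V(μ) = V^{⊗|μ|} ⊗ S^μ`. -/
abbrev LL (lam : Multipartition ℓ d) : Type _ :=
  Circ F (BA F ℓ) (fun j => (lam.part j).card) lam.sum_card
    (fun j => Twist F (LMod F j) (spechtRep F (lam.part j)))

/-- `P(λ) = P_0(λ⁽⁰⁾) ∘ ⋯ ∘ P_{ℓ-1}(λ⁽ℓ⁻¹⁾)`, where `V(μ) = V^{⊗|μ|} ⊗ S^μ`. -/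
abbrev PP (lam : Multipartition ℓ d) : Type _ :=
  Circ F (BA F ℓ) (fun j => (lam.part j).card) lam.sum_card
    (fun j => Twist F (PMod F j) (spechtRep F (lam.part j)))

/-- `β^{(j+1)}`, read as `∅` for `j = ℓ - 1`. -/
def nextPart (beta : Fin ℓ → YoungDiagram) (j : Fin ℓ) : YoungDiagram :=
  if h : (j : ℕ) + 1 < ℓ then beta ⟨j + 1, h⟩ else ⊥

/-- `γ^{(j-1)}`, read as the conjugate of `β^{(0)}` for `j = 0`. -/
def prevPart (beta gamma : Fin ℓ → YoungDiagram) (j : Fin ℓ) : YoungDiagram :=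
  if j = 0 then (beta 0).transpose
  else gamma ⟨j - 1, lt_of_le_of_lt (Nat.sub_le _ _) j.isLt⟩

/-- The quadruples `(α, β, γ, δ)` of families of partitions indexed by `J` with
`γ^{(ℓ-1)} = ∅`. -/
structure Quad (ℓ : ℕ) where
  alpha : Fin ℓ → YoungDiagram
  beta : Fin ℓ → YoungDiagram
  gamma : Fin ℓ → YoungDiagram
  delta : Fin ℓ → YoungDiagram
  gamma_last : ∀ j : Fin ℓ, (j : ℕ) + 1 = ℓ → gamma j = ⊥

end Main

end WreathSuper

end

/-!
The composition multiplicity `[P(λ) : L(μ)]` is the dimension of a corner `ε_μ W_d ε_λ`, and this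
corner is computed in the basis of `W_d` given by words of paths and permutations.

**Idempotents.** The factorials up to `d!` are invertible in `F`, so a multiple of the Young
symmetrizer of each partition of `n ≤ d` is an idempotent of `F 𝔖_n`. By von Neumann's lemma its
corner is `F`, idempotents of different shapes are orthogonal, and there are as many of them as
conjugacy classes; hence the central elements obtained from them by averaging span the centre
(`splitFamily_yId`). Such complete families are inherited by Young subgroups (`splitFamily_box`).
For a multipartition `μ` put `ε_μ = e_T · e`, where `T = 0 ⋯ 0 1 ⋯ 1 ⋯` contains `|μ^{(j)}|`
letters `j`, and `e` is the idempotent of the family `μ` in the group algebra of the stabilizer of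
`T` (`cartanIdem`).

**Multiplicities are dimensions.** `P(λ)` is generated by a vector fixed by `ε_λ` and maps to `W_d`
such that this vector goes to `ε_λ`, so `P(λ) ≅ W_d ε_λ` (`idemDim_PP`). The words of positive
length span a nilpotent ideal, modulo which `ε_μ W_d ε_μ` is one-dimensional
(`exists_isLocalIdem`). They kill the generator of `L(μ)`, which is fixed by `ε_μ`, and so `L(μ)`
is irreducible (`isIrred_of_generator`). A local idempotent has rank at most one on each
irreducible supermodule, and at most one irreducible supermodule up to isomorphism is not killed by
it; adding up over a composition series gives `[P(λ) : L(μ)] = dim ε_μ W_d ε_λ`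
(`hasMultiplicity_idemDim`, `hasMultiplicity_finrank`).

**The corner.** The algebra `A_ℓ` has a basis of paths: four for each start vertex `j`, namely
`e_j`, the arrow to `j - 1` (the loop `u` if `j = 0`), the arrow to `j + 1` (missing if
`j = ℓ - 1`), and the cycle of length two (`coord_path`, `sum_coord_smul_path`). So `W_d` has a
basis of pairs of a word of length `d` in these letters and a permutation. For a sorted word `b`, the
coefficients of `z ∈ W_d` at the rearrangements of `b` are, up to signs, the matrix entries of an
operator on `F 𝔖_d` (`kernelOp`), and the operators that occur are those commuting with right
translations by the stabilizer of `b`, up to the sign of the permutation of the odd letters.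
Multiplication by `ε_λ` and `ε_μ` becomes composition with projections (`refOp`), so `ε_μ W_d ε_λ`
is the direct sum, over the types of words, of spaces of equivariant maps (`finrank_corner`).

The dimension of a space of equivariant maps is a sum of products of ranks of primitive
idempotents, over families of partitions indexed by the letters (`finrank_equivHom`). The
partitions of the four letters starting at `j` are `α^{(j)}, β^{(j)}, γ^{(j)}, δ^{(j)}`. On the
source, letters are grouped by their start vertices, and the rank is the product of the
coefficients `c^{λ^{(j)}}_{α^{(j)}, β^{(j)}, γ^{(j)}, δ^{(j)}}`. On the target they are grouped by
their end vertices, which gives the other factor; there the sign twist on the odd letter `u`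
conjugates the partition `β^{(0)}` (`finrank_refOp`, `equivIdem_sgnAlg`, `vec_twist_toQuad`,
`finrank_cartanIdem`).

**Change of field.** The ranks are those of operators over `F`, while the Littlewood–Richardson
coefficients are defined over `ℂ`. Both are ranks of the same integer matrix `M` with `M² = k M`,
where `k` is not zero in `F`. The order of vanishing of the characteristic polynomial at `0` can
only grow under reduction; applied to `M` and `k - M`, this shows that the ranks agree
(`rank_map_eq`, `lr_eq_lrNum`).
-/

noncomputable section

namespace WreathSuper

/-! ### Young symmetrizers -/

section Tableaux

variable {α : Type*} [Fintype α] [DecidableEq α] {lam mu : YoungDiagram}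

/-- No two distinct entries lie in the same row of `t` and in the same column of `s`. -/
def RowColDisjoint (t : α ≃ lam.cells) (s : α ≃ mu.cells) : Prop :=
  ∀ a b, (t a).1.1 = (t b).1.1 → (s a).1.2 = (s b).1.2 → a = b

/-- Both sides count within column `c` of `s`. An entry there lying in one of the first `k` rows of
`t` is determined by its row in `t`, so there are at most `min k (mu.colLen c)` of them, which is
the number of cells of column `c` in the first `k` rows. -/
lemma card_row_lt_col_le {t : α ≃ lam.cells} {s : α ≃ mu.cells} (h : RowColDisjoint t s)
    (k c : ℕ) :
    (Finset.univ.filter fun a => (s a).1.2 = c ∧ (t a).1.1 < k).card ≤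
      (Finset.univ.filter fun a => (s a).1.2 = c ∧ (s a).1.1 < k).card := by
  have hB : (Finset.range (min k (mu.colLen c))).card ≤
      (Finset.univ.filter fun a => (s a).1.2 = c ∧ (s a).1.1 < k).card := by
    refine Finset.card_le_card_of_surjOn (fun a => (s a).1.1) ?_
    intro i hi
    have hi' : i < min k (mu.colLen c) := by simpa using hi
    have hm : (i, c) ∈ mu.cells :=
      YoungDiagram.mem_iff_lt_colLen.2 (lt_of_lt_of_le hi' (min_le_right _ _))
    refine ⟨s.symm ⟨(i, c), hm⟩, ?_, ?_⟩
    · simpa using lt_of_lt_of_le hi' (min_le_left _ _)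
    · simp
  refine le_trans ?_ hB
  rw [Finset.card_range]
  refine le_min ?_ ?_
  · rw [← Finset.card_range k]
    refine Finset.card_le_card_of_injOn (fun a => (t a).1.1) ?_ ?_
    · intro a ha
      have : (s a).1.2 = c ∧ (t a).1.1 < k := by simpa using ha
      simpa using this.2
    · intro a ha b hb hab
      have h1 : (s a).1.2 = c ∧ (t a).1.1 < k := by simpa using ha
      have h2 : (s b).1.2 = c ∧ (t b).1.1 < k := by simpa using hb
      exact h a b hab (h1.1.trans h2.1.symm)
  · rw [← Finset.card_range (mu.colLen c)]
    refine Finset.card_le_card_of_injOn (fun a => (s a).1.1) ?_ ?_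
    · intro a ha
      have h1 : (s a).1.2 = c ∧ (t a).1.1 < k := by simpa using ha
      have := (s a).2
      have h3 : ((s a).1.1, (s a).1.2) ∈ mu := this
      rw [h1.1] at h3
      simpa using YoungDiagram.mem_iff_lt_colLen.1 h3
    · intro a ha b hb hab
      have h1 : (s a).1.2 = c ∧ (t a).1.1 < k := by simpa using ha
      have h2 : (s b).1.2 = c ∧ (t b).1.1 < k := by simpa using hb
      exact s.injective (Subtype.ext (Prod.ext hab (h1.1.trans h2.1.symm)))

lemma card_row_lt (t : α ≃ lam.cells) (k : ℕ) :
    (Finset.univ.filter fun a => (t a).1.1 < k).card =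
      (lam.cells.filter fun x => x.1 < k).card := by
  refine Finset.card_bij (fun a _ => (t a).1) ?_ ?_ ?_
  · intro a ha
    have := (t a).2
    simp only [Finset.mem_filter, Finset.mem_univ, true_and] at ha ⊢
    exact ⟨this, ha⟩
  · intro a _ b _ hab
    exact t.injective (Subtype.ext hab)
  · intro x hx
    rw [Finset.mem_filter] at hx
    exact ⟨t.symm ⟨x, hx.1⟩, by simpa using hx.2, by simp⟩

/-- Counting entries column by column of `s`. -/
lemma card_eq_sum_col (s : α ≃ mu.cells) (p : α → Prop) [DecidablePred p] :
    (Finset.univ.filter p).card = ∑ c ∈ Finset.univ.image (fun a => (s a).1.2),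
      (Finset.univ.filter fun a => (s a).1.2 = c ∧ p a).card := by
  rw [Finset.card_eq_sum_card_fiberwise (f := fun a => (s a).1.2)
    (t := Finset.univ.image (fun a => (s a).1.2)) fun a _ => by simp]
  refine Finset.sum_congr rfl fun c _ => ?_
  rw [Finset.filter_filter]
  simp only [and_comm]

/-- The dominance inequality: the rows of `t` are spread over different columns of `s`. -/
lemma RowColDisjoint.card_le {t : α ≃ lam.cells} {s : α ≃ mu.cells} (h : RowColDisjoint t s)
    (k : ℕ) :
    (lam.cells.filter fun x => x.1 < k).card ≤ (mu.cells.filter fun x => x.1 < k).card := by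
  rw [← card_row_lt t, ← card_row_lt s, card_eq_sum_col s, card_eq_sum_col s]
  exact Finset.sum_le_sum fun c _ => card_row_lt_col_le h k c

/-- A partition is determined by its partial sums. -/
lemma eq_of_card_row_lt
    (h : ∀ k, (lam.cells.filter fun x => x.1 < k).card =
      (mu.cells.filter fun x => x.1 < k).card) : lam = mu := by
  have key : ∀ (nu : YoungDiagram) (k : ℕ), (nu.cells.filter fun x => x.1 < k + 1).card =
      (nu.cells.filter fun x => x.1 < k).card + nu.rowLen k := by
    intro nu k
    rw [YoungDiagram.rowLen_eq_card, YoungDiagram.row, ← Finset.card_union_of_disjoint]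
    · congr 1
      ext x
      simp only [Finset.mem_filter, Finset.mem_union, Nat.lt_succ_iff, le_iff_lt_or_eq]
      tauto
    · rw [Finset.disjoint_left]
      intro x hx hx'
      rw [Finset.mem_filter] at hx hx'
      omega
  have h2 : ∀ k, lam.rowLen k = mu.rowLen k := fun k => by
    have h1 := h (k + 1)
    rw [key, key, h k] at h1
    omega
  ext ⟨i, j⟩
  change (i, j) ∈ lam ↔ (i, j) ∈ mu
  rw [YoungDiagram.mem_iff_lt_rowLen, YoungDiagram.mem_iff_lt_rowLen, h2]

/-- Dominance in both directions forces equal shapes. -/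
lemma RowColDisjoint.shape_eq {β : Type*} [Fintype β] [DecidableEq β]
    {t : α ≃ lam.cells} {s : α ≃ mu.cells}
    {t' : β ≃ lam.cells} {s' : β ≃ mu.cells} (h : RowColDisjoint t s)
    (h' : RowColDisjoint s' t') : lam = mu :=
  eq_of_card_row_lt fun k => le_antisymm (h.card_le k) (h'.card_le k)

/-- Equality in the dominance inequality: when the shapes agree, the cell in the row of `a` in `t`
and in the column of `a` in `s` belongs to the diagram. -/
lemma RowColDisjoint.mem {t s : α ≃ lam.cells} (h : RowColDisjoint t s) (a : α) :
    ((t a).1.1, (s a).1.2) ∈ lam.cells := by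
  -- Take `k` to be the length of the column of `a`. The sums over all columns agree, hence so do
  -- the summands: every entry of this column of `s` lies in the first `k` rows of `t`.
  set c := (s a).1.2 with hc
  set k := lam.colLen c with hk
  have e : ∑ c ∈ Finset.univ.image (fun a => (s a).1.2),
      (Finset.univ.filter fun a => (s a).1.2 = c ∧ (t a).1.1 < k).card =
      ∑ c ∈ Finset.univ.image (fun a => (s a).1.2),
      (Finset.univ.filter fun a => (s a).1.2 = c ∧ (s a).1.1 < k).card := by
    rw [← card_eq_sum_col s, ← card_eq_sum_col s, card_row_lt, card_row_lt]
  have e' := (Finset.sum_eq_sum_iff_of_le fun c _ => card_row_lt_col_le h k c).1 e c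
    (by simp [hc])
  have hall : (Finset.univ.filter fun a => (s a).1.2 = c ∧ (s a).1.1 < k) =
      Finset.univ.filter fun a => (s a).1.2 = c := by
    refine Finset.filter_congr fun b _ => ⟨fun hb => hb.1, fun hb => ⟨hb, ?_⟩⟩
    have h3 : ((s b).1.1, (s b).1.2) ∈ lam := (s b).2
    rw [hb] at h3
    exact YoungDiagram.mem_iff_lt_colLen.1 h3
  rw [hall] at e'
  have hsub : (Finset.univ.filter fun a => (s a).1.2 = c ∧ (t a).1.1 < k) ⊆
      Finset.univ.filter fun a => (s a).1.2 = c := fun b hb => by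
    simp only [Finset.mem_filter, Finset.mem_univ, true_and] at hb ⊢
    exact hb.1
  have := Finset.eq_of_subset_of_card_le hsub e'.ge
  have ha : a ∈ Finset.univ.filter fun a => (s a).1.2 = c := by simp [hc]
  rw [← this, Finset.mem_filter] at ha
  exact YoungDiagram.mem_iff_lt_colLen.2 ha.2.2

/-- The row stabilizer of a tableau. -/
def rowSt (t : α ≃ lam.cells) : Finset (Equiv.Perm α) :=
  Finset.univ.filter fun w => ∀ i, (t (w i)).1.1 = (t i).1.1

/-- The column stabilizer of a tableau. -/
def colSt (t : α ≃ lam.cells) : Finset (Equiv.Perm α) :=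
  Finset.univ.filter fun w => ∀ i, (t (w i)).1.2 = (t i).1.2

lemma mem_rowSt {t : α ≃ lam.cells} {w : Equiv.Perm α} :
    w ∈ rowSt t ↔ ∀ i, (t (w i)).1.1 = (t i).1.1 := by simp [rowSt]

lemma mem_colSt {t : α ≃ lam.cells} {w : Equiv.Perm α} :
    w ∈ colSt t ↔ ∀ i, (t (w i)).1.2 = (t i).1.2 := by simp [colSt]

lemma mul_mem_rowSt {t : α ≃ lam.cells} {v w : Equiv.Perm α} (hv : v ∈ rowSt t) :
    v * w ∈ rowSt t ↔ w ∈ rowSt t := by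
  rw [mem_rowSt] at hv
  simp [mem_rowSt, hv]

lemma mul_mem_colSt {t : α ≃ lam.cells} {v w : Equiv.Perm α} (hv : v ∈ colSt t) :
    w * v ∈ colSt t ↔ w ∈ colSt t := by
  rw [mem_colSt] at hv
  simp only [mem_colSt]
  constructor
  · intro h i
    have h1 := h (v.symm i)
    have h2 := hv (v.symm i)
    simp only [Equiv.Perm.mul_apply, Equiv.apply_symm_apply] at h1 h2
    rw [h1, h2]
  · intro h i
    rw [Equiv.Perm.mul_apply, h, hv]

/-- If `g` moves no two entries of a row of `t` into one column, then `g` is the product of a column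
and a row permutation. -/
lemma RowColDisjoint.exists_mul {t : α ≃ lam.cells} {g : Equiv.Perm α}
    (h : RowColDisjoint t (g.trans t)) : ∃ c ∈ colSt t, ∃ r ∈ rowSt t, g = c * r := by
  -- `f a` stays in the row of `a` and moves to the column of `g a`.
  let f : α → α := fun a => t.symm ⟨((t a).1.1, (t (g a)).1.2), h.mem a⟩
  have h1 : ∀ a, (t (f a)).1.1 = (t a).1.1 := fun a => by simp [f]
  have h2 : ∀ a, (t (f a)).1.2 = (t (g a)).1.2 := fun a => by simp [f]
  have hf : Function.Injective f := fun a b hab =>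
    h a b (by rw [← h1, hab, h1]) (by
      change (t (g a)).1.2 = (t (g b)).1.2
      rw [← h2, hab, h2])
  let r : Equiv.Perm α := Equiv.ofBijective f (Finite.injective_iff_bijective.1 hf)
  refine ⟨g * r⁻¹, ?_, r, mem_rowSt.2 h1, by simp⟩
  rw [mem_colSt]
  intro i
  have := h2 (r⁻¹ i)
  rw [Equiv.Perm.mul_apply, ← this]
  congr 3
  exact r.apply_symm_apply i

variable (R : Type*) [CommRing R]

/-- The sum of the row stabilizer in the group algebra. -/
def rowSum (t : α ≃ lam.cells) : MonoidAlgebra R (Equiv.Perm α) :=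
  ∑ w ∈ rowSt t, MonoidAlgebra.single w (1 : R)

/-- The signed sum of the column stabilizer in the group algebra. -/
def colSum (t : α ≃ lam.cells) : MonoidAlgebra R (Equiv.Perm α) :=
  ∑ w ∈ colSt t, MonoidAlgebra.single w (((Equiv.Perm.sign w : ℤˣ) : ℤ) : R)

variable {R}

lemma single_mul_rowSum {t : α ≃ lam.cells} {v : Equiv.Perm α} (hv : v ∈ rowSt t) :
    MonoidAlgebra.single v (1 : R) * rowSum R t = rowSum R t := by
  rw [rowSum, Finset.mul_sum]
  refine Finset.sum_equiv (Equiv.mulLeft v) (fun w => (mul_mem_rowSt hv).symm) fun w _ => ?_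
  simp [MonoidAlgebra.single_mul_single]

lemma colSum_mul_single {t : α ≃ lam.cells} {v : Equiv.Perm α} (hv : v ∈ colSt t) :
    colSum R t * MonoidAlgebra.single v (1 : R) =
      (((Equiv.Perm.sign v : ℤˣ) : ℤ) : R) • colSum R t := by
  rw [colSum, Finset.sum_mul, Finset.smul_sum]
  refine Finset.sum_equiv (Equiv.mulRight v) (fun w => (mul_mem_colSt hv).symm) fun w _ => ?_
  rw [MonoidAlgebra.single_mul_single, MonoidAlgebra.smul_single, Equiv.coe_mulRight, map_mul]
  congr 1
  rcases Int.units_eq_one_or (Equiv.Perm.sign v) with h | h <;> simp [h]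

/-- The antiautomorphism of the group algebra inverting the group elements. -/
def invAlg {G : Type*} [Group G] : MonoidAlgebra R G →ₗ[R] MonoidAlgebra R G :=
  MonoidAlgebra.mapDomainLinearMap R R (fun g : G => g⁻¹)

lemma invAlg_single {G : Type*} [Group G] (g : G) (r : R) :
    invAlg (MonoidAlgebra.single g r) = MonoidAlgebra.single g⁻¹ r := by
  simp [invAlg]

lemma invAlg_mul {G : Type*} [Group G] (x y : MonoidAlgebra R G) :
    invAlg (x * y) = invAlg y * invAlg x := by
  induction x using MonoidAlgebra.induction_linear with
  | zero => simp
  | add x x' h h' => rw [add_mul, map_add, h, h', map_add, mul_add]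
  | single g r =>
    induction y using MonoidAlgebra.induction_linear with
    | zero => simp
    | add x x' h h' => rw [mul_add, map_add, h, h', map_add, add_mul]
    | single g' r' =>
      simp [invAlg_single, MonoidAlgebra.single_mul_single, mul_comm]

lemma invAlg_invAlg {G : Type*} [Group G] (x : MonoidAlgebra R G) : invAlg (invAlg x) = x := by
  induction x using MonoidAlgebra.induction_linear with
  | zero => simp
  | add x x' h h' => rw [map_add, map_add, h, h']
  | single g r => simp [invAlg_single]

lemma invAlg_rowSum (t : α ≃ lam.cells) : invAlg (rowSum R t) = rowSum R t := by
  rw [rowSum, map_sum]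
  refine Finset.sum_equiv (Equiv.inv _) (fun w => ?_) fun w _ => by simp [invAlg_single]
  have h1 : ∀ w : Equiv.Perm α, w ∈ rowSt t → w⁻¹ ∈ rowSt t := fun w hw => by
    rw [← mul_mem_rowSt hw, mul_inv_cancel]; simp [mem_rowSt]
  exact ⟨h1 w, fun h => by simpa using h1 _ h⟩

lemma invAlg_colSum (t : α ≃ lam.cells) : invAlg (colSum R t) = colSum R t := by
  rw [colSum, map_sum]
  refine Finset.sum_equiv (Equiv.inv _) (fun w => ?_) fun w _ => by simp [invAlg_single]
  have h1 : ∀ w : Equiv.Perm α, w ∈ colSt t → w⁻¹ ∈ colSt t := fun w hw => by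
    rw [← mul_mem_colSt hw, inv_mul_cancel]; simp [mem_colSt]
  exact ⟨h1 w, fun h => by simpa using h1 _ h⟩

/-- `g⁻¹ · colSum s · g` is the column sum of the tableau `s ∘ g`. -/
lemma single_mul_colSum (s : α ≃ mu.cells) (g : Equiv.Perm α) :
    colSum R s * MonoidAlgebra.single g (1 : R) =
      MonoidAlgebra.single g (1 : R) * colSum R (g.trans s) := by
  rw [colSum, colSum, Finset.sum_mul, Finset.mul_sum]
  refine Finset.sum_equiv (MulAut.conj g⁻¹).toEquiv (fun w => ?_) fun w _ => ?_
  · rw [mem_colSt, mem_colSt]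
    constructor
    · intro h i
      simpa using h (g i)
    · intro h i
      simpa using h (g⁻¹ i)
  · have h1 : Equiv.Perm.sign (g⁻¹ * w * g) = Equiv.Perm.sign w := by
      rw [map_mul, map_mul, Equiv.Perm.sign_inv, mul_comm, ← mul_assoc, Int.units_mul_self,
        one_mul]
    simp only [MonoidAlgebra.single_mul_single, MulEquiv.toEquiv_eq_coe, EquivLike.coe_coe,
      MulAut.conj_apply, inv_inv, h1]
    simp [mul_assoc]

variable (h2 : ∀ r : R, r + r = 0 → r = 0)
include h2

/-- A transposition which preserves the rows of `t` and the columns of `s` makes the product equal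
to its negative. -/
lemma colSum_mul_rowSum_eq_zero {t : α ≃ lam.cells} {s : α ≃ mu.cells}
    (h : ¬ RowColDisjoint t s) : colSum R s * rowSum R t = 0 := by
  simp only [RowColDisjoint, not_forall] at h
  obtain ⟨a, b, h1, h3, hab⟩ := h
  have hr : Equiv.swap a b ∈ rowSt t := by
    rw [mem_rowSt]
    intro i
    rw [Equiv.swap_apply_def]
    split_ifs with e e' <;> simp_all
  have hc : Equiv.swap a b ∈ colSt s := by
    rw [mem_colSt]
    intro i
    rw [Equiv.swap_apply_def]
    split_ifs with e e' <;> simp_all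
  -- Move the transposition of `a` and `b` from the row sum to the column sum.
  have e : colSum R s * rowSum R t = -(colSum R s * rowSum R t) := by
    conv_lhs => rw [← single_mul_rowSum hr, ← mul_assoc, colSum_mul_single hc]
    rw [Equiv.Perm.sign_swap hab]
    simp
  ext g
  refine h2 _ ?_
  have := congrArg (fun x => x.coeff g) e
  simp only [MonoidAlgebra.coeff_neg, Finsupp.neg_apply] at this
  nth_rw 1 [this]
  exact neg_add_cancel _

/-- Von Neumann's lemma: `c x r` is a multiple of `c r`. -/
lemma exists_colSum_mul_rowSum (t : α ≃ lam.cells) (x : MonoidAlgebra R (Equiv.Perm α)) :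
    ∃ k : R, colSum R t * x * rowSum R t = k • (colSum R t * rowSum R t) := by
  induction x using MonoidAlgebra.induction_linear with
  | zero => exact ⟨0, by simp⟩
  | add x y hx hy =>
    obtain ⟨k, hk⟩ := hx
    obtain ⟨l, hl⟩ := hy
    exact ⟨k + l, by rw [mul_add, add_mul, hk, hl, add_smul]⟩
  | single g r =>
    have hr : (MonoidAlgebra.single g r : MonoidAlgebra R (Equiv.Perm α)) =
        r • MonoidAlgebra.single g 1 := by simp
    by_cases h : RowColDisjoint t (g.trans t)
    · obtain ⟨c, hc, w, hw, rfl⟩ := h.exists_mul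
      refine ⟨r * (((Equiv.Perm.sign c : ℤˣ) : ℤ) : R), ?_⟩
      have : (MonoidAlgebra.single (c * w) 1 : MonoidAlgebra R (Equiv.Perm α)) =
        MonoidAlgebra.single c 1 * MonoidAlgebra.single w 1 := by
          simp [MonoidAlgebra.single_mul_single]
      rw [hr, mul_smul_comm, smul_mul_assoc, this, ← mul_assoc, colSum_mul_single hc, mul_assoc,
        single_mul_rowSum hw, smul_mul_assoc, smul_smul]
    · refine ⟨0, ?_⟩
      rw [hr, mul_smul_comm, single_mul_colSum, smul_mul_assoc, mul_assoc,
        colSum_mul_rowSum_eq_zero h2 h]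
      simp

lemma colSum_single_rowSum {t : α ≃ lam.cells} {s : α ≃ mu.cells} {g : Equiv.Perm α}
    (h : colSum R t * MonoidAlgebra.single g (1 : R) * rowSum R s ≠ 0) :
    RowColDisjoint s (g.trans t) := by
  by_contra hn
  refine h ?_
  rw [single_mul_colSum, mul_assoc, colSum_mul_rowSum_eq_zero h2 hn, mul_zero]

/-- Young symmetrizers `y`, `y'` of different shapes satisfy `y x y' = 0` for all `x`. -/
lemma young_mul_young_eq_zero (hne : lam ≠ mu) (t : α ≃ lam.cells) (s : α ≃ mu.cells)
    (x : MonoidAlgebra R (Equiv.Perm α)) :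
    (colSum R t * rowSum R t) * x * (colSum R s * rowSum R s) = 0 := by
  have hs : ∀ x : MonoidAlgebra R (Equiv.Perm α), ∀ a b : MonoidAlgebra R (Equiv.Perm α),
      (∀ g, a * MonoidAlgebra.single g (1 : R) * b = 0) → a * x * b = 0 := by
    intro x a b hab
    induction x using MonoidAlgebra.induction_linear with
    | zero => simp
    | add x y hx hy => rw [mul_add, add_mul, hx, hy, add_zero]
    | single g r =>
      rw [show (MonoidAlgebra.single g r : MonoidAlgebra R (Equiv.Perm α)) =
        r • MonoidAlgebra.single g 1 by simp, mul_smul_comm, smul_mul_assoc, hab, smul_zero]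
  have e : (colSum R t * rowSum R t) * x * (colSum R s * rowSum R s) =
      colSum R t * (rowSum R t * x * colSum R s) * rowSum R s := by
    simp only [mul_assoc]
  rw [e]
  -- If both `c_t F𝔖 r_s` and `r_t F𝔖 c_s` were non-zero, the shapes would dominate each other.
  by_cases h1 : ∀ g, colSum R t * MonoidAlgebra.single g (1 : R) * rowSum R s = 0
  · exact hs _ _ _ h1
  · have h3 : rowSum R t * x * colSum R s = 0 := by
      refine hs x _ _ fun g => ?_
      by_contra h4
      have h5 : colSum R s * MonoidAlgebra.single g⁻¹ (1 : R) * rowSum R t ≠ 0 := by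
        intro h5
        refine h4 ?_
        have := congrArg invAlg h5
        rw [invAlg_mul, invAlg_mul, invAlg_rowSum, invAlg_colSum, invAlg_single, inv_inv,
          map_zero, ← mul_assoc] at this
        exact this
      obtain ⟨g', h1⟩ := not_forall.1 h1
      exact hne ((colSum_single_rowSum h2 h5).shape_eq (colSum_single_rowSum h2 h1))
    rw [h3, mul_zero, zero_mul]

omit h2

/-- The row and column stabilizers meet trivially. -/
lemma coeff_one_young (t : α ≃ lam.cells) : (colSum R t * rowSum R t).coeff 1 = 1 := by
  have : colSum R t * rowSum R t = ∑ c ∈ colSt t, ∑ r ∈ rowSt t,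
      MonoidAlgebra.single (c * r) (((Equiv.Perm.sign c : ℤˣ) : ℤ) : R) := by
    rw [colSum, rowSum, Finset.sum_mul]
    refine Finset.sum_congr rfl fun c _ => ?_
    rw [Finset.mul_sum]
    simp [MonoidAlgebra.single_mul_single]
  rw [this]
  simp only [MonoidAlgebra.coeff_sum, Finsupp.finsetSum_apply, MonoidAlgebra.coeff_single,
    Finsupp.single_apply]
  rw [Finset.sum_eq_single 1]
  · rw [Finset.sum_eq_single 1]
    · simp
    · intro r _ hr; simp [hr]
    · intro h; exact absurd (mem_rowSt.2 fun i => rfl) h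
  · intro c hc hc1
    refine Finset.sum_eq_zero fun r hr => if_neg fun h => hc1 ?_
    have hr' : r = c⁻¹ := eq_inv_of_mul_eq_one_right h
    ext i
    have h1 := mem_colSt.1 hc i
    have h3 := mem_rowSt.1 hr (c i)
    rw [hr', show c⁻¹ (c i) = i from c.symm_apply_apply i] at h3
    exact t.injective (Subtype.ext (Prod.ext h3.symm h1))
  · intro h; exact absurd (mem_colSt.2 fun i => rfl) h

end Tableaux

/-! ### Primitive idempotents of a split semisimple group algebra -/

section Split

variable {F : Type*} [Field F] {G : Type*} [Group G] [Fintype G] {I : Type*} [Fintype I]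

/-- A complete family of pairwise inequivalent primitive idempotents `e i` of `F G`, all of whose
corner algebras `e i F G e i` equal `F e i`; completeness says that `1` is a combination of the
central elements `∑ g, g (e i) g⁻¹`. -/
structure SplitFamily (e : I → MonoidAlgebra F G) : Prop where
  scal : ∀ i x, ∃ k : F, e i * x * e i = k • e i
  orth : ∀ i j, i ≠ j → ∀ x, e i * x * e j = 0
  idem : ∀ i, e i * e i = e i
  ne : ∀ i, e i ≠ 0
  complete : ∃ a : I → F, ∑ i, a i • ∑ g : G,
    MonoidAlgebra.single g (1 : F) * e i * MonoidAlgebra.single g⁻¹ (1 : F) = 1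

/-- Left multiplication by a group element other than `1` fixes no group element. -/
lemma trace_mulLeft (x : MonoidAlgebra F G) :
    LinearMap.trace F _ (LinearMap.mulLeft F x) = Fintype.card G * x.coeff 1 := by
  classical
  let b : Module.Basis G F (MonoidAlgebra F G) := Module.Basis.ofRepr
    (MonoidAlgebra.coeffLinearEquiv F)
  have hb : ∀ g, b g = MonoidAlgebra.single g 1 := fun g => rfl
  have hr : ∀ y g, b.repr y g = y.coeff g := fun y g => rfl
  rw [LinearMap.trace_eq_matrix_trace F b, Matrix.trace]
  simp only [Matrix.diag_apply, LinearMap.toMatrix_apply, LinearMap.mulLeft_apply, hb, hr]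
  simp [MonoidAlgebra.coeff_mul_single_apply]

/-- An element `y` with `y² = k y` and constant term `1` is a non-zero multiple of an idempotent:
otherwise `y² = 0`, while the trace of left multiplication by `y` is `|G|`. -/
lemma ne_zero_of_mul_self_eq_smul (hG : (Fintype.card G : F) ≠ 0) {y : MonoidAlgebra F G} {k : F}
    (hy : y * y = k • y) (h1 : y.coeff 1 = 1) : k ≠ 0 := by
  rintro rfl
  have hn : IsNilpotent (LinearMap.mulLeft F y) := ⟨2, by
    rw [pow_two, Module.End.mul_eq_comp, ← LinearMap.mulLeft_mul, hy]; simp⟩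
  have h2 := (LinearMap.isNilpotent_trace_of_isNilpotent hn).eq_zero
  rw [trace_mulLeft, h1, mul_one] at h2
  exact hG h2

/-- Elements of `F G` given by class functions. -/
def classFun : (ConjClasses G → F) →ₗ[F] MonoidAlgebra F G :=
  (MonoidAlgebra.coeffLinearEquiv F).symm.toLinearMap ∘ₗ
    (Finsupp.linearEquivFunOnFinite F F G).symm.toLinearMap ∘ₗ LinearMap.funLeft F F ConjClasses.mk

/-- Central elements have constant coefficients on conjugacy classes. -/
lemma mem_range_classFun {x : MonoidAlgebra F G}
    (h : ∀ g, MonoidAlgebra.single g (1 : F) * x * MonoidAlgebra.single g⁻¹ (1 : F) = x) :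
    x ∈ LinearMap.range (classFun (F := F) (G := G)) := by
  have hx : ∀ a b : G, IsConj a b → x.coeff a = x.coeff b := by
    intro a b hab
    obtain ⟨c, rfl⟩ := isConj_iff.1 hab
    nth_rw 2 [← h c]
    rw [MonoidAlgebra.coeff_mul_single_apply, MonoidAlgebra.coeff_single_mul_apply]
    simp [mul_assoc]
  refine ⟨Quotient.lift (fun g => x.coeff g) hx, ?_⟩
  ext g
  rfl

/-- As many orthogonal idempotents with one-dimensional corners as there are conjugacy classes
form a complete family: the central elements attached to them are linearly independent, hence
span the centre. -/
lemma splitFamily_of_card (hG : (Fintype.card G : F) ≠ 0) {e : I → MonoidAlgebra F G}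
    (scal : ∀ i x, ∃ k : F, e i * x * e i = k • e i)
    (orth : ∀ i j, i ≠ j → ∀ x, e i * x * e j = 0) (idem : ∀ i, e i * e i = e i)
    (h1 : ∀ i, (e i).coeff 1 ≠ 0) (hcard : Nat.card (ConjClasses G) ≤ Fintype.card I) :
    SplitFamily e where
  scal := scal
  orth := orth
  idem := idem
  ne i h := h1 i (by rw [h]; rfl)
  complete := by
    classical
    let s : G → MonoidAlgebra F G := fun g => MonoidAlgebra.single g (1 : F)
    have ss : ∀ g h, s g * s h = s (g * h) := fun g h => by simp [s]
    have s1 : s 1 = 1 := rfl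
    -- The central element attached to `e i`.
    let C : I → MonoidAlgebra F G := fun i => ∑ g : G, s g * e i * s g⁻¹
    have hC : ∀ i h, s h * C i * s h⁻¹ = C i := by
      intro i h
      simp only [C, Finset.mul_sum, Finset.sum_mul]
      refine Fintype.sum_equiv (Equiv.mulLeft h) _ _ fun g => ?_
      simp only [Equiv.coe_mulLeft, ← mul_assoc, ss, mul_inv_rev]
      rw [mul_assoc _ (s g⁻¹), ss]
    have hcomm : ∀ i h, s h * C i = C i * s h := fun i h => by
      conv_rhs => rw [← hC i h]
      rw [mul_assoc, ss, inv_mul_cancel, s1, mul_one]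
    have hoff : ∀ i j, i ≠ j → C i * e j = 0 := by
      intro i j hij
      simp only [C, Finset.sum_mul]
      refine Finset.sum_eq_zero fun g _ => ?_
      rw [mul_assoc, mul_assoc, ← mul_assoc (e i), orth i j hij, mul_zero]
    -- If `C i * e i = 0`, then `C i` has square zero, hence trace zero; but its trace is `|G|²`
    -- times the constant term of `e i`.
    have hdiag : ∀ i, C i * e i ≠ 0 := by
      intro i h
      have hsq : C i * C i = 0 := by
        conv_lhs => rw [show C i * C i = ∑ g : G, C i * (s g * e i * s g⁻¹) from Finset.mul_sum ..]
        refine Finset.sum_eq_zero fun g _ => ?_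
        rw [← mul_assoc, ← mul_assoc, ← hcomm, mul_assoc (s g), h, mul_zero, zero_mul]
      have hn : IsNilpotent (LinearMap.mulLeft F (C i)) := ⟨2, by
        rw [pow_two, Module.End.mul_eq_comp, ← LinearMap.mulLeft_mul, hsq]; simp⟩
      have h2 := (LinearMap.isNilpotent_trace_of_isNilpotent hn).eq_zero
      rw [trace_mulLeft] at h2
      have h3 : (C i).coeff 1 = Fintype.card G * (e i).coeff 1 := by
        simp only [C, s, MonoidAlgebra.coeff_sum, Finsupp.finsetSum_apply,
          MonoidAlgebra.coeff_mul_single_apply, MonoidAlgebra.coeff_single_mul_apply]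
        simp
      rw [h3] at h2
      exact mul_ne_zero hG (mul_ne_zero hG (h1 i)) h2
    have hli : LinearIndependent F C := by
      rw [Fintype.linearIndependent_iff]
      intro a ha j
      have h := congrArg (· * e j) ha
      simp only [Finset.sum_mul, zero_mul] at h
      rw [Finset.sum_eq_single j] at h
      · rw [smul_mul_assoc] at h
        exact (smul_eq_zero.1 h).resolve_right (hdiag j)
      · intro i _ hij
        rw [smul_mul_assoc, hoff i j hij, smul_zero]
      · simp
    have hle : Submodule.span F (Set.range C) ≤ LinearMap.range (classFun (F := F) (G := G)) := by
      rw [Submodule.span_le]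
      rintro _ ⟨i, rfl⟩
      exact mem_range_classFun (hC i)
    -- There are at least as many `C i` as conjugacy classes, so they span the class functions.
    have heq := Submodule.eq_of_le_of_finrank_le hle (by
      rw [finrank_span_eq_card hli]
      refine le_trans (LinearMap.finrank_range_le _) ?_
      rw [Module.finrank_pi, ← Nat.card_eq_fintype_card]
      exact hcard)
    have h1mem : (1 : MonoidAlgebra F G) ∈ Submodule.span F (Set.range C) := by
      rw [heq]
      refine mem_range_classFun fun g => ?_
      rw [mul_one]
      change s g * s g⁻¹ = 1
      rw [ss, mul_inv_cancel, s1]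
    exact (Submodule.mem_span_range_iff_exists_fun F).1 h1mem

end Split

/-! ### The idempotents of the symmetric groups -/

section Shapes

lemma card_cellsOfRowLens (w : List ℕ) : (YoungDiagram.cellsOfRowLens w).card = w.sum := by
  induction w with
  | nil => rfl
  | cons a w ih =>
    rw [YoungDiagram.cellsOfRowLens, Finset.card_union_of_disjoint, Finset.card_map, ih,
      Finset.card_product, Finset.card_singleton, Finset.card_range, one_mul, List.sum_cons]
    rw [Finset.disjoint_left]
    rintro ⟨i, j⟩ h h'
    simp only [Finset.singleton_product, Finset.mem_map] at h h'
    obtain ⟨_, _, h⟩ := h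
    obtain ⟨⟨a, b⟩, _, h'⟩ := h'
    simp [Function.Embedding.prodMap] at h h'
    omega

/-- The partitions of `n`, as Young diagrams. -/
abbrev Shape (n : ℕ) : Type := {lam : YoungDiagram // lam.card = n}

instance (n : ℕ) : Finite (Shape n) := by
  have hle : ∀ lam : Shape n, lam.1.cells ⊆ Finset.range n ×ˢ Finset.range n := by
    rintro ⟨lam, h⟩ ⟨i, j⟩ hij
    rw [Finset.mem_product, Finset.mem_range, Finset.mem_range, ← h]
    have h1 := YoungDiagram.mem_iff_lt_colLen.1 (show (i, j) ∈ lam from hij)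
    have h2 := YoungDiagram.mem_iff_lt_rowLen.1 (show (i, j) ∈ lam from hij)
    rw [YoungDiagram.colLen_eq_card] at h1
    rw [YoungDiagram.rowLen_eq_card] at h2
    exact ⟨lt_of_lt_of_le h1 (Finset.card_le_card (Finset.filter_subset _ _)),
      lt_of_lt_of_le h2 (Finset.card_le_card (Finset.filter_subset _ _))⟩
  refine Finite.of_injective
    (β := ((Finset.range n ×ˢ Finset.range n).powerset : Finset (Finset (ℕ × ℕ))))
    (fun lam => ⟨lam.1.cells, Finset.mem_powerset.2 (hle lam)⟩) ?_
  intro a b hab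
  exact Subtype.ext (YoungDiagram.ext (congrArg Subtype.val hab))

instance (n : ℕ) : Fintype (Shape n) := Fintype.ofFinite _

/-- The cycle type embeds the set of conjugacy classes of `𝔖_n` into the set of partitions of `n`.
This inequality is all that is needed to see that the Young idempotents are complete. -/
lemma card_conjClasses_le (n : ℕ) :
    Nat.card (ConjClasses (Equiv.Perm (Fin n))) ≤ Fintype.card (Shape n) := by
  have hs : ∀ w : Equiv.Perm (Fin n), (w.partition.parts.sort (· ≥ ·)).SortedGE := fun w =>
    (Multiset.pairwise_sort _ _).sortedGE
  let f : Equiv.Perm (Fin n) → Shape n := fun w =>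
    ⟨YoungDiagram.ofRowLens (w.partition.parts.sort (· ≥ ·)) (hs w), by
      refine (card_cellsOfRowLens _).trans ?_
      rw [← Multiset.sum_coe, Multiset.sort_eq, w.partition.parts_sum, Fintype.card_fin]⟩
  have hf : ∀ v w, f v = f w ↔ IsConj v w := by
    intro v w
    rw [Equiv.Perm.partition_eq_of_isConj]
    constructor
    · intro h
      have h1 := congrArg (fun x : Shape n => x.1.rowLens) h
      have hp : ∀ w : Equiv.Perm (Fin n), ∀ x ∈ w.partition.parts.sort (· ≥ ·), 0 < x :=
        fun w x hx => w.partition.parts_pos ((Multiset.mem_sort _).1 hx)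
      simp only [f] at h1
      rw [YoungDiagram.rowLens_ofRowLens_eq_self (hp v),
        YoungDiagram.rowLens_ofRowLens_eq_self (hp w)] at h1
      have h2 := congrArg (fun l : List ℕ => (l : Multiset ℕ)) h1
      simp only [Multiset.sort_eq] at h2
      exact Nat.Partition.ext h2
    · intro h
      simp only [f, h]
  rw [← Nat.card_eq_fintype_card]
  refine Nat.card_le_card_of_injective
    (Quotient.lift f fun v w h => (hf v w).2 h : ConjClasses (Equiv.Perm (Fin n)) → Shape n) ?_
  intro a b
  induction a using Quotient.inductionOn with | _ a => ?_
  induction b using Quotient.inductionOn with | _ b => ?_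
  intro h
  exact Quotient.sound ((hf a b).1 h)

/-- The fixed tableau `tableau lam`, with its entries taken in `Fin n`. -/
def tab {n : ℕ} (lam : Shape n) : Fin n ≃ lam.1.cells :=
  (finCongr lam.2.symm).trans (tableau lam.1)

variable (R : Type*) [CommRing R] (F : Type*) [Field F]

/-- The Young symmetrizer: the signed column sum times the row sum of the fixed tableau. -/
def young {n : ℕ} (lam : Shape n) : MonoidAlgebra R (Equiv.Perm (Fin n)) :=
  colSum R (tab lam) * rowSum R (tab lam)

lemma young_self (lam : YoungDiagram) :
    young F (⟨lam, rfl⟩ : Shape lam.card) = youngElt F lam := by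
  have h : tab (⟨lam, rfl⟩ : Shape lam.card) = tableau lam := rfl
  rw [young, h, youngElt, colSum, rowSum]
  congr 1
  · exact Finset.sum_congr (by ext; simp [colSt, colStab]) fun _ _ => rfl
  · exact Finset.sum_congr (by ext; simp [rowSt, rowStab]) fun _ _ => rfl

lemma exists_young_mul_self (h2 : ∀ r : R, r + r = 0 → r = 0) {n : ℕ} (lam : Shape n) :
    ∃ k : R, young R lam * young R lam = k • young R lam := by
  obtain ⟨k, hk⟩ := exists_colSum_mul_rowSum h2 (tab lam) (rowSum R (tab lam) * colSum R (tab lam))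
  exact ⟨k, by rw [young, ← hk]; simp only [mul_assoc]⟩

lemma int_two_reg : ∀ r : ℤ, r + r = 0 → r = 0 := fun r h => by omega

/-- The integer `k` with `y² = k y` for the Young symmetrizer `y` (the quotient of `n!` by the
dimension of the Specht module). -/
def hookZ {n : ℕ} (lam : Shape n) : ℤ := (exists_young_mul_self ℤ int_two_reg lam).choose

variable {R F}

lemma map_young {n : ℕ} (lam : Shape n) :
    MonoidAlgebra.mapRingHom _ (Int.castRingHom R) (young ℤ lam) = young R lam := by
  simp only [young, rowSum, colSum, map_mul, map_sum, MonoidAlgebra.mapRingHom_single]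
  simp

lemma young_mul_self {n : ℕ} (lam : Shape n) :
    young R lam * young R lam = (hookZ lam : R) • young R lam := by
  have h := congrArg (MonoidAlgebra.mapRingHom _ (Int.castRingHom R))
    (exists_young_mul_self ℤ int_two_reg lam).choose_spec
  rw [map_mul, map_young, zsmul_eq_mul, map_mul, map_young, map_intCast] at h
  rw [h, Algebra.smul_def]
  simp [hookZ]

lemma coeff_one_young' {n : ℕ} (lam : Shape n) : (young R lam).coeff 1 = 1 := coeff_one_young _

lemma hookZ_ne_zero {n : ℕ} (hn : (n.factorial : F) ≠ 0) (lam : Shape n) :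
    (hookZ lam : F) ≠ 0 :=
  ne_zero_of_mul_self_eq_smul (by rwa [Fintype.card_perm, Fintype.card_fin])
    (young_mul_self lam) (coeff_one_young' lam)

/-- The idempotent proportional to the Young symmetrizer. -/
def yId (F : Type*) [Field F] {n : ℕ} (lam : Shape n) : MonoidAlgebra F (Equiv.Perm (Fin n)) :=
  (hookZ lam : F)⁻¹ • young F lam

lemma yId_idem {n : ℕ} (hn : (n.factorial : F) ≠ 0) (lam : Shape n) :
    yId F lam * yId F lam = yId F lam := by
  rw [yId, smul_mul_smul_comm, young_mul_self, smul_smul, mul_assoc,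
    inv_mul_cancel₀ (hookZ_ne_zero hn lam), mul_one]

lemma two_reg (h2 : (2 : F) ≠ 0) (r : F) (h : r + r = 0) : r = 0 := by
  rw [← two_mul] at h
  exact (mul_eq_zero.1 h).resolve_left h2

/-- The Young symmetrizers give a complete family of primitive idempotents of `F 𝔖_n`. -/
theorem splitFamily_yId (h2 : (2 : F) ≠ 0) {n : ℕ} (hn : (n.factorial : F) ≠ 0) :
    SplitFamily (fun lam : Shape n => yId F lam) := by
  refine splitFamily_of_card (by rwa [Fintype.card_perm, Fintype.card_fin]) ?_ ?_
    (yId_idem hn) ?_ (card_conjClasses_le n)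
  · intro lam x
    obtain ⟨k, hk⟩ := exists_colSum_mul_rowSum (two_reg h2) (tab lam)
      (rowSum F (tab lam) * x * colSum F (tab lam))
    refine ⟨(hookZ lam : F)⁻¹ * k, ?_⟩
    rw [yId, smul_mul_assoc, smul_mul_smul_comm, mul_comm _ k, mul_smul, ← smul_smul]
    rw [show young F lam * x * young F lam = k • young F lam by
      rw [young, ← hk]; simp only [mul_assoc]]
    simp only [smul_smul]
    ring_nf
  · intro lam mu hne x
    rw [yId, yId, smul_mul_assoc, smul_mul_smul_comm]
    refine (congrArg _ (young_mul_young_eq_zero (two_reg h2)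
      (fun h => hne (Subtype.ext h)) (tab lam) (tab mu) x)).trans (smul_zero _)
  · intro lam
    rw [yId, MonoidAlgebra.coeff_smul, Finsupp.smul_apply, coeff_one_young', smul_eq_mul, mul_one]
    exact inv_ne_zero (hookZ_ne_zero hn lam)

end Shapes

/-! ### Group algebras of products -/

section Box

variable {F : Type*} [Field F] {ι : Type*} [Fintype ι] [DecidableEq ι]
  {G : ι → Type*} [∀ i, Group (G i)] [∀ i, Fintype (G i)]

variable (F G) in
/-- The outer tensor product `⨂ F G_i → F (∏ G_i)` of elements of group algebras. -/
def box : MultilinearMap F (fun i => MonoidAlgebra F (G i)) (MonoidAlgebra F (∀ i, G i)) :=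
  ∑ g : ∀ i, G i, ((MultilinearMap.mkPiAlgebra F ι F).compLinearMap fun i =>
    Finsupp.lapply (g i) ∘ₗ (MonoidAlgebra.coeffLinearEquiv F).toLinearMap).smulRight
      (MonoidAlgebra.single g 1)

lemma box_apply (f : ∀ i, MonoidAlgebra F (G i)) :
    box F G f = ∑ g : ∀ i, G i, MonoidAlgebra.single g (∏ i, (f i).coeff (g i)) := by
  rw [box, sum_apply]
  refine Finset.sum_congr rfl fun g _ => ?_
  simp

lemma coeff_box (f : ∀ i, MonoidAlgebra F (G i)) (g : ∀ i, G i) :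
    (box F G f).coeff g = ∏ i, (f i).coeff (g i) := by
  classical
  rw [box_apply]
  simp [MonoidAlgebra.coeff_sum, Finsupp.single_apply]

lemma box_single (g : ∀ i, G i) :
    box F G (fun i => MonoidAlgebra.single (g i) (1 : F)) = MonoidAlgebra.single g 1 := by
  classical
  ext h
  rw [coeff_box]
  simp only [MonoidAlgebra.coeff_single, Finsupp.single_apply]
  rw [Finset.prod_ite_zero]
  simp [funext_iff]

lemma coeff_mul_sum {H : Type*} [Group H] [Fintype H] (x y : MonoidAlgebra F H) (g : H) :
    (x * y).coeff g = ∑ h, x.coeff h * y.coeff (h⁻¹ * g) := by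
  rw [MonoidAlgebra.coeff_mul_apply_left, Finsupp.sum_fintype]
  simp

lemma box_mul (f f' : ∀ i, MonoidAlgebra F (G i)) :
    box F G f * box F G f' = box F G fun i => f i * f' i := by
  ext g
  rw [coeff_mul_sum, coeff_box]
  simp only [coeff_box, coeff_mul_sum, ← Finset.prod_mul_distrib, Pi.mul_apply, Pi.inv_apply]
  rw [Finset.prod_univ_sum, Fintype.piFinset_univ]

/-- Complete families of primitive idempotents multiply. -/
theorem splitFamily_box {I : ι → Type*} [∀ i, Fintype (I i)]
    {e : ∀ i, I i → MonoidAlgebra F (G i)} (he : ∀ i, SplitFamily (e i)) :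
    SplitFamily (fun nu : ∀ i, I i => box F G fun i => e i (nu i)) := by
  -- It suffices to test `a x b` on the group elements, which are pure tensors.
  have hlin : ∀ a b : MonoidAlgebra F (∀ i, G i),
      ∀ p : MonoidAlgebra F (∀ i, G i) → Prop, p 0 → (∀ x y, p x → p y → p (x + y)) →
      (∀ (r : F) x, p x → p (r • x)) →
      (∀ g : ∀ i, G i, p (a * box F G (fun i => MonoidAlgebra.single (g i) (1 : F)) * b)) →
      ∀ x, p (a * x * b) := by
    intro a b p h0 hadd hs hg x
    induction x using MonoidAlgebra.induction_linear with
    | zero => simpa using h0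
    | add x y hx hy => rw [mul_add, add_mul]; exact hadd _ _ hx hy
    | single g r =>
      rw [show (MonoidAlgebra.single g r : MonoidAlgebra F (∀ i, G i)) =
        r • MonoidAlgebra.single g 1 by simp, mul_smul_comm, smul_mul_assoc, ← box_single]
      exact hs _ _ (hg g)
  refine ⟨fun nu => hlin _ _ (fun z => ∃ k : F, z = k • _) ⟨0, by simp⟩ ?_ ?_ ?_,
    fun nu nu' hne => hlin _ _ (fun z => z = 0) rfl ?_ ?_ ?_, fun nu => ?_, fun nu => ?_, ?_⟩
  · rintro _ _ ⟨k, rfl⟩ ⟨l, rfl⟩; exact ⟨k + l, by rw [add_smul]⟩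
  · rintro r _ ⟨k, rfl⟩; exact ⟨r * k, by rw [mul_smul]⟩
  · intro g
    choose k hk using fun i => (he i).scal (nu i) (MonoidAlgebra.single (g i) 1)
    refine ⟨∏ i, k i, ?_⟩
    rw [box_mul, box_mul, ← MultilinearMap.map_smul_univ]
    simp only [hk]
  · rintro _ _ rfl rfl; simp
  · rintro r _ rfl; simp
  · intro g
    obtain ⟨i, hi⟩ := Function.ne_iff.1 hne
    rw [box_mul, box_mul]
    exact MultilinearMap.map_coord_zero _ i ((he i).orth _ _ hi _)
  · rw [box_mul]; simp only [(he _).idem]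
  · intro h
    have : ∀ i, ∃ g, (e i (nu i)).coeff g ≠ 0 := fun i => by
      by_contra hn
      refine (he i).ne (nu i) ?_
      ext g
      by_contra h'
      exact hn ⟨g, h'⟩
    choose g hg using this
    have h1 := congrArg (fun x => x.coeff g) h
    rw [coeff_box] at h1
    exact Finset.prod_ne_zero_iff.2 (fun i _ => hg i) h1
  · choose a ha using fun i => (he i).complete
    refine ⟨fun nu => ∏ i, a i (nu i), ?_⟩
    have h1 : (1 : MonoidAlgebra F (∀ i, G i)) = box F G fun i => 1 :=
      (box_single (F := F) (G := G) 1).symm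
    rw [h1]
    simp only [← ha]
    rw [MultilinearMap.map_sum]
    refine Finset.sum_congr rfl fun nu _ => ?_
    rw [MultilinearMap.map_smul_univ, MultilinearMap.map_sum]
    congr 1
    refine Finset.sum_congr rfl fun g _ => ?_
    rw [← box_mul, ← box_mul, box_single]
    congr 1
    exact (box_single (F := F) (G := G) g⁻¹).symm

end Box

/-! ### Equivalent idempotents -/

section Equivalent

variable {M : Type*} [Mul M]

/-- Murray–von Neumann equivalence: `e = u v` and `e' = v u`. -/
def EquivIdem (e e' : M) : Prop := ∃ u v, u * v = e ∧ v * u = e'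

lemma equivIdem_box {F : Type*} [Field F] {ι : Type*} [Fintype ι] [DecidableEq ι]
    {G : ι → Type*} [∀ i, Group (G i)] [∀ i, Fintype (G i)] {e e' : ∀ i, MonoidAlgebra F (G i)}
    (h : ∀ i, EquivIdem (e i) (e' i)) : EquivIdem (box F G e) (box F G e') := by
  choose u v h1 h2 using h
  refine ⟨box F G u, box F G v, ?_, ?_⟩
  · rw [box_mul]; simp only [h1]
  · rw [box_mul]; simp only [h2]

/-- If `u v` is idempotent and `v` commutes with `p`, then `u v p = u (v u p) v` factors through the
image of `v u p`. -/
lemma finrank_range_le_of_idem {F V : Type*} [Field F] [AddCommGroup V] [Module F V]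
    [FiniteDimensional F V] {u v p : Module.End F V} (h : (u * v) * (u * v) = u * v)
    (hv : p * v = v * p) :
    Module.finrank F (LinearMap.range (u * v * p)) ≤
      Module.finrank F (LinearMap.range (v * u * p)) := by
  have e : u * v * p = u * (v * u * p) * v := by
    rw [← h]
    simp only [mul_assoc, hv]
  rw [e]
  calc Module.finrank F (LinearMap.range (u * (v * u * p) * v))
      ≤ Module.finrank F (LinearMap.range (u * (v * u * p))) := by
        refine Submodule.finrank_mono ?_
        rintro _ ⟨x, rfl⟩
        exact ⟨v x, rfl⟩
    _ ≤ _ := by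
        rw [Module.End.mul_eq_comp, LinearMap.range_comp]
        exact Submodule.finrank_map_le _ _

/-- Equivalent idempotents have images of the same dimension, also when cut down by an operator `p`
commuting with the action. -/
lemma EquivIdem.finrank_eq {F V A : Type*} [Field F] [AddCommGroup V] [Module F V]
    [FiniteDimensional F V] [Ring A] [Algebra F A] {e e' : A} (h : EquivIdem e e')
    (he : e * e = e) (he' : e' * e' = e') (ρ : A →ₐ[F] Module.End F V) {p : Module.End F V}
    (hp : ∀ a, p * ρ a = ρ a * p) :
    Module.finrank F (LinearMap.range (ρ e * p)) =
      Module.finrank F (LinearMap.range (ρ e' * p)) := by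
  obtain ⟨u, v, rfl, rfl⟩ := h
  rw [map_mul, map_mul]
  refine le_antisymm (finrank_range_le_of_idem ?_ (hp v))
    (finrank_range_le_of_idem ?_ (hp u))
  · rw [← map_mul, ← map_mul, he]
  · rw [← map_mul, ← map_mul, he']

variable {F : Type*} [Field F] {n : ℕ}

lemma invAlg_yId (lam : Shape n) : invAlg (yId F lam) =
    (hookZ lam : F)⁻¹ • (rowSum F (tab lam) * colSum F (tab lam)) := by
  rw [yId, map_smul, young, invAlg_mul, invAlg_rowSum, invAlg_colSum]

/-- Inverting the group elements exchanges `c r` with `r c`, an equivalent quasi-idempotent. -/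
lemma equivIdem_invAlg (lam : Shape n) : EquivIdem (yId F lam) (invAlg (yId F lam)) := by
  refine ⟨(hookZ lam : F)⁻¹ • colSum F (tab lam), rowSum F (tab lam), ?_, ?_⟩
  · rw [smul_mul_assoc]; rfl
  · rw [invAlg_yId, mul_smul_comm]

variable (F) in
/-- The twist of the group algebra by the sign character. -/
def sgnAlg (α : Type*) [Fintype α] [DecidableEq α] :
    MonoidAlgebra F (Equiv.Perm α) →ₐ[F] MonoidAlgebra F (Equiv.Perm α) :=
  MonoidAlgebra.lift F _ _
    { toFun := fun w => MonoidAlgebra.single w (((Equiv.Perm.sign w : ℤˣ) : ℤ) : F)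
      map_one' := by simp [MonoidAlgebra.one_def]
      map_mul' := fun v w => by simp [MonoidAlgebra.single_mul_single] }

lemma sgnAlg_single {α : Type*} [Fintype α] [DecidableEq α] (w : Equiv.Perm α) (r : F) :
    sgnAlg F α (MonoidAlgebra.single w r) =
      MonoidAlgebra.single w (r * (((Equiv.Perm.sign w : ℤˣ) : ℤ) : F)) := by
  rw [sgnAlg, MonoidAlgebra.lift_single]
  simp

lemma coeff_sgnAlg {α : Type*} [Fintype α] [DecidableEq α] (x : MonoidAlgebra F (Equiv.Perm α))
    (w : Equiv.Perm α) :
    (sgnAlg F α x).coeff w = x.coeff w * (((Equiv.Perm.sign w : ℤˣ) : ℤ) : F) := by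
  induction x using MonoidAlgebra.induction_linear with
  | zero => simp
  | add x y hx hy =>
    rw [map_add, MonoidAlgebra.coeff_add, Finsupp.add_apply, hx, hy]
    simp [add_mul]
  | single g r =>
    rw [sgnAlg_single]
    simp only [MonoidAlgebra.coeff_single, Finsupp.single_apply]
    split_ifs with h <;> simp [h]

lemma sign_mul_sign (α : Type*) [Fintype α] [DecidableEq α] (w : Equiv.Perm α) :
    (((Equiv.Perm.sign w : ℤˣ) : ℤ) : F) * (((Equiv.Perm.sign w : ℤˣ) : ℤ) : F) = 1 := by
  rw [← Int.cast_mul, ← Units.val_mul, Int.units_mul_self]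
  simp

/-- The conjugate partition. -/
def Shape.tr (lam : Shape n) : Shape n := ⟨lam.1.transpose, (Finset.card_map _).trans lam.2⟩

/-- The conjugate tableau: transposing the diagram. -/
def trTab {α : Type*} {lam : YoungDiagram} (t : α ≃ lam.transpose.cells) : α ≃ lam.cells where
  toFun a := ⟨(t a).1.swap, YoungDiagram.mem_transpose.1 (t a).2⟩
  invFun x := t.symm ⟨x.1.swap, YoungDiagram.mem_transpose.2 (by simp)⟩
  left_inv a := by simp
  right_inv x := by simp

/-- `g⁻¹ · rowSum s · g` is the row sum of the tableau `s ∘ g`. -/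
lemma rowSum_mul_single {α : Type*} [Fintype α] [DecidableEq α] {mu : YoungDiagram}
    (s : α ≃ mu.cells) (g : Equiv.Perm α) :
    rowSum F s * MonoidAlgebra.single g (1 : F) =
      MonoidAlgebra.single g (1 : F) * rowSum F (g.trans s) := by
  rw [rowSum, rowSum, Finset.sum_mul, Finset.mul_sum]
  refine Finset.sum_equiv (MulAut.conj g⁻¹).toEquiv (fun w => ?_) fun w _ => ?_
  · rw [mem_rowSt, mem_rowSt]
    constructor
    · intro h i
      simpa using h (g i)
    · intro h i
      simpa using h (g⁻¹ i)
  · simp [MonoidAlgebra.single_mul_single, mul_assoc]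

lemma rowSum_transpose {α : Type*} [Fintype α] [DecidableEq α] {lam : YoungDiagram}
    (t : α ≃ lam.transpose.cells) : rowSum F t = sgnAlg F α (colSum F (trTab t)) := by
  rw [rowSum, colSum, map_sum]
  refine Finset.sum_congr rfl fun w _ => ?_
  rw [sgnAlg_single, sign_mul_sign]

lemma colSum_transpose {α : Type*} [Fintype α] [DecidableEq α] {lam : YoungDiagram}
    (t : α ≃ lam.transpose.cells) : colSum F t = sgnAlg F α (rowSum F (trTab t)) := by
  rw [rowSum, colSum, map_sum]
  refine Finset.sum_congr rfl fun w _ => ?_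
  rw [sgnAlg_single, one_mul]

lemma rowSum_colSum_sq (lam : Shape n) :
    (rowSum F (tab lam) * colSum F (tab lam)) * (rowSum F (tab lam) * colSum F (tab lam)) =
      (hookZ lam : F) • (rowSum F (tab lam) * colSum F (tab lam)) := by
  have h := congrArg invAlg (young_mul_self (R := F) lam)
  rwa [map_smul, invAlg_mul, young, invAlg_mul, invAlg_rowSum, invAlg_colSum] at h

/-- Twisting by the sign character conjugates the partition. -/
lemma equivIdem_sgnAlg (lam : Shape n) : EquivIdem (sgnAlg F _ (yId F lam)) (yId F lam.tr) := by
  -- The fixed tableau of the conjugate shape, transposed, differs from the fixed tableau of shape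
  -- `lam` by a permutation `h` of the entries.
  set h : Equiv.Perm (Fin n) := (trTab (tab lam.tr)).trans (tab lam).symm with hh
  have ht : trTab (tab lam.tr) = h.trans (tab lam) :=
    Equiv.ext fun a => ((tab lam).apply_symm_apply _).symm
  let s : Equiv.Perm (Fin n) → MonoidAlgebra F (Equiv.Perm (Fin n)) :=
    fun g => MonoidAlgebra.single g 1
  have ss : ∀ a b, s a * s b = s (a * b) := fun a b => by simp [s]
  have s1 : s 1 = 1 := rfl
  have hc : colSum F (trTab (tab lam.tr)) = s h⁻¹ * colSum F (tab lam) * s h := by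
    rw [mul_assoc, single_mul_colSum, ← mul_assoc, ss, inv_mul_cancel, s1, one_mul, ht]
  have hr : rowSum F (trTab (tab lam.tr)) = s h⁻¹ * rowSum F (tab lam) * s h := by
    rw [mul_assoc, rowSum_mul_single, ← mul_assoc, ss, inv_mul_cancel, s1, one_mul, ht]
  have hy : young F lam.tr =
      sgnAlg F _ (s h⁻¹ * (rowSum F (tab lam) * colSum F (tab lam)) * s h) := by
    have e : s h * (s h⁻¹ * (colSum F (tab lam) * s h)) = colSum F (tab lam) * s h := by
      rw [← mul_assoc, ss, mul_inv_cancel, s1, one_mul]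
    have h1 : colSum F (tab lam.tr) = _ := colSum_transpose (tab lam.tr)
    have h2 : rowSum F (tab lam.tr) = _ := rowSum_transpose (tab lam.tr)
    rw [young, h1, h2, ← map_mul, hc, hr]
    simp only [mul_assoc, e]
  -- `y` and its twisted conjugate satisfy the same quadratic relation, and both have constant term
  -- `1`, so the integers of the two shapes agree in `F`.
  have hk : (hookZ lam.tr : F) = hookZ lam := by
    have h1 := young_mul_self (R := F) lam.tr
    have h3 : young F lam.tr * young F lam.tr = (hookZ lam : F) • young F lam.tr := by
      have e : ∀ x : MonoidAlgebra F (Equiv.Perm (Fin n)), s h * (s h⁻¹ * x) = x := fun x => by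
        rw [← mul_assoc, ss, mul_inv_cancel, s1, one_mul]
      have e2 := rowSum_colSum_sq (F := F) lam
      rw [hy, ← map_mul, ← map_smul, ← smul_mul_assoc, ← mul_smul_comm, ← e2]
      simp only [mul_assoc, e]
    rw [h1] at h3
    have h4 := congrArg (fun x => x.coeff 1) h3
    simpa only [MonoidAlgebra.coeff_smul, Finsupp.smul_apply, coeff_one_young', smul_eq_mul,
      mul_one] using h4
  refine ⟨(hookZ lam : F)⁻¹ • sgnAlg F _ (colSum F (tab lam) * s h),
    sgnAlg F _ (s h⁻¹ * rowSum F (tab lam)), ?_, ?_⟩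
  · rw [smul_mul_assoc, ← map_mul, yId, map_smul, young]
    congr 2
    rw [mul_assoc, ← mul_assoc (s h), ss, mul_inv_cancel, s1, one_mul]
  · rw [mul_smul_comm, ← map_mul, yId, hk, hy]
    simp only [mul_assoc]

end Equivalent

/-! ### Spaces of equivariant maps -/

section Hom

variable {F : Type*} [Field F] {G : Type*} [Group G] [Fintype G] {I : Type*} [Fintype I]
  {V V' : Type*} [AddCommGroup V] [Module F V] [FiniteDimensional F V]
  [AddCommGroup V'] [Module F V'] [FiniteDimensional F V']

/-- The `G`-equivariant maps `Z : V → V'` with `p' Z = Z = Z p`. -/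
def equivHom (ρ : MonoidAlgebra F G →ₐ[F] Module.End F V)
    (ρ' : MonoidAlgebra F G →ₐ[F] Module.End F V') (p : Module.End F V) (p' : Module.End F V') :
    Submodule F (V →ₗ[F] V') where
  carrier := {Z | (∀ x, Z ∘ₗ ρ x = ρ' x ∘ₗ Z) ∧ p' ∘ₗ Z = Z ∧ Z ∘ₗ p = Z}
  add_mem' {Y Z} hY hZ := ⟨fun x => by rw [LinearMap.add_comp, LinearMap.comp_add, hY.1, hZ.1],
    by rw [LinearMap.comp_add, hY.2.1, hZ.2.1], by rw [LinearMap.add_comp, hY.2.2, hZ.2.2]⟩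
  zero_mem' := by simp
  smul_mem' r Z hZ := ⟨fun x => by rw [LinearMap.smul_comp, LinearMap.comp_smul, hZ.1],
    by rw [LinearMap.comp_smul, hZ.2.1], by rw [LinearMap.smul_comp, hZ.2.2]⟩

/-- Equivariant maps are determined by, and can be prescribed arbitrarily on, the images of the
primitive idempotents. -/
theorem finrank_equivHom {e : I → MonoidAlgebra F G} (he : SplitFamily e)
    (ρ : MonoidAlgebra F G →ₐ[F] Module.End F V)
    (ρ' : MonoidAlgebra F G →ₐ[F] Module.End F V') {p : Module.End F V} {p' : Module.End F V'}
    (hp : p * p = p) (hp' : p' * p' = p') (hpρ : ∀ x, p * ρ x = ρ x * p)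
    (hpρ' : ∀ x, p' * ρ' x = ρ' x * p') :
    Module.finrank F (equivHom ρ ρ' p p') =
      ∑ i, Module.finrank F (LinearMap.range (ρ (e i) * p)) *
        Module.finrank F (LinearMap.range (ρ' (e i) * p')) := by
  classical
  have hmap : ∀ (Z : equivHom ρ ρ' p p') (i : I), ∀ v ∈ LinearMap.range (ρ (e i) * p),
      Z.1 v ∈ LinearMap.range (ρ' (e i) * p') := by
    rintro ⟨Z, hZ, hZ1, hZ2⟩ i _ ⟨v, rfl⟩
    refine ⟨Z v, ?_⟩
    have h1 := LinearMap.congr_fun (hZ (e i)) (p v)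
    have h2 := LinearMap.congr_fun hZ2 v
    have h3 := LinearMap.congr_fun hZ1 v
    simp only [LinearMap.comp_apply, Module.End.mul_apply] at *
    rw [h1, h2, h3]
  -- Restriction of an equivariant map to the images of the idempotents `e i`.
  let Φ : equivHom ρ ρ' p p' →ₗ[F] ∀ i, (LinearMap.range (ρ (e i) * p) →ₗ[F]
      LinearMap.range (ρ' (e i) * p')) :=
    { toFun := fun Z i => Z.1.restrict (hmap Z i)
      map_add' := fun Y Z => by ext; rfl
      map_smul' := fun r Z => by ext; rfl }
  obtain ⟨a, ha⟩ := he.complete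
  let s : G → MonoidAlgebra F G := fun g => MonoidAlgebra.single g 1
  have ss : ∀ g h, s g * s h = s (g * h) := fun g h => by simp [s]
  have s1 : s 1 = 1 := rfl
  -- A map vanishing on all `e i V` vanishes on `g e i V`, and these span `V` by completeness.
  have hinj : Function.Injective Φ := by
    refine (injective_iff_map_eq_zero Φ).2 fun Z hZ => Subtype.ext (LinearMap.ext fun v => ?_)
    have hz : ∀ i w, Z.1 (ρ (e i) (p w)) = 0 := fun i w =>
      congrArg Subtype.val (LinearMap.congr_fun (congrFun hZ i) ⟨ρ (e i) (p w), ⟨w, rfl⟩⟩)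
    have h1 : Z.1 v = Z.1 (ρ 1 (p v)) := by
      rw [map_one]; exact (LinearMap.congr_fun Z.2.2.2 v).symm
    rw [h1, ← ha]
    simp only [map_sum, map_smul, map_mul, LinearMap.sum_apply, LinearMap.smul_apply,
      Module.End.mul_apply]
    refine Finset.sum_eq_zero fun i _ => ?_
    rw [Finset.sum_eq_zero, smul_zero]
    intro g _
    have h2 := LinearMap.congr_fun (Z.2.1 (s g)) (ρ (e i) (ρ (s g⁻¹) (p v)))
    have h3 := LinearMap.congr_fun (hpρ (s g⁻¹)) v
    simp only [LinearMap.comp_apply, Module.End.mul_apply] at h2 h3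
    change Z.1 (ρ (s g) (ρ (e i) (ρ (s g⁻¹) (p v)))) = 0
    rw [h2, ← h3, hz, map_zero]
  -- A family `z i : e i V → e i V'` is extended by averaging `z i ∘ e i` over the group; the
  -- scalars `a i` from completeness are the normalization making this an extension of `z`.
  have hsurj : Function.Surjective Φ := by
    intro z
    let zt : I → (V →ₗ[F] V') := fun i => (LinearMap.range (ρ' (e i) * p')).subtype ∘ₗ z i ∘ₗ
      LinearMap.rangeRestrict (ρ (e i) * p)
    have hq : ∀ i, (ρ (e i) * p) * (ρ (e i) * p) = ρ (e i) * p := fun i => by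
      rw [mul_assoc, ← mul_assoc p, hpρ, mul_assoc, hp, ← mul_assoc, ← map_mul, he.idem]
    have hq' : ∀ i, (ρ' (e i) * p') * (ρ' (e i) * p') = ρ' (e i) * p' := fun i => by
      rw [mul_assoc, ← mul_assoc p', hpρ', mul_assoc, hp', ← mul_assoc, ← map_mul, he.idem]
    have hzl : ∀ i v, ρ' (e i) (p' (zt i v)) = zt i v := by
      intro i v
      obtain ⟨w, hw⟩ := (z i (LinearMap.rangeRestrict (ρ (e i) * p) v)).2
      have : zt i v = (ρ' (e i) * p') w := hw.symm
      rw [this]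
      exact LinearMap.congr_fun (hq' i) w
    have hzr : ∀ i v, zt i (ρ (e i) (p v)) = zt i v := by
      intro i v
      have : LinearMap.rangeRestrict (ρ (e i) * p) (ρ (e i) (p v)) =
          LinearMap.rangeRestrict (ρ (e i) * p) v :=
        Subtype.ext (LinearMap.congr_fun (hq i) v)
      change ((z i (LinearMap.rangeRestrict (ρ (e i) * p) (ρ (e i) (p v)))).1) = _
      rw [this]
      rfl
    have hzp : ∀ i v, zt i (p v) = zt i v := fun i v => by
      have h := LinearMap.congr_fun hp v
      rw [Module.End.mul_apply] at h
      rw [← hzr, h, hzr]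
    have hzp' : ∀ i v, p' (zt i v) = zt i v := fun i v => by
      have h := LinearMap.congr_fun hp' (zt i v)
      have h' := fun w => LinearMap.congr_fun (hpρ' (e i)) w
      simp only [Module.End.mul_apply] at h h'
      rw [← hzl i v, h', h]
    have hze : ∀ i v, ρ' (e i) (zt i v) = zt i v := fun i v => by
      conv_lhs => rw [← hzp']
      exact hzl i v
    let Z : V →ₗ[F] V' := ∑ i, a i • ∑ g : G, ρ' (s g) ∘ₗ zt i ∘ₗ ρ (s g⁻¹)
    have hZapp : ∀ v, Z v = ∑ i, a i • ∑ g : G, ρ' (s g) (zt i (ρ (s g⁻¹) v)) := fun v => by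
      simp only [Z, LinearMap.sum_apply, LinearMap.smul_apply, LinearMap.comp_apply]
    have hZg : ∀ h v, Z (ρ (s h) v) = ρ' (s h) (Z v) := by
      intro h v
      rw [hZapp, hZapp]
      simp only [map_sum, map_smul]
      refine Finset.sum_congr rfl fun i _ => ?_
      congr 1
      refine Fintype.sum_equiv (Equiv.mulLeft h⁻¹) _ _ fun g => ?_
      rw [← Module.End.mul_apply, ← map_mul, ss, ← Module.End.mul_apply (ρ' (s h)), ← map_mul, ss]
      simp
    have hZx : ∀ x, Z ∘ₗ ρ x = ρ' x ∘ₗ Z := by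
      intro x
      induction x using MonoidAlgebra.induction_linear with
      | zero => simp
      | add x y hx hy => rw [map_add, map_add, LinearMap.comp_add, LinearMap.add_comp, hx, hy]
      | single g r =>
        rw [show (MonoidAlgebra.single g r : MonoidAlgebra F G) = r • s g by simp [s], map_smul,
          map_smul, LinearMap.comp_smul, LinearMap.smul_comp]
        congr 1
        exact LinearMap.ext fun v => hZg g v
    have hZp : ∀ v, Z (p v) = Z v := by
      intro v
      rw [hZapp, hZapp]
      refine Finset.sum_congr rfl fun i _ => ?_
      congr 1
      refine Finset.sum_congr rfl fun g _ => ?_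
      have h := LinearMap.congr_fun (hpρ (s g⁻¹)) v
      simp only [Module.End.mul_apply] at h
      rw [← h, hzp]
    have hZp' : ∀ v, p' (Z v) = Z v := by
      intro v
      rw [hZapp]
      simp only [map_sum, map_smul]
      refine Finset.sum_congr rfl fun i _ => ?_
      congr 1
      refine Finset.sum_congr rfl fun g _ => ?_
      have h := LinearMap.congr_fun (hpρ' (s g)) (zt i (ρ (s g⁻¹) v))
      simp only [Module.End.mul_apply] at h
      rw [h, hzp']
    refine ⟨⟨Z, hZx, LinearMap.ext hZp', LinearMap.ext hZp⟩, funext fun j => ?_⟩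
    refine LinearMap.ext fun w => Subtype.ext ?_
    obtain ⟨_, v, rfl⟩ := w
    change Z (ρ (e j) (p v)) = (z j _).1
    choose φ hφ using fun g => he.scal j (s g)
    -- Sandwich the completeness relation between two copies of `e j`.
    have hone : a j * ∑ g : G, φ g * φ g⁻¹ = 1 := by
      have h1 : e j * 1 * e j = (a j * ∑ g : G, φ g * φ g⁻¹) • e j := by
        rw [← ha, Finset.mul_sum, Finset.sum_mul, Finset.sum_eq_single j]
        · rw [mul_smul_comm, smul_mul_assoc, mul_smul, Finset.mul_sum, Finset.sum_mul,
            Finset.sum_smul]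
          congr 1
          refine Finset.sum_congr rfl fun g _ => ?_
          have : e j * (s g * e j * s g⁻¹) * e j = (e j * s g * e j) * (s g⁻¹ * e j) := by
            simp only [mul_assoc]
          change e j * (s g * e j * s g⁻¹) * e j = _
          rw [this, hφ, smul_mul_assoc, ← mul_assoc, hφ, smul_smul]
        · intro i _ hij
          rw [mul_smul_comm, smul_mul_assoc, Finset.mul_sum, Finset.sum_mul,
            Finset.sum_eq_zero, smul_zero]
          intro g _
          rw [← mul_assoc, ← mul_assoc, he.orth j i (Ne.symm hij), zero_mul, zero_mul]
        · simp
      rw [mul_one, he.idem] at h1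
      by_contra hne
      have : ((a j * ∑ g : G, φ g * φ g⁻¹) - 1) • e j = 0 := by
        rw [sub_smul, one_smul, ← h1, sub_self]
      exact (smul_eq_zero.1 this).elim (fun h => hne (sub_eq_zero.1 h)) (he.ne j)
    have h1 : Z (ρ (e j) (p v)) = ρ' (e j) (Z (ρ (e j) (p v))) := by
      have h2 := fun x w => LinearMap.congr_fun (hZx x) w
      simp only [LinearMap.comp_apply] at h2
      rw [h2, ← Module.End.mul_apply, ← map_mul, he.idem]
    rw [h1, hZapp]
    simp only [map_sum, map_smul]
    rw [Finset.sum_eq_single j]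
    · have h2 : ∀ g, ρ' (e j) (ρ' (s g) (zt j (ρ (s g⁻¹) (ρ (e j) (p v))))) =
          (φ g * φ g⁻¹) • zt j v := by
        intro g
        rw [← hze, ← Module.End.mul_apply (ρ' (s g)), ← Module.End.mul_apply (ρ' (e j)),
          ← map_mul, ← map_mul, ← mul_assoc, hφ, map_smul, LinearMap.smul_apply, hze, mul_smul]
        congr 1
        have h3 : p (ρ (s g⁻¹ * e j) (p v)) = ρ (s g⁻¹ * e j) (p v) := by
          have h4 := LinearMap.congr_fun (hpρ (s g⁻¹ * e j)) v
          have h5 := LinearMap.congr_fun hp (ρ (s g⁻¹ * e j) v)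
          rw [Module.End.mul_apply, Module.End.mul_apply] at h4
          rw [Module.End.mul_apply] at h5
          rw [← h4, h5]
        rw [← Module.End.mul_apply (ρ (s g⁻¹)), ← map_mul, ← hzr, h3, ← Module.End.mul_apply,
          ← map_mul, ← mul_assoc, hφ, map_smul, LinearMap.smul_apply, map_smul, hzr]
      simp only [h2]
      rw [← Finset.sum_smul, smul_smul, hone, one_smul]
      rfl
    · intro i _ hij
      rw [Finset.sum_eq_zero, smul_zero]
      intro g _
      rw [← hze, ← Module.End.mul_apply (ρ' (s g)), ← Module.End.mul_apply (ρ' (e j)),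
        ← map_mul, ← map_mul, ← mul_assoc, he.orth j i (Ne.symm hij), map_zero,
        LinearMap.zero_apply]
    · simp
  rw [(LinearEquiv.ofBijective Φ ⟨hinj, hsurj⟩).finrank_eq, Module.finrank_pi_fintype]
  exact Finset.sum_congr rfl fun i _ => Module.finrank_linearMap ..

end Hom

/-! ### Littlewood–Richardson coefficients over an arbitrary field -/

section MultilinearExt

/-- Multilinear maps that agree on spanning sets are equal. -/
lemma multilinear_ext_span {F ι N : Type*} [Field F] [Fintype ι] [DecidableEq ι] {M : ι → Type*}
    [∀ i, AddCommGroup (M i)] [∀ i, Module F (M i)] [AddCommGroup N] [Module F N]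
    {S : ∀ i, Set (M i)} (hS : ∀ i, Submodule.span F (S i) = ⊤) {f g : MultilinearMap F M N}
    (h : ∀ m, (∀ i, m i ∈ S i) → f m = g m) : f = g := by
  have key : ∀ s : Finset ι, ∀ m : ∀ i, M i, (∀ i, i ∉ s → m i ∈ S i) → f m = g m := by
    intro s
    induction s using Finset.induction with
    | empty => exact fun m hm => h m fun i => hm i (by simp)
    | insert a s ha ih =>
      intro m hm
      have h1 : Submodule.span F (S a) ≤ LinearMap.eqLocus (f.toLinearMap m a)
          (g.toLinearMap m a) := by
        rw [Submodule.span_le]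
        intro x hx
        refine ih (Function.update m a x) fun i hi => ?_
        by_cases hia : i = a
        · subst hia; simpa using hx
        · rw [Function.update_of_ne hia]
          exact hm i (by simp [hia, hi])
      have h2 : m a ∈ LinearMap.eqLocus (f.toLinearMap m a) (g.toLinearMap m a) :=
        h1 (by rw [hS]; trivial)
      have h3 : f (Function.update m a (m a)) = g (Function.update m a (m a)) := h2
      rwa [Function.update_eq_self] at h3
  exact MultilinearMap.ext fun m => key Finset.univ m fun i hi => absurd (Finset.mem_univ i) hi

end MultilinearExt

section Transfer

/-- If `A² = c A` with `c ≠ 0`, the eigenvalue `0` is semisimple, so the dimension of the kernel is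
the multiplicity of the root `0` of the characteristic polynomial. -/
lemma finrank_ker_of_sq {K n : Type*} [Field K] [Fintype n] [DecidableEq n] {A : Matrix n n K}
    {c : K} (hA : A * A = c • A) (hc : c ≠ 0) :
    Module.finrank K (LinearMap.ker A.toLin') = A.charpoly.natTrailingDegree := by
  rw [← Matrix.charpoly_toLin', ← LinearMap.finrank_maxGenEigenspace_zero_eq]
  set φ := A.toLin' with hφ
  suffices h : LinearMap.ker φ = Module.End.maxGenEigenspace φ 0 by rw [h]
  have hsq : ∀ v, φ (φ v) = c • φ v := fun v => by
    have := LinearMap.congr_fun (Matrix.toLin'_mul A A) v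
    rw [hA, map_smul] at this
    exact this.symm
  have hpow : ∀ (k : ℕ) v, (φ ^ (k + 1)) v = c ^ k • φ v := by
    intro k v
    induction k with
    | zero => simp
    | succ k ih => rw [pow_succ', Module.End.mul_apply, ih, map_smul, hsq, smul_smul, pow_succ]
  ext v
  rw [Module.End.mem_maxGenEigenspace, LinearMap.mem_ker]
  simp only [zero_smul, sub_zero]
  constructor
  · intro h
    exact ⟨1, by simpa using h⟩
  · rintro ⟨k, hk⟩
    have h1 := hpow k v
    rw [pow_succ', Module.End.mul_apply, hk, map_zero] at h1
    exact (smul_eq_zero.1 h1.symm).resolve_left (pow_ne_zero _ hc)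

lemma rank_add_finrank_ker {K n : Type*} [Field K] [Fintype n] [DecidableEq n]
    (A : Matrix n n K) :
    A.rank + Module.finrank K (LinearMap.ker A.toLin') = Fintype.card n := by
  have := LinearMap.finrank_range_add_finrank_ker A.toLin'
  rw [Module.finrank_pi] at this
  rw [← this]
  rfl

lemma map_intCast_sq {n : Type*} [Fintype n] {M : Matrix n n ℤ} {k : ℤ} (hM : M * M = k • M)
    (L : Type*) [Field L] : M.map (Int.castRingHom L) * M.map (Int.castRingHom L) =
      (k : L) • M.map (Int.castRingHom L) := by
  rw [← Matrix.map_mul, hM]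
  ext i j
  simp only [Matrix.map_apply, Matrix.smul_apply, smul_eq_mul, eq_intCast, Int.cast_mul]

lemma map_intCast_compl {n : Type*} [DecidableEq n] (M : Matrix n n ℤ) (k : ℤ)
    (L : Type*) [Field L] : (k • (1 : Matrix n n ℤ) - M).map (Int.castRingHom L) =
      (k : L) • (1 : Matrix n n L) - M.map (Int.castRingHom L) := by
  ext i j
  simp only [Matrix.map_apply, Matrix.smul_apply, Matrix.sub_apply, smul_eq_mul, eq_intCast,
    Int.cast_mul, Int.cast_sub, Matrix.one_apply]
  split_ifs <;> simp

/-- The rank of a quasi-idempotent integer matrix cannot increase by reduction: the order of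
vanishing at `0` of the characteristic polynomial can only grow. -/
lemma rank_map_le {n F K : Type*} [Fintype n] [DecidableEq n] [Field F] [Field K] [CharZero K]
    {M : Matrix n n ℤ} {k : ℤ} (hM : M * M = k • M) (hk : (k : F) ≠ 0) :
    (M.map (Int.castRingHom F)).rank ≤ (M.map (Int.castRingHom K)).rank := by
  have hk0 : k ≠ 0 := by rintro rfl; simp at hk
  have h1 := rank_add_finrank_ker (M.map (Int.castRingHom F))
  have h2 := rank_add_finrank_ker (M.map (Int.castRingHom K))
  rw [finrank_ker_of_sq (map_intCast_sq hM F) hk, Matrix.charpoly_map] at h1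
  rw [finrank_ker_of_sq (map_intCast_sq hM K) (Int.cast_ne_zero.2 hk0), Matrix.charpoly_map] at h2
  have h3 : ((M.charpoly).map (Int.castRingHom K)).natTrailingDegree ≤
      ((M.charpoly).map (Int.castRingHom F)).natTrailingDegree := by
    refine Polynomial.le_natTrailingDegree ((M.charpoly_monic).map _).ne_zero fun m hm => ?_
    have h4 := Polynomial.coeff_eq_zero_of_lt_natTrailingDegree hm
    rw [Polynomial.coeff_map, eq_intCast, Int.cast_eq_zero] at h4
    rw [Polynomial.coeff_map, h4, map_zero]
  omega

/-- The complement `c - A` projects onto the kernel of `A`, up to the scalar `c`. -/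
lemma rank_add_rank_compl {K n : Type*} [Field K] [Fintype n] [DecidableEq n] {A : Matrix n n K}
    {c : K} (hA : A * A = c • A) (hc : c ≠ 0) :
    A.rank + (c • (1 : Matrix n n K) - A).rank = Fintype.card n := by
  have h1 := rank_add_finrank_ker A
  have h2 : LinearMap.range (c • (1 : Matrix n n K) - A).toLin' = LinearMap.ker A.toLin' := by
    ext v
    rw [LinearMap.mem_range, LinearMap.mem_ker]
    constructor
    · rintro ⟨w, rfl⟩
      rw [← LinearMap.comp_apply, ← Matrix.toLin'_mul, mul_sub, hA]
      simp
    · intro h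
      refine ⟨c⁻¹ • v, ?_⟩
      rw [map_smul, map_sub, LinearMap.sub_apply, h, map_smul]
      simp [smul_smul, inv_mul_cancel₀ hc]
  rw [← h2] at h1
  exact h1

/-- A quasi-idempotent integer matrix `M`, `M² = k M`, has the same rank in characteristic zero
and in each characteristic not dividing `k`. -/
lemma rank_map_eq {n F K : Type*} [Fintype n] [DecidableEq n] [Field F] [Field K] [CharZero K]
    {M : Matrix n n ℤ} {k : ℤ} (hM : M * M = k • M) (hk : (k : F) ≠ 0) :
    (M.map (Int.castRingHom F)).rank = (M.map (Int.castRingHom K)).rank := by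
  have hk0 : k ≠ 0 := by rintro rfl; simp at hk
  -- Apply the inequality both to `M` and to its complement `k - M`; the two ranks add up to the
  -- size of the matrix over either field.
  have hN : (k • (1 : Matrix n n ℤ) - M) * (k • (1 : Matrix n n ℤ) - M) =
      k • (k • (1 : Matrix n n ℤ) - M) := by
    rw [sub_mul, mul_sub, mul_sub, hM, smul_mul_smul_comm, smul_mul_assoc, mul_smul_comm, smul_sub,
      smul_smul]
    simp
  have h1 := rank_map_le (F := F) (K := K) hM hk
  have h2 := rank_map_le (F := F) (K := K) hN hk
  rw [map_intCast_compl, map_intCast_compl] at h2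
  have h3 := rank_add_rank_compl (map_intCast_sq hM F) hk
  have h4 := rank_add_rank_compl (map_intCast_sq hM K) (Int.cast_ne_zero.2 hk0)
  omega

end Transfer

section LR

variable {k N : ℕ} {n : Fin k → ℕ} (hn : ∑ j, n j = N)

@[simp] lemma blockPerm_apply (w : ∀ j, Equiv.Perm (Fin (n j))) (x : Σ j, Fin (n j)) :
    blockPerm n hn w (blockEquiv n hn x) = blockEquiv n hn ⟨x.1, w x.1 x.2⟩ := by
  simp [blockPerm]

/-- The embedding of a Young subgroup as a homomorphism. -/
def blockHom : (∀ j, Equiv.Perm (Fin (n j))) →* Equiv.Perm (Fin N) where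
  toFun := blockPerm n hn
  map_one' := by
    ext i
    obtain ⟨x, rfl⟩ := (blockEquiv n hn).surjective i
    rw [blockPerm_apply]; rfl
  map_mul' v w := by
    ext i
    obtain ⟨x, rfl⟩ := (blockEquiv n hn).surjective i
    rw [Equiv.Perm.mul_apply, blockPerm_apply, blockPerm_apply, blockPerm_apply]; rfl

variable (K : Type*) [Field K]

/-- The embedding of the group algebra of a Young subgroup. -/
def blockAlg : MonoidAlgebra K (∀ j, Equiv.Perm (Fin (n j))) →ₐ[K]
    MonoidAlgebra K (Equiv.Perm (Fin N)) :=
  MonoidAlgebra.mapDomainAlgHom K K (blockHom hn)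

lemma blockAlg_single (w : ∀ j, Equiv.Perm (Fin (n j))) (r : K) :
    blockAlg hn K (MonoidAlgebra.single w r) = MonoidAlgebra.single (blockPerm n hn w) r := by
  simp [blockAlg, blockHom]

/-- The primitive idempotent attached to a family of partitions. -/
def famId {ι : Type*} [Fintype ι] [DecidableEq ι] {n : ι → ℕ} (alpha : ∀ j, Shape (n j)) :
    MonoidAlgebra K (∀ j, Equiv.Perm (Fin (n j))) :=
  box K _ fun j => yId K (alpha j)

lemma famId_idem {ι : Type*} [Fintype ι] [DecidableEq ι] {n : ι → ℕ} (alpha : ∀ j, Shape (n j))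
    (hK : ∀ j, ((n j).factorial : K) ≠ 0) :
    famId K alpha * famId K alpha = famId K alpha := by
  rw [famId, box_mul]
  simp only [yId_idem (hK _)]

/-- The operator `x ↦ e_α x e_λ` on the group algebra. -/
def lrOp (alpha : ∀ j, Shape (n j)) (lam : Shape N) :
    Module.End K (MonoidAlgebra K (Equiv.Perm (Fin N))) :=
  LinearMap.mulLeft K (blockAlg hn K (famId K alpha)) * LinearMap.mulRight K (yId K lam)

lemma lrOp_apply (alpha : ∀ j, Shape (n j)) (lam : Shape N)
    (x : MonoidAlgebra K (Equiv.Perm (Fin N))) :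
    lrOp hn K alpha lam x = blockAlg hn K (famId K alpha) * (x * yId K lam) := rfl

/-- The dimension of `e_α K𝔖_N e_λ`: the Littlewood–Richardson coefficient computed over `K`. -/
def lrNum (alpha : ∀ j, Shape (n j)) (lam : Shape N) : ℕ :=
  Module.finrank K (LinearMap.range (lrOp hn K alpha lam))

/-- The integral form of the Young symmetrizer of a Young subgroup. -/
def famZ (alpha : ∀ j, Shape (n j)) : MonoidAlgebra ℤ (Equiv.Perm (Fin N)) :=
  ∑ g : ∀ j, Equiv.Perm (Fin (n j)),
    MonoidAlgebra.single (blockPerm n hn g) (∏ j, (young ℤ (alpha j)).coeff (g j))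

lemma coeff_young_map {m : ℕ} (lam : Shape m) (g : Equiv.Perm (Fin m)) :
    (young K lam).coeff g = ((young ℤ lam).coeff g : K) := by
  rw [← map_young (R := K)]
  rfl

lemma map_famZ (alpha : ∀ j, Shape (n j)) :
    MonoidAlgebra.mapRingHom _ (Int.castRingHom K) (famZ hn alpha) =
      blockAlg hn K (box K _ fun j => young K (alpha j)) := by
  rw [famZ, box_apply, map_sum, map_sum]
  refine Finset.sum_congr rfl fun g _ => ?_
  rw [MonoidAlgebra.mapRingHom_single, blockAlg_single]
  simp [coeff_young_map]

/-- The integral matrix of `x ↦ y_α x y_λ`. -/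
def lrMat (alpha : ∀ j, Shape (n j)) (lam : Shape N) :
    Matrix (Equiv.Perm (Fin N)) (Equiv.Perm (Fin N)) ℤ :=
  fun g h => (famZ hn alpha * MonoidAlgebra.single h 1 * young ℤ lam).coeff g

/-- The basis of the group algebra given by the group elements. -/
def grpBasis (G : Type*) : Module.Basis G K (MonoidAlgebra K G) :=
  Module.Basis.ofRepr (MonoidAlgebra.coeffLinearEquiv K)

/-- The product of the integers `k` with `y² = k y`. -/
def lrScale (alpha : ∀ j, Shape (n j)) (lam : Shape N) : ℤ :=
  (∏ j, hookZ (alpha j)) * hookZ lam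

/-- The operator `x ↦ y_α x y_λ`. -/
def lrOpY (alpha : ∀ j, Shape (n j)) (lam : Shape N) :
    Module.End K (MonoidAlgebra K (Equiv.Perm (Fin N))) :=
  LinearMap.mulLeft K (blockAlg hn K (box K _ fun j => young K (alpha j))) *
    LinearMap.mulRight K (young K lam)

lemma toMatrix_lrOpY (alpha : ∀ j, Shape (n j)) (lam : Shape N) :
    LinearMap.toMatrix (grpBasis K _) (grpBasis K _) (lrOpY hn K alpha lam) =
      (lrMat hn alpha lam).map (Int.castRingHom K) := by
  ext g h
  rw [LinearMap.toMatrix_apply, Matrix.map_apply]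
  change (blockAlg hn K (box K _ fun j => young K (alpha j)) *
    (MonoidAlgebra.single h 1 * young K lam)).coeff g = _
  rw [← map_famZ, ← map_young lam, ← mul_assoc]
  have : (MonoidAlgebra.single h 1 : MonoidAlgebra K (Equiv.Perm (Fin N))) =
      MonoidAlgebra.mapRingHom _ (Int.castRingHom K) (MonoidAlgebra.single h 1) := by
    rw [MonoidAlgebra.mapRingHom_single, map_one]
  rw [this, ← map_mul, ← map_mul]
  rfl

lemma lrOpY_sq (alpha : ∀ j, Shape (n j)) (lam : Shape N) :
    lrOpY hn K alpha lam * lrOpY hn K alpha lam =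
      (lrScale alpha lam : K) • lrOpY hn K alpha lam := by
  refine LinearMap.ext fun x => ?_
  set Y := blockAlg hn K (box K _ fun j => young K (alpha j)) with hY
  change Y * ((Y * (x * young K lam)) * young K lam) =
    (lrScale alpha lam : K) • (Y * (x * young K lam))
  have h1 : Y * Y = ((∏ j, hookZ (alpha j) : ℤ) : K) • Y := by
    rw [hY, ← map_mul, box_mul, ← map_smul]
    simp only [young_mul_self]
    rw [MultilinearMap.map_smul_univ]
    simp
  have h2 : Y * ((Y * (x * young K lam)) * young K lam) =
      (Y * Y) * (x * (young K lam * young K lam)) := by simp only [mul_assoc]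
  rw [h2, h1, young_mul_self, mul_smul_comm, smul_mul_smul_comm, lrScale]
  push_cast
  rfl

lemma lrMat_sq (alpha : ∀ j, Shape (n j)) (lam : Shape N) :
    lrMat hn alpha lam * lrMat hn alpha lam = lrScale alpha lam • lrMat hn alpha lam := by
  have h := congrArg (LinearMap.toMatrix (grpBasis ℚ _) (grpBasis ℚ _)) (lrOpY_sq hn ℚ alpha lam)
  rw [LinearMap.toMatrix_mul, map_smul, toMatrix_lrOpY, ← Matrix.map_mul] at h
  ext i j
  have h1 := congrFun (congrFun h i) j
  simp only [Matrix.map_apply, Matrix.smul_apply, eq_intCast, smul_eq_mul] at h1 ⊢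
  exact_mod_cast h1

lemma lrOp_eq (alpha : ∀ j, Shape (n j)) (lam : Shape N) :
    lrOp hn K alpha lam = (lrScale alpha lam : K)⁻¹ • lrOpY hn K alpha lam := by
  refine LinearMap.ext fun x => ?_
  change blockAlg hn K (famId K alpha) * (x * yId K lam) =
    (lrScale alpha lam : K)⁻¹ • (blockAlg hn K (box K _ fun j => young K (alpha j)) *
      (x * young K lam))
  simp only [famId, yId]
  rw [MultilinearMap.map_smul_univ, map_smul, mul_smul_comm, smul_mul_smul_comm, lrScale]
  congr 1
  push_cast
  rw [Finset.prod_inv_distrib, mul_inv]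

lemma lrNum_eq_rank (alpha : ∀ j, Shape (n j)) (lam : Shape N) (h : (lrScale alpha lam : K) ≠ 0) :
    lrNum hn K alpha lam = ((lrMat hn alpha lam).map (Int.castRingHom K)).rank := by
  rw [lrNum, lrOp_eq, LinearMap.range_smul _ _ (inv_ne_zero h), ← toMatrix_lrOpY,
    Matrix.rank_eq_finrank_range_toLin _ (grpBasis K _) (grpBasis K _), Matrix.toLin_toMatrix]

/-- Littlewood–Richardson coefficients can be computed over any field in which the factorials
do not vanish. -/
theorem lrNum_eq {F : Type*} [Field F] [CharZero K] (alpha : ∀ j, Shape (n j)) (lam : Shape N)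
    (hF : ∀ j, ((n j).factorial : F) ≠ 0) (hN : (N.factorial : F) ≠ 0) :
    lrNum hn K alpha lam = lrNum hn F alpha lam := by
  have h : (lrScale alpha lam : F) ≠ 0 := by
    rw [lrScale]
    push_cast
    exact mul_ne_zero (Finset.prod_ne_zero_iff.2 fun j _ => hookZ_ne_zero (hF j) _)
      (hookZ_ne_zero hN _)
  have h0 : (lrScale alpha lam : K) ≠ 0 := by
    intro h0
    rw [Int.cast_eq_zero] at h0
    rw [h0] at h
    simp at h
  rw [lrNum_eq_rank hn F _ _ h, lrNum_eq_rank hn K _ _ h0]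
  exact (rank_map_eq (lrMat_sq hn alpha lam) h).symm

end LR

section Specht

variable (lam : YoungDiagram)

/-- The generator of the Specht module which is an idempotent of the group algebra. -/
def spechtGen (K : Type*) [Field K] : Specht K lam :=
  ⟨yId K (⟨lam, rfl⟩ : Shape lam.card), by
    rw [yId, young_self]
    exact Submodule.smul_of_tower_mem _ _ (Submodule.mem_span_singleton_self _)⟩

/-- The Specht module is the left ideal generated by the Young idempotent. -/
lemma mem_specht_iff {K : Type*} [Field K] (hK : (lam.card.factorial : K) ≠ 0)
    (x : MonoidAlgebra K (Equiv.Perm (Fin lam.card))) :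
    x ∈ Submodule.span (MonoidAlgebra K (Equiv.Perm (Fin lam.card))) {youngElt K lam} ↔
      x * yId K (⟨lam, rfl⟩ : Shape lam.card) = x := by
  rw [Submodule.mem_span_singleton]
  constructor
  · rintro ⟨a, rfl⟩
    rw [smul_eq_mul, mul_assoc, ← young_self, yId, mul_smul_comm, young_mul_self, smul_smul,
      inv_mul_cancel₀ (hookZ_ne_zero hK _), one_smul]
  · intro h
    refine ⟨(hookZ (⟨lam, rfl⟩ : Shape lam.card) : K)⁻¹ • x, ?_⟩
    rw [smul_eq_mul, smul_mul_assoc, ← young_self, ← mul_smul_comm]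
    exact h

/-- The idempotent generator acts as a right identity on the Specht module. -/
lemma smul_spechtGen {K : Type*} [Field K] (hK : (lam.card.factorial : K) ≠ 0)
    (x : Specht K lam) :
    (x : MonoidAlgebra K (Equiv.Perm (Fin lam.card))) • spechtGen lam K = x :=
  Subtype.ext ((mem_specht_iff lam hK _).1 x.2)

variable {k : ℕ} (alpha : Fin k → YoungDiagram) (h : ∑ j, (alpha j).card = lam.card)

set_option synthInstance.maxHeartbeats 400000 in
set_option maxHeartbeats 1000000 in
/-- A homomorphism from `S^{α₁} ⊠ ⋯ ⊠ S^{α_k}` is determined by the image of the tensor product of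
the idempotent generators, which can be any element of `e_α S^λ`. -/
theorem finrank_lrHom : Module.finrank ℂ (lrHom lam alpha h) =
    lrNum h ℂ (fun j => (⟨alpha j, rfl⟩ : Shape (alpha j).card)) ⟨lam, rfl⟩ := by
  classical
  have fac : ∀ m : ℕ, (m.factorial : ℂ) ≠ 0 := fun m => by exact_mod_cast m.factorial_ne_zero
  set E := blockAlg h ℂ (famId ℂ fun j => (⟨alpha j, rfl⟩ : Shape (alpha j).card)) with hE
  set e := yId ℂ (⟨lam, rfl⟩ : Shape lam.card) with he
  set g : ∀ j, Specht ℂ (alpha j) := fun j => spechtGen (alpha j) ℂ with hg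
  have hEE : E * E = E := by rw [hE, ← map_mul, famId_idem _ _ fun j => fac _]
  have hee : e * e = e := yId_idem (fac _) _
  -- Equivariance under the Young subgroup extends multilinearly to its group algebra.
  have equi : ∀ f : lrHom lam alpha h, ∀ x : ∀ j, MonoidAlgebra ℂ (Equiv.Perm (Fin (alpha j).card)),
      ∀ s : ∀ j, Specht ℂ (alpha j), f.1 (PiTensorProduct.tprod ℂ fun j => x j • s j) =
        blockAlg h ℂ (box ℂ _ x) • f.1 (PiTensorProduct.tprod ℂ s) := by
    intro f x s
    let A : MultilinearMap ℂ (fun j => MonoidAlgebra ℂ (Equiv.Perm (Fin (alpha j).card)))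
        (Specht ℂ lam) :=
      (f.1.compMultilinearMap (PiTensorProduct.tprod ℂ)).compLinearMap fun j =>
        (LinearMap.toSpanSingleton (MonoidAlgebra ℂ (Equiv.Perm (Fin (alpha j).card))) _
          (s j)).restrictScalars ℂ
    let B : MultilinearMap ℂ (fun j => MonoidAlgebra ℂ (Equiv.Perm (Fin (alpha j).card)))
        (Specht ℂ lam) :=
      ((LinearMap.toSpanSingleton (MonoidAlgebra ℂ (Equiv.Perm (Fin lam.card))) _
          (f.1 (PiTensorProduct.tprod ℂ s))).restrictScalars ℂ ∘ₗ
        (blockAlg h ℂ).toLinearMap).compMultilinearMap (box ℂ _)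
    have hAB : A = B := by
      refine Module.Basis.ext_multilinear (fun j => grpBasis ℂ _) fun w => ?_
      have h1 := LinearMap.congr_fun (f.2 w) (PiTensorProduct.tprod ℂ s)
      rw [LinearMap.comp_apply, PiTensorProduct.map_tprod] at h1
      refine Eq.trans h1 ?_
      change MonoidAlgebra.single (blockPerm _ h w) (1 : ℂ) •
          (f.1 (PiTensorProduct.tprod ℂ s) : Specht ℂ lam) =
        blockAlg h ℂ (box ℂ _ fun j => MonoidAlgebra.single (w j) 1) •
          (f.1 (PiTensorProduct.tprod ℂ s) : Specht ℂ lam)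
      rw [box_single, blockAlg_single]
    exact congrFun (congrArg DFunLike.coe hAB) x
  -- Evaluation at the tensor product of the idempotent generators.
  let Ev : lrHom lam alpha h →ₗ[ℂ] MonoidAlgebra ℂ (Equiv.Perm (Fin lam.card)) :=
    { toFun := fun f => (f.1 (PiTensorProduct.tprod ℂ g) : Specht ℂ lam)
      map_add' := fun f f' => rfl
      map_smul' := fun r f => rfl }
  have hinj : Function.Injective Ev := by
    intro f f' hf
    refine Subtype.ext (PiTensorProduct.ext (MultilinearMap.ext fun s => ?_))
    have hf' : f.1 (PiTensorProduct.tprod ℂ g) = f'.1 (PiTensorProduct.tprod ℂ g) :=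
      Subtype.ext hf
    have h1 := equi f (fun j => (s j : MonoidAlgebra ℂ (Equiv.Perm (Fin (alpha j).card)))) g
    rw [hf', ← equi f'] at h1
    have h2 : (fun j => (s j : MonoidAlgebra ℂ (Equiv.Perm (Fin (alpha j).card))) • g j) = s :=
      funext fun j => smul_spechtGen (alpha j) (fac _) (s j)
    rw [h2] at h1
    exact h1
  -- A value `v` satisfies `e_α v = v = v e_λ`; conversely such a `v` is the value at the generators
  -- of the homomorphism `x ↦ x v`.
  have hrange : LinearMap.range Ev =
      LinearMap.range (lrOp h ℂ (fun j => (⟨alpha j, rfl⟩ : Shape (alpha j).card)) ⟨lam, rfl⟩) := by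
    ext v
    constructor
    · rintro ⟨f, rfl⟩
      refine ⟨Ev f, ?_⟩
      have hx : Ev f * e = Ev f :=
        (mem_specht_iff lam (fac _) _).1 (f.1 (PiTensorProduct.tprod ℂ g)).2
      rw [lrOp_apply, ← he, hx]
      have h1 := equi f (fun j => yId ℂ (⟨alpha j, rfl⟩ : Shape (alpha j).card)) g
      have h2 : (fun j => yId ℂ (⟨alpha j, rfl⟩ : Shape (alpha j).card) • g j) = g :=
        funext fun j => smul_spechtGen (alpha j) (fac _) (g j)
      rw [h2] at h1
      exact (congrArg Subtype.val h1).symm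
    · rintro ⟨x, rfl⟩
      rw [lrOp_apply]
      set v := E * (x * e) with hv
      have hv1 : E * v = v := by rw [hv, ← mul_assoc, hEE]
      have hv2 : v * e = v := by rw [hv, mul_assoc, mul_assoc, hee]
      clear_value v
      let m : MultilinearMap ℂ (fun j => Specht ℂ (alpha j))
          (MonoidAlgebra ℂ (Equiv.Perm (Fin lam.card))) :=
        ((LinearMap.mulRight ℂ v) ∘ₗ (blockAlg h ℂ).toLinearMap).compMultilinearMap
          ((box ℂ _).compLinearMap fun j => (Submodule.subtype _).restrictScalars ℂ)
      have hm : ∀ s, m s = blockAlg h ℂ (box ℂ _ fun j => (s j).1) * v := fun s => rfl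
      let L := PiTensorProduct.lift m
      have hL : ∀ t, L t ∈ (Submodule.span (MonoidAlgebra ℂ (Equiv.Perm (Fin lam.card)))
          {youngElt ℂ lam}).restrictScalars ℂ := by
        intro t
        induction t using PiTensorProduct.induction_on with
        | smul_tprod r s =>
          rw [map_smul, PiTensorProduct.lift.tprod, hm]
          refine Submodule.smul_mem _ _ ?_
          refine (mem_specht_iff lam (fac _) _).2 ?_
          rw [mul_assoc, hv2]
        | add t t' ht ht' => rw [map_add]; exact Submodule.add_mem _ ht ht'
      let L' : (⨂[ℂ] j, Specht ℂ (alpha j)) →ₗ[ℂ] Specht ℂ lam :=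
        { toFun := fun t => ⟨L t, hL t⟩
          map_add' := fun t t' => Subtype.ext (map_add L t t')
          map_smul' := fun r t => Subtype.ext (map_smul L r t) }
      refine ⟨⟨L', fun w => ?_⟩, ?_⟩
      · refine PiTensorProduct.ext (MultilinearMap.ext fun s => Subtype.ext ?_)
        refine (congrArg L
          (PiTensorProduct.map_tprod (fun j => spechtRep ℂ (alpha j) (w j)) s)).trans ?_
        change L _ = MonoidAlgebra.single (blockPerm _ h w) (1 : ℂ) * L (PiTensorProduct.tprod ℂ s)
        rw [PiTensorProduct.lift.tprod, PiTensorProduct.lift.tprod, hm, hm, ← mul_assoc,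
          ← blockAlg_single, ← map_mul, ← box_single, box_mul]
        rfl
      · change L (PiTensorProduct.tprod ℂ g) = v
        rw [PiTensorProduct.lift.tprod, hm]
        exact hv1
  rw [lrNum, ← hrange]
  exact (LinearEquiv.ofInjective Ev hinj).finrank_eq

/-- The Littlewood–Richardson coefficient over a field of sufficiently large characteristic. -/
theorem lr_eq_lrNum {F : Type*} [Field F] {k N : ℕ} {n : Fin k → ℕ} (hn : ∑ j, n j = N)
    (alpha : ∀ j, Shape (n j)) (lam : Shape N)
    (hF : ∀ j, ((n j).factorial : F) ≠ 0) (hN : (N.factorial : F) ≠ 0) :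
    lr lam.1 (fun j => (alpha j).1) = lrNum hn F alpha lam := by
  obtain ⟨lam, rfl⟩ := lam
  obtain ⟨beta, hb⟩ : ∃ beta : Fin k → YoungDiagram, ∀ j, (beta j).card = n j :=
    ⟨fun j => (alpha j).1, fun j => (alpha j).2⟩
  have : n = fun j => (alpha j).1.card := funext fun j => ((alpha j).2).symm
  obtain ⟨beta, hbeta⟩ : ∃ beta : Fin k → YoungDiagram, beta = fun j => (alpha j).1 := ⟨_, rfl⟩
  have h3 : n = fun j => (beta j).card := by rw [hbeta]; exact this
  subst h3
  have h4 : alpha = fun j => ⟨beta j, rfl⟩ := by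
    funext j
    exact Subtype.ext (congrFun hbeta j).symm
  subst h4
  rw [lr, dif_pos hn, finrank_lrHom, lrNum_eq hn ℂ (F := F) _ _ hF hN]

end Specht

/-! ### A basis of the Brauer tree algebra -/

section Basis

variable {F : Type*} [Field F] {ℓ : ℕ} [NeZero ℓ]

/-- Labels for the paths spanning `A_ℓ`: `(j, 0)` stands for the path `e_j`, `(j, 1)` for the
arrow `j → j - 1` (the loop `u` if `j = 0`), `(j, 2)` for the arrow `j → j + 1`, and `(j, 3)` for
the cycle of length two at `j`. There is no arrow `(ℓ - 1, 2)`; this label is kept for uniformity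
and stands for `0`. -/
abbrev Slot (ℓ : ℕ) : Type := Fin ℓ × Fin 4

/-- The labels that stand for a path. -/
def Slot.Ok (β : Slot ℓ) : Prop := β.2 = 2 → (β.1 : ℕ) + 1 < ℓ

/-- The arrow `j → j - 1`, or the loop `u` if `j = 0`. -/
def leftArrow (j : Fin ℓ) : Arrow ℓ :=
  if h : (j : ℕ) = 0 then .u else .down (j - 1) (by omega)

/-- The arrow `j - 1 → j`, or the loop `u` if `j = 0`. -/
def backArrow (j : Fin ℓ) : Arrow ℓ :=
  if h : (j : ℕ) = 0 then .u else .up (j - 1) (by omega)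

/-- The label of an arrow. -/
def Arrow.slot : Arrow ℓ → Slot ℓ
  | u => (0, 1)
  | up k h => (⟨k, Nat.lt_of_succ_lt h⟩, 2)
  | down k h => (⟨k + 1, h⟩, 1)

/-- The end vertex of a path. The label `(ℓ - 1, 2)`, which stands for no path, gets the end vertex
`ℓ - 1`. -/
def Slot.tgt (β : Slot ℓ) : Fin ℓ :=
  match β.2 with
  | 0 => β.1
  | 1 => (leftArrow β.1).tgt
  | 2 => if h : (β.1 : ℕ) + 1 < ℓ then ⟨β.1 + 1, h⟩ else β.1
  | 3 => β.1

/-- The length of a path. -/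
def Slot.deg (β : Slot ℓ) : ℕ := ![0, 1, 1, 2] β.2

/-- The parity of a path. -/
def Slot.par (β : Slot ℓ) : ZMod 2 := if β = (0, 1) then 1 else 0

variable (F) in
/-- The path with a given label. -/
def path (β : Slot ℓ) : BA F ℓ :=
  match β.2 with
  | 0 => gen F (.e β.1)
  | 1 => gen F (.arr (leftArrow β.1))
  | 2 => if h : (β.1 : ℕ) + 1 < ℓ then gen F (.arr (.up β.1 h)) else 0
  | 3 => gen F (.arr (backArrow β.1)) * gen F (.arr (leftArrow β.1))

lemma leftArrow_src (j : Fin ℓ) : (leftArrow j).src = j := by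
  rw [leftArrow]
  split_ifs with h
  · exact Fin.ext h.symm
  · exact Fin.ext (by simp only [Arrow.src]; omega)

lemma backArrow_tgt (j : Fin ℓ) : (backArrow j).tgt = j := by
  rw [backArrow]
  split_ifs with h
  · exact Fin.ext h.symm
  · exact Fin.ext (by simp only [Arrow.tgt]; omega)

lemma backArrow_src (j : Fin ℓ) : (backArrow j).src = (leftArrow j).tgt := by
  rw [backArrow, leftArrow]
  split_ifs with h
  · rfl
  · rfl

lemma slot_leftArrow (j : Fin ℓ) : (leftArrow j).slot = (j, 1) := by
  rw [leftArrow]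
  split_ifs with h
  · exact Prod.ext (Fin.ext h.symm) rfl
  · exact Prod.ext (Fin.ext (by simp only [Arrow.slot]; omega)) rfl

lemma slot_fst (a : Arrow ℓ) : a.slot.1 = a.src := by cases a <;> rfl

lemma slot_snd (a : Arrow ℓ) : a.slot.2 = 1 ∨ a.slot.2 = 2 := by cases a <;> simp [Arrow.slot]

lemma slot_ok (a : Arrow ℓ) : a.slot.Ok := by
  cases a <;> simp [Arrow.slot, Slot.Ok]
  assumption

lemma leftArrow_down (k : ℕ) (h : k + 1 < ℓ) : leftArrow (⟨k + 1, h⟩ : Fin ℓ) = .down k h := by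
  rw [leftArrow, dif_neg (by simp)]; rfl

lemma leftArrow_zero : leftArrow (0 : Fin ℓ) = .u := by
  rw [leftArrow, dif_pos (by simp)]

lemma slot_tgt (a : Arrow ℓ) : a.slot.tgt = a.tgt := by
  cases a with
  | u => simp [Arrow.slot, Slot.tgt, leftArrow_zero]
  | up k h => simp [Arrow.slot, Slot.tgt, Arrow.tgt, h]
  | down k h => simp [Arrow.slot, Slot.tgt, leftArrow_down]

lemma path_slot (a : Arrow ℓ) : path F a.slot = gen F (.arr a) := by
  cases a with
  | u => simp [Arrow.slot, path, leftArrow_zero]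
  | up k h => simp [Arrow.slot, path, h]
  | down k h => simp [Arrow.slot, path, leftArrow_down]

/-- Every label of an arrow comes from an arrow. -/
lemma exists_arrow {β : Slot ℓ} (hβ : β.Ok) (h : β.2 = 1 ∨ β.2 = 2) :
    ∃ a : Arrow ℓ, a.slot = β := by
  rcases h with h | h
  · exact ⟨leftArrow β.1, by rw [slot_leftArrow]; exact Prod.ext rfl h.symm⟩
  · exact ⟨.up β.1 (hβ h), Prod.ext rfl h.symm⟩

lemma fin_four_cases : ∀ {i : Fin 4}, ¬ (i = 1 ∨ i = 2) → i = 0 ∨ i = 3 := by decide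

/-! Relations between the generators. -/

lemma gen_e_mul_e (i j : Fin ℓ) :
    gen F (.e i) * gen F (.e j) = if i = j then gen F (.e i) else 0 := by
  split_ifs with h
  · subst h
    have := baMk_rel F ℓ (Rel.idem i)
    rwa [map_mul] at this
  · have := baMk_rel F ℓ (Rel.orth i j h)
    rwa [map_mul, map_zero] at this

lemma sum_gen_e : ∑ i : Fin ℓ, gen F (.e i) = 1 := by
  have := baMk_rel F ℓ Rel.one
  rwa [map_sum, map_one] at this

lemma gen_tgt_mul (a : Arrow ℓ) : gen F (.e a.tgt) * gen F (.arr a) = gen F (.arr a) := by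
  have := baMk_rel F ℓ (Rel.tgt a)
  rwa [map_mul] at this

lemma gen_mul_src (a : Arrow ℓ) : gen F (.arr a) * gen F (.e a.src) = gen F (.arr a) := by
  have := baMk_rel F ℓ (Rel.src a)
  rwa [map_mul] at this

lemma gen_e_mul_arr (i : Fin ℓ) (a : Arrow ℓ) :
    gen F (.e i) * gen F (.arr a) = if a.tgt = i then gen F (.arr a) else 0 := by
  rw [← gen_tgt_mul, ← mul_assoc, gen_e_mul_e]
  by_cases h : i = a.tgt
  · simp [h]
  · simp [h, Ne.symm h]

lemma gen_arr_mul_e (i : Fin ℓ) (a : Arrow ℓ) :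
    gen F (.arr a) * gen F (.e i) = if a.src = i then gen F (.arr a) else 0 := by
  rw [← gen_mul_src, mul_assoc, gen_e_mul_e]
  split_ifs <;> simp

lemma gen_arr_mul_arr_eq_zero {a b : Arrow ℓ} (h : ¬ (a.src = b.tgt ∧ a.tgt = b.src)) :
    gen F (.arr a) * gen F (.arr b) = 0 := by
  by_cases h1 : a.src = b.tgt
  · have := baMk_rel F ℓ (Rel.noncycle a b h1 fun h2 => h ⟨h1, h2⟩)
    rwa [map_mul, map_zero] at this
  · rw [← gen_tgt_mul b, ← mul_assoc, gen_arr_mul_e, if_neg h1, zero_mul]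

lemma gen_three (a b c : Arrow ℓ) :
    gen F (.arr a) * (gen F (.arr b) * gen F (.arr c)) = 0 := by
  by_cases h : b.src = c.tgt ∧ b.tgt = c.src
  · by_cases h2 : a.src = b.tgt ∧ a.tgt = b.src
    · have := baMk_rel F ℓ (Rel.three a b c h2.1 h.1)
      rwa [map_mul, map_mul, map_zero, mul_assoc] at this
    · rw [← mul_assoc, gen_arr_mul_arr_eq_zero h2, zero_mul]
  · rw [gen_arr_mul_arr_eq_zero h, mul_zero]

/-- An arrow is determined by its end vertices. -/
lemma eq_backArrow {a : Arrow ℓ} {j : Fin ℓ} (h1 : a.src = (leftArrow j).tgt) (h2 : a.tgt = j) :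
    a = backArrow j := by
  subst h2
  cases a with
  | u => rw [backArrow, dif_pos (by simp [Arrow.tgt])]
  | up k h => rw [backArrow, dif_neg (by simp [Arrow.tgt])]; rfl
  | down k h =>
    exfalso
    rw [leftArrow] at h1
    split_ifs at h1 with h0
    · simp [Arrow.src, Arrow.tgt, Fin.ext_iff] at h1
    · simp [Arrow.src, Arrow.tgt, Fin.ext_iff] at h1
      omega

/-- All cycles of length two at a vertex are equal; at the vertex `0` this is the relation `u² = a⁰¹
a¹⁰`. -/
lemma cycle_eq {a b : Arrow ℓ} (h1 : a.src = b.tgt) (h2 : a.tgt = b.src) :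
    gen F (.arr a) * gen F (.arr b) = path F (b.src, 3) := by
  change _ = gen F (.arr (backArrow b.src)) * gen F (.arr (leftArrow b.src))
  cases b with
  | u =>
    rw [show leftArrow (Arrow.u : Arrow ℓ).src = .u from leftArrow_zero]
    rw [← eq_backArrow (a := a) (j := (Arrow.u : Arrow ℓ).src) _ h2]
    rw [h1, show leftArrow (Arrow.u : Arrow ℓ).src = .u from leftArrow_zero]
  | down k h =>
    rw [show leftArrow (Arrow.down k h : Arrow ℓ).src = .down k h from leftArrow_down k h]
    rw [← eq_backArrow (a := a) (j := (Arrow.down k h : Arrow ℓ).src) _ h2]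
    rw [h1, show leftArrow (Arrow.down k h : Arrow ℓ).src = .down k h from leftArrow_down k h]
  | up k h =>
    have ha : a = .down k h := by
      cases a with
      | u => simp [Arrow.src, Arrow.tgt, Fin.ext_iff] at h1
      | up k' h' => simp [Arrow.src, Arrow.tgt] at h1 h2; omega
      | down k' h' =>
        simp [Arrow.src, Arrow.tgt] at h1
        subst h1; rfl
    subst ha
    by_cases hk : k = 0
    · subst hk
      have := baMk_rel F ℓ (Rel.usq h)
      rw [map_mul, map_mul] at this
      have e : (Arrow.up 0 h : Arrow ℓ).src = 0 := Fin.ext (by simp [Arrow.src])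
      rw [e, leftArrow_zero, backArrow, dif_pos (by simp)]
      exact this.symm
    · have := baMk_rel F ℓ (Rel.cycle (Arrow.up k h : Arrow ℓ).src
        (by simp [Arrow.src]; omega) (by simp [Arrow.src]; omega) (.down k h) (.up k h)
        (backArrow (Arrow.up k h : Arrow ℓ).src) (leftArrow (Arrow.up k h : Arrow ℓ).src)
        rfl rfl rfl (backArrow_src _) (backArrow_tgt _) (leftArrow_src _))
      rwa [map_mul, map_mul] at this

/-! Left multiplication by generators permutes the paths, up to zeros. -/

open Classical in
/-- The label of the product of a generator and a path, if the product is not zero. -/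
def step : Gen ℓ → Slot ℓ → Option (Slot ℓ)
  | .e i, β => if β.tgt = i then some β else none
  | .arr a, β =>
    if β.2 = 0 ∧ a.src = β.1 then some a.slot
    else if (β.2 = 1 ∨ β.2 = 2) ∧ β.Ok ∧ a.src = β.tgt ∧ a.tgt = β.1 then some (β.1, 3)
    else none

variable (F) in
/-- The path with a given label, or zero. -/
def optPath (o : Option (Slot ℓ)) : BA F ℓ := o.elim 0 (path F)

lemma path_of_not_ok {β : Slot ℓ} (h : ¬ β.Ok) : path F β = 0 := by
  obtain ⟨j, i⟩ := β
  simp only [Slot.Ok, Classical.not_imp] at h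
  obtain ⟨rfl, h⟩ := h
  exact dif_neg h

lemma gen_mul_path (x : Gen ℓ) (β : Slot ℓ) : gen F x * path F β = optPath F (step x β) := by
  by_cases hβ : β.Ok
  · by_cases h12 : β.2 = 1 ∨ β.2 = 2
    · obtain ⟨b, rfl⟩ := exists_arrow hβ h12
      have h0 : b.slot.2 ≠ 0 := by rcases h12 with h | h <;> simp [h]
      rw [path_slot]
      cases x with
      | e i =>
        rw [gen_e_mul_arr, step, slot_tgt]
        split_ifs
        · exact (path_slot b).symm
        · rfl
      | arr a =>
        rw [step, if_neg fun h => h0 h.1, slot_tgt, slot_fst]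
        split_ifs with h
        · exact cycle_eq h.2.2.1 h.2.2.2
        · exact gen_arr_mul_arr_eq_zero fun h' => h ⟨h12, hβ, h'⟩
    · obtain ⟨j, i⟩ := β
      have h03 := fin_four_cases h12
      rcases h03 with rfl | rfl
      · change gen F x * gen F (.e j) = _
        cases x with
        | e i =>
          rw [gen_e_mul_e, step]
          by_cases h : i = j
          · subst h; simp [Slot.tgt, optPath, path]
          · simp [Slot.tgt, h, Ne.symm h, optPath]
        | arr a =>
          rw [gen_arr_mul_e, step]
          by_cases h : a.src = j
          · simp [h, optPath, path_slot]
          · simp [h, optPath]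
      · change gen F x * (gen F (.arr (backArrow j)) * gen F (.arr (leftArrow j))) = _
        cases x with
        | e i =>
          rw [← mul_assoc, gen_e_mul_arr, step, backArrow_tgt]
          by_cases h : j = i
          · subst h; simp [Slot.tgt, optPath, path]
          · simp [Slot.tgt, h, optPath]
        | arr a => rw [gen_three]; simp [step, optPath]
  · rw [path_of_not_ok hβ, mul_zero]
    have hp := path_of_not_ok (F := F) hβ
    cases x with
    | e i => rw [step]; split_ifs <;> simp [optPath, hp]
    | arr a =>
      have h2 : β.2 = 2 := by
        by_contra h; exact hβ fun h' => absurd h' h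
      simp [step, h2, hβ, optPath]

variable (F) in
/-- The formal version of `optPath`. -/
def optSingle (o : Option (Slot ℓ)) : Slot ℓ →₀ F := o.elim 0 fun β => Finsupp.single β 1

variable (F) in
/-- The action of the generators on formal combinations of labels. -/
def stepLin (x : Gen ℓ) : Module.End F (Slot ℓ →₀ F) :=
  Finsupp.linearCombination F fun β => optSingle F (step x β)

lemma stepLin_optSingle (x : Gen ℓ) (o : Option (Slot ℓ)) :
    stepLin F x (optSingle F o) = optSingle F (o.bind (step x)) := by
  cases o <;> simp [optSingle, stepLin]

lemma stepLin_single (x : Gen ℓ) (β : Slot ℓ) :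
    stepLin F x (Finsupp.single β 1) = optSingle F (step x β) := by
  simp [stepLin]

lemma stepLin_mul_single (x y : Gen ℓ) (β : Slot ℓ) :
    (stepLin F x * stepLin F y) (Finsupp.single β 1) = optSingle F ((step y β).bind (step x)) := by
  rw [Module.End.mul_apply, stepLin_single, stepLin_optSingle]

/-- The product of two arrows and a path is zero unless the path has length `0`. -/
lemma step_step (a b : Arrow ℓ) (β : Slot ℓ) : (step (.arr b) β).bind (step (.arr a)) =
    if β.2 = 0 ∧ b.src = β.1 ∧ a.src = b.tgt ∧ a.tgt = b.src then some (b.src, 3) else none := by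
  by_cases h0 : β.2 = 0 ∧ b.src = β.1
  · have h1 : step (.arr b) β = some b.slot := by rw [step, if_pos h0]
    have h2 : b.slot.2 ≠ 0 := by rcases slot_snd b with h | h <;> simp [h]
    rw [h1, Option.bind_some, step, if_neg fun h => h2 h.1]
    simp [slot_snd, slot_ok, slot_tgt, slot_fst, h0]
  · rw [step, if_neg h0]
    rw [if_neg (c := _ ∧ b.src = β.1 ∧ _) fun h => h0 ⟨h.1, h.2.1⟩]
    split_ifs
    · simp [step]
    · rfl

lemma step_e_step (a : Arrow ℓ) (β : Slot ℓ) :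
    (step (.arr a) β).bind (step (.e a.tgt)) = step (.arr a) β := by
  rw [step]
  split_ifs with h1 h2
  · simp [step, slot_tgt]
  · simp [step, Slot.tgt, h2.2.2.2]
  · rfl

lemma step_step_e (a : Arrow ℓ) (β : Slot ℓ) :
    (step (.e a.src) β).bind (step (.arr a)) = step (.arr a) β := by
  by_cases h : β.tgt = a.src
  · rw [show step (.e a.src) β = some β by rw [step, if_pos h]]; rfl
  · rw [show step (.e a.src) β = none by rw [step, if_neg h]]
    rw [step, if_neg, if_neg]
    · rfl
    · exact fun h' => h h'.2.2.1.symm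
    · rintro ⟨h1, h2⟩
      refine h ?_
      rw [h2]
      obtain ⟨j, i⟩ := β
      simp only at h1
      subst h1; rfl

/-- The formal action on labels satisfies the defining relations of `A_ℓ`; this is what makes the
paths linearly independent. -/
lemma stepLin_rel ⦃x y : FreeAlgebra F (Gen ℓ)⦄ (h : Rel F ℓ x y) :
    FreeAlgebra.lift F (stepLin F) x = FreeAlgebra.lift F (stepLin F) y := by
  have ext : ∀ f g : Module.End F (Slot ℓ →₀ F),
      (∀ β, f (Finsupp.single β 1) = g (Finsupp.single β 1)) → f = g := fun f g h =>
    Finsupp.lhom_ext' fun β => LinearMap.ext_ring (h β)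
  induction h with
  | idem i =>
    simp only [map_mul, FreeAlgebra.lift_ι_apply]
    refine ext _ _ fun β => ?_
    rw [stepLin_mul_single, stepLin_single]
    congr 1
    rw [step]
    split_ifs with h
    · simp [step, h]
    · rfl
  | orth i j hij =>
    simp only [map_mul, map_zero, FreeAlgebra.lift_ι_apply]
    refine ext _ _ fun β => ?_
    rw [stepLin_mul_single, step]
    split_ifs with h
    · simp [step, h, Ne.symm hij, optSingle]
    · rfl
  | one =>
    simp only [map_sum, map_one, FreeAlgebra.lift_ι_apply]
    refine ext _ _ fun β => ?_
    rw [LinearMap.sum_apply, Finset.sum_eq_single β.tgt]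
    · rw [stepLin_single]; simp [step, optSingle]
    · intro i _ hi
      rw [stepLin_single]; simp [step, optSingle, Ne.symm hi]
    · simp
  | tgt a =>
    simp only [map_mul, FreeAlgebra.lift_ι_apply]
    exact ext _ _ fun β => by rw [stepLin_mul_single, stepLin_single, step_e_step]
  | src a =>
    simp only [map_mul, FreeAlgebra.lift_ι_apply]
    exact ext _ _ fun β => by rw [stepLin_mul_single, stepLin_single, step_step_e]
  | three a b c hab hbc =>
    simp only [map_mul, map_zero, FreeAlgebra.lift_ι_apply]
    refine ext _ _ fun β => ?_
    rw [mul_assoc, Module.End.mul_apply, stepLin_mul_single, stepLin_optSingle, step_step]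
    split_ifs
    · simp [step, optSingle]
    · rfl
  | noncycle a b hab h =>
    simp only [map_mul, map_zero, FreeAlgebra.lift_ι_apply]
    refine ext _ _ fun β => ?_
    rw [stepLin_mul_single, step_step, if_neg fun h' => h h'.2.2.2]
    rfl
  | cycle i _ _ a b a' b' h1 h2 h3 h4 h5 h6 =>
    simp only [map_mul, FreeAlgebra.lift_ι_apply]
    refine ext _ _ fun β => ?_
    rw [stepLin_mul_single, stepLin_mul_single, step_step, step_step]
    simp [h1, h2, h3, h4, h5, h6]
  | usq h =>
    simp only [map_mul, FreeAlgebra.lift_ι_apply]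
    refine ext _ _ fun β => ?_
    rw [stepLin_mul_single, stepLin_mul_single, step_step, step_step]
    have e : (Arrow.up 0 h : Arrow ℓ).src = 0 := Fin.ext (by simp [Arrow.src])
    have e' : (Arrow.down 0 h : Arrow ℓ).tgt = 0 := Fin.ext (by simp [Arrow.tgt])
    rw [e, e']
    simp [Arrow.src, Arrow.tgt]

variable (F ℓ) in
/-- The left regular representation of `A_ℓ`, written in the basis of paths. -/
def regRep : BA F ℓ →ₐ[F] Module.End F (Slot ℓ →₀ F) := baLift F ℓ (stepLin F) stepLin_rel

variable (F ℓ) in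
/-- The coordinates of `1`. -/
def unitVec : Slot ℓ →₀ F := ∑ j : Fin ℓ, Finsupp.single (j, 0) 1

/-- The coordinates of an element of `A_ℓ` in the basis of paths. -/
def coord (β : Slot ℓ) : BA F ℓ →ₗ[F] F :=
  Finsupp.lapply β ∘ₗ LinearMap.applyₗ (unitVec F ℓ) ∘ₗ (regRep F ℓ).toLinearMap

lemma coord_apply (β : Slot ℓ) (a : BA F ℓ) : coord β a = regRep F ℓ a (unitVec F ℓ) β := rfl

/-- The span of the paths is a left ideal, on which `A_ℓ` acts as in `regRep`. -/
lemma mul_linearCombination_path (a : BA F ℓ) (v : Slot ℓ →₀ F) :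
    a * Finsupp.linearCombination F (path F) v =
      Finsupp.linearCombination F (path F) (regRep F ℓ a v) := by
  induction a using ba_induction F ℓ generalizing v with
  | hc r => rw [AlgHom.commutes, Module.algebraMap_end_apply, map_smul, Algebra.smul_def]
  | hg x =>
    rw [regRep, baLift_gen]
    induction v using Finsupp.induction_linear with
    | zero => simp
    | add f g hf hg => rw [map_add, mul_add, hf, hg, map_add, map_add]
    | single β r =>
      rw [show Finsupp.single β r = r • Finsupp.single β (1 : F) by simp, map_smul, map_smul,
        map_smul, mul_smul_comm, stepLin_single, Finsupp.linearCombination_single, one_smul,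
        gen_mul_path]
      congr 1
      cases step x β <;> simp [optPath, optSingle]
  | ha a b h h' => rw [add_mul, h, h', map_add, LinearMap.add_apply, map_add]
  | hm a b h h' => rw [mul_assoc, h', h, map_mul, Module.End.mul_apply]

/-- The paths span `A_ℓ`. -/
lemma sum_coord_smul_path (a : BA F ℓ) : ∑ β : Slot ℓ, coord β a • path F β = a := by
  have h1 : Finsupp.linearCombination F (path F) (unitVec F ℓ) = 1 := by
    rw [unitVec, map_sum, ← sum_gen_e]
    simp [path]
  have h := mul_linearCombination_path a (unitVec F ℓ)
  rw [h1, mul_one, Finsupp.linearCombination_apply, Finsupp.sum_fintype _ _ (by simp)] at h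
  exact h.symm

lemma regRep_gen_unitVec (a : Arrow ℓ) :
    regRep F ℓ (gen F (.arr a)) (unitVec F ℓ) = Finsupp.single a.slot 1 := by
  rw [regRep, baLift_gen, unitVec, map_sum, Finset.sum_eq_single a.src]
  · rw [stepLin_single]; simp [step, optSingle]
  · intro j _ hj
    rw [stepLin_single]; simp [step, optSingle, Ne.symm hj]
  · simp

/-- The paths are linearly independent. -/
lemma coord_path {β : Slot ℓ} (hβ : β.Ok) (γ : Slot ℓ) :
    coord γ (path F β) = if γ = β then 1 else 0 := by
  suffices h : regRep F ℓ (path F β) (unitVec F ℓ) = Finsupp.single β 1 by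
    rw [coord_apply, h, Finsupp.single_apply]
    simp only [eq_comm]
  by_cases h12 : β.2 = 1 ∨ β.2 = 2
  · obtain ⟨b, rfl⟩ := exists_arrow hβ h12
    rw [path_slot, regRep_gen_unitVec]
  · obtain ⟨j, i⟩ := β
    have h03 := fin_four_cases h12
    rcases h03 with rfl | rfl
    · change regRep F ℓ (gen F (.e j)) (unitVec F ℓ) = _
      rw [regRep, baLift_gen, unitVec, map_sum, Finset.sum_eq_single j]
      · rw [stepLin_single]; simp [step, optSingle, Slot.tgt]
      · intro i _ hi
        rw [stepLin_single]; simp [step, optSingle, Slot.tgt, hi]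
      · simp
    · change regRep F ℓ (gen F (.arr (backArrow j)) * gen F (.arr (leftArrow j))) _ = _
      rw [map_mul, Module.End.mul_apply, regRep_gen_unitVec, regRep, baLift_gen, stepLin_single,
        slot_leftArrow, step, if_neg (by simp), if_pos]
      · rfl
      · exact ⟨Or.inl rfl, by simp [Slot.Ok], backArrow_src j, backArrow_tgt j⟩

lemma path_e (j : Fin ℓ) : path F (j, 0) = gen F (.e j) := rfl

lemma e_mul_path (j : Fin ℓ) (β : Slot ℓ) :
    gen F (.e j) * path F β = if β.tgt = j then path F β else 0 := by
  rw [gen_mul_path, step]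
  split_ifs <;> rfl

lemma path_mul_e (j : Fin ℓ) (β : Slot ℓ) :
    path F β * gen F (.e j) = if β.1 = j then path F β else 0 := by
  obtain ⟨i, k⟩ := β
  fin_cases k
  · change gen F (.e i) * gen F (.e j) = if i = j then gen F (.e i) else 0
    exact gen_e_mul_e i j
  · change gen F (.arr (leftArrow i)) * gen F (.e j) = if i = j then _ else 0
    rw [gen_arr_mul_e, leftArrow_src]; rfl
  · by_cases h : (i : ℕ) + 1 < ℓ
    · have e : path F (i, 2) = gen F (.arr (.up i h)) := dif_pos h
      change path F (i, 2) * _ = if i = j then path F (i, 2) else 0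
      rw [e, gen_arr_mul_e]; rfl
    · have e : path F (i, 2) = 0 := dif_neg h
      change path F (i, 2) * _ = if i = j then path F (i, 2) else 0
      simp [e]
  · change gen F (.arr (backArrow i)) * gen F (.arr (leftArrow i)) * gen F (.e j) =
      if i = j then gen F (.arr (backArrow i)) * gen F (.arr (leftArrow i)) else 0
    rw [mul_assoc, gen_arr_mul_e, leftArrow_src]
    split_ifs <;> simp

/-- Paths are homogeneous. The cycle `u²` at the vertex `0` is even. -/
lemma pr_path (β : Slot ℓ) : pr F β.par (path F β) = path F β := by
  by_cases hβ : β.Ok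
  · by_cases h12 : β.2 = 1 ∨ β.2 = 2
    · obtain ⟨b, rfl⟩ := exists_arrow hβ h12
      rw [path_slot]
      have : b.slot.par = (Gen.arr b).parity := by
        cases b with
        | u => simp [Slot.par, Arrow.slot, Gen.parity]
        | up k h => simp [Slot.par, Arrow.slot, Gen.parity]
        | down k h => simp [Slot.par, Arrow.slot, Gen.parity, Fin.ext_iff]
      rw [this]
      exact pr_gen F ℓ _
    · obtain ⟨j, i⟩ := β
      have h03 := fin_four_cases h12
      rcases h03 with rfl | rfl
      · rw [show Slot.par (j, 0) = 0 from if_neg (by simp)]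
        exact pr_gen F ℓ (.e j)
      · have h0 : (Slot.par (j, 3) : ZMod 2) =
            (Gen.arr (backArrow j)).parity + (Gen.arr (leftArrow j)).parity := by
          rw [backArrow, leftArrow]
          split_ifs <;> simp [Slot.par, Gen.parity]
          rfl
        rw [h0]
        exact smul_homog (V := BA F ℓ) (pr_gen F ℓ (.arr (backArrow j)))
          (pr_gen F ℓ (.arr (leftArrow j)))
  · rw [path_of_not_ok hβ, map_zero]

/-- The set of paths with a zero is closed under products, and lengths add. -/
lemma path_mul_path (β γ : Slot ℓ) : path F β * path F γ = 0 ∨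
    ∃ δ : Slot ℓ, path F β * path F γ = path F δ ∧ δ.deg = β.deg + γ.deg := by
  have key : ∀ (a : Arrow ℓ) (γ : Slot ℓ), gen F (.arr a) * path F γ = 0 ∨
      ∃ δ : Slot ℓ, gen F (.arr a) * path F γ = path F δ ∧ δ.deg = 1 + γ.deg := by
    intro a γ
    rw [gen_mul_path, step]
    split_ifs with h1 h2
    · refine Or.inr ⟨a.slot, rfl, ?_⟩
      rcases slot_snd a with h | h <;> simp [Slot.deg, h, h1]
    · refine Or.inr ⟨(γ.1, 3), rfl, ?_⟩
      rcases h2.1 with h | h <;> simp [Slot.deg, h]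
    · exact Or.inl rfl
  by_cases hβ : β.Ok
  · by_cases h12 : β.2 = 1 ∨ β.2 = 2
    · obtain ⟨b, rfl⟩ := exists_arrow hβ h12
      rw [path_slot]
      have : b.slot.deg = 1 := by rcases h12 with h | h <;> simp [Slot.deg, h]
      rw [this]
      exact key b γ
    · obtain ⟨j, i⟩ := β
      have h03 := fin_four_cases h12
      rcases h03 with rfl | rfl
      · rw [path_e, e_mul_path]
        split_ifs
        · exact Or.inr ⟨γ, rfl, by simp [Slot.deg]⟩
        · exact Or.inl rfl
      · change gen F (.arr (backArrow j)) * gen F (.arr (leftArrow j)) * path F γ = 0 ∨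
          ∃ δ : Slot ℓ,
            gen F (.arr (backArrow j)) * gen F (.arr (leftArrow j)) * path F γ = path F δ ∧
            δ.deg = 2 + γ.deg
        rw [mul_assoc]
        rcases key (leftArrow j) γ with h | ⟨δ, h, hd⟩
        · left; rw [h, mul_zero]
        · rw [h]
          rcases key (backArrow j) δ with h' | ⟨δ', h', hd'⟩
          · exact Or.inl h'
          · exact Or.inr ⟨δ', h', by omega⟩
  · left; rw [path_of_not_ok hβ, zero_mul]

/-- The character of `L_j` is the coefficient of `e_j`. -/
lemma charHom_path (j : Fin ℓ) (β : Slot ℓ) :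
    charHom F j (path F β) = if β = (j, 0) then 1 else 0 := by
  have h : ∀ x, charHom F j (gen F x) = charGen F j x := fun x => baLift_gen F ℓ _ _ x
  obtain ⟨i, k⟩ := β
  fin_cases k
  · change charHom F j (gen F (.e i)) = if (i, (0 : Fin 4)) = (j, 0) then 1 else 0
    rw [h]; simp [charGen]
  · change charHom F j (gen F (.arr (leftArrow i))) = if (i, (1 : Fin 4)) = (j, 0) then 1 else 0
    rw [h]; simp [charGen]
  · change charHom F j (path F (i, 2)) = if (i, (2 : Fin 4)) = (j, 0) then 1 else 0
    by_cases hi : (i : ℕ) + 1 < ℓ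
    · have e : path F (i, 2) = gen F (.arr (.up i hi)) := dif_pos hi
      rw [e, h]; simp [charGen]
    · have e : path F (i, 2) = 0 := dif_neg hi
      simp [e]
  · change charHom F j (gen F (.arr (backArrow i)) * gen F (.arr (leftArrow i))) =
      if (i, (3 : Fin 4)) = (j, 0) then 1 else 0
    rw [map_mul, h, h]; simp [charGen]

end Basis

/-! ### Counting composition factors with an idempotent -/

section Counting

variable {F : Type*} [Field F]

section Sub

variable {A V : Type*} [Ring A] [Algebra F A] [SuperAlgebra F A]
  [AddCommGroup V] [Module F V] [Module A V] [IsScalarTower F A V] [SuperSpace F V]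

lemma SubSM.ext' {N N' : SubSM F A V} (h : N.toSubmodule = N'.toSubmodule) : N = N' := by
  cases N; cases N'; cases h; rfl

variable (F A V) in
/-- The zero subsupermodule. -/
def SubSM.zero : SubSM F A V where
  __ := (⊥ : Submodule A V)
  pr_mem i v hv := by
    have : v = 0 := hv
    rw [this, map_zero]; exact rfl

variable (F A V) in
/-- The supermodule itself as a subsupermodule. -/
def SubSM.whole : SubSM F A V where
  __ := (⊤ : Submodule A V)
  pr_mem _ _ _ := trivial

/-- Irreducibility in the usual form: a non-zero supermodule without proper non-zero
subsupermodules. -/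
lemma isIrred_iff : IsIrred F A V ↔
    (∃ v : V, v ≠ 0) ∧ ∀ N : SubSM F A V, N.toSubmodule = ⊥ ∨ N.toSubmodule = ⊤ := by
  rw [IsIrred, Nat.card_eq_two_iff]
  constructor
  · rintro ⟨N, N', hne, huniv⟩
    have h : ∀ M, M = N ∨ M = N' := fun M => by
      have : M ∈ ({N, N'} : Set (SubSM F A V)) := by rw [huniv]; trivial
      simpa using this
    have hzw : SubSM.zero F A V ≠ SubSM.whole F A V := by
      intro he
      have hb : (⊥ : Submodule A V) = ⊤ := congrArg SubSM.toSubmodule he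
      refine hne (SubSM.ext' ?_)
      have := subsingleton_of_bot_eq_top hb
      exact Subsingleton.elim _ _
    constructor
    · by_contra! hv
      refine hzw (SubSM.ext' ?_)
      ext v
      rw [hv v]
      exact ⟨fun _ => trivial, fun _ => rfl⟩
    · intro M
      rcases h M with h1 | h1 <;> rcases h (SubSM.zero F A V) with h2 | h2 <;>
        rcases h (SubSM.whole F A V) with h3 | h3
      · exact absurd (h2.trans h3.symm) hzw
      · left; rw [h1, ← h2]; rfl
      · right; rw [h1, ← h3]; rfl
      · exact absurd (h2.trans h3.symm) hzw
      · exact absurd (h2.trans h3.symm) hzw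
      · right; rw [h1, ← h3]; rfl
      · left; rw [h1, ← h2]; rfl
      · exact absurd (h2.trans h3.symm) hzw
  · rintro ⟨⟨v, hv⟩, h⟩
    refine ⟨SubSM.zero F A V, SubSM.whole F A V, fun he => hv ?_, ?_⟩
    · have : v ∈ (SubSM.zero F A V).toSubmodule := by rw [he]; trivial
      exact this
    · ext M
      refine ⟨fun _ => trivial, fun _ => ?_⟩
      rcases h M with h | h
      · exact Or.inl (SubSM.ext' h)
      · exact Or.inr (SubSM.ext' h)

end Sub

section Iso

variable {A V W : Type*} [Ring A] [Algebra F A] [SuperAlgebra F A]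
  [AddCommGroup V] [Module F V] [Module A V] [SuperSpace F V]
  [AddCommGroup W] [Module F W] [Module A W] [SuperSpace F W]

lemma isHomogHom_zero (i : ZMod 2) : IsHomogHom F A i (0 : V →ₗ[F] W) :=
  ⟨fun _ _ _ => by simp, fun _ _ _ _ => by simp⟩

lemma IsHomogHom.isSuperHom {i : ZMod 2} {f : V →ₗ[F] W} (h : IsHomogHom F A i f) :
    IsSuperHom F A f := by
  rcases zmod_cases i with rfl | rfl
  · exact ⟨f, 0, (add_zero f).symm, h, isHomogHom_zero 1⟩
  · exact ⟨0, f, (zero_add f).symm, isHomogHom_zero 0, h⟩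

lemma IsHomogHom.pr_apply {i : ZMod 2} {f : V →ₗ[F] W} (h : IsHomogHom F A i f) (δ : ZMod 2)
    (v : V) : f (pr F δ v) = pr F (δ + i) (f v) := by
  have key : ∀ k, pr F (δ + i) (f (pr F k v)) = if δ = k then f (pr F k v) else 0 := by
    intro k
    rw [pr_of_homog (h.1 k (pr F k v) (by simp [pr_pr]))]
    simp
  have hv := sum_pr (F := F) v
  rw [sum_zmod] at hv
  conv_rhs => rw [← hv, map_add, map_add, key, key]
  rcases zmod_cases δ with rfl | rfl <;> simp

lemma sg_mul_self (x : ZMod 2) : sg F x * sg F x = 1 := by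
  rw [← sg_add, two_zmod, sg_zero]

/-- A bijective homogeneous homomorphism is an isomorphism. -/
lemma superIso_of_isHomogHom {i : ZMod 2} [IsScalarTower F A V] [IsScalarTower F A W]
    (e : V ≃ₗ[F] W)
    (h : IsHomogHom F A i e.toLinearMap) : SuperIso F A V W := by
  refine ⟨e, h.isSuperHom, IsHomogHom.isSuperHom (i := i) ⟨fun δ w hw => ?_, fun α a w ha => ?_⟩⟩
  · apply e.injective
    have h1 := h.pr_apply (δ + i) (e.symm w)
    have h2 : δ + i + i = δ := by rw [add_assoc, two_zmod, add_zero]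
    rw [h2] at h1
    change e (pr F (δ + i) (e.symm w)) = e (e.symm w)
    refine h1.trans ?_
    simpa using hw
  · apply e.injective
    have h1 := h.2 α a (e.symm w) ha
    change e (e.symm (a • w)) = e (sg F (i * α) • a • e.symm w)
    refine Eq.trans ?_ (e.map_smul _ _).symm
    have h2 : e (a • e.symm w) = sg F (i * α) • a • e (e.symm w) := h1
    rw [h2, smul_smul, sg_mul_self, one_smul]
    simp

/-- Even elements act in the same way on isomorphic supermodules. -/
lemma IsSuperHom.map_even {f : V →ₗ[F] W} (h : IsSuperHom F A f) {a : A} (ha : pr F 0 a = a)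
    (v : V) : f (a • v) = a • f v := by
  obtain ⟨f₀, f₁, rfl, h₀, h₁⟩ := h
  have e0 := h₀.2 0 a v ha
  have e1 := h₁.2 0 a v ha
  rw [mul_zero, sg_zero, one_smul] at e0 e1
  rw [LinearMap.add_apply, LinearMap.add_apply, smul_add, e0, e1]

end Iso

variable {A : Type*} [Ring A] [Algebra F A] [SuperAlgebra F A]

variable (F A) in
/-- A descending chain of homogeneous subspaces of a superalgebra which shows that its term
`I 1` is contained in the radical. -/
structure RadChain where
  I : ℕ → Submodule F A
  one_mem : 1 ∈ I 0
  mul_mem : ∀ k x y, x ∈ I 1 → y ∈ I k → x * y ∈ I (k + 1)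
  length : ℕ
  eq_bot : I length = ⊥
  mul_right_mem : ∀ x y, x ∈ I 1 → x * y ∈ I 1
  pr_mem : ∀ i x, x ∈ I 1 → pr F i x ∈ I 1

/-- An even idempotent `ε` of a superalgebra with `ε x ε ≡ φ(x) ε` modulo the radical for
all `x`. -/
structure IsLocalIdem (R : RadChain F A) (ε : A) (φ : A → F) : Prop where
  idem : ε * ε = ε
  even : pr F 0 ε = ε
  corner : ∀ x, ε * x * ε - φ x • ε ∈ R.I 1

section OneModule

variable {V : Type*} [AddCommGroup V] [Module F V] [Module A V] [IsScalarTower F A V]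
  [SuperSpace F V] [SuperModule F A V]

lemma pr_even_smul {ε : A} (h : pr F 0 ε = ε) (i : ZMod 2) (v : V) :
    pr F i (ε • v) = ε • pr F i v := by
  rw [SuperModule.proj_smul (F := F), h, pr_of_homog h]
  simp

/-- The vectors killed by all elements of a homogeneous right ideal. -/
def annSub (I : Submodule F A) (hr : ∀ x y, x ∈ I → x * y ∈ I) (hI : ∀ i x, x ∈ I → pr F i x ∈ I) :
    SubSM F A V where
  carrier := {v | ∀ x ∈ I, x • v = 0}
  add_mem' {v w} hv hw x hx := by rw [smul_add, hv x hx, hw x hx, add_zero]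
  zero_mem' x _ := smul_zero x
  smul_mem' a v hv x hx := by rw [smul_smul]; exact hv _ (hr x a hx)
  pr_mem i v hv x hx := by
    have key : ∀ j, pr F j x • pr F i v = 0 := by
      intro j
      have h1 := hv _ (hI j x hx)
      have h2 := congrArg (pr F (j + i)) h1
      rw [SuperModule.proj_smul (F := F), map_zero, pr_pr, pr_pr] at h2
      rcases zmod_cases j with rfl | rfl
      · simpa using h2
      · rw [if_neg (by decide), if_pos rfl, zero_smul, zero_add] at h2
        rwa [show 1 + i + 1 = i by rw [add_right_comm, two_zmod, zero_add]] at h2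
    have hs := sum_pr (F := F) x
    rw [sum_zmod] at hs
    rw [← hs, add_smul, key, key, add_zero]

/-- Elements of the radical act by zero on irreducible supermodules. -/
lemma irred_rad_smul (R : RadChain F A) (hV : IsIrred F A V) {x : A} (hx : x ∈ R.I 1) (v : V) :
    x • v = 0 := by
  classical
  obtain ⟨⟨v₀, hv₀⟩, hN⟩ := isIrred_iff.1 hV
  rcases hN (annSub (R.I 1) R.mul_right_mem R.pr_mem) with h | h
  · exfalso
    -- For the least `k` such that `I k` acts by zero, the vectors `I (k - 1) v` are killed by `I
    -- 1`.
    have hex : ∃ k, ∀ y ∈ R.I k, ∀ v : V, y • v = 0 := by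
      refine ⟨R.length, fun y hy v => ?_⟩
      rw [R.eq_bot] at hy
      rw [(Submodule.mem_bot F).1 hy, zero_smul]
    obtain ⟨k, hk⟩ : ∃ k, Nat.find hex = k + 1 := by
      refine Nat.exists_eq_succ_of_ne_zero fun h0 => ?_
      have := Nat.find_spec hex
      rw [h0] at this
      exact hv₀ (by simpa using this 1 R.one_mem v₀)
    have hlt : k < Nat.find hex := by omega
    have hnot := Nat.find_min hex hlt
    push Not at hnot
    obtain ⟨y, hy, w, hw⟩ := hnot
    have hspec := Nat.find_spec hex
    rw [hk] at hspec
    have hmem : y • w ∈ (annSub (V := V) (R.I 1) R.mul_right_mem R.pr_mem).toSubmodule := by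
      intro x hx
      rw [smul_smul]
      exact hspec _ (R.mul_mem k x y hx hy) w
    rw [h] at hmem
    exact hw hmem
  · have hmem : v ∈ (annSub (V := V) (R.I 1) R.mul_right_mem R.pr_mem).toSubmodule := by
      rw [h]; trivial
    exact hmem x hx

/-- The subsupermodule generated by a homogeneous vector. -/
def genSub {i : ZMod 2} (v : V) (hv : pr F i v = v) : SubSM F A V where
  __ := Submodule.span A {v}
  pr_mem := span_pr_mem fun t ht => ⟨i, by rw [Set.mem_singleton_iff.1 ht]; exact hv⟩

lemma exists_smul_eq (hV : IsIrred F A V) {i : ZMod 2} {v : V} (hv : pr F i v = v) (h0 : v ≠ 0)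
    (w : V) : ∃ x : A, x • v = w := by
  rcases (isIrred_iff.1 hV).2 (genSub v hv) with h | h
  · refine absurd ?_ h0
    have : v ∈ (genSub (A := A) v hv).toSubmodule := Submodule.mem_span_singleton_self v
    rw [h] at this
    exact this
  · have : w ∈ (genSub (A := A) v hv).toSubmodule := by rw [h]; trivial
    exact Submodule.mem_span_singleton.1 this

/-- The dimension of `ε V`. -/
def idemDim (F : Type*) [Field F] {A : Type*} [Ring A] [Algebra F A] (V : Type*) [AddCommGroup V]
    [Module F V] [Module A V] [IsScalarTower F A V] (ε : A) : ℕ :=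
  Module.finrank F (LinearMap.range (Algebra.lsmul F F V ε))

variable {R : RadChain F A} {ε : A} {φ : A → F}

lemma exists_homog_fixed (hε : IsLocalIdem R ε φ) {v : V} (hv : ε • v ≠ 0) :
    ∃ (i : ZMod 2) (w : V), pr F i w = w ∧ ε • w = w ∧ w ≠ 0 := by
  have h := sum_pr (F := F) (ε • v)
  rw [sum_zmod] at h
  have hex : ∃ i, pr F i (ε • v) ≠ 0 := by
    by_contra! h'
    rw [h', h', add_zero] at h
    exact hv h.symm
  obtain ⟨i, hi⟩ := hex
  refine ⟨i, pr F i (ε • v), by simp [pr_pr], ?_, hi⟩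
  rw [← pr_even_smul hε.even, smul_smul, hε.idem]

/-- On vectors fixed by `ε`, the operator `ε x` acts by the scalar `φ x`. -/
lemma corner_smul (hε : IsLocalIdem R ε φ) (hV : IsIrred F A V) {v : V} (hv : ε • v = v) (x : A) :
    ε • x • v = φ x • v := by
  have h := irred_rad_smul R hV (hε.corner x) v
  rw [sub_smul, mul_smul, mul_smul, smul_assoc, hv, sub_eq_zero] at h
  exact h

/-- A local idempotent has rank at most one on an irreducible supermodule. -/
lemma idemDim_eq_one (hε : IsLocalIdem R ε φ) (hV : IsIrred F A V) {v : V} (hv : ε • v ≠ 0) :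
    idemDim F V ε = 1 := by
  obtain ⟨i, w, hw, hεw, h0⟩ := exists_homog_fixed hε hv
  have : LinearMap.range (Algebra.lsmul F F V ε) = Submodule.span F {w} := by
    ext u
    rw [Submodule.mem_span_singleton]
    constructor
    · rintro ⟨u, rfl⟩
      obtain ⟨x, rfl⟩ := exists_smul_eq hV hw h0 u
      exact ⟨φ x, (corner_smul hε hV hεw x).symm⟩
    · rintro ⟨r, rfl⟩
      refine ⟨r • w, ?_⟩
      rw [map_smul]
      exact congrArg (r • ·) hεw
  rw [idemDim, this, finrank_span_singleton h0]

/-- The annihilator of a vector fixed by `ε` depends on `φ` only. -/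
lemma smul_eq_zero_iff_corner (hε : IsLocalIdem R ε φ) (hV : IsIrred F A V) {v : V}
    (hv : ε • v = v) (h0 : v ≠ 0) (x : A) : x • v = 0 ↔ ∀ y, φ (y * x) = 0 := by
  constructor
  · intro h y
    have := corner_smul hε hV hv (y * x)
    rw [mul_smul, h, smul_zero, smul_zero] at this
    exact (smul_eq_zero.1 this.symm).resolve_right h0
  · intro h
    -- The largest subsupermodule killed by `ε`; it is proper, hence zero.
    let N : SubSM F A V :=
      { carrier := {w | ∀ y : A, ε • y • w = 0}
        add_mem' := fun {v w} hv hw y => by rw [smul_add, smul_add, hv, hw, add_zero]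
        zero_mem' := fun y => by rw [smul_zero, smul_zero]
        smul_mem' := fun a v hv y => by rw [smul_smul y]; exact hv _
        pr_mem := fun i w hw y => by
          have key : ∀ j, ε • pr F j y • pr F i w = 0 := by
            intro j
            have h1 := hw (pr F j y)
            have h2 := congrArg (pr F (j + i)) h1
            rw [pr_even_smul hε.even, SuperModule.proj_smul (F := F), map_zero, pr_pr, pr_pr] at h2
            rcases zmod_cases j with rfl | rfl
            · simpa using h2
            · rw [if_neg (by decide), if_pos rfl, zero_smul, zero_add] at h2
              rwa [show 1 + i + 1 = i by rw [add_right_comm, two_zmod, zero_add]] at h2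
          have hs := sum_pr (F := F) y
          rw [sum_zmod] at hs
          rw [← hs, add_smul, smul_add, key, key, add_zero] }
    have hx : x • v ∈ N.toSubmodule := by
      intro y
      rw [smul_smul y, corner_smul hε hV hv, h, zero_smul]
    rcases (isIrred_iff.1 hV).2 N with hN | hN
    · rw [hN] at hx; exact hx
    · exfalso
      have : v ∈ N.toSubmodule := by rw [hN]; trivial
      have := this 1
      rw [one_smul, hv] at this
      exact h0 this

variable {V' : Type*} [AddCommGroup V'] [Module F V'] [Module A V'] [IsScalarTower F A V']
  [SuperSpace F V'] [SuperModule F A V']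

/-- Irreducible supermodules that are not killed by `ε` are isomorphic: they are generated by
vectors fixed by `ε`, which have the same annihilator. -/
lemma superIso_of_idem (hε : IsLocalIdem R ε φ) (hV : IsIrred F A V) (hV' : IsIrred F A V')
    {v : V} (hv : ε • v ≠ 0) {v' : V'} (hv' : ε • v' ≠ 0) : SuperIso F A V V' := by
  obtain ⟨i, w, hw, hεw, h0⟩ := exists_homog_fixed hε hv
  obtain ⟨i', w', hw', hεw', h0'⟩ := exists_homog_fixed hε hv'
  let q : A →ₗ[F] V := (Algebra.lsmul F F V).toLinearMap.flip w
  let q' : A →ₗ[F] V' := (Algebra.lsmul F F V').toLinearMap.flip w'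
  have hq : Function.Surjective q := exists_smul_eq hV hw h0
  have hq' : Function.Surjective q' := exists_smul_eq hV' hw' h0'
  have hker : LinearMap.ker q = LinearMap.ker q' := by
    ext x
    exact (smul_eq_zero_iff_corner hε hV hεw h0 x).trans
      (smul_eq_zero_iff_corner hε hV' hεw' h0' x).symm
  let e : V ≃ₗ[F] V' := (q.quotKerEquivOfSurjective hq).symm.trans
    ((Submodule.quotEquivOfEq _ _ hker).trans (q'.quotKerEquivOfSurjective hq'))
  have he : ∀ x : A, e (x • w) = x • w' := by
    intro x
    have h1 : (q.quotKerEquivOfSurjective hq).symm (x • w) = Submodule.Quotient.mk x := by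
      rw [LinearEquiv.symm_apply_eq]; rfl
    change q'.quotKerEquivOfSurjective hq' (Submodule.quotEquivOfEq _ _ hker
      ((q.quotKerEquivOfSurjective hq).symm (x • w))) = _
    rw [h1]; rfl
  have hsm : ∀ (a : A) (u : V), e (a • u) = a • e u := by
    intro a u
    obtain ⟨x, rfl⟩ := hq u
    change e (a • x • w) = a • e (x • w)
    rw [smul_smul, he, he, smul_smul]
  have hprw : ∀ (δ : ZMod 2) (x : A), pr F δ (x • w) = pr F (δ + i) x • w := by
    intro δ x
    rw [SuperModule.proj_smul (F := F), pr_of_homog hw, pr_of_homog hw]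
    rcases zmod_cases δ with rfl | rfl <;> rcases zmod_cases i with rfl | rfl <;>
      simp [show (1 + 1 : ZMod 2) = 0 from rfl]
  have hprw' : ∀ (δ : ZMod 2) (x : A), pr F δ (x • w') = pr F (δ + i') x • w' := by
    intro δ x
    rw [SuperModule.proj_smul (F := F), pr_of_homog hw', pr_of_homog hw']
    rcases zmod_cases δ with rfl | rfl <;> rcases zmod_cases i' with rfl | rfl <;>
      simp [show (1 + 1 : ZMod 2) = 0 from rfl]
  have hpe : ∀ (δ : ZMod 2) (u : V), e (pr F δ u) = pr F (δ + (i + i')) (e u) := by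
    intro δ u
    obtain ⟨x, rfl⟩ := hq u
    change e (pr F δ (x • w)) = pr F (δ + (i + i')) (e (x • w))
    rw [hprw, he, he, hprw']
    congr 3
    rw [add_assoc, add_assoc, two_zmod, add_zero]
  -- the twist by the parity turns `e` into a homogeneous homomorphism if it is odd
  let P : V →ₗ[F] V := pr F 0 + sg F (i + i') • pr F 1
  have hP : ∀ u, P u = pr F 0 u + sg F (i + i') • pr F 1 u := fun u => rfl
  have hPP : ∀ u, P (P u) = u := by
    intro u
    have hs := sum_pr (F := F) u
    rw [sum_zmod] at hs
    rw [hP (P u), hP u, map_add, map_add, map_smul, map_smul, pr_pr, pr_pr, pr_pr, pr_pr]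
    simp only [if_true, smul_add, smul_smul]
    rw [if_neg (by decide), if_neg (by decide), sg_mul_self]
    simpa using hs
  let Pe : V ≃ₗ[F] V := LinearEquiv.ofInvolutive P hPP
  have hPpr : ∀ (δ : ZMod 2) (u : V), pr F δ u = u → P u = sg F (δ * (i + i')) • u := by
    intro δ u hu
    rw [hP, pr_of_homog hu, pr_of_homog hu]
    rcases zmod_cases δ with rfl | rfl <;> simp
  refine superIso_of_isHomogHom (i := i + i') (Pe.trans e) ⟨fun δ u hu => ?_, fun α a u ha => ?_⟩
  · change pr F (δ + (i + i')) (e (P u)) = e (P u)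
    rw [← hpe, hPpr δ u hu, map_smul, hu]
  · change e (P (a • u)) = sg F ((i + i') * α) • a • e (P u)
    have hPa : P (a • u) = sg F ((i + i') * α) • a • P u := by
      have key : ∀ k, P (a • pr F k u) = sg F ((i + i') * α) • a • P (pr F k u) := by
        intro k
        have hk : pr F k (pr F k u) = pr F k u := by simp [pr_pr]
        rw [hPpr _ _ hk, hPpr _ _ (smul_homog ha hk), smul_comm a, smul_smul, ← sg_add]
        congr 2; ring
      have hs := sum_pr (F := F) u
      rw [sum_zmod] at hs
      rw [← hs, smul_add, map_add, map_add, key, key, smul_add, smul_add]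
    rw [hPa, map_smul, hsm]

end OneModule

section Series

variable {V : Type*} [AddCommGroup V] [Module F V] [Module A V] [IsScalarTower F A V]
  [SuperSpace F V] [SuperModule F A V]

/-- The dimension of `ε N`. -/
def subIdemDim (ε : A) (N : SubSM F A V) : ℕ :=
  Module.finrank F ((N.toSubmodule.restrictScalars F).map (Algebra.lsmul F F V ε))

/-- Multiplication by an idempotent is exact. -/
lemma subIdemDim_add [FiniteDimensional F V] {ε : A} (hε : ε * ε = ε) {N N' : SubSM F A V}
    (h : N.toSubmodule ≤ N'.toSubmodule) :
    subIdemDim ε N' = subIdemDim ε N + idemDim F (N.factor N') ε := by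
  set E := (N'.toSubmodule.restrictScalars F).map (Algebra.lsmul F F V ε) with hE
  have hEN : ∀ v ∈ E, v ∈ N'.toSubmodule := by
    rintro _ ⟨v, hv, rfl⟩
    exact N'.toSubmodule.smul_mem ε hv
  have hEε : ∀ v ∈ E, ε • v = v := by
    rintro _ ⟨v, hv, rfl⟩
    change ε • ε • v = ε • v
    rw [smul_smul, hε]
  let f : E →ₗ[F] N.factor N' :=
    { toFun := fun v => Submodule.Quotient.mk ⟨v.1, hEN v.1 v.2⟩
      map_add' := fun _ _ => rfl
      map_smul' := fun _ _ => rfl }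
  have hrange : LinearMap.range f = LinearMap.range (Algebra.lsmul F F (N.factor N') ε) := by
    ext q
    constructor
    · rintro ⟨v, rfl⟩
      refine ⟨f v, ?_⟩
      change Submodule.Quotient.mk (ε • (⟨v.1, hEN v.1 v.2⟩ : N'.toSubmodule)) = _
      refine congrArg Submodule.Quotient.mk (Subtype.ext ?_)
      exact hEε v.1 v.2
    · rintro ⟨q, rfl⟩
      induction q using Submodule.Quotient.induction_on with | _ v => ?_
      exact ⟨⟨ε • v.1, ⟨v.1, v.2, rfl⟩⟩, rfl⟩
  have hker : (LinearMap.ker f).map E.subtype =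
      (N.toSubmodule.restrictScalars F).map (Algebra.lsmul F F V ε) := by
    ext v
    constructor
    · rintro ⟨⟨v, hv⟩, hv', rfl⟩
      have h1 : (⟨v, hEN v hv⟩ : N'.toSubmodule) ∈ (N.within N').toSubmodule :=
        (Submodule.Quotient.mk_eq_zero _).1 hv'
      exact ⟨v, h1, hEε v hv⟩
    · rintro ⟨v, hv, rfl⟩
      have hv' : v ∈ N.toSubmodule := hv
      refine ⟨⟨ε • v, ⟨v, h hv', rfl⟩⟩, ?_, rfl⟩
      refine (Submodule.Quotient.mk_eq_zero _).2 ?_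
      exact N.toSubmodule.smul_mem ε hv'
  have h1 := LinearMap.finrank_range_add_finrank_ker f
  have h2 : Module.finrank F (LinearMap.ker f) = subIdemDim ε N := by
    rw [subIdemDim, ← hker]
    exact (Submodule.finrank_map_subtype_eq _ _).symm
  rw [hrange, h2, add_comm] at h1
  exact h1.symm

/-- `dim ε V` is the sum of the dimensions `dim ε M` over the composition factors `M` of `V`. -/
lemma CompSeries.sum_idemDim [FiniteDimensional F V] {ε : A} (hε : ε * ε = ε)
    (s : CompSeries F A V) :
    ∑ k : Fin s.length, idemDim F ((s.term k.castSucc).factor (s.term k.succ)) ε =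
      idemDim F V ε := by
  have key : ∀ k : Fin (s.length + 1), subIdemDim ε (s.term k) =
      ∑ i : Fin s.length, if i.castSucc < k then
        idemDim F ((s.term i.castSucc).factor (s.term i.succ)) ε else 0 := by
    intro k
    induction k using Fin.induction with
    | zero =>
      have : (Submodule.restrictScalars F (⊥ : Submodule A V)).map (Algebra.lsmul F F V ε) = ⊥ := by
        rw [Submodule.restrictScalars_bot]; exact Submodule.map_bot _
      rw [subIdemDim, s.bot, this, finrank_bot]
      simp
    | succ k ih =>
      rw [subIdemDim_add hε (s.le k), ih]
      have : ∀ i : Fin s.length, (if i.castSucc < k.succ then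
          idemDim F ((s.term i.castSucc).factor (s.term i.succ)) ε else 0) =
          (if i.castSucc < k.castSucc then
            idemDim F ((s.term i.castSucc).factor (s.term i.succ)) ε else 0) +
          if i = k then idemDim F ((s.term i.castSucc).factor (s.term i.succ)) ε else 0 := by
        intro i
        rcases lt_trichotomy i k with h | h | h
        · have h1 : i.castSucc < k.succ := by
            rw [Fin.lt_def] at h ⊢; simp only [Fin.val_castSucc, Fin.val_succ]; omega
          simp [h, h.ne, h1]
        · subst h; simp
        · have h1 : ¬ i.castSucc < k.succ := by
            rw [Fin.lt_def] at h ⊢; simp only [Fin.val_castSucc, Fin.val_succ]; omega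
          simp [h.not_gt, h.ne', h1]
      simp only [this, Finset.sum_add_distrib]
      simp
  have h := key (Fin.last s.length)
  simp only [Fin.castSucc_lt_last, if_true] at h
  have htop : (Submodule.restrictScalars F (⊤ : Submodule A V)).map (Algebra.lsmul F F V ε) =
      LinearMap.range (Algebra.lsmul F F V ε) := by
    rw [Submodule.restrictScalars_top]; exact Submodule.map_top _
  rw [← h, subIdemDim, s.top, idemDim, htop]

variable (F A V) in
/-- Existence of composition series. -/
lemma nonempty_compSeries [FiniteDimensional F V] : Nonempty (CompSeries F A V) := by
  classical
  let r : SetRel (SubSM F A V) (SubSM F A V) :=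
    {p | p.1.toSubmodule ≤ p.2.toSubmodule ∧ IsIrred F A (p.1.factor p.2)}
  have key : ∀ (n : ℕ) (N : SubSM F A V),
      Module.finrank F (N.toSubmodule.restrictScalars F) = n →
      ∃ s : RelSeries r, s.head = SubSM.zero F A V ∧ s.last = N := by
    intro n
    induction n using Nat.strong_induction_on with
    | _ n ih =>
    intro N hN
    by_cases h0 : N = SubSM.zero F A V
    · exact ⟨RelSeries.singleton r N, h0, rfl⟩
    -- a proper subsupermodule of maximal dimension
    let d : SubSM F A V → ℕ := fun M => Module.finrank F (M.toSubmodule.restrictScalars F)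
    have hlt : ∀ M M' : SubSM F A V, M.toSubmodule < M'.toSubmodule → d M < d M' := fun M M' h =>
      Submodule.finrank_lt_finrank_of_lt (s := M.toSubmodule.restrictScalars F)
        (t := M'.toSubmodule.restrictScalars F) h
    have hex : ∃ m, ∃ M : SubSM F A V, M.toSubmodule < N.toSubmodule ∧ n - d M = m := by
      refine ⟨_, SubSM.zero F A V, ?_, rfl⟩
      refine lt_of_le_of_ne bot_le fun h => h0 (SubSM.ext' h.symm)
    obtain ⟨M, hMN, hM⟩ := Nat.find_spec hex
    have hmax : ∀ M' : SubSM F A V, M.toSubmodule < M'.toSubmodule →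
        ¬ M'.toSubmodule < N.toSubmodule := by
      intro M' h1 h2
      have h3 := Nat.find_min' hex ⟨M', h2, rfl⟩
      have h4 := hlt _ _ h1
      have h5 := hlt _ _ h2
      have h6 : d N = n := hN
      omega
    obtain ⟨s, hs1, hs2⟩ := ih (d M) (by rw [← hN]; exact hlt _ _ hMN) M rfl
    have hirr : IsIrred F A (M.factor N) := by
      rw [isIrred_iff]
      constructor
      · obtain ⟨v, hv, hv'⟩ := SetLike.exists_of_lt hMN
        refine ⟨Submodule.Quotient.mk ⟨v, hv⟩, fun h => hv' ?_⟩
        exact (Submodule.Quotient.mk_eq_zero (M.within N).toSubmodule).1 h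
      · intro K
        let K' : SubSM F A V :=
          { __ := (K.toSubmodule.comap (M.within N).toSubmodule.mkQ).map N.toSubmodule.subtype
            pr_mem := by
              rintro i _ ⟨v, hv, rfl⟩
              exact ⟨pr F i v, K.pr_mem' i hv, rfl⟩ }
        have hK' : ∀ v (hv : v ∈ N.toSubmodule),
            v ∈ K'.toSubmodule ↔ Submodule.Quotient.mk ⟨v, hv⟩ ∈ K.toSubmodule := by
          intro v hv
          constructor
          · rintro ⟨w, hw, rfl⟩
            exact hw
          · intro h
            exact ⟨⟨v, hv⟩, h, rfl⟩
        have hMK : M.toSubmodule ≤ K'.toSubmodule := by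
          intro v hv
          rw [hK' v (hMN.le hv)]
          have : (Submodule.Quotient.mk ⟨v, hMN.le hv⟩ : M.factor N) = 0 :=
            (Submodule.Quotient.mk_eq_zero _).2 hv
          rw [this]
          exact K.toSubmodule.zero_mem
        have hKN : K'.toSubmodule ≤ N.toSubmodule := by
          rintro _ ⟨v, hv, rfl⟩
          exact v.2
        rcases hMK.lt_or_eq with h | h
        · right
          have h2 : K'.toSubmodule = N.toSubmodule := by
            by_contra hne
            exact hmax K' h (lt_of_le_of_ne hKN hne)
          rw [eq_top_iff]
          rintro q -
          induction q using Submodule.Quotient.induction_on with | _ v => ?_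
          exact (hK' v.1 v.2).1 (by rw [h2]; exact v.2)
        · left
          rw [eq_bot_iff]
          intro q hq
          induction q using Submodule.Quotient.induction_on with | _ v => ?_
          have h3 := (hK' v.1 v.2).2 hq
          rw [← h] at h3
          exact (Submodule.Quotient.mk_eq_zero _).2 h3
    refine ⟨s.snoc N ?_, ?_, ?_⟩
    · rw [hs2]; exact ⟨hMN.le, hirr⟩
    · rw [RelSeries.head_snoc, hs1]
    · rw [RelSeries.last_snoc]
  obtain ⟨s, h1, h2⟩ := key _ (SubSM.whole F A V) rfl
  exact ⟨{
    length := s.length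
    term := s.toFun
    bot := by
      have : s.toFun 0 = SubSM.zero F A V := h1
      rw [this]; rfl
    top := by
      have : s.toFun (Fin.last s.length) = SubSM.whole F A V := h2
      rw [this]; rfl
    le := fun k => (s.step k).1
    irred := fun k => (s.step k).2 }⟩

/-- If `L` is irreducible and not killed by `ε`, then `[V : L] = dim ε V`: a composition factor
contributes `1` if it is isomorphic to `L`, and is killed by `ε` otherwise. -/
theorem hasMultiplicity_idemDim [FiniteDimensional F V] {L : Type*} [AddCommGroup L] [Module F L]
    [Module A L] [IsScalarTower F A L] [SuperSpace F L] [SuperModule F A L]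
    {R : RadChain F A} {ε : A} {φ : A → F} (hε : IsLocalIdem R ε φ) (hL : IsIrred F A L)
    {v : L} (hv : ε • v ≠ 0) : HasMultiplicity F A V L (idemDim F V ε) := by
  classical
  refine ⟨nonempty_compSeries F A V, fun s => ?_⟩
  rw [← s.sum_idemDim hε.idem, CompSeries.mult, Nat.card_eq_fintype_card, Fintype.card_subtype,
    Finset.card_filter]
  refine Finset.sum_congr rfl fun k _ => ?_
  split_ifs with h
  · obtain ⟨e, he, he'⟩ := h
    refine (idemDim_eq_one hε (s.irred k) (v := e.symm v) ?_).symm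
    have h1 := he'.map_even hε.even v
    change e.symm (ε • v) = ε • e.symm v at h1
    rw [← h1]
    exact fun h2 => hv (by simpa using h2)
  · have h0 : ∀ u : (s.term k.castSucc).factor (s.term k.succ), ε • u = 0 := by
      intro u
      by_contra hu
      exact h (superIso_of_idem hε (s.irred k) hL hu hv)
    rw [idemDim]
    have : Algebra.lsmul F F ((s.term k.castSucc).factor (s.term k.succ)) ε = 0 :=
      LinearMap.ext h0
    rw [this, LinearMap.range_zero, finrank_bot]

end Series

end Counting

/-! ### Signs and block permutations -/

section BlockSigns

variable {k d : ℕ} {n : Fin k → ℕ} (hn : ∑ j, n j = d)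

/-- The identification of the disjoint union of the blocks with `Fin d` is lexicographic. -/
lemma blockEquiv_lt_iff (x y : Σ j, Fin (n j)) :
    blockEquiv n hn x < blockEquiv n hn y ↔
      x.1 < y.1 ∨ ∃ h : x.1 = y.1, (h ▸ x.2 : Fin (n y.1)) < y.2 := by
  have hval : ∀ z : Σ j, Fin (n j), (blockEquiv n hn z : ℕ) =
      ∑ i : Fin z.1.1, n (Fin.castLE z.1.2.le i) + z.2 := fun z => by
    simp [blockEquiv, finSigmaFinEquiv_apply]
  have hmono : ∀ (i j : Fin k), i < j →
      ∑ a : Fin i.1, n (Fin.castLE i.2.le a) + n i ≤ ∑ a : Fin j.1, n (Fin.castLE j.2.le a) := by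
    intro i j hij
    have h1 : ∀ m (hm : m ≤ k), ∑ a : Fin m, n (Fin.castLE hm a) =
        ∑ a : Fin k, if (a : ℕ) < m then n a else 0 := by
      intro m hm
      rw [← Finset.sum_filter]
      refine Finset.sum_bij (fun a _ => Fin.castLE hm a) ?_ ?_ ?_ ?_
      · intro a _; simp
      · intro a _ b _ h; simpa [Fin.ext_iff] using h
      · intro b hb
        exact ⟨⟨b, (Finset.mem_filter.1 hb).2⟩, Finset.mem_univ _, by ext; simp⟩
      · intro a _; rfl
    rw [h1, h1]
    have h2 : n i = ∑ a : Fin k, if a = i then n a else 0 := by simp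
    rw [h2, ← Finset.sum_add_distrib]
    refine Finset.sum_le_sum fun a _ => ?_
    have hij' : i.1 < j.1 := hij
    by_cases h3 : a = i
    · subst h3; simp [hij']
    · rw [if_neg h3, add_zero]
      by_cases h4 : (a : ℕ) < i
      · rw [if_pos h4, if_pos (h4.trans hij')]
      · rw [if_neg h4]; exact Nat.zero_le _
  obtain ⟨i, a⟩ := x
  obtain ⟨j, b⟩ := y
  rw [Fin.lt_def, hval, hval]
  rcases lt_trichotomy i j with h | h | h
  · have h1 := hmono i j h
    have := a.2
    simp only [h, true_or, iff_true]
    omega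
  · subst h
    simp
  · have h1 := hmono j i h
    have := b.2
    simp only [h.not_gt, false_or, h.ne', IsEmpty.exists_iff, iff_false]
    omega

lemma blockEquiv_lt_same (j : Fin k) (a b : Fin (n j)) :
    blockEquiv n hn ⟨j, a⟩ < blockEquiv n hn ⟨j, b⟩ ↔ a < b := by
  rw [blockEquiv_lt_iff]
  simp

lemma blockEquiv_lt_of_lt {i j : Fin k} (h : i < j) (a : Fin (n i)) (b : Fin (n j)) :
    blockEquiv n hn ⟨i, a⟩ < blockEquiv n hn ⟨j, b⟩ := by
  rw [blockEquiv_lt_iff]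
  exact Or.inl h

lemma sum_block {M : Type*} [AddCommMonoid M] (f : Fin d → M) :
    ∑ i, f i = ∑ j, ∑ m, f (blockEquiv n hn ⟨j, m⟩) := by
  rw [← Equiv.sum_comp (blockEquiv n hn) f, Fintype.sum_sigma]

/-- A double sum over pairs, split into pairs in the same block and in different blocks. -/
lemma sum_block_pairs {M : Type*} [AddCommMonoid M] (G : Fin d → Fin d → M)
    (h0 : ∀ i j, i < j → ∀ a b, G (blockEquiv n hn ⟨j, a⟩) (blockEquiv n hn ⟨i, b⟩) = 0) :
    ∑ r, ∑ s, G r s =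
      ∑ j, ∑ a, ∑ b, G (blockEquiv n hn ⟨j, a⟩) (blockEquiv n hn ⟨j, b⟩) +
        ∑ i, ∑ j, if i < j then
          ∑ a, ∑ b, G (blockEquiv n hn ⟨i, a⟩) (blockEquiv n hn ⟨j, b⟩) else 0 := by
  rw [sum_block hn, ← Finset.sum_add_distrib]
  refine Finset.sum_congr rfl fun i _ => ?_
  have h1 : ∀ a, ∑ s, G (blockEquiv n hn ⟨i, a⟩) s =
      ∑ b, G (blockEquiv n hn ⟨i, a⟩) (blockEquiv n hn ⟨i, b⟩) +
        ∑ j, if i < j then ∑ b, G (blockEquiv n hn ⟨i, a⟩) (blockEquiv n hn ⟨j, b⟩) else 0 := by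
    intro a
    rw [sum_block hn]
    have h2 : ∀ j, ∑ b, G (blockEquiv n hn ⟨i, a⟩) (blockEquiv n hn ⟨j, b⟩) =
        (if j = i then ∑ b, G (blockEquiv n hn ⟨i, a⟩) (blockEquiv n hn ⟨i, b⟩) else 0) +
        if i < j then ∑ b, G (blockEquiv n hn ⟨i, a⟩) (blockEquiv n hn ⟨j, b⟩) else 0 := by
      intro j
      rcases lt_trichotomy i j with h | h | h
      · simp [h, h.ne']
      · subst h; simp
      · simp only [h.ne, h.not_gt, if_false, add_zero]
        exact Finset.sum_eq_zero fun b _ => h0 j i h a b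
    rw [Finset.sum_congr rfl fun j _ => h2 j, Finset.sum_add_distrib]
    simp
  rw [Finset.sum_congr rfl fun a _ => h1 a, Finset.sum_add_distrib,
    Finset.sum_comm (s := Finset.univ) (t := Finset.univ) (f := fun a j => if i < j then _ else _)]
  congr 1
  refine Finset.sum_congr rfl fun j _ => ?_
  split_ifs <;> simp

/-- The sign exponent of a product in `A^{⊗d}` splits into the contributions of the blocks and that
of the total parities of the blocks. -/
lemma chi_block (p q : Fin d → ZMod 2) :
    chi p q =
      ∑ j, chi (fun m => p (blockEquiv n hn ⟨j, m⟩)) (fun m => q (blockEquiv n hn ⟨j, m⟩)) +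
      chi (fun j => ∑ m, p (blockEquiv n hn ⟨j, m⟩))
        (fun j => ∑ m, q (blockEquiv n hn ⟨j, m⟩)) := by
  rw [chi, sum_block_pairs hn]
  · congr 1
    · refine Finset.sum_congr rfl fun j _ => ?_
      rw [chi]
      simp only [blockEquiv_lt_same]
    · rw [chi]
      refine Finset.sum_congr rfl fun i _ => Finset.sum_congr rfl fun j _ => ?_
      split_ifs with h
      · simp only [blockEquiv_lt_of_lt hn h, if_true]
        rw [Finset.sum_mul_sum, Finset.sum_comm]
      · rfl
  · intro i j h a b
    rw [if_neg (blockEquiv_lt_of_lt hn h b a).not_gt]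

/-- A block permutation has no inversions between different blocks. -/
lemma invExp_block (w : ∀ j, Equiv.Perm (Fin (n j))) (q : Fin d → ZMod 2) :
    invExp (blockPerm n hn w) q = ∑ j, invExp (w j) (fun m => q (blockEquiv n hn ⟨j, m⟩)) := by
  rw [invExp, sum_block_pairs hn]
  · have h0 : ∀ i j : Fin k, (if i < j then ∑ a, ∑ b,
        (if blockEquiv n hn ⟨i, a⟩ < blockEquiv n hn ⟨j, b⟩ ∧
          blockPerm n hn w (blockEquiv n hn ⟨j, b⟩) < blockPerm n hn w (blockEquiv n hn ⟨i, a⟩)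
          then q (blockEquiv n hn ⟨i, a⟩) * q (blockEquiv n hn ⟨j, b⟩) else 0) else 0) = 0 := by
      intro i j
      split_ifs with h
      · refine Finset.sum_eq_zero fun a _ => Finset.sum_eq_zero fun b _ => if_neg fun h' => ?_
        rw [blockPerm_apply, blockPerm_apply] at h'
        exact (blockEquiv_lt_of_lt hn h _ _).not_gt h'.2
      · rfl
    simp only [h0, Finset.sum_const_zero, add_zero]
    refine Finset.sum_congr rfl fun j _ => ?_
    rw [invExp]
    simp only [blockPerm_apply, blockEquiv_lt_same]
  · intro i j h a b
    rw [if_neg fun h' => (blockEquiv_lt_of_lt hn h b a).not_gt h'.1]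

lemma blockPerm_symm_apply (w : ∀ j, Equiv.Perm (Fin (n j))) (x : Σ j, Fin (n j)) :
    (blockPerm n hn w).symm (blockEquiv n hn x) = blockEquiv n hn ⟨x.1, (w x.1).symm x.2⟩ := by
  rw [Equiv.symm_apply_eq, blockPerm_apply]
  simp

end BlockSigns

/-! ### The wreath superproduct -/

section WreathBasics

variable {F : Type*} [Field F] {A : Type*} [Ring A] [Algebra F A] [SuperAlgebra F A] {n : ℕ}

variable (F A n) in
/-- The linear map `z ↦ z w` on `A^{⊗n}`. -/
def wrSingle (w : Equiv.Perm (Fin n)) : SAlg F A n →ₗ[F] Wr F A n where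
  toFun z := SkewMonoidAlgebra.single w z
  map_add' _ _ := SkewMonoidAlgebra.single_add _ _ _
  map_smul' r z := (SkewMonoidAlgebra.smul_single r w z).symm

variable (F A n) in
/-- The coefficient of `w`. -/
def wrCoeff (w : Equiv.Perm (Fin n)) : Wr F A n →ₗ[F] SAlg F A n where
  toFun f := f.coeff w
  map_add' f g := by rw [SkewMonoidAlgebra.coeff_add]; rfl
  map_smul' r f := by rw [SkewMonoidAlgebra.coeff_smul]; rfl

lemma wrCoeff_single (u w : Equiv.Perm (Fin n)) (z : SAlg F A n) :
    wrCoeff F A n u (SkewMonoidAlgebra.single w z) = if w = u then z else 0 :=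
  SkewMonoidAlgebra.coeff_single_apply

lemma sum_wrSingle_wrCoeff (f : Wr F A n) : ∑ w, wrSingle F A n w (wrCoeff F A n w f) = f := by
  induction f using wr_induction F with
  | h0 => simp
  | ha f g hf hg => simp only [map_add, Finset.sum_add_distrib, hf, hg]
  | hs w z =>
    rw [Finset.sum_eq_single w]
    · rw [wrCoeff_single, if_pos rfl]; rfl
    · intro u _ hu
      rw [wrCoeff_single, if_neg hu.symm, map_zero]
    · simp

lemma pten_mul_pten {x y : Fin n → ZMod 2} {a b : Fin n → A} (ha : ∀ i, pr F (x i) (a i) = a i)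
    (hb : ∀ i, pr F (y i) (b i) = b i) :
    pten F a * pten F b = sg F (chi x y) • pten F fun i => a i * b i :=
  sact_tprod (V := A) ha hb

lemma perm_smul_pten (w : Equiv.Perm (Fin n)) {x : Fin n → ZMod 2} {a : Fin n → A}
    (ha : ∀ i, pr F (x i) (a i) = a i) :
    w • pten F a = sg F (invExp w x) • pten F fun i => a (w.symm i) :=
  sperm_tprod (V := A) w ha

lemma wr_mul_wr {x y : Fin n → ZMod 2} {a b : Fin n → A} (ha : ∀ i, pr F (x i) (a i) = a i)
    (hb : ∀ i, pr F (y i) (b i) = b i) (w u : Equiv.Perm (Fin n)) :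
    wr F a w * wr F b u = sg F (invExp w y + chi x fun i => y (w.symm i)) •
      wr F (fun i => a i * b (w.symm i)) (w * u) := by
  rw [wr, wr, SkewMonoidAlgebra.single_mul_single, perm_smul_pten w hb, mul_smul_comm,
    pten_mul_pten (y := fun i => y (w.symm i)) ha fun i => hb _, smul_smul, ← sg_add, wr,
    SkewMonoidAlgebra.smul_single]

variable (F A n) in
/-- The elements `(a₁ ⊗ ⋯ ⊗ a_n) w` with homogeneous `a_i`. -/
def homogWr : Set (Wr F A n) :=
  {f | ∃ (x : Fin n → ZMod 2) (a : Fin n → A) (w : Equiv.Perm (Fin n)),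
    (∀ i, pr F (x i) (a i) = a i) ∧ f = wr F a w}

lemma span_homogWr : Submodule.span F (homogWr F A n) = ⊤ := by
  rw [eq_top_iff]
  rintro f -
  rw [← sum_wrSingle_wrCoeff f]
  refine Submodule.sum_mem _ fun w _ => ?_
  generalize wrCoeff F A n w f = z
  have h : (Submodule.span F (homogWr F A n)).mkQ ∘ₗ wrSingle F A n w = 0 := by
    refine ext_homog (s := fun _ => A) fun x a ha => ?_
    change Submodule.Quotient.mk (wr F a w) = 0
    rw [Submodule.Quotient.mk_eq_zero]
    exact Submodule.subset_span ⟨x, a, w, ha, rfl⟩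
  have h1 := LinearMap.congr_fun h z
  exact (Submodule.Quotient.mk_eq_zero _).1 h1

variable (F A n) in
/-- The group algebra of `𝔖_n` inside the wreath superproduct. -/
def permAlg : MonoidAlgebra F (Equiv.Perm (Fin n)) →ₐ[F] Wr F A n :=
  MonoidAlgebra.lift F _ _
    { toFun := fun w => SkewMonoidAlgebra.single w 1
      map_one' := rfl
      map_mul' := fun u w => by
        rw [SkewMonoidAlgebra.single_mul_single, smul_one, mul_one] }

lemma permAlg_single (w : Equiv.Perm (Fin n)) (r : F) :
    permAlg F A n (MonoidAlgebra.single w r) = r • SkewMonoidAlgebra.single w 1 := by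
  rw [permAlg, MonoidAlgebra.lift_single]
  rfl

lemma permAlg_apply (x : MonoidAlgebra F (Equiv.Perm (Fin n))) :
    permAlg F A n x = ∑ w, x.coeff w • SkewMonoidAlgebra.single w 1 := by
  conv_lhs => rw [← (grpBasis F (Equiv.Perm (Fin n))).sum_repr x]
  rw [map_sum]
  refine Finset.sum_congr rfl fun w _ => ?_
  rw [map_smul]
  congr 1
  exact (permAlg_single w 1).trans (one_smul _ _)

lemma single_one_mul_permAlg (z : SAlg F A n) (x : MonoidAlgebra F (Equiv.Perm (Fin n))) :
    wrSingle F A n 1 z * permAlg F A n x = ∑ w, x.coeff w • wrSingle F A n w z := by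
  rw [permAlg_apply, Finset.mul_sum]
  refine Finset.sum_congr rfl fun w _ => ?_
  rw [mul_smul_comm]
  congr 1
  change SkewMonoidAlgebra.single 1 z * SkewMonoidAlgebra.single w 1 = SkewMonoidAlgebra.single w z
  rw [SkewMonoidAlgebra.single_mul_single, one_mul, one_smul, mul_one]

lemma pr_wrSingle (i : ZMod 2) (w : Equiv.Perm (Fin n)) (z : SAlg F A n) :
    pr F i (wrSingle F A n w z) = wrSingle F A n w (pr F i z) := pr_single F i w z

lemma pr_single_mul_permAlg (i : ZMod 2) (z : SAlg F A n)
    (x : MonoidAlgebra F (Equiv.Perm (Fin n))) :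
    pr F i (wrSingle F A n 1 z * permAlg F A n x) =
      wrSingle F A n 1 (pr F i z) * permAlg F A n x := by
  rw [single_one_mul_permAlg, single_one_mul_permAlg, map_sum]
  simp only [map_smul, pr_wrSingle]

end WreathBasics

/-! ### The embedding of a parabolic subalgebra -/

section Join

variable {F : Type*} [Field F] {ℓ : ℕ} [NeZero ℓ]

/-- The coefficient of the tensor product of paths with labels `c₁, …, c_n`. -/
def wordCoord {n : ℕ} (c : Fin n → Slot ℓ) : SAlg F (BA F ℓ) n →ₗ[F] F :=
  PiTensorProduct.lift ((MultilinearMap.mkPiAlgebra F (Fin n) F).compLinearMap fun i => coord (c i))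

lemma wordCoord_pten {n : ℕ} (c : Fin n → Slot ℓ) (a : Fin n → BA F ℓ) :
    wordCoord c (pten F a) = ∏ i, coord (c i) (a i) := by
  refine (PiTensorProduct.lift.tprod _).trans ?_
  simp

/-- The tensor products of paths are linearly independent. -/
lemma wordCoord_path {n : ℕ} (c : Fin n → Slot ℓ) {c' : Fin n → Slot ℓ} (h : ∀ i, (c' i).Ok) :
    wordCoord c (pten F fun i => path F (c' i)) = if c = c' then 1 else 0 := by
  rw [wordCoord_pten]
  simp only [coord_path (h _)]
  split_ifs with hc
  · simp [hc]
  · obtain ⟨i, hi⟩ := Function.ne_iff.1 hc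
    exact Finset.prod_eq_zero (Finset.mem_univ i) (if_neg hi)

/-- The tensor products of paths span `A_ℓ^{⊗n}`. -/
lemma sum_wordCoord {n : ℕ} (z : SAlg F (BA F ℓ) n) :
    ∑ c : Fin n → Slot ℓ, wordCoord c z • pten F (fun i => path F (c i)) = z := by
  have h : ∑ c : Fin n → Slot ℓ, (LinearMap.toSpanSingleton F (SAlg F (BA F ℓ) n)
      (pten F fun i => path F (c i))) ∘ₗ wordCoord c = LinearMap.id := by
    refine PiTensorProduct.ext (s := fun _ => BA F ℓ) (MultilinearMap.ext fun a => ?_)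
    have h1 := MultilinearMap.map_sum (PiTensorProduct.tprod F)
      fun (i : Fin n) (β : Slot ℓ) => coord β (a i) • path F β
    simp only [sum_coord_smul_path] at h1
    refine Eq.trans ?_ h1.symm
    change (∑ c : Fin n → Slot ℓ, (LinearMap.toSpanSingleton F (SAlg F (BA F ℓ) n)
      (pten F fun i => path F (c i))) ∘ₗ wordCoord c) (pten F a) = _
    rw [LinearMap.sum_apply]
    refine Finset.sum_congr rfl fun c _ => ?_
    rw [MultilinearMap.map_smul_univ, LinearMap.comp_apply, wordCoord_pten]
    rfl
  have h2 := LinearMap.congr_fun h z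
  rw [LinearMap.sum_apply] at h2
  exact h2

variable {k d : ℕ} {n : Fin k → ℕ} (hn : ∑ j, n j = d)

/-- The identification of `A^{⊗ n₁} ⊗ ⋯ ⊗ A^{⊗ n_k}` with `A^{⊗ d}`. -/
def joinTensor : MultilinearMap F (fun j => SAlg F (BA F ℓ) (n j)) (SAlg F (BA F ℓ) d) :=
  ∑ c : Fin d → Slot ℓ, (LinearMap.toSpanSingleton F (SAlg F (BA F ℓ) d)
    (pten F fun i => path F (c i))).compMultilinearMap
      ((MultilinearMap.mkPiAlgebra F (Fin k) F).compLinearMap fun j =>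
        wordCoord fun m => c (blockEquiv n hn ⟨j, m⟩))

/-- The concatenation of families indexed by the blocks. -/
def concat {X : Type*} (a : ∀ j, Fin (n j) → X) (i : Fin d) : X :=
  a ((blockEquiv n hn).symm i).1 ((blockEquiv n hn).symm i).2

@[simp] lemma concat_blockEquiv {X : Type*} (a : ∀ j, Fin (n j) → X) (x : Σ j, Fin (n j)) :
    concat hn a (blockEquiv n hn x) = a x.1 x.2 := by
  change (fun y : Σ j, Fin (n j) => a y.1 y.2) ((blockEquiv n hn).symm (blockEquiv n hn x)) = _
  rw [Equiv.symm_apply_apply]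

lemma joinTensor_pten (a : ∀ j, Fin (n j) → BA F ℓ) :
    joinTensor hn (fun j => pten F (a j)) = pten F (concat hn a) := by
  rw [← sum_wordCoord (pten F (concat hn a)), joinTensor, sum_apply]
  refine Finset.sum_congr rfl fun c _ => ?_
  change (∏ j, wordCoord (fun m => c (blockEquiv n hn ⟨j, m⟩)) (pten F (a j))) •
    pten F (fun i => path F (c i)) = _
  congr 1
  simp only [wordCoord_pten]
  rw [← Equiv.prod_comp (blockEquiv n hn), Fintype.prod_sigma]
  simp

/-- The embedding of the parabolic subalgebra `W_{n₁} ⊗ ⋯ ⊗ W_{n_k}` into `W_d`, as a multilinear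
map. -/
def joinWr : MultilinearMap F (fun j => Wr F (BA F ℓ) (n j)) (Wr F (BA F ℓ) d) :=
  ∑ w : ∀ j, Equiv.Perm (Fin (n j)), (wrSingle F (BA F ℓ) d (blockPerm n hn w)).compMultilinearMap
    ((joinTensor hn).compLinearMap fun j => wrCoeff F (BA F ℓ) (n j) (w j))

lemma joinWr_apply (f : ∀ j, Wr F (BA F ℓ) (n j)) :
    joinWr hn f = ∑ w : ∀ j, Equiv.Perm (Fin (n j)), wrSingle F (BA F ℓ) d (blockPerm n hn w)
      (joinTensor hn fun j => wrCoeff F (BA F ℓ) (n j) (w j) (f j)) := by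
  rw [joinWr, sum_apply]
  rfl

lemma joinWr_wr (a : ∀ j, Fin (n j) → BA F ℓ) (w : ∀ j, Equiv.Perm (Fin (n j))) :
    joinWr hn (fun j => wr F (a j) (w j)) = wr F (concat hn a) (blockPerm n hn w) := by
  rw [joinWr_apply, Finset.sum_eq_single w]
  · simp only [wr, wrCoeff_single, if_true]
    rw [joinTensor_pten]
    rfl
  · intro u _ hu
    obtain ⟨j, hj⟩ := Function.ne_iff.1 hu
    rw [MultilinearMap.map_coord_zero (joinTensor hn) j, map_zero]
    rw [wr, wrCoeff_single, if_neg (Ne.symm hj)]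
  · simp

/-- The embedding of the parabolic subalgebra is multiplicative, in the sense of the sign rule. -/
lemma wr_mul_joinWr {x : Fin d → ZMod 2} {z : Fin d → BA F ℓ} (hz : ∀ i, pr F (x i) (z i) = z i)
    (w : ∀ j, Equiv.Perm (Fin (n j))) {y : Fin k → ZMod 2} {f : ∀ j, Wr F (BA F ℓ) (n j)}
    (hf : ∀ j, pr F (y j) (f j) = f j) :
    wr F z (blockPerm n hn w) * joinWr hn f =
      sg F (chi (fun s => ∑ m, x (blockEquiv n hn ⟨s, m⟩)) y) •
        joinWr hn fun j => wr F (fun m => z (blockEquiv n hn ⟨j, m⟩)) (w j) * f j := by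
  -- Both sides are multilinear in `f`, once `f j` is replaced by its component of parity `y j`, so
  -- it suffices to take `f j = (a₁ ⊗ ⋯ ⊗ a_n) u` with homogeneous `a_i`.
  have key : ((LinearMap.mulLeft F (wr F z (blockPerm n hn w))).compMultilinearMap
      ((joinWr hn).compLinearMap fun j => pr F (y j))) =
      (sg F (chi (fun s => ∑ m, x (blockEquiv n hn ⟨s, m⟩)) y) •
        (joinWr hn).compLinearMap fun j =>
          LinearMap.mulLeft F (wr F (fun m => z (blockEquiv n hn ⟨j, m⟩)) (w j)) ∘ₗ
            pr F (y j)) := by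
    refine multilinear_ext_span (fun j => span_homogWr) fun g hg => ?_
    choose q a u ha hg using hg
    obtain rfl : g = fun j => wr F (a j) (u j) := funext hg
    have hpr : ∀ j, pr F (y j) (wr F (a j) (u j)) =
        if y j = ∑ i, q j i then wr F (a j) (u j) else 0 := fun j =>
      pr_of_homog (pr_wr F (ha j) (u j)) _
    change wr F z (blockPerm n hn w) * joinWr hn (fun j => pr F (y j) (wr F (a j) (u j))) =
      sg F (chi (fun s => ∑ m, x (blockEquiv n hn ⟨s, m⟩)) y) • joinWr hn fun j =>
        wr F (fun m => z (blockEquiv n hn ⟨j, m⟩)) (w j) * pr F (y j) (wr F (a j) (u j))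
    by_cases hy : ∀ j, y j = ∑ i, q j i
    · have hy' : y = fun j => ∑ i, q j i := funext hy
      simp only [hpr, ← hy, if_true]
      rw [joinWr_wr]
      have hR : ∀ j, wr F (fun m => z (blockEquiv n hn ⟨j, m⟩)) (w j) * wr F (a j) (u j) =
          sg F (invExp (w j) (q j) + chi (fun m => x (blockEquiv n hn ⟨j, m⟩))
            fun m => q j ((w j).symm m)) •
          wr F (fun m => z (blockEquiv n hn ⟨j, m⟩) * a j ((w j).symm m)) (w j * u j) := fun j =>
        wr_mul_wr (fun m => hz _) (ha j) _ _
      rw [wr_mul_wr (y := concat hn q) (b := concat hn a) hz (fun i => ha _ _)]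
      simp only [hR]
      rw [MultilinearMap.map_smul_univ, joinWr_wr, smul_smul]
      have hw : (fun i => z i * concat hn a ((blockPerm n hn w).symm i)) =
          concat hn fun j m => z (blockEquiv n hn ⟨j, m⟩) * a j ((w j).symm m) := by
        funext i
        obtain ⟨t, rfl⟩ := (blockEquiv n hn).surjective i
        rw [blockPerm_symm_apply, concat_blockEquiv, concat_blockEquiv]
      have hwu : blockPerm n hn w * blockPerm n hn u = blockPerm n hn fun j => w j * u j :=
        ((blockHom hn).map_mul w u).symm
      rw [hw, hwu]
      congr 1
      have hprod : ∀ e : Fin k → ZMod 2, ∏ j, sg F (e j) = sg F (∑ j, e j) := by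
        intro e
        rw [← Finset.prod_congr rfl fun j _ => rfl]
        induction (Finset.univ : Finset (Fin k)) using Finset.induction with
        | empty => simp
        | insert a s ha ih => rw [Finset.prod_insert ha, Finset.sum_insert ha, sg_add, ih]
      rw [hprod, ← sg_add, invExp_block, chi_block hn, Finset.sum_add_distrib]
      congr 1
      have e1 : ∀ j, (fun m => concat hn q (blockEquiv n hn ⟨j, m⟩)) = q j := fun j => by
        funext m; rw [concat_blockEquiv]
      have e2 : ∀ j, (fun m => concat hn q ((blockPerm n hn w).symm (blockEquiv n hn ⟨j, m⟩))) =
          fun m => q j ((w j).symm m) := fun j => by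
        funext m; rw [blockPerm_symm_apply, concat_blockEquiv]
      have e3 : ∀ j, ∑ m, q j ((w j).symm m) = ∑ m, q j m := fun j =>
        Equiv.sum_comp (w j).symm (q j)
      simp only [e1, e2, e3, hy']
      abel
    · push Not at hy
      obtain ⟨j, hj⟩ := hy
      have h0 : pr F (y j) (wr F (a j) (u j)) = 0 := by rw [hpr, if_neg hj]
      rw [MultilinearMap.map_coord_zero (joinWr hn) j h0,
        MultilinearMap.map_coord_zero (joinWr hn) j (by rw [h0, mul_zero]), mul_zero, smul_zero]
  have h := congrFun (congrArg DFunLike.coe key) f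
  change wr F z (blockPerm n hn w) * joinWr hn (fun j => pr F (y j) (f j)) =
      sg F (chi (fun s => ∑ m, x (blockEquiv n hn ⟨s, m⟩)) y) • joinWr hn (fun j =>
        wr F (fun m => z (blockEquiv n hn ⟨j, m⟩)) (w j) * pr F (y j) (f j)) at h
  simpa only [hf] using h

/-- The embedding of the parabolic subalgebra on products of a pure tensor and an element of the
group algebra. -/
lemma joinWr_single_mul_permAlg (a : ∀ j, Fin (n j) → BA F ℓ)
    (x : ∀ j, MonoidAlgebra F (Equiv.Perm (Fin (n j)))) :
    joinWr hn (fun j =>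
        wrSingle F (BA F ℓ) (n j) 1 (pten F (a j)) * permAlg F (BA F ℓ) (n j) (x j)) =
      wrSingle F (BA F ℓ) d 1 (pten F (concat hn a)) *
        permAlg F (BA F ℓ) d (blockAlg hn F (box F _ x)) := by
  simp only [single_one_mul_permAlg (z := pten F (a _))]
  rw [MultilinearMap.map_sum, box_apply, map_sum, map_sum, Finset.mul_sum]
  refine Finset.sum_congr rfl fun w _ => ?_
  rw [MultilinearMap.map_smul_univ, blockAlg_single, permAlg_single, mul_smul_comm]
  congr 1
  refine (joinWr_wr hn a w).trans ?_
  change SkewMonoidAlgebra.single _ _ = SkewMonoidAlgebra.single 1 _ * SkewMonoidAlgebra.single _ 1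
  rw [SkewMonoidAlgebra.single_mul_single, one_mul, one_smul, mul_one]

end Join

/-! ### Induction products of cyclic supermodules -/

section CircGen

variable {F : Type*} [Field F] {ℓ : ℕ} [NeZero ℓ] {k d : ℕ} {n : Fin k → ℕ} (hn : ∑ j, n j = d)
  {M : Fin k → Type*} [∀ j, AddCommGroup (M j)] [∀ j, Module F (M j)]
  [∀ j, Module (Wr F (BA F ℓ) (n j)) (M j)] [∀ j, SuperSpace F (M j)]
  [∀ j, IsScalarTower F (Wr F (BA F ℓ) (n j)) (M j)]
  [∀ j, SuperModule F (Wr F (BA F ℓ) (n j)) (M j)]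

/-- The quotient map onto the induction product. -/
def circMk : Wr F (BA F ℓ) d ⊗[F] (⨂[F] j, M j) →ₗ[Wr F (BA F ℓ) d] Circ F (BA F ℓ) n hn M :=
  (circSub F (BA F ℓ) n hn M).toSubmodule.mkQ

lemma circMk_surjective : Function.Surjective (circMk (F := F) (ℓ := ℓ) hn (M := M)) :=
  Submodule.mkQ_surjective _

/-- The defining relation of the induction product. -/
lemma circMk_rel {x : Fin d → ZMod 2} {z : Fin d → BA F ℓ} {w : ∀ j, Equiv.Perm (Fin (n j))}
    {y : Fin k → ZMod 2} {v : ∀ j, M j} (hz : ∀ i, pr F (x i) (z i) = z i)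
    (hv : ∀ j, pr F (y j) (v j) = v j) :
    circMk hn (wr F z (blockPerm n hn w) ⊗ₜ[F] PiTensorProduct.tprod F v) =
      circMk hn (1 ⊗ₜ[F] (sg F (chi (fun s => ∑ m, x (blockEquiv n hn ⟨s, m⟩)) y) •
        PiTensorProduct.tprod F fun j =>
          wr F (fun m => z (blockEquiv n hn ⟨j, m⟩)) (w j) • v j)) := by
  rw [← sub_eq_zero, ← map_sub]
  refine (Submodule.Quotient.mk_eq_zero _).2 (Submodule.subset_span ?_)
  exact ⟨x, z, w, y, v, hz, hv, rfl⟩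

/-- Elements of the parabolic subalgebra can be moved across the tensor sign; there is no sign
because the vectors `v j` are even. -/
lemma circMk_joinWr {v : ∀ j, M j} (hv : ∀ j, pr F 0 (v j) = v j)
    (f : ∀ j, Wr F (BA F ℓ) (n j)) :
    circMk hn (joinWr hn f ⊗ₜ[F] PiTensorProduct.tprod F v) =
      circMk hn (1 ⊗ₜ[F] PiTensorProduct.tprod F fun j => f j • v j) := by
  let M₁ : MultilinearMap F (fun j => Wr F (BA F ℓ) (n j)) (Circ F (BA F ℓ) n hn M) :=
    (((circMk hn).restrictScalars F) ∘ₗ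
      (TensorProduct.mk F _ _).flip (PiTensorProduct.tprod F v)).compMultilinearMap (joinWr hn)
  let M₂ : MultilinearMap F (fun j => Wr F (BA F ℓ) (n j)) (Circ F (BA F ℓ) n hn M) :=
    (((circMk hn).restrictScalars F) ∘ₗ
      (TensorProduct.mk F _ _) 1).compMultilinearMap
      ((PiTensorProduct.tprod F).compLinearMap fun j =>
        (Algebra.lsmul F F (M j) : Wr F (BA F ℓ) (n j) →ₐ[F] Module.End F (M j)).toLinearMap.flip
          (v j))
  have h : M₁ = M₂ := by
    refine multilinear_ext_span (fun j => span_homogWr) fun g hg => ?_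
    choose q a u ha hg using hg
    obtain rfl : g = fun j => wr F (a j) (u j) := funext hg
    change circMk hn (joinWr hn (fun j => wr F (a j) (u j)) ⊗ₜ[F] PiTensorProduct.tprod F v) =
      circMk hn (1 ⊗ₜ[F] PiTensorProduct.tprod F fun j => wr F (a j) (u j) • v j)
    rw [joinWr_wr, circMk_rel (x := concat hn q) (z := concat hn a) (y := 0) hn
      (fun i => ha _ _) hv,
      chi_zero_right, sg_zero, one_smul]
    simp only [concat_blockEquiv]
  exact congrFun (congrArg DFunLike.coe h) f

/-- An induction product of cyclic supermodules is cyclic. -/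
lemma exists_smul_circMk {v : ∀ j, M j} (hv : ∀ j, pr F 0 (v j) = v j)
    (hgen : ∀ j (m : M j), ∃ f : Wr F (BA F ℓ) (n j), f • v j = m)
    (c : Circ F (BA F ℓ) n hn M) :
    ∃ x : Wr F (BA F ℓ) d, x • circMk hn (1 ⊗ₜ[F] PiTensorProduct.tprod F v) = c := by
  obtain ⟨t, rfl⟩ := circMk_surjective hn c
  induction t using TensorProduct.induction_on with
  | zero => exact ⟨0, by rw [zero_smul, map_zero]⟩
  | add t t' h h' =>
    obtain ⟨x, hx⟩ := h
    obtain ⟨x', hx'⟩ := h'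
    exact ⟨x + x', by rw [add_smul, hx, hx', map_add]⟩
  | tmul b t =>
    induction t using PiTensorProduct.induction_on with
    | smul_tprod r m =>
      choose f hf using fun j => hgen j (m j)
      obtain rfl : (fun j => f j • v j) = m := funext hf
      refine ⟨r • (b * joinWr hn f), ?_⟩
      have h1 := circMk_joinWr hn hv f
      have h2 : circMk hn ((joinWr hn f) ⊗ₜ[F] PiTensorProduct.tprod F v) =
          joinWr hn f • circMk hn (1 ⊗ₜ[F] PiTensorProduct.tprod F v) := by
        rw [← map_smul, TensorProduct.smul_tmul', smul_eq_mul, mul_one]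
      have h3 : circMk hn (b ⊗ₜ[F] (r • PiTensorProduct.tprod F fun j => f j • v j)) =
          r • b • circMk hn (1 ⊗ₜ[F] PiTensorProduct.tprod F fun j => f j • v j) := by
        have h4 : b ⊗ₜ[F] (PiTensorProduct.tprod F fun j => f j • v j) =
            b • ((1 : Wr F (BA F ℓ) d) ⊗ₜ[F] PiTensorProduct.tprod F fun j => f j • v j) := by
          rw [TensorProduct.smul_tmul', smul_eq_mul, mul_one]
        rw [TensorProduct.tmul_smul, LinearMap.map_smul_of_tower, h4, map_smul]
      rw [h3, ← h1, h2, smul_assoc, smul_smul]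
    | add t t' h h' =>
      obtain ⟨x, hx⟩ := h
      obtain ⟨x', hx'⟩ := h'
      exact ⟨x + x', by rw [add_smul, hx, hx', TensorProduct.tmul_add, map_add]⟩

variable (h : ∀ j, M j →ₗ[F] Wr F (BA F ℓ) (n j))

/-- The homomorphism from `W_d ⊗ (M₁ ⊠ ⋯ ⊠ M_k)` to `W_d` given by homomorphisms
`M_j → W_{n_j}`. -/
def preCircMap : Wr F (BA F ℓ) d ⊗[F] (⨂[F] j, M j) →ₗ[Wr F (BA F ℓ) d] Wr F (BA F ℓ) d :=
  TensorProduct.AlgebraTensorModule.lift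
    { toFun := fun x => LinearMap.mulLeft F x ∘ₗ PiTensorProduct.lift ((joinWr hn).compLinearMap h)
      map_add' := fun x y => by ext; simp [add_mul]
      map_smul' := fun x y => by ext; simp }

lemma preCircMap_tmul (x : Wr F (BA F ℓ) d) (v : ∀ j, M j) :
    preCircMap hn h (x ⊗ₜ[F] PiTensorProduct.tprod F v) = x * joinWr hn fun j => h j (v j) := by
  change x * PiTensorProduct.lift ((joinWr hn).compLinearMap h) (PiTensorProduct.tprod F v) = _
  rw [PiTensorProduct.lift.tprod]
  rfl

/-- Even homomorphisms `M_j → W_{n_j}` induce a homomorphism from the induction product to `W_d`. -/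
lemma exists_circMap (heven : ∀ j i m, h j (pr F i m) = pr F i (h j m))
    (hlin : ∀ j (f : Wr F (BA F ℓ) (n j)) m, h j (f • m) = f * h j m) :
    ∃ Ψ : Circ F (BA F ℓ) n hn M →ₗ[Wr F (BA F ℓ) d] Wr F (BA F ℓ) d,
      ∀ x (v : ∀ j, M j), Ψ (circMk hn (x ⊗ₜ[F] PiTensorProduct.tprod F v)) =
        x * joinWr hn fun j => h j (v j) := by
  refine ⟨Submodule.liftQ _ (preCircMap hn h) ?_, fun x v => ?_⟩
  · refine Submodule.span_le.2 ?_
    rintro _ ⟨x, z, w, y, v, hz, hv, rfl⟩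
    have h1 := wr_mul_joinWr hn hz w (y := y) (f := fun j => h j (v j)) fun j => by
      rw [← heven, hv]
    rw [SetLike.mem_coe, LinearMap.mem_ker, map_sub, TensorProduct.tmul_smul, sub_eq_zero]
    rw [LinearMap.map_smul_of_tower, preCircMap_tmul, preCircMap_tmul, h1, one_mul]
    simp only [hlin]
  · exact (Submodule.liftQ_apply _ _ _).trans (preCircMap_tmul hn h x v)

end CircGen

section TwistGen

variable {F : Type*} [Field F] {ℓ : ℕ} [NeZero ℓ] {V : Type*} [AddCommGroup V] [Module F V]
  [Module (BA F ℓ) V] [IsScalarTower F (BA F ℓ) V] [SuperSpace F V] [SuperModule F (BA F ℓ) V]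
  (lam : YoungDiagram)

/-- The vector `g ⊗ ⋯ ⊗ g ⊗ y` of `V^{⊗n} ⊗ S^λ`. -/
def twistVec (g : V) (y : Specht F lam) : Twist F V (spechtRep F lam) :=
  ((PiTensorProduct.tprod F fun _ : Fin lam.card => g) ⊗ₜ[F] y :
    (⨂[F] _ : Fin lam.card, V) ⊗[F] Specht F lam)

variable {lam}

lemma pr_twistVec {g : V} (hg : pr F 0 g = g) (y : Specht F lam) :
    pr F 0 (twistVec lam g y) = twistVec lam g y := by
  refine congrArg (· ⊗ₜ[F] y) ?_
  have := pr_tprod (F := F) (x := fun _ : Fin lam.card => 0) (v := fun _ => g) fun _ => hg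
  simpa using this

lemma permAlg_smul_twistVec {g : V} (hg : pr F 0 g = g)
    (x : MonoidAlgebra F (Equiv.Perm (Fin lam.card))) (y : Specht F lam) :
    permAlg F (BA F ℓ) lam.card x • twistVec lam g y = twistVec lam g (x • y) := by
  have key : ∀ w : Equiv.Perm (Fin lam.card),
      (SkewMonoidAlgebra.single w 1 : Wr F (BA F ℓ) lam.card) • twistVec lam g y =
        twistVec lam g ((MonoidAlgebra.single w 1 :
          MonoidAlgebra F (Equiv.Perm (Fin lam.card))) • y) := by
    intro w
    rw [single_smul_twist, map_one, Module.End.one_apply]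
    refine congrArg (· ⊗ₜ[F] spechtRep F lam w y) ?_
    rw [sperm_tprod (x := 0) w fun _ => hg]
    simp [invExp]
  let L : Specht F lam →ₗ[F] Twist F V (spechtRep F lam) :=
    TensorProduct.mk F (⨂[F] _ : Fin lam.card, V) (Specht F lam)
      (PiTensorProduct.tprod F fun _ => g)
  have hlin : ∀ s : Specht F lam, twistVec lam g s = L s := fun _ => rfl
  have hx := (grpBasis F (Equiv.Perm (Fin lam.card))).sum_repr x
  rw [← hx, map_sum, Finset.sum_smul, Finset.sum_smul, hlin, hlin, map_sum]
  refine Finset.sum_congr rfl fun w _ => ?_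
  have h1 : grpBasis F (Equiv.Perm (Fin lam.card)) w = MonoidAlgebra.single w 1 := rfl
  rw [h1, map_smul, permAlg_single, one_smul, smul_assoc, ← hlin, key, hlin, smul_assoc]
  exact (L.map_smul _ _).symm

/-- No signs arise when `A^{⊗n}` acts on a tensor product of even vectors. -/
lemma sact_tprod_even (a : Fin lam.card → BA F ℓ) {g : V} (hg : pr F 0 g = g) :
    sact (PiTensorProduct.tprod F a) (PiTensorProduct.tprod F fun _ => g) =
      PiTensorProduct.tprod F fun i => a i • g := by
  have h : (sact (F := F) (A := BA F ℓ) (V := V) (n := lam.card)).flip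
      (PiTensorProduct.tprod F fun _ => g) =
      PiTensorProduct.map fun _ => (Algebra.lsmul F F V).toLinearMap.flip g := by
    refine ext_homog fun x a ha => ?_
    rw [LinearMap.flip_apply, sact_tprod (y := 0) ha fun _ => hg, chi_zero_right,
      PiTensorProduct.map_tprod]
    simp
  have h1 := LinearMap.congr_fun h (PiTensorProduct.tprod F a)
  rw [PiTensorProduct.map_tprod] at h1
  exact h1

lemma pten_smul_twistVec (a : Fin lam.card → BA F ℓ) {g : V} (hg : pr F 0 g = g)
    (y : Specht F lam) :
    wrSingle F (BA F ℓ) lam.card 1 (pten F a) • twistVec lam g y =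
      ((PiTensorProduct.tprod F fun i => a i • g) ⊗ₜ[F] y :
        (⨂[F] _ : Fin lam.card, V) ⊗[F] Specht F lam) := by
  refine (single_smul_twist F 1 (pten F a) (twistVec lam g y)).trans ?_
  rw [map_one]
  exact congrArg (· ⊗ₜ[F] y) (sact_tprod_even a hg)

/-- If `g` generates `V`, then `g ⊗ ⋯ ⊗ g` tensored with the idempotent generator of `S^λ` generates
`V^{⊗n} ⊗ S^λ`. -/
lemma exists_smul_twistVec (hF : (lam.card.factorial : F) ≠ 0) {g : V} (hg : pr F 0 g = g)
    (hgen : ∀ v : V, ∃ a : BA F ℓ, a • g = v) (m : Twist F V (spechtRep F lam)) :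
    ∃ f : Wr F (BA F ℓ) lam.card, f • twistVec lam g (spechtGen lam F) = m := by
  change (⨂[F] _ : Fin lam.card, V) ⊗[F] Specht F lam at m
  induction m using TensorProduct.induction_on with
  | zero => exact ⟨0, zero_smul _ _⟩
  | add t t' h h' =>
    obtain ⟨x, hx⟩ := h
    obtain ⟨x', hx'⟩ := h'
    exact ⟨x + x', by rw [add_smul, hx, hx']; rfl⟩
  | tmul t y =>
    induction t using PiTensorProduct.induction_on with
    | smul_tprod r v =>
      choose a ha using fun i => hgen (v i)
      refine ⟨r • (wrSingle F (BA F ℓ) lam.card 1 (pten F a) *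
        permAlg F (BA F ℓ) lam.card (y : MonoidAlgebra F (Equiv.Perm (Fin lam.card)))), ?_⟩
      rw [smul_assoc, mul_smul, permAlg_smul_twistVec hg, smul_spechtGen lam hF,
        pten_smul_twistVec a hg]
      simp only [ha]
      rfl
    | add t t' h h' =>
      obtain ⟨x, hx⟩ := h
      obtain ⟨x', hx'⟩ := h'
      exact ⟨x + x', by rw [add_smul, hx, hx', TensorProduct.add_tmul]; rfl⟩

variable (s : V →ₗ[BA F ℓ] BA F ℓ)

/-- Pure tensors in `V^{⊗n} ⊗ S^λ`. -/
def twistTmul (t : ⨂[F] _ : Fin lam.card, V) (y : Specht F lam) : Twist F V (spechtRep F lam) :=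
  (t ⊗ₜ[F] y : (⨂[F] _ : Fin lam.card, V) ⊗[F] Specht F lam)

lemma twist_ext {E : Type*} [AddCommGroup E] [Module F E]
    {f g : Twist F V (spechtRep F lam) →ₗ[F] E}
    (h : ∀ t y, f (twistTmul t y) = g (twistTmul t y)) : f = g :=
  TensorProduct.ext' h

variable (lam) in
/-- The homomorphism `V^{⊗n} ⊗ S^λ → W_n` given by a homomorphism `V → A_ℓ` and the inclusion of
`S^λ` into the group algebra. -/
def twistMap : Twist F V (spechtRep F lam) →ₗ[F] Wr F (BA F ℓ) lam.card :=
  (TensorProduct.lift ((LinearMap.mul F (Wr F (BA F ℓ) lam.card)).compl₁₂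
    (wrSingle F (BA F ℓ) lam.card 1 ∘ₗ PiTensorProduct.map fun _ => s.restrictScalars F)
    ((permAlg F (BA F ℓ) lam.card).toLinearMap ∘ₗ
      (Submodule.subtype (Submodule.span (MonoidAlgebra F (Equiv.Perm (Fin lam.card)))
        {youngElt F lam})).restrictScalars F)) :
    (⨂[F] _ : Fin lam.card, V) ⊗[F] Specht F lam →ₗ[F] Wr F (BA F ℓ) lam.card)

/-- The map `V^{⊗n} → A^{⊗n}` induced by a map `V → A`. -/
def tensorMap (n : ℕ) : (⨂[F] _ : Fin n, V) →ₗ[F] SAlg F (BA F ℓ) n :=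
  PiTensorProduct.map fun _ => s.restrictScalars F

lemma tensorMap_tprod {n : ℕ} (v : Fin n → V) :
    tensorMap s n (PiTensorProduct.tprod F v) = pten F fun i => s (v i) :=
  PiTensorProduct.map_tprod _ _

lemma twistMap_tmul (t : ⨂[F] _ : Fin lam.card, V) (y : Specht F lam) :
    twistMap lam s (twistTmul t y) =
      wrSingle F (BA F ℓ) lam.card 1 (tensorMap s _ t) *
        permAlg F (BA F ℓ) lam.card (y : MonoidAlgebra F (Equiv.Perm (Fin lam.card))) := rfl

lemma twistMap_twistVec (g : V) (y : Specht F lam) :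
    twistMap lam s (twistVec lam g y) =
      wrSingle F (BA F ℓ) lam.card 1 (pten F fun _ => s g) *
        permAlg F (BA F ℓ) lam.card (y : MonoidAlgebra F (Equiv.Perm (Fin lam.card))) := by
  refine (twistMap_tmul s _ y).trans ?_
  rw [tensorMap_tprod]

variable {s} (hs : ∀ i v, s (pr F i v) = pr F i (s v))
include hs

lemma tensorMap_pr {n : ℕ} (i : ZMod 2) (t : ⨂[F] _ : Fin n, V) :
    tensorMap s n (pr F i t) = pr F i (tensorMap s n t) := by
  have h : tensorMap s n ∘ₗ pr F i = pr F i ∘ₗ tensorMap s n := by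
    refine ext_homog fun x v hv => ?_
    have h1 : pr F (∑ i, x i) (pten F fun i => s (v i)) = pten F fun i => s (v i) :=
      pr_tprod fun i => by rw [← hs, hv]
    rw [LinearMap.comp_apply, LinearMap.comp_apply, pr_of_homog (pr_tprod hv), tensorMap_tprod,
      pr_of_homog h1]
    split_ifs
    · exact tensorMap_tprod s v
    · exact map_zero _
  exact LinearMap.congr_fun h t

lemma tensorMap_sperm {n : ℕ} (w : Equiv.Perm (Fin n)) (t : ⨂[F] _ : Fin n, V) :
    tensorMap s n (sperm w t) = w • tensorMap s n t := by
  have h : tensorMap s n ∘ₗ sperm w = sperm w ∘ₗ tensorMap s n := by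
    refine ext_homog fun x v hv => ?_
    have h1 := perm_smul_pten w (a := fun i => s (v i)) (x := x) fun i => by rw [← hs, hv]
    rw [LinearMap.comp_apply, sperm_tprod w hv, map_smul, tensorMap_tprod]
    refine h1.symm.trans ?_
    exact congrArg (w • ·) (tensorMap_tprod s v).symm
  exact LinearMap.congr_fun h t

lemma tensorMap_sact {n : ℕ} (z : SAlg F (BA F ℓ) n) (t : ⨂[F] _ : Fin n, V) :
    tensorMap s n (sact z t) = z * tensorMap s n t := by
  have key : ∀ (x y : Fin n → ZMod 2) (a : Fin n → BA F ℓ) (v : Fin n → V),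
      (∀ i, pr F (x i) (a i) = a i) → (∀ i, pr F (y i) (v i) = v i) →
      tensorMap s n (sact (PiTensorProduct.tprod F a) (PiTensorProduct.tprod F v)) =
        sact (PiTensorProduct.tprod F a) (tensorMap s n (PiTensorProduct.tprod F v)) := by
    intro x y a v ha hv
    have h1 := pten_mul_pten (b := fun i => s (v i)) (y := y) ha fun i => by rw [← hs, hv]
    rw [sact_tprod ha hv, map_smul, tensorMap_tprod, tensorMap_tprod]
    simp only [map_smul]
    exact h1.symm
  have k1 : ∀ (x : Fin n → ZMod 2) (a : Fin n → BA F ℓ), (∀ i, pr F (x i) (a i) = a i) →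
      tensorMap s n ∘ₗ sact (PiTensorProduct.tprod F a) =
        sact (PiTensorProduct.tprod F a) ∘ₗ tensorMap s n :=
    fun x a ha => ext_homog fun y v hv => key x y a v ha hv
  have k2 : tensorMap s n ∘ₗ (sact (A := BA F ℓ)).flip t =
      (sact (A := BA F ℓ) (V := BA F ℓ)).flip (tensorMap s n t) :=
    ext_homog fun x a ha => LinearMap.congr_fun (k1 x a ha) t
  exact LinearMap.congr_fun k2 z

lemma twistMap_pr (i : ZMod 2) (m : Twist F V (spechtRep F lam)) :
    twistMap lam s (pr F i m) = pr F i (twistMap lam s m) := by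
  have h : twistMap lam s ∘ₗ pr F i = pr F i ∘ₗ twistMap lam s := by
    refine twist_ext fun t y => ?_
    change twistMap lam s (twistTmul (pr F i t) y) = pr F i (twistMap lam s (twistTmul t y))
    rw [twistMap_tmul, twistMap_tmul, tensorMap_pr hs, pr_single_mul_permAlg]
  exact LinearMap.congr_fun h m

lemma twistMap_smul (f : Wr F (BA F ℓ) lam.card) (m : Twist F V (spechtRep F lam)) :
    twistMap lam s (f • m) = f * twistMap lam s m := by
  induction f using wr_induction F with
  | h0 => rw [zero_smul, zero_mul, map_zero]
  | ha f g hf hg => rw [add_smul, add_mul, map_add, hf, hg]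
  | hs w z =>
    have h : twistMap lam s ∘ₗ Algebra.lsmul F F (Twist F V (spechtRep F lam))
        (SkewMonoidAlgebra.single w z : Wr F (BA F ℓ) lam.card) =
        LinearMap.mulLeft F (SkewMonoidAlgebra.single w z) ∘ₗ twistMap lam s := by
      refine twist_ext fun t y => ?_
      change twistMap lam s ((SkewMonoidAlgebra.single w z : Wr F (BA F ℓ) lam.card) •
        twistTmul t y) = SkewMonoidAlgebra.single w z * twistMap lam s (twistTmul t y)
      have h1 : (SkewMonoidAlgebra.single w z : Wr F (BA F ℓ) lam.card) • twistTmul t y =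
          twistTmul (sact z (sperm w t)) ((MonoidAlgebra.single w 1 :
            MonoidAlgebra F (Equiv.Perm (Fin lam.card))) • y) :=
        single_smul_twist F w z _
      refine (congrArg (twistMap lam s) h1).trans ?_
      rw [twistMap_tmul, twistMap_tmul, tensorMap_sact hs, tensorMap_sperm hs]
      have h2 : (((MonoidAlgebra.single w 1 : MonoidAlgebra F (Equiv.Perm (Fin lam.card))) • y :
          Specht F lam) : MonoidAlgebra F (Equiv.Perm (Fin lam.card))) =
          MonoidAlgebra.single w 1 *
            (y : MonoidAlgebra F (Equiv.Perm (Fin lam.card))) := rfl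
      rw [h2, map_mul (permAlg F (BA F ℓ) lam.card), permAlg_single, one_smul, ← mul_assoc,
        ← mul_assoc]
      congr 1
      change SkewMonoidAlgebra.single 1 _ * SkewMonoidAlgebra.single w 1 =
        SkewMonoidAlgebra.single w z * SkewMonoidAlgebra.single 1 _
      rw [SkewMonoidAlgebra.single_mul_single, SkewMonoidAlgebra.single_mul_single, one_smul,
        mul_one, one_mul, mul_one]
    exact LinearMap.congr_fun h m

end TwistGen

/-! ### The radical filtration and the idempotents of the wreath superproduct -/

section Filtration

variable {F : Type*} [Field F] {ℓ : ℕ} [NeZero ℓ] {d : ℕ}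

variable (F) in
/-- The basis elements of the wreath superproduct: a tensor product of paths times a
permutation. -/
def wordElt (c : Fin d → Slot ℓ) (w : Equiv.Perm (Fin d)) : Wr F (BA F ℓ) d :=
  wr F (fun i => path F (c i)) w

/-- The total length of a word of paths. -/
def wordDeg (c : Fin d → Slot ℓ) : ℕ := ∑ i, (c i).deg

/-- A pure tensor with a zero factor vanishes. -/
lemma wr_eq_zero (a : Fin d → BA F ℓ) (i : Fin d) (h : a i = 0) (w : Equiv.Perm (Fin d)) :
    wr F a w = 0 := by
  have h0 : pten F a = 0 := MultilinearMap.map_coord_zero (PiTensorProduct.tprod F) i h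
  rw [wr, h0, SkewMonoidAlgebra.single_zero]

/-- Up to signs and zeros, the words of paths times permutations are closed under products, and
lengths add. -/
lemma wordElt_mul_wordElt (c c' : Fin d → Slot ℓ) (w w' : Equiv.Perm (Fin d)) :
    ∃ (c'' : Fin d → Slot ℓ) (r : F), wordElt F c w * wordElt F c' w' = r • wordElt F c'' (w * w') ∧
      wordDeg c'' = wordDeg c + wordDeg c' ∨ wordElt F c w * wordElt F c' w' = 0 := by
  have h := wr_mul_wr (fun i => pr_path (F := F) (c i)) (fun i => pr_path (F := F) (c' i)) w w'
  by_cases h0 : ∃ i, path F (c i) * path F (c' (w.symm i)) = 0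
  · obtain ⟨i, hi⟩ := h0
    refine ⟨c, 0, Or.inr ?_⟩
    rw [wordElt, wordElt, h, wr_eq_zero _ i hi, smul_zero]
  · push Not at h0
    have h1 : ∀ i, ∃ δ : Slot ℓ, path F (c i) * path F (c' (w.symm i)) = path F δ ∧
        δ.deg = (c i).deg + (c' (w.symm i)).deg := fun i =>
      (path_mul_path (c i) (c' (w.symm i))).resolve_left (h0 i)
    choose c'' hc hdeg using h1
    refine ⟨c'', sg F (invExp w (fun i => (c' i).par) +
      chi (fun i => (c i).par) fun i => (c' (w.symm i)).par), Or.inl ⟨?_, ?_⟩⟩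
    · rw [wordElt, wordElt, h]
      simp only [hc]
      rfl
    · simp only [wordDeg, hdeg, Finset.sum_add_distrib]
      congr 1
      exact Equiv.sum_comp w.symm fun i => (c' i).deg

variable (F ℓ d) in
/-- The span of the words of length at least `k`. -/
def wordFil (k : ℕ) : Submodule F (Wr F (BA F ℓ) d) :=
  Submodule.span F {f | ∃ (c : Fin d → Slot ℓ) (w : Equiv.Perm (Fin d)),
    k ≤ wordDeg c ∧ f = wordElt F c w}

lemma wordElt_mem {k : ℕ} {c : Fin d → Slot ℓ} (h : k ≤ wordDeg c) (w : Equiv.Perm (Fin d)) :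
    wordElt F c w ∈ wordFil F ℓ d k :=
  Submodule.subset_span ⟨c, w, h, rfl⟩

lemma wordFil_zero : wordFil F ℓ d 0 = ⊤ := by
  rw [eq_top_iff]
  rintro f -
  rw [← sum_wrSingle_wrCoeff f]
  refine Submodule.sum_mem _ fun w _ => ?_
  rw [← sum_wordCoord (wrCoeff F (BA F ℓ) d w f), map_sum]
  refine Submodule.sum_mem _ fun c _ => ?_
  rw [map_smul]
  exact Submodule.smul_mem _ _ (wordElt_mem (Nat.zero_le _) w)

lemma wordFil_mul {j k : ℕ} {x y : Wr F (BA F ℓ) d} (hx : x ∈ wordFil F ℓ d j)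
    (hy : y ∈ wordFil F ℓ d k) : x * y ∈ wordFil F ℓ d (j + k) := by
  induction hx using Submodule.span_induction with
  | zero => rw [zero_mul]; exact Submodule.zero_mem _
  | add a b _ _ ha hb => rw [add_mul]; exact Submodule.add_mem _ ha hb
  | smul r a _ ha => rw [smul_mul_assoc]; exact Submodule.smul_mem _ _ ha
  | mem a ha =>
    obtain ⟨c, w, hc, rfl⟩ := ha
    induction hy using Submodule.span_induction with
    | zero => rw [mul_zero]; exact Submodule.zero_mem _
    | add a b _ _ ha hb => rw [mul_add]; exact Submodule.add_mem _ ha hb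
    | smul r a _ ha => rw [mul_smul_comm]; exact Submodule.smul_mem _ _ ha
    | mem a ha =>
      obtain ⟨c', w', hc', rfl⟩ := ha
      obtain ⟨c'', r, ⟨h1, h2⟩ | h1⟩ := wordElt_mul_wordElt (F := F) c c' w w'
      · rw [h1]
        exact Submodule.smul_mem _ _ (wordElt_mem (by omega) _)
      · rw [h1]; exact Submodule.zero_mem _

lemma slot_deg_le (β : Slot ℓ) : β.deg ≤ 2 := by
  obtain ⟨j, i⟩ := β
  fin_cases i <;> simp [Slot.deg]

lemma wordFil_eq_bot : wordFil F ℓ d (2 * d + 1) = ⊥ := by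
  rw [wordFil, Submodule.span_eq_bot]
  rintro _ ⟨c, w, hc, -⟩
  have : wordDeg c ≤ ∑ _i : Fin d, 2 := Finset.sum_le_sum fun i _ => slot_deg_le (c i)
  simp at this
  omega

lemma pr_wordElt (c : Fin d → Slot ℓ) (w : Equiv.Perm (Fin d)) :
    pr F (∑ i, (c i).par) (wordElt F c w) = wordElt F c w :=
  pr_wr F (fun i => pr_path (c i)) w

lemma pr_mem_wordFil (k : ℕ) (i : ZMod 2) {x : Wr F (BA F ℓ) d} (hx : x ∈ wordFil F ℓ d k) :
    pr F i x ∈ wordFil F ℓ d k := by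
  induction hx using Submodule.span_induction with
  | zero => rw [map_zero]; exact Submodule.zero_mem _
  | add a b _ _ ha hb => rw [map_add]; exact Submodule.add_mem _ ha hb
  | smul r a _ ha => rw [map_smul]; exact Submodule.smul_mem _ _ ha
  | mem a ha =>
    obtain ⟨c, w, hc, rfl⟩ := ha
    rw [pr_of_homog (pr_wordElt c w)]
    split_ifs
    · exact wordElt_mem hc w
    · exact Submodule.zero_mem _

lemma mem_wordFil_zero (x : Wr F (BA F ℓ) d) : x ∈ wordFil F ℓ d 0 := by
  rw [wordFil_zero]; trivial

variable (F ℓ d) in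
/-- The filtration by the length of words. -/
def wordChain : RadChain F (Wr F (BA F ℓ) d) where
  I := wordFil F ℓ d
  one_mem := mem_wordFil_zero _
  mul_mem k x y hx hy := by rw [add_comm]; exact wordFil_mul hx hy
  length := 2 * d + 1
  eq_bot := wordFil_eq_bot
  mul_right_mem x y hx := wordFil_mul (k := 0) hx (mem_wordFil_zero y)
  pr_mem i x hx := pr_mem_wordFil 1 i hx

lemma mul_mem_wordFil (x : Wr F (BA F ℓ) d) {y : Wr F (BA F ℓ) d} {k : ℕ}
    (hy : y ∈ wordFil F ℓ d k) : x * y ∈ wordFil F ℓ d k := by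
  have := wordFil_mul (mem_wordFil_zero x) hy
  rwa [zero_add] at this

lemma mem_wordFil_mul {x : Wr F (BA F ℓ) d} (y : Wr F (BA F ℓ) d) {k : ℕ}
    (hx : x ∈ wordFil F ℓ d k) : x * y ∈ wordFil F ℓ d k :=
  wordFil_mul (k := 0) hx (mem_wordFil_zero y)

lemma finite_wr : Module.Finite F (Wr F (BA F ℓ) d) := by
  classical
  refine ⟨⟨(Finset.univ : Finset ((Fin d → Slot ℓ) × Equiv.Perm (Fin d))).image
    (fun p => wordElt F p.1 p.2), ?_⟩⟩
  rw [eq_top_iff, ← wordFil_zero]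
  refine Submodule.span_le.2 ?_
  rintro _ ⟨c, w, -, rfl⟩
  exact Submodule.subset_span (by simp)

/-! Idempotents. -/

variable (F) in
/-- The idempotent `e_{T(1)} ⊗ ⋯ ⊗ e_{T(d)}`. -/
def wordIdem (T : Fin d → Fin ℓ) : Wr F (BA F ℓ) d := wr F (fun i => gen F (.e (T i))) 1

lemma pr_gen_e (j : Fin ℓ) : pr F 0 (gen F (.e j)) = gen F (.e j) := pr_gen F ℓ (.e j)

/-- A word of paths survives multiplication by `e_T` from the left if its end vertices are given by
`T`. -/
lemma wordIdem_mul_wordElt (T : Fin d → Fin ℓ) (c : Fin d → Slot ℓ) (w : Equiv.Perm (Fin d)) :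
    wordIdem F T * wordElt F c w = if ∀ i, (c i).tgt = T i then wordElt F c w else 0 := by
  rw [wordIdem, wordElt, wr_mul_wr (x := 0) (fun i => pr_gen_e _) fun i => pr_path (c i),
    invExp_one, chi_zero_left, add_zero, sg_zero, one_smul, one_mul]
  have h1 : ∀ i, (1 : Equiv.Perm (Fin d)).symm i = i := fun _ => rfl
  simp only [h1, e_mul_path]
  split_ifs with h
  · simp only [h, if_true]
  · push Not at h
    obtain ⟨i, hi⟩ := h
    exact wr_eq_zero _ i (if_neg hi) w

/-- A word of paths times `w` survives multiplication by `e_T` from the right if its start vertices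
are given by `T ∘ w⁻¹`. -/
lemma wordElt_mul_wordIdem (T : Fin d → Fin ℓ) (c : Fin d → Slot ℓ) (w : Equiv.Perm (Fin d)) :
    wordElt F c w * wordIdem F T =
      if ∀ i, (c i).1 = T (w.symm i) then wordElt F c w else 0 := by
  have h0 : invExp w (0 : Fin d → ZMod 2) = 0 := by simp [invExp]
  have h1 := wr_mul_wr (y := 0) (fun i => pr_path (F := F) (c i))
    (b := fun i => gen F (.e (T i))) (fun i => pr_gen_e _) w 1
  have h2 : (fun i => (0 : Fin d → ZMod 2) (w.symm i)) = 0 := rfl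
  rw [h0, h2, chi_zero_right, add_zero, sg_zero, one_smul, mul_one] at h1
  rw [wordIdem, wordElt, h1]
  simp only [path_mul_e]
  split_ifs with h
  · simp only [h, if_true]
  · push Not at h
    obtain ⟨i, hi⟩ := h
    exact wr_eq_zero _ i (if_neg hi) w

lemma wordIdem_eq (T : Fin d → Fin ℓ) : wordIdem F T = wordElt F (fun i => (T i, 0)) 1 := rfl

lemma wordIdem_mul_wordIdem (S T : Fin d → Fin ℓ) :
    wordIdem F S * wordIdem F T = if T = S then wordIdem F T else 0 := by
  rw [wordIdem_eq T, wordIdem_mul_wordElt]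
  simp only [funext_iff]
  rfl

lemma sum_wordIdem : ∑ T : Fin d → Fin ℓ, wordIdem F T = 1 := by
  have h := MultilinearMap.map_sum (PiTensorProduct.tprod F)
    fun (_ : Fin d) (j : Fin ℓ) => gen F (.e j)
  simp only [sum_gen_e] at h
  have h1 : ∑ T : Fin d → Fin ℓ, wordIdem F T =
      wrSingle F (BA F ℓ) d 1 (∑ T : Fin d → Fin ℓ, pten F fun i => gen F (.e (T i))) := by
    rw [map_sum]; rfl
  rw [h1]
  exact congrArg (wrSingle F (BA F ℓ) d 1) h.symm

lemma single_mul_wordIdem (w : Equiv.Perm (Fin d)) (T : Fin d → Fin ℓ) :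
    (SkewMonoidAlgebra.single w 1 : Wr F (BA F ℓ) d) * wordIdem F T =
      wordIdem F (fun i => T (w.symm i)) * SkewMonoidAlgebra.single w 1 := by
  rw [wordIdem, wr, SkewMonoidAlgebra.single_mul_single, wordIdem, wr,
    SkewMonoidAlgebra.single_mul_single, perm_smul_pten (x := 0) w fun i => pr_gen_e _]
  simp [invExp]

lemma wordIdem_mul_single (w : Equiv.Perm (Fin d)) (T : Fin d → Fin ℓ) :
    wordIdem F T * SkewMonoidAlgebra.single w 1 = wordElt F (fun i => (T i, 0)) w := by
  rw [wordIdem, wr, SkewMonoidAlgebra.single_mul_single, one_smul, mul_one, one_mul]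
  rfl

lemma wordDeg_eq_zero_iff (c : Fin d → Slot ℓ) : wordDeg c = 0 ↔ ∀ i, c i = ((c i).1, 0) := by
  rw [wordDeg, Finset.sum_eq_zero_iff]
  have h : ∀ β : Slot ℓ, β.deg = 0 ↔ β = (β.1, 0) := by
    rintro ⟨j, i⟩
    fin_cases i <;> simp [Slot.deg]
  simp [h]

/-- Modulo the radical, the space `e_S W e_T` is spanned by permutations that map the word `T` to
the word `S`. -/
lemma exists_corner (S T : Fin d → Fin ℓ) (x : Wr F (BA F ℓ) d) :
    ∃ γ : MonoidAlgebra F (Equiv.Perm (Fin d)),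
      (∀ w, γ.coeff w ≠ 0 → ∀ i, S i = T (w.symm i)) ∧
      wordIdem F S * x * wordIdem F T - wordIdem F S * permAlg F (BA F ℓ) d γ ∈
        wordFil F ℓ d 1 := by
  have hx := mem_wordFil_zero x
  induction hx using Submodule.span_induction with
  | zero => exact ⟨0, fun w h => absurd rfl h, by simp⟩
  | add a b _ _ ha hb =>
    obtain ⟨γ, h1, h2⟩ := ha
    obtain ⟨γ', h1', h2'⟩ := hb
    refine ⟨γ + γ', fun w h => ?_, ?_⟩
    · by_cases h0 : γ.coeff w = 0
      · refine h1' w fun h0' => h ?_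
        rw [MonoidAlgebra.coeff_add, Finsupp.add_apply, h0, h0', add_zero]
      · exact h1 w h0
    · have := Submodule.add_mem _ h2 h2'
      rw [mul_add, add_mul, map_add, mul_add]
      convert this using 1
      abel
  | smul r a _ ha =>
    obtain ⟨γ, h1, h2⟩ := ha
    refine ⟨r • γ, fun w h => h1 w fun h0 => h ?_, ?_⟩
    · rw [MonoidAlgebra.coeff_smul, Finsupp.smul_apply, h0, smul_zero]
    · have := Submodule.smul_mem _ r h2
      rw [smul_sub] at this
      rwa [mul_smul_comm, smul_mul_assoc, map_smul, mul_smul_comm]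
  | mem a ha =>
    obtain ⟨c, w, -, rfl⟩ := ha
    rw [wordIdem_mul_wordElt]
    by_cases h1 : ∀ i, (c i).tgt = S i
    swap
    · refine ⟨0, fun w h => absurd rfl h, ?_⟩
      rw [if_neg h1, zero_mul, map_zero, mul_zero, sub_zero]
      exact Submodule.zero_mem _
    rw [if_pos h1, wordElt_mul_wordIdem]
    by_cases h2 : ∀ i, (c i).1 = T (w.symm i)
    swap
    · refine ⟨0, fun w h => absurd rfl h, ?_⟩
      rw [if_neg h2, map_zero, mul_zero, sub_zero]
      exact Submodule.zero_mem _
    rw [if_pos h2]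
    by_cases h3 : wordDeg c = 0
    · have h4 := (wordDeg_eq_zero_iff c).1 h3
      have h5 : ∀ i, (c i).1 = S i := fun i => by rw [← h1 i, h4 i]; rfl
      refine ⟨MonoidAlgebra.single w 1, fun u hu => ?_, ?_⟩
      · have hwu : w = u := by
          by_contra hne
          apply hu
          rw [MonoidAlgebra.coeff_single, Finsupp.single_apply, if_neg hne]
        subst hwu
        exact fun i => (h5 i).symm.trans (h2 i)
      · rw [permAlg_single, one_smul, wordIdem_mul_single]
        have : c = fun i => (S i, 0) := funext fun i => by rw [h4 i, h5 i]
        rw [this, sub_self]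
        exact Submodule.zero_mem _
    · refine ⟨0, fun w h => absurd rfl h, ?_⟩
      rw [map_zero, mul_zero, sub_zero]
      exact wordElt_mem (by omega) w

end Filtration

section BlockWord

variable {ℓ d : ℕ} {n : Fin ℓ → ℕ} (hn : ∑ j, n j = d)

/-- The word `0 ⋯ 0 1 ⋯ 1 ⋯` with `n j` letters `j`. -/
def blockWord (i : Fin d) : Fin ℓ := ((blockEquiv n hn).symm i).1

@[simp] lemma blockWord_blockEquiv (x : Σ j, Fin (n j)) :
    blockWord hn (blockEquiv n hn x) = x.1 := by
  simp [blockWord]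

lemma blockWord_blockPerm (w : ∀ j, Equiv.Perm (Fin (n j))) (i : Fin d) :
    blockWord hn (blockPerm n hn w i) = blockWord hn i := by
  obtain ⟨x, rfl⟩ := (blockEquiv n hn).surjective i
  rw [blockPerm_apply, blockWord_blockEquiv, blockWord_blockEquiv]

lemma blockWord_blockPerm_symm (w : ∀ j, Equiv.Perm (Fin (n j))) (i : Fin d) :
    blockWord hn ((blockPerm n hn w).symm i) = blockWord hn i := by
  rw [← blockWord_blockPerm hn w, Equiv.apply_symm_apply]

/-- The stabilizer of the word `0 ⋯ 0 1 ⋯ 1 ⋯` is the Young subgroup. -/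
lemma exists_blockPerm {w : Equiv.Perm (Fin d)} (h : ∀ i, blockWord hn (w i) = blockWord hn i) :
    ∃ u, blockPerm n hn u = w := by
  let σ : Equiv.Perm (Σ j, Fin (n j)) := (blockEquiv n hn).symm.permCongr w
  have hσ : ∀ x, (σ x).1 = x.1 := by
    intro x
    have := h (blockEquiv n hn x)
    rw [blockWord_blockEquiv] at this
    exact this
  have hσ' : ∀ x, (σ.symm x).1 = x.1 := fun x => by
    rw [← hσ (σ.symm x), Equiv.apply_symm_apply]
  let f : ∀ (τ : (Σ j, Fin (n j)) → (Σ j, Fin (n j))), (∀ x, (τ x).1 = x.1) → ∀ j,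
      Fin (n j) → Fin (n j) := fun τ hτ j a =>
    Fin.cast (congrArg n (hτ ⟨j, a⟩)) (τ ⟨j, a⟩).2
  have hf : ∀ τ (hτ : ∀ x, (τ x).1 = x.1) (j : Fin ℓ) (a : Fin (n j)),
      (⟨j, f τ hτ j a⟩ : Σ j, Fin (n j)) = τ ⟨j, a⟩ := by
    intro τ hτ j a
    have h1 : ∀ (y : Σ j, Fin (n j)) (hy : y.1 = j),
        (⟨j, Fin.cast (congrArg n hy) y.2⟩ : Σ j, Fin (n j)) = y := by
      rintro ⟨i, b⟩ rfl; rfl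
    exact h1 (τ ⟨j, a⟩) (hτ ⟨j, a⟩)
  have hinv : ∀ (τ τ' : (Σ j, Fin (n j)) → (Σ j, Fin (n j))) (hτ : ∀ x, (τ x).1 = x.1)
      (hτ' : ∀ x, (τ' x).1 = x.1), (∀ x, τ' (τ x) = x) → ∀ j a, f τ' hτ' j (f τ hτ j a) = a := by
    intro τ τ' hτ hτ' hinv j a
    have h1 := hf τ' hτ' j (f τ hτ j a)
    rw [hf τ hτ j a, hinv] at h1
    exact eq_of_heq (Sigma.mk.inj h1).2
  refine ⟨fun j => ⟨f σ hσ j, f σ.symm hσ' j,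
    hinv σ σ.symm hσ hσ' (fun x => σ.symm_apply_apply x) j,
    hinv σ.symm σ hσ' hσ (fun x => σ.apply_symm_apply x) j⟩, ?_⟩
  ext i
  obtain ⟨x, rfl⟩ := (blockEquiv n hn).surjective i
  rw [blockPerm_apply]
  congr 1
  change blockEquiv n hn ⟨x.1, f σ hσ x.1 x.2⟩ = _
  rw [hf σ hσ]
  simp [σ]

end BlockWord

section BlockIdem

variable {F : Type*} [Field F] {ℓ : ℕ} [NeZero ℓ] {d : ℕ} {n : Fin ℓ → ℕ} (hn : ∑ j, n j = d)

/-- The group algebra of the Young subgroup inside the wreath superproduct. -/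
def youngAlg : MonoidAlgebra F (∀ j, Equiv.Perm (Fin (n j))) →ₐ[F] Wr F (BA F ℓ) d :=
  (permAlg F (BA F ℓ) d).comp (blockAlg hn F)

lemma youngAlg_single (w : ∀ j, Equiv.Perm (Fin (n j))) (r : F) :
    youngAlg (ℓ := ℓ) hn (MonoidAlgebra.single w r) =
      r • SkewMonoidAlgebra.single (blockPerm n hn w) 1 := by
  rw [youngAlg, AlgHom.comp_apply, blockAlg_single, permAlg_single]

lemma youngAlg_commute (y : MonoidAlgebra F (∀ j, Equiv.Perm (Fin (n j)))) :
    youngAlg hn y * wordIdem F (blockWord hn) = wordIdem F (blockWord hn) * youngAlg hn y := by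
  have h := (grpBasis F (∀ j, Equiv.Perm (Fin (n j)))).sum_repr y
  rw [← h, map_sum, Finset.sum_mul, Finset.mul_sum]
  refine Finset.sum_congr rfl fun w _ => ?_
  have h1 : grpBasis F (∀ j, Equiv.Perm (Fin (n j))) w = MonoidAlgebra.single w 1 := rfl
  rw [h1, map_smul, smul_mul_assoc, mul_smul_comm, youngAlg_single, one_smul, single_mul_wordIdem]
  simp only [blockWord_blockPerm_symm]

lemma pr_youngAlg (y : MonoidAlgebra F (∀ j, Equiv.Perm (Fin (n j)))) :
    pr F 0 (youngAlg (ℓ := ℓ) hn y) = youngAlg hn y := by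
  have h := pr_single_mul_permAlg (A := BA F ℓ) 0 1 (blockAlg hn F y)
  rw [one_homog] at h
  have h1 : wrSingle F (BA F ℓ) d 1 1 = 1 := rfl
  rw [h1, one_mul] at h
  exact h

/-- The idempotent `e_T y` of the wreath superproduct, where `T = 0 ⋯ 0 1 ⋯ 1 ⋯` and `y` belongs to
the group algebra of the stabilizer of `T`. -/
def blockIdem (y : MonoidAlgebra F (∀ j, Equiv.Perm (Fin (n j)))) : Wr F (BA F ℓ) d :=
  wordIdem F (blockWord hn) * youngAlg hn y

lemma blockIdem_mul (y y' : MonoidAlgebra F (∀ j, Equiv.Perm (Fin (n j)))) :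
    blockIdem hn y * blockIdem hn y' = blockIdem hn (y * y') := by
  rw [blockIdem, blockIdem, mul_assoc, ← mul_assoc (youngAlg hn y), youngAlg_commute, mul_assoc,
    ← mul_assoc (wordIdem F (blockWord hn)), wordIdem_mul_wordIdem, if_pos rfl, ← map_mul]
  rfl

lemma conj_blockIdem (x y z : MonoidAlgebra F (∀ j, Equiv.Perm (Fin (n j)))) :
    youngAlg (ℓ := ℓ) hn (x * y * z) * wordIdem F (blockWord hn) =
      youngAlg hn x * blockIdem hn y * youngAlg hn z := by
  rw [map_mul, map_mul, mul_assoc, youngAlg_commute, blockIdem, ← youngAlg_commute (y := y)]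
  simp only [mul_assoc]

lemma pr_wordIdem (T : Fin d → Fin ℓ) : pr F 0 (wordIdem F T) = wordIdem F T := by
  have h := pr_wr F (x := 0) (a := fun i => gen F (.e (T i))) (fun i => pr_gen_e _) 1
  simpa [wordIdem] using h

lemma pr_blockIdem (y : MonoidAlgebra F (∀ j, Equiv.Perm (Fin (n j)))) :
    pr F 0 (blockIdem (ℓ := ℓ) hn y) = blockIdem hn y := by
  have := smul_homog (pr_wordIdem (blockWord hn)) (pr_youngAlg (ℓ := ℓ) (F := F) hn y)
  rwa [add_zero] at this

/-- Modulo the radical, `(e_T y) W (e_T y')` is the space `y FY y'`, where `Y` is the Young subgroup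
stabilizing `T`. -/
lemma exists_block_corner (y y' : MonoidAlgebra F (∀ j, Equiv.Perm (Fin (n j))))
    (x : Wr F (BA F ℓ) d) : ∃ γ, blockIdem hn y * x * blockIdem hn y' -
      blockIdem hn (y * γ * y') ∈ wordFil F ℓ d 1 := by
  obtain ⟨γ, h1, h2⟩ := exists_corner (F := F) (blockWord hn) (blockWord hn) x
  have hγ : ∃ γ', blockAlg hn F γ' = γ := by
    have hγ := (grpBasis F (Equiv.Perm (Fin d))).sum_repr γ
    have hex : ∀ w, ∃ u, blockAlg hn F u =
        (grpBasis F (Equiv.Perm (Fin d))).repr γ w • grpBasis F (Equiv.Perm (Fin d)) w := by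
      intro w
      have hb : grpBasis F (Equiv.Perm (Fin d)) w = MonoidAlgebra.single w 1 := rfl
      have hr : (grpBasis F (Equiv.Perm (Fin d))).repr γ w = γ.coeff w := rfl
      rw [hb, hr]
      by_cases h0 : γ.coeff w = 0
      · exact ⟨0, by rw [h0, zero_smul, map_zero]⟩
      · obtain ⟨u, rfl⟩ := exists_blockPerm hn (w := w) fun i => by
          have := h1 w h0 (w i)
          rwa [Equiv.symm_apply_apply] at this
        refine ⟨γ.coeff (blockPerm n hn u) • MonoidAlgebra.single u 1, ?_⟩
        rw [map_smul, blockAlg_single]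
    choose u hu using hex
    exact ⟨∑ w, u w, by rw [map_sum, ← hγ]; exact Finset.sum_congr rfl fun w _ => hu w⟩
  obtain ⟨γ', rfl⟩ := hγ
  refine ⟨γ', ?_⟩
  have h3 := mem_wordFil_mul (youngAlg hn y') (mul_mem_wordFil (youngAlg hn y) h2)
  convert h3 using 1
  have e1 : blockIdem (ℓ := ℓ) hn y = youngAlg hn y * wordIdem F (blockWord hn) :=
    (youngAlg_commute hn y).symm
  have e2 : blockIdem (ℓ := ℓ) hn (y * γ' * y') =
      youngAlg hn y * (wordIdem F (blockWord hn) * youngAlg hn γ') * youngAlg hn y' := by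
    rw [blockIdem, map_mul, map_mul, ← mul_assoc, ← mul_assoc, ← youngAlg_commute]
    simp only [mul_assoc]
  have e3 : youngAlg (ℓ := ℓ) hn γ' = permAlg F (BA F ℓ) d (blockAlg hn F γ') := rfl
  rw [e2, e1, blockIdem, e3]
  simp only [mul_sub, sub_mul, mul_assoc]

variable (F) in
/-- The idempotent of the wreath superproduct attached to a multipartition. -/
def multiIdem (mu : ∀ j, Shape (n j)) : Wr F (BA F ℓ) d := blockIdem hn (famId F mu)

lemma splitFamily_famId (h2 : (2 : F) ≠ 0) (hF : ∀ j, ((n j).factorial : F) ≠ 0) :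
    SplitFamily (fun mu : ∀ j, Shape (n j) => famId F mu) :=
  splitFamily_box fun j => splitFamily_yId h2 (hF j)

/-- The corner of the idempotent of a multipartition is one-dimensional modulo the radical, because
`famId F mu` is a primitive idempotent of the group algebra of the Young subgroup. -/
lemma exists_isLocalIdem (h2 : (2 : F) ≠ 0) (hF : ∀ j, ((n j).factorial : F) ≠ 0)
    (mu : ∀ j, Shape (n j)) :
    ∃ φ, IsLocalIdem (wordChain F ℓ d) (multiIdem F hn mu) φ := by
  have hs := splitFamily_famId h2 hF
  have hex : ∀ x, ∃ r : F, multiIdem F hn mu * x * multiIdem F hn mu - r • multiIdem F hn mu ∈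
      wordFil F ℓ d 1 := by
    intro x
    obtain ⟨γ, h⟩ := exists_block_corner hn (famId F mu) (famId F mu) x
    obtain ⟨r, hr⟩ := hs.scal mu γ
    refine ⟨r, ?_⟩
    have e : blockIdem (ℓ := ℓ) hn (famId F mu * γ * famId F mu) = r • multiIdem F hn mu := by
      rw [show famId F mu * γ * famId F mu = r • famId F mu from hr, blockIdem, map_smul,
        mul_smul_comm]
      rfl
    rwa [e] at h
  choose φ hφ using hex
  refine ⟨φ, ?_, pr_blockIdem hn _, hφ⟩
  rw [multiIdem, blockIdem_mul, famId_idem F mu hF]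

/-- If the idempotents `e_T famId` of all families of partitions kill a submodule, so does `e_T`, by
completeness. -/
lemma wordIdem_smul_eq_zero (h2 : (2 : F) ≠ 0) (hF : ∀ j, ((n j).factorial : F) ≠ 0)
    {L : Type*} [AddCommGroup L] [Module (Wr F (BA F ℓ) d) L]
    (U : Submodule (Wr F (BA F ℓ) d) L)
    (h : ∀ nu : ∀ j, Shape (n j), ∀ u ∈ U, blockIdem hn (famId F nu) • u = 0) {u : L}
    (hu : u ∈ U) : wordIdem F (blockWord hn) • u = 0 := by
  obtain ⟨a, ha⟩ := (splitFamily_famId h2 hF).complete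
  have h1 : wordIdem F (blockWord (ℓ := ℓ) hn) = ∑ nu, a nu • ∑ g,
      youngAlg hn (MonoidAlgebra.single g 1) * blockIdem hn (famId F nu) *
        youngAlg hn (MonoidAlgebra.single g⁻¹ 1) := by
    have h0 := congrArg (fun t => youngAlg hn t * wordIdem F (blockWord (ℓ := ℓ) hn)) ha
    simp only [map_sum, map_smul, map_one, one_mul, Finset.sum_mul, smul_mul_assoc] at h0
    refine h0.symm.trans (Finset.sum_congr rfl fun nu _ => congrArg (a nu • ·) ?_)
    exact Finset.sum_congr rfl fun g _ => conj_blockIdem hn _ _ _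
  rw [h1, Finset.sum_smul]
  refine Finset.sum_eq_zero fun nu _ => ?_
  have h3 : ∀ x : Wr F (BA F ℓ) d, x • u = 0 → (a nu • x) • u = 0 := fun x hx => by
    rw [Algebra.smul_def, mul_smul, hx, smul_zero]
  refine h3 _ ?_
  rw [Finset.sum_smul]
  refine Finset.sum_eq_zero fun g _ => ?_
  rw [mul_smul, mul_smul, h nu _ (U.smul_mem _ hu), smul_zero]

/-- A supermodule generated by a vector that is fixed by the idempotent of a multipartition and
killed by the radical is irreducible: that idempotent maps a subsupermodule to `F v`, and a
subsupermodule that it kills is killed by all idempotents of the splitting family. -/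
lemma isIrred_of_generator (h2 : (2 : F) ≠ 0) (hF : ∀ j, ((n j).factorial : F) ≠ 0)
    (mu : ∀ j, Shape (n j)) {L : Type*} [AddCommGroup L] [Module F L]
    [Module (Wr F (BA F ℓ) d) L] [IsScalarTower F (Wr F (BA F ℓ) d) L] [SuperSpace F L]
    {v : L} (hv : v ≠ 0) (hgen : ∀ u : L, ∃ x : Wr F (BA F ℓ) d, x • v = u)
    (hfix : multiIdem F hn mu • v = v)
    (hrad : ∀ x ∈ wordFil F ℓ d 1, x • v = 0) : IsIrred F (Wr F (BA F ℓ) d) L := by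
  have hs := splitFamily_famId h2 hF
  obtain ⟨φ, hφ⟩ := exists_isLocalIdem (ℓ := ℓ) hn h2 hF mu
  rw [isIrred_iff]
  refine ⟨⟨v, hv⟩, fun U => ?_⟩
  by_cases hU : ∃ u ∈ U.toSubmodule, multiIdem F hn mu • u ≠ 0
  · right
    obtain ⟨u, hu, hne⟩ := hU
    obtain ⟨x, rfl⟩ := hgen u
    have h1 : multiIdem F hn mu • x • v = φ x • v := by
      have h3 := hrad _ (hφ.corner x)
      rw [sub_smul, sub_eq_zero, mul_smul, mul_smul, hfix, smul_assoc, hfix] at h3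
      exact h3
    have h0 : φ x ≠ 0 := by
      intro h0
      rw [h1, h0, zero_smul] at hne
      exact hne rfl
    have hvU : v ∈ U.toSubmodule := by
      have h3 := U.toSubmodule.smul_mem (multiIdem F hn mu) hu
      rw [h1] at h3
      have h4 := Submodule.smul_of_tower_mem U.toSubmodule (φ x)⁻¹ h3
      rwa [smul_smul, inv_mul_cancel₀ h0, one_smul] at h4
    rw [eq_top_iff]
    rintro u -
    obtain ⟨x, rfl⟩ := hgen u
    exact U.toSubmodule.smul_mem x hvU
  · left
    push Not at hU
    have hfixT : wordIdem F (blockWord hn) • v = v := by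
      conv_lhs => rw [← hfix]
      rw [multiIdem, blockIdem, smul_smul, ← mul_assoc, wordIdem_mul_wordIdem, if_pos rfl]
      exact hfix
    have hfixE : youngAlg hn (famId F mu) • v = v := by
      conv_lhs => rw [← hfixT]
      rw [smul_smul, youngAlg_commute]
      exact hfix
    -- The idempotent of `mu` kills `U` by assumption, those of the other families kill all of `W v`
    -- by orthogonality; hence `e_T` kills `U`.
    have hT : ∀ u ∈ U.toSubmodule, wordIdem F (blockWord hn) • u = 0 := by
      intro u hu
      have hnu : ∀ nu : ∀ j, Shape (n j), ∀ u ∈ U.toSubmodule,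
          blockIdem hn (famId F nu) • u = 0 := by
        intro nu u hu
        by_cases hne : nu = mu
        · rw [hne]; exact hU u hu
        · obtain ⟨x, rfl⟩ := hgen u
          obtain ⟨γ, hγ⟩ := exists_block_corner (ℓ := ℓ) hn (famId F nu) (famId F mu) x
          have h3 := hrad _ hγ
          have h4 : famId F nu * γ * famId F mu = 0 := hs.orth nu mu hne γ
          have h5 : blockIdem (ℓ := ℓ) hn (famId F nu * γ * famId F mu) = 0 := by
            rw [h4, blockIdem, map_zero, mul_zero]
          rw [h5, sub_zero] at h3
          calc blockIdem hn (famId F nu) • x • v =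
              blockIdem hn (famId F nu) • x • multiIdem F hn mu • v := by
                exact congrArg (fun t => blockIdem hn (famId F nu) • x • t) hfix.symm
            _ = (blockIdem hn (famId F nu) * x * blockIdem hn (famId F mu)) • v := by
                rw [mul_smul, mul_smul]; rfl
            _ = 0 := h3
      exact wordIdem_smul_eq_zero hn h2 hF U.toSubmodule hnu hu
    rw [eq_bot_iff]
    intro u hu
    -- `e_S` is zero on `W v`, or `S` is a rearrangement of `T` and `e_S` is conjugate to `e_T`.
    have h1 : u = ∑ S : Fin d → Fin ℓ, wordIdem F S • u := by
      rw [← Finset.sum_smul, sum_wordIdem, one_smul]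
    rw [Submodule.mem_bot, h1]
    refine Finset.sum_eq_zero fun S _ => ?_
    obtain ⟨x, hx⟩ := hgen u
    obtain ⟨γ, hγ1, hγ2⟩ := exists_corner (F := F) S (blockWord hn) x
    have h3 := hrad _ hγ2
    rw [sub_smul, sub_eq_zero, mul_smul, mul_smul, hfixT, hx] at h3
    by_cases h0 : γ = 0
    · rw [h3, h0, map_zero, mul_zero, zero_smul]
    · obtain ⟨w, hw⟩ : ∃ w, γ.coeff w ≠ 0 := by
        by_contra! hall
        exact h0 (MonoidAlgebra.ext (Finsupp.ext hall))
      have hS : S = fun i => blockWord hn (w.symm i) := funext (hγ1 w hw)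
      have h4 : wordIdem F S = SkewMonoidAlgebra.single w 1 * wordIdem F (blockWord hn) *
          SkewMonoidAlgebra.single w⁻¹ 1 := by
        rw [single_mul_wordIdem, ← hS, mul_assoc, SkewMonoidAlgebra.single_mul_single, smul_one,
          mul_one, mul_inv_cancel]
        exact (mul_one _).symm
      rw [h4, mul_smul, mul_smul, hT _ (U.toSubmodule.smul_mem _ hu), smul_zero]

end BlockIdem

/-! ### The supermodules `P(λ)` and `L(λ)` -/

section CircTwist

variable {F : Type*} [Field F] {ℓ : ℕ} [NeZero ℓ] {d : ℕ} (mu : Multipartition ℓ d)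

/-- The parts of a multipartition as shapes. -/
def Multipartition.shape (j : Fin ℓ) : Shape (mu.part j).card := ⟨mu.part j, rfl⟩

variable (F) in
/-- The idempotent of the wreath superproduct attached to a multipartition. -/
def cartanIdem : Wr F (BA F ℓ) d := multiIdem F mu.sum_card mu.shape

lemma cartanIdem_eq_joinWr : cartanIdem F mu = joinWr mu.sum_card (fun j =>
    wrSingle F (BA F ℓ) (mu.part j).card 1 (pten F fun _ => gen F (.e j)) *
      permAlg F (BA F ℓ) (mu.part j).card (yId F (mu.shape j))) := by
  rw [joinWr_single_mul_permAlg mu.sum_card (fun j _ => gen F (.e j))]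
  rfl

variable {V : Fin ℓ → Type*} [∀ j, AddCommGroup (V j)] [∀ j, Module F (V j)]
  [∀ j, Module (BA F ℓ) (V j)] [∀ j, IsScalarTower F (BA F ℓ) (V j)] [∀ j, SuperSpace F (V j)]
  [∀ j, SuperModule F (BA F ℓ) (V j)]

variable (F) in
/-- The vector of `V_0(μ⁽⁰⁾) ∘ ⋯ ∘ V_{ℓ-1}(μ⁽ℓ⁻¹⁾)` given by vectors `g_j` of `V_j`. -/
def circVec (g : ∀ j, V j) : Circ F (BA F ℓ) (fun j => (mu.part j).card) mu.sum_card
    (fun j => Twist F (V j) (spechtRep F (mu.part j))) :=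
  circMk mu.sum_card (1 ⊗ₜ[F] PiTensorProduct.tprod F fun j =>
    twistVec (mu.part j) (g j) (spechtGen (mu.part j) F))

variable {g : ∀ j, V j} (hg : ∀ j, pr F 0 (g j) = g j)
include hg

lemma exists_smul_circVec (hF : ∀ j, ((mu.part j).card.factorial : F) ≠ 0)
    (hgen : ∀ j (v : V j), ∃ a : BA F ℓ, a • g j = v)
    (c : Circ F (BA F ℓ) (fun j => (mu.part j).card) mu.sum_card
      (fun j => Twist F (V j) (spechtRep F (mu.part j)))) :
    ∃ x : Wr F (BA F ℓ) d, x • circVec F mu g = c :=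
  exists_smul_circMk mu.sum_card (fun j => pr_twistVec (hg j) _)
    (fun j m => exists_smul_twistVec (hF j) (hg j) (hgen j) m) c

lemma cartanIdem_smul_circVec (hF : ∀ j, ((mu.part j).card.factorial : F) ≠ 0)
    (he : ∀ j, gen F (.e j) • g j = g j) : cartanIdem F mu • circVec F mu g = circVec F mu g := by
  have h1 : ∀ j, (wrSingle F (BA F ℓ) (mu.part j).card 1 (pten F fun _ => gen F (.e j)) *
      permAlg F (BA F ℓ) (mu.part j).card (yId F (mu.shape j))) •
        twistVec (mu.part j) (g j) (spechtGen (mu.part j) F) =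
      twistVec (mu.part j) (g j) (spechtGen (mu.part j) F) := by
    intro j
    have h2 : yId F (mu.shape j) • spechtGen (mu.part j) F = spechtGen (mu.part j) F :=
      smul_spechtGen (mu.part j) (hF j) (spechtGen (mu.part j) F)
    rw [mul_smul, permAlg_smul_twistVec (hg j), h2, pten_smul_twistVec _ (hg j)]
    simp only [he]
    rfl
  have h3 := circMk_joinWr mu.sum_card
    (v := fun j => twistVec (mu.part j) (g j) (spechtGen (mu.part j) F))
    (fun j => pr_twistVec (hg j) _) (fun j =>
      wrSingle F (BA F ℓ) (mu.part j).card 1 (pten F fun _ => gen F (.e j)) *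
      permAlg F (BA F ℓ) (mu.part j).card (yId F (mu.shape j)))
  simp only [h1] at h3
  rw [← cartanIdem_eq_joinWr] at h3
  refine Eq.trans ?_ h3
  rw [circVec, ← map_smul, TensorProduct.smul_tmul', smul_eq_mul, mul_one]

/-- Even homomorphisms `V_j → A_ℓ` induce a homomorphism from
`V_0(μ⁽⁰⁾) ∘ ⋯ ∘ V_{ℓ-1}(μ⁽ℓ⁻¹⁾)` to the wreath superproduct. -/
lemma exists_map_circVec {s : ∀ j, V j →ₗ[BA F ℓ] BA F ℓ}
    (hs : ∀ j i v, s j (pr F i v) = pr F i (s j v)) :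
    ∃ Ψ : Circ F (BA F ℓ) (fun j => (mu.part j).card) mu.sum_card
      (fun j => Twist F (V j) (spechtRep F (mu.part j))) →ₗ[Wr F (BA F ℓ) d] Wr F (BA F ℓ) d,
      Ψ (circVec F mu g) = wr F (fun i => s (blockWord mu.sum_card i) (g _)) 1 *
        youngAlg mu.sum_card (famId F mu.shape) := by
  obtain ⟨Ψ, hΨ⟩ := exists_circMap (M := fun j => Twist F (V j) (spechtRep F (mu.part j)))
    mu.sum_card (fun j => twistMap (mu.part j) (s j))
    (fun j i m => twistMap_pr (hs j) i m) (fun j f m => twistMap_smul (hs j) f m)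
  refine ⟨Ψ, ?_⟩
  rw [circVec, hΨ, one_mul]
  simp only [twistMap_twistVec]
  exact joinWr_single_mul_permAlg mu.sum_card (fun j _ => s j (g j)) _

end CircTwist

section Standard

variable {F : Type*} [Field F] {ℓ : ℕ} [NeZero ℓ] {d : ℕ} (mu : Multipartition ℓ d)

variable (F) in
/-- The generator `e_j` of `P_j`. -/
def projGen (j : Fin ℓ) : PMod F j := ⟨gen F (.e j), Submodule.mem_span_singleton_self _⟩

lemma pr_projGen (j : Fin ℓ) : pr F 0 (projGen F j) = projGen F j :=
  Subtype.ext (pr_gen_e j)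

lemma exists_smul_projGen (j : Fin ℓ) (v : PMod F j) : ∃ a : BA F ℓ, a • projGen F j = v := by
  obtain ⟨a, ha⟩ := Submodule.mem_span_singleton.1 v.2
  exact ⟨a, Subtype.ext ha⟩

lemma e_smul_projGen (j : Fin ℓ) : gen F (.e j) • projGen F j = projGen F j :=
  Subtype.ext ((gen_e_mul_e j j).trans (if_pos rfl))

lemma finite_PP (hF : ∀ j, ((mu.part j).card.factorial : F) ≠ 0) :
    FiniteDimensional F (PP F mu) := by
  have := finite_wr (F := F) (ℓ := ℓ) (d := d)
  refine Module.Finite.of_surjective ((LinearMap.toSpanSingleton (Wr F (BA F ℓ) d) (PP F mu)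
    (circVec F mu (projGen F))).restrictScalars F) fun c => ?_
  obtain ⟨x, hx⟩ := exists_smul_circVec mu pr_projGen hF exists_smul_projGen c
  exact ⟨x, hx⟩

/-- If `v = e v` generates `V` and a homomorphism `V → A` maps `v` to `e`, then `V ≅ A e`. -/
lemma idemDim_of_cyclic {A : Type*} [Ring A] [Algebra F A] {V : Type*} [AddCommGroup V]
    [Module F V] [Module A V] [IsScalarTower F A V] {e : A} {v : V} (hfix : e • v = v)
    (hgen : ∀ c : V, ∃ x : A, x • v = c) (Ψ : V →ₗ[A] A) (hΨ : Ψ v = e) (ε : A) :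
    idemDim F V ε = Module.finrank F (LinearMap.range
      (LinearMap.mulLeft F ε ∘ₗ LinearMap.mulRight F e)) := by
  have hinj : Function.Injective Ψ := by
    refine (injective_iff_map_eq_zero Ψ).2 fun c hc => ?_
    obtain ⟨x, rfl⟩ := hgen c
    rw [map_smul, hΨ, smul_eq_mul] at hc
    rw [← hfix, smul_smul, hc, zero_smul]
  have hrange : LinearMap.range (LinearMap.mulLeft F ε ∘ₗ LinearMap.mulRight F e) =
      (LinearMap.range (Algebra.lsmul F F V ε)).map (Ψ.restrictScalars F) := by
    ext y
    constructor
    · rintro ⟨x, rfl⟩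
      refine ⟨ε • x • v, ⟨_, rfl⟩, ?_⟩
      change Ψ (ε • x • v) = ε * (x * e)
      rw [map_smul, map_smul, hΨ]
      rfl
    · rintro ⟨_, ⟨c, rfl⟩, rfl⟩
      obtain ⟨x, rfl⟩ := hgen c
      refine ⟨x, ?_⟩
      change ε * (x * e) = Ψ (ε • x • v)
      rw [map_smul, map_smul, hΨ]
      rfl
  rw [idemDim, hrange]
  exact (Submodule.equivMapOfInjective (Ψ.restrictScalars F) hinj _).finrank_eq

/-- `P(λ)` is isomorphic to `W ε_λ`. -/
lemma idemDim_PP (hF : ∀ j, ((mu.part j).card.factorial : F) ≠ 0) (ε : Wr F (BA F ℓ) d) :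
    idemDim F (PP F mu) ε = Module.finrank F (LinearMap.range
      (LinearMap.mulLeft F ε ∘ₗ LinearMap.mulRight F (cartanIdem F mu))) := by
  obtain ⟨Ψ, hΨ⟩ := exists_map_circVec mu pr_projGen
    (s := fun j => (projSub F j).toSubmodule.subtype) fun j i v => rfl
  have hΨ' : Ψ (circVec F mu (projGen F)) = cartanIdem F mu := hΨ
  exact idemDim_of_cyclic (cartanIdem_smul_circVec mu pr_projGen hF e_smul_projGen)
    (exists_smul_circVec mu pr_projGen hF exists_smul_projGen) Ψ hΨ' ε

variable (F) in
/-- The generator of `L_j`. -/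
def charVec (j : Fin ℓ) : LMod F j := (1 : F)

lemma smul_charVec (j : Fin ℓ) (a : BA F ℓ) : a • charVec F j = charHom F j a • charVec F j := rfl

lemma pr_charVec (j : Fin ℓ) : pr F 0 (charVec F j) = charVec F j := rfl

lemma exists_smul_charVec (j : Fin ℓ) (v : LMod F j) : ∃ a : BA F ℓ, a • charVec F j = v := by
  refine ⟨algebraMap F _ (show F from v), ?_⟩
  have h : charHom F j (algebraMap F _ (show F from v)) * (1 : F) = (show F from v) := by
    rw [AlgHom.commutes, mul_one]; rfl
  exact h

lemma charHom_e (j : Fin ℓ) : charHom F j (gen F (.e j)) = 1 := by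
  have := charHom_path (F := F) j (j, 0)
  rwa [if_pos rfl] at this

lemma e_smul_charVec (j : Fin ℓ) : gen F (.e j) • charVec F j = charVec F j := by
  rw [smul_charVec, charHom_e, one_smul]

/-- The cycle of length two at `j` spans a copy of `L_j`. -/
lemma mul_cycle (j : Fin ℓ) (a : BA F ℓ) : a * path F (j, 3) = charHom F j a • path F (j, 3) := by
  induction a using ba_induction F ℓ with
  | hc r => rw [AlgHom.commutes, Algebra.smul_def]; rfl
  | hg x =>
    have hx : charHom F j (gen F x) = charGen F j x := baLift_gen F ℓ _ _ x
    rw [gen_mul_path, hx]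
    rcases x with i | a
    · by_cases h : i = j
      · subst h; simp [step, Slot.tgt, charGen, optPath]
      · simp [step, Slot.tgt, charGen, optPath, h, Ne.symm h]
    · simp [step, charGen, optPath]
  | ha a b h h' => rw [add_mul, h, h', map_add, add_smul]
  | hm a b h h' => rw [mul_assoc, h', mul_smul_comm, h, map_mul, smul_smul, mul_comm]

variable (F) in
/-- The embedding of `L_j` into `A_ℓ` as the socle of `P_j`. -/
def socleMap (j : Fin ℓ) : LMod F j →ₗ[BA F ℓ] BA F ℓ where
  toFun v := (show F from v) • path F (j, 3)
  map_add' v w := add_smul (show F from v) (show F from w) (path F (j, 3))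
  map_smul' a v := by
    have h : (charHom F j a * (show F from v)) • path F (j, 3) =
        a * ((show F from v) • path F (j, 3)) := by
      rw [mul_smul_comm, mul_cycle, smul_smul, mul_comm]
    exact h

lemma socleMap_charVec (j : Fin ℓ) : socleMap F j (charVec F j) = path F (j, 3) :=
  one_smul F (path F (j, 3))

lemma socleMap_pr (j : Fin ℓ) (i : ZMod 2) (v : LMod F j) :
    socleMap F j (pr F i v) = pr F i (socleMap F j v) := by
  have hp : Slot.par ((j, 3) : Slot ℓ) = 0 := by simp [Slot.par]
  have h : pr F i (path F (j, 3)) = if i = 0 then path F (j, 3) else 0 := by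
    have := pr_of_homog (F := F) (pr_path (F := F) (j, 3)) i
    rwa [hp] at this
  have h1 : pr F i (socleMap F j v) = (show F from v) • pr F i (path F (j, 3)) :=
    map_smul (pr F i) (show F from v) (path F (j, 3))
  rw [h1, h]
  rcases zmod_cases i with rfl | rfl
  · rfl
  · exact (zero_smul F (path F (j, 3))).trans (smul_zero _).symm

/-- The image of the generator of `L(μ)` under the homomorphism to `W_d` induced by the socle
embeddings `L_j → A_ℓ` is `(z_{T(1)} ⊗ ⋯ ⊗ z_{T(d)}) famId`, where `z_j` is the cycle of length two
at `j`; its coefficient at the identity permutation is not zero. -/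
lemma circVec_ne_zero (hF : ∀ j, ((mu.part j).card.factorial : F) ≠ 0) :
    circVec F mu (charVec F) ≠ 0 := by
  intro h0
  obtain ⟨Ψ, hΨ⟩ := exists_map_circVec mu pr_charVec (s := socleMap F) socleMap_pr
  rw [h0, map_zero] at hΨ
  simp only [socleMap_charVec] at hΨ
  have h1 : wr F (fun i => path F (blockWord mu.sum_card i, 3)) 1 *
      youngAlg mu.sum_card (famId F mu.shape) =
      ∑ u : ∀ j, Equiv.Perm (Fin (mu.part j).card), (famId F mu.shape).coeff u •
        wrSingle F (BA F ℓ) d (blockPerm (fun j => (mu.part j).card) mu.sum_card u)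
          (pten F fun i => path F (blockWord mu.sum_card i, 3)) := by
    have h2 := (grpBasis F (∀ j, Equiv.Perm (Fin (mu.part j).card))).sum_repr (famId F mu.shape)
    conv_lhs => rw [← h2]
    rw [map_sum, Finset.mul_sum]
    refine Finset.sum_congr rfl fun u _ => ?_
    have hb : grpBasis F (∀ j, Equiv.Perm (Fin (mu.part j).card)) u =
      MonoidAlgebra.single u 1 := rfl
    rw [map_smul, hb, youngAlg_single, one_smul, mul_smul_comm]
    refine congrArg ((famId F mu.shape).coeff u • ·) ?_
    change SkewMonoidAlgebra.single 1 _ * SkewMonoidAlgebra.single _ 1 =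
      SkewMonoidAlgebra.single _ _
    rw [SkewMonoidAlgebra.single_mul_single, one_mul, one_smul, mul_one]
  rw [h1] at hΨ
  have h3 := congrArg (fun f => wordCoord (fun i => (blockWord mu.sum_card i, 3))
    (wrCoeff F (BA F ℓ) d 1 f)) hΨ
  simp only [map_zero, map_sum, map_smul] at h3
  rw [Finset.sum_eq_single 1] at h3
  · have h4 : wrCoeff F (BA F ℓ) d 1 (wrSingle F (BA F ℓ) d
        (blockPerm (fun j => (mu.part j).card) mu.sum_card 1)
        (pten F fun i => path F (blockWord mu.sum_card i, 3))) =
        pten F fun i => path F (blockWord mu.sum_card i, 3) := by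
      have h5 : blockPerm (fun j => (mu.part j).card) mu.sum_card 1 = 1 :=
        map_one (blockHom mu.sum_card)
      rw [h5]
      exact (wrCoeff_single _ _ _).trans (if_pos rfl)
    rw [h4, wordCoord_path _ fun i => by simp [Slot.Ok], if_pos rfl, famId, coeff_box] at h3
    refine absurd h3.symm ?_
    rw [smul_eq_mul, mul_one]
    refine Finset.prod_ne_zero_iff.2 fun j _ => ?_
    rw [yId, MonoidAlgebra.coeff_smul, Finsupp.smul_apply]
    have h6 : (young F (mu.shape j)).coeff 1 = 1 := coeff_one_young' _
    have h7 : (1 : ∀ j, Equiv.Perm (Fin (mu.part j).card)) j = 1 := rfl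
    rw [h7, h6, smul_eq_mul, mul_one]
    exact inv_ne_zero (hookZ_ne_zero (hF j) _)
  · intro u _ hu
    have h5 : blockPerm (fun j => (mu.part j).card) mu.sum_card u ≠ 1 := by
      intro h
      apply hu
      funext j
      ext a
      have h6 := congrArg (fun w => w (blockEquiv (fun j => (mu.part j).card) mu.sum_card ⟨j, a⟩)) h
      simp only [blockPerm_apply, Equiv.Perm.one_apply] at h6
      have h7 := (blockEquiv (fun j => (mu.part j).card) mu.sum_card).injective h6
      have h8 := eq_of_heq (Sigma.mk.inj h7).2
      exact congrArg Fin.val h8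
    have h4 : wrCoeff F (BA F ℓ) d 1 (wrSingle F (BA F ℓ) d
        (blockPerm (fun j => (mu.part j).card) mu.sum_card u)
        (pten F fun i => path F (blockWord mu.sum_card i, 3))) = 0 :=
      (wrCoeff_single _ _ _).trans (if_neg h5)
    rw [h4, map_zero, smul_zero]
  · simp

/-- Words of positive length kill the generator of `L(μ)`. -/
lemma wordElt_smul_circVec {c : Fin d → Slot ℓ} {w : Equiv.Perm (Fin d)} (hc : 1 ≤ wordDeg c) :
    wordElt F c w • circVec F mu (charVec F) = 0 := by
  -- Move the permutation to the left; the tensor factors then act on the generators of the `L_j`.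
  let c' : Fin d → Slot ℓ := fun i => c (w i)
  have h1 : wordElt F c w = sg F (invExp w fun i => (c' i).par) •
      (SkewMonoidAlgebra.single w 1 * wr F (fun i => path F (c' i)) 1) := by
    have h2 := perm_smul_pten w (a := fun i => path F (c' i)) (x := fun i => (c' i).par)
      fun i => pr_path _
    rw [wr, SkewMonoidAlgebra.single_mul_single, mul_one, one_mul, h2,
      SkewMonoidAlgebra.smul_single, smul_smul, ← sg_add, two_zmod, sg_zero, one_smul]
    simp [c', wordElt, wr]
  -- Some letter has positive length, hence acts as zero on the corresponding `L_j`.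
  obtain ⟨i, hi⟩ : ∃ i, c' i ≠ ((c' i).1, 0) := by
    by_contra! hall
    have h3 := (wordDeg_eq_zero_iff c).2 fun i => by
      have := hall (w.symm i)
      simpa [c'] using this
    omega
  rw [h1, smul_assoc, mul_smul]
  have h4 : wr F (fun i => path F (c' i)) 1 • circVec F mu (charVec F) = 0 := by
    have h5 := circMk_rel (x := fun i => (c' i).par) (z := fun i => path F (c' i)) (w := 1) (y := 0)
      (v := fun j => twistVec (mu.part j) (charVec F j) (spechtGen (mu.part j) F))
      mu.sum_card (fun i => pr_path (F := F) (c' i)) fun j => pr_twistVec (pr_charVec j) _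
    have h6 : blockPerm (fun j => (mu.part j).card) mu.sum_card 1 = 1 :=
      map_one (blockHom mu.sum_card)
    rw [h6] at h5
    rw [circVec, ← map_smul, TensorProduct.smul_tmul', smul_eq_mul, mul_one]
    refine h5.trans ?_
    obtain ⟨⟨j, a⟩, rfl⟩ := (blockEquiv (fun j => (mu.part j).card) mu.sum_card).surjective i
    rw [MultilinearMap.map_coord_zero (PiTensorProduct.tprod F) j, smul_zero,
      TensorProduct.tmul_zero, map_zero]
    refine (pten_smul_twistVec (fun m => path F (c' (blockEquiv (fun j => (mu.part j).card)
      mu.sum_card ⟨j, m⟩))) (pr_charVec j) (spechtGen (mu.part j) F)).trans ?_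
    rw [MultilinearMap.map_coord_zero (PiTensorProduct.tprod F) a]
    · exact TensorProduct.zero_tmul _ _
    · rw [smul_charVec, charHom_path, if_neg, zero_smul]
      intro h
      apply hi
      rw [h]
  rw [h4, smul_zero, smul_zero]

/-- `[P(λ) : L(μ)]` is the dimension of `ε_μ W ε_λ`. -/
theorem hasMultiplicity_finrank (h2 : (2 : F) ≠ 0) (hF : ∀ k, k ≤ d → (k.factorial : F) ≠ 0)
    (lam : Multipartition ℓ d) :
    HasMultiplicity F (Wd F ℓ d) (PP F lam) (LL F mu) (Module.finrank F (LinearMap.range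
      (LinearMap.mulLeft F (cartanIdem F mu) ∘ₗ LinearMap.mulRight F (cartanIdem F lam)))) := by
  have hle : ∀ (nu : Multipartition ℓ d) j, (nu.part j).card ≤ d := fun nu j => by
    conv_rhs => rw [← nu.sum_card]
    exact Finset.single_le_sum (f := fun j => (nu.part j).card) (fun _ _ => Nat.zero_le _)
      (Finset.mem_univ j)
  have hmu : ∀ j, ((mu.part j).card.factorial : F) ≠ 0 := fun j => hF _ (hle mu j)
  have hlam : ∀ j, ((lam.part j).card.factorial : F) ≠ 0 := fun j => hF _ (hle lam j)
  have := finite_PP lam hlam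
  obtain ⟨φ, hφ⟩ := exists_isLocalIdem (ℓ := ℓ) mu.sum_card h2 hmu mu.shape
  have hfix := cartanIdem_smul_circVec mu pr_charVec hmu e_smul_charVec
  have hne := circVec_ne_zero (F := F) mu hmu
  have hirr : IsIrred F (Wd F ℓ d) (LL F mu) := by
    refine isIrred_of_generator mu.sum_card h2 hmu mu.shape hne
      (exists_smul_circVec mu pr_charVec hmu exists_smul_charVec) hfix fun x hx => ?_
    induction hx using Submodule.span_induction with
    | zero => rw [zero_smul]
    | add a b _ _ ha hb => rw [add_smul, ha, hb, add_zero]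
    | smul r a _ ha => rw [smul_assoc, ha, smul_zero]
    | mem a ha =>
      obtain ⟨c, w, hc, rfl⟩ := ha
      exact wordElt_smul_circVec mu hc
  rw [← idemDim_PP lam hlam]
  refine hasMultiplicity_idemDim hφ hirr (v := circVec F mu (charVec F)) ?_
  intro h
  exact hne (hfix.symm.trans h)

end Standard

/-! ### Ranks of operators on group algebras of Young subgroups -/

section BoxRank

variable {F : Type*} [Field F] {ι : Type*} [Fintype ι] [DecidableEq ι]
  {G : ι → Type*} [∀ i, Group (G i)] [∀ i, Fintype (G i)]

instance finite_monoidAlgebra {G : Type*} [Finite G] : Module.Finite F (MonoidAlgebra F G) :=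
  Module.Finite.of_basis (grpBasis F G)

/-- The outer tensor product of linear forms on group algebras. -/
def boxForm (φ : ∀ i, MonoidAlgebra F (G i) →ₗ[F] F) : MonoidAlgebra F (∀ i, G i) →ₗ[F] F :=
  (grpBasis F (∀ i, G i)).constr F fun g => ∏ i, φ i (MonoidAlgebra.single (g i) 1)

lemma boxForm_single (φ : ∀ i, MonoidAlgebra F (G i) →ₗ[F] F) (g : ∀ i, G i) (r : F) :
    boxForm φ (MonoidAlgebra.single g r) = r * ∏ i, φ i (MonoidAlgebra.single (g i) 1) := by
  have h := (grpBasis F (∀ i, G i)).constr_basis F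
    (fun g => ∏ i, φ i (MonoidAlgebra.single (g i) 1)) g
  have h1 : (MonoidAlgebra.single g r : MonoidAlgebra F (∀ i, G i)) =
      r • grpBasis F (∀ i, G i) g := by
    rw [show grpBasis F (∀ i, G i) g = MonoidAlgebra.single g 1 from rfl]
    simp
  rw [h1, map_smul, smul_eq_mul]
  exact congrArg (r * ·) h

lemma sum_coeff_smul {G : Type*} [Fintype G] (x : MonoidAlgebra F G) :
    ∑ g, x.coeff g • MonoidAlgebra.single g (1 : F) = x :=
  (grpBasis F G).sum_repr x

lemma boxForm_box (φ : ∀ i, MonoidAlgebra F (G i) →ₗ[F] F) (f : ∀ i, MonoidAlgebra F (G i)) :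
    boxForm φ (box F G f) = ∏ i, φ i (f i) := by
  rw [box_apply, map_sum]
  simp only [boxForm_single, ← Finset.prod_mul_distrib]
  have h : ∀ i, φ i (f i) = ∑ g, (f i).coeff g * φ i (MonoidAlgebra.single g 1) := fun i => by
    conv_lhs => rw [← sum_coeff_smul (f i)]
    simp only [map_sum, map_smul, smul_eq_mul]
  simp only [h]
  rw [Finset.prod_univ_sum, Fintype.piFinset_univ]

/-- The rank of an outer tensor product of operators is the product of the ranks. -/
lemma finrank_range_box {T : Module.End F (MonoidAlgebra F (∀ i, G i))}
    {t : ∀ i, Module.End F (MonoidAlgebra F (G i))}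
    (h : ∀ f, T (box F G f) = box F G fun i => t i (f i)) :
    Module.finrank F (LinearMap.range T) = ∏ i, Module.finrank F (LinearMap.range (t i)) := by
  let B : ∀ i, Module.Basis (Fin (Module.finrank F (LinearMap.range (t i)))) F
    (LinearMap.range (t i)) := fun i => Module.finBasis F _
  let b : (∀ i, Fin (Module.finrank F (LinearMap.range (t i)))) → MonoidAlgebra F (∀ i, G i) :=
    fun k => box F G fun i => (B i (k i) : MonoidAlgebra F (G i))
  have hrange : LinearMap.range T = Submodule.span F (Set.range b) := by
    refine le_antisymm ?_ (Submodule.span_le.2 ?_)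
    · rintro _ ⟨x, rfl⟩
      rw [← sum_coeff_smul x, map_sum]
      refine Submodule.sum_mem _ fun g _ => ?_
      rw [map_smul, ← box_single, h]
      refine Submodule.smul_mem _ _ ?_
      have h1 : ∀ i, ∃ c : Fin (Module.finrank F (LinearMap.range (t i))) → F,
          t i (MonoidAlgebra.single (g i) 1) = ∑ k, c k • (B i k : MonoidAlgebra F (G i)) := by
        intro i
        have := congrArg Subtype.val
          ((B i).sum_repr ⟨t i (MonoidAlgebra.single (g i) 1), LinearMap.mem_range_self _ _⟩)
        rw [Submodule.coe_sum] at this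
        exact ⟨_, this.symm⟩
      choose c hc using h1
      simp only [hc]
      rw [MultilinearMap.map_sum]
      refine Submodule.sum_mem _ fun k _ => ?_
      rw [MultilinearMap.map_smul_univ]
      exact Submodule.smul_mem _ _ (Submodule.subset_span ⟨k, rfl⟩)
    · rintro _ ⟨k, rfl⟩
      choose f hf using fun i => (B i (k i)).2
      refine ⟨box F G f, ?_⟩
      rw [h]
      simp only [hf]
      rfl
  -- Linear forms dual to the bases of the images separate the outer tensor products of basis
  -- vectors.
  have hdual : ∀ i, ∃ φ : Fin (Module.finrank F (LinearMap.range (t i))) →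
      (MonoidAlgebra F (G i) →ₗ[F] F), ∀ k k', φ k (B i k' : MonoidAlgebra F (G i)) =
        if k' = k then 1 else 0 := by
    intro i
    obtain ⟨q, hq⟩ := LinearMap.exists_leftInverse_of_injective
      (LinearMap.range (t i)).subtype (Submodule.ker_subtype _)
    refine ⟨fun k => (B i).coord k ∘ₗ q, fun k k' => ?_⟩
    have := LinearMap.congr_fun hq (B i k')
    simp only [LinearMap.comp_apply, Submodule.subtype_apply, LinearMap.id_apply] at this
    rw [LinearMap.comp_apply, this, Module.Basis.coord_apply, Module.Basis.repr_self,
      Finsupp.single_apply]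
  choose φ hφ using hdual
  have hli : LinearIndependent F b := by
    rw [Fintype.linearIndependent_iff]
    intro r hr k
    have h1 := congrArg (boxForm fun i => φ i (k i)) hr
    rw [map_sum, map_zero, Finset.sum_eq_single k] at h1
    · rw [map_smul, boxForm_box] at h1
      simpa [hφ] using h1
    · intro k' _ hk'
      obtain ⟨i, hi⟩ := Function.ne_iff.1 hk'
      rw [map_smul, boxForm_box, Finset.prod_eq_zero (Finset.mem_univ i), smul_zero]
      rw [hφ, if_neg hi]
    · simp
  rw [hrange, finrank_span_eq_card hli, Fintype.card_pi]
  simp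

lemma coeff_invAlg {G : Type*} [Group G] (x : MonoidAlgebra F G) (g : G) :
    (invAlg x).coeff g = x.coeff g⁻¹ := by
  classical
  induction x using MonoidAlgebra.induction_linear with
  | zero => simp
  | add x y hx hy => simp [hx, hy]
  | single h r =>
    rw [invAlg_single, MonoidAlgebra.coeff_single, MonoidAlgebra.coeff_single,
      Finsupp.single_apply, Finsupp.single_apply]
    simp only [inv_eq_iff_eq_inv]

lemma invAlg_box (f : ∀ i, MonoidAlgebra F (G i)) :
    invAlg (box F G f) = box F G fun i => invAlg (f i) := by
  ext g
  rw [coeff_invAlg, coeff_box, coeff_box]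
  simp only [coeff_invAlg, Pi.inv_apply]

lemma invAlg_blockAlg {k d : ℕ} {n : Fin k → ℕ} (hn : ∑ j, n j = d)
    (x : MonoidAlgebra F (∀ j, Equiv.Perm (Fin (n j)))) :
    invAlg (blockAlg hn F x) = blockAlg hn F (invAlg x) := by
  induction x using MonoidAlgebra.induction_linear with
  | zero => simp
  | add x y hx hy => rw [map_add, map_add, hx, hy, map_add, map_add]
  | single h r =>
    rw [invAlg_single, blockAlg_single, blockAlg_single, invAlg_single]
    exact congrArg (MonoidAlgebra.single · r) (map_inv (blockHom hn) h).symm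

lemma blockPerm_injective {k d : ℕ} {n : Fin k → ℕ} (hn : ∑ j, n j = d) :
    Function.Injective (blockPerm n hn) := by
  intro u v h
  funext j
  ext a
  have h1 := congrArg (fun w => w (blockEquiv n hn ⟨j, a⟩)) h
  simp only [blockPerm_apply] at h1
  exact congrArg Fin.val (eq_of_heq (Sigma.mk.inj ((blockEquiv n hn).injective h1)).2)

lemma blockAlg_injective {k d : ℕ} {n : Fin k → ℕ} (hn : ∑ j, n j = d) :
    Function.Injective (blockAlg hn F) :=
  MonoidAlgebra.mapDomain_injective (blockPerm_injective hn)

/-- Let `a ↦ a*` be the antiautomorphism inverting the group elements, and let `a` be the idempotent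
of a family of partitions. Then `x ↦ e_λ x a*` has the same rank as `x ↦ a x e_λ`, because `e_λ` and
`e_λ*` are equivalent. -/
lemma finrank_range_inv {r N : ℕ} {n : Fin r → ℕ} (hn : ∑ i, n i = N) (hN : (N.factorial : F) ≠ 0)
    (alpha : ∀ i, Shape (n i)) (lam : Shape N) :
    Module.finrank F (LinearMap.range (LinearMap.mulLeft F (yId F lam) ∘ₗ
      LinearMap.mulRight F (invAlg (blockAlg hn F (famId F alpha))))) = lrNum hn F alpha lam := by
  set a := blockAlg hn F (famId F alpha) with ha
  have h1 := (equivIdem_invAlg (F := F) lam).finrank_eq (yId_idem hN lam)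
    (by rw [← invAlg_mul, yId_idem hN]) (Algebra.lmul F (MonoidAlgebra F (Equiv.Perm (Fin N))))
    (p := LinearMap.mulRight F (invAlg a)) fun x => LinearMap.ext fun y => (mul_assoc x y _)
  refine h1.trans ?_
  let inv : MonoidAlgebra F (Equiv.Perm (Fin N)) ≃ₗ[F] MonoidAlgebra F (Equiv.Perm (Fin N)) :=
    LinearEquiv.ofInvolutive invAlg invAlg_invAlg
  have h2 : LinearMap.range (lrOp hn F alpha lam) =
      (LinearMap.range (Algebra.lmul F _ (invAlg (yId F lam)) *
        LinearMap.mulRight F (invAlg a))).map inv.toLinearMap := by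
    have h3 : ∀ x, invAlg (invAlg (yId F lam) * (x * invAlg a)) =
        lrOp hn F alpha lam (invAlg x) := fun x => by
      rw [lrOp_apply, ← ha, invAlg_mul, invAlg_mul, invAlg_invAlg, invAlg_invAlg, mul_assoc]
    ext y
    constructor
    · rintro ⟨x, rfl⟩
      refine ⟨_, ⟨invAlg x, rfl⟩, ?_⟩
      refine (h3 (invAlg x)).trans ?_
      rw [invAlg_invAlg]
    · rintro ⟨_, ⟨x, rfl⟩, rfl⟩
      exact ⟨invAlg x, (h3 x).symm⟩
  rw [lrNum, h2]
  exact (LinearEquiv.finrank_map_eq inv _).symm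

end BoxRank

/-! ### Refinements of Young subgroups -/

section Refine

variable {k r K d : ℕ} {m : Fin k → ℕ} (hm : ∑ j, m j = d) {n : Fin K → ℕ} (hn : ∑ b, n b = d)
  (π : Fin k × Fin r ≃ Fin K)

/-- The condition that `g` maps the block of the composition `n` with index `π (j, i)` into the
`j`th block of the composition `m`, for all `j` and `i`. -/
def Refines (g : Equiv.Perm (Fin d)) : Prop :=
  ∀ i, blockWord hm (g i) = (π.symm (blockWord hn i)).1

lemma sum_blockWord {M : Type*} [AddCommMonoid M] {k d : ℕ} {m : Fin k → ℕ} (hm : ∑ j, m j = d)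
    (f : Fin k → M) : ∑ i, f (blockWord hm i) = ∑ j, m j • f j := by
  rw [← Equiv.sum_comp (blockEquiv m hm), Fintype.sum_sigma]
  simp

lemma Refines.sum_eq {g : Equiv.Perm (Fin d)} (h : Refines hm hn π g) (j : Fin k) :
    ∑ i, n (π (j, i)) = m j := by
  have h1 := sum_blockWord hm fun j' => if j' = j then 1 else 0
  have h2 := sum_blockWord hn fun b => if (π.symm b).1 = j then 1 else 0
  rw [← Equiv.sum_comp g] at h1
  simp only [h _] at h1
  rw [h1, ← Equiv.sum_comp π, Fintype.sum_prod_type] at h2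
  simpa using h2.symm

variable {hm hn π}

lemma Refines.blockPerm_mul {g : Equiv.Perm (Fin d)} (u : ∀ j, Equiv.Perm (Fin (m j))) :
    Refines hm hn π (blockPerm m hm u * g) ↔ Refines hm hn π g := by
  simp only [Refines, Equiv.Perm.mul_apply, blockWord_blockPerm]

lemma Refines.mul_blockPerm {g : Equiv.Perm (Fin d)} (u : ∀ j, Equiv.Perm (Fin (n j))) :
    Refines hm hn π (g * blockPerm n hn u) ↔ Refines hm hn π g := by
  constructor
  · intro h i
    have := h ((blockPerm n hn u).symm i)
    rwa [Equiv.Perm.mul_apply, Equiv.apply_symm_apply, blockWord_blockPerm_symm] at this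
  · intro h i
    rw [Equiv.Perm.mul_apply, h, blockWord_blockPerm]

variable (hm hn) (hπ : ∀ j, ∑ i, n (π (j, i)) = m j)

/-- The standard permutation that maps the blocks of the composition `n` to subblocks of those
of `m`. -/
def basePerm : Equiv.Perm (Fin d) :=
  (blockEquiv n hn).symm.trans <|
    ((Equiv.sigmaAssocProd (γ := fun j i => Fin (n (π (j, i))))).symm.trans
      (Equiv.sigmaCongrLeft (β := fun b => Fin (n b)) π)).symm.trans <|
    (Equiv.sigmaCongrRight fun j => blockEquiv (fun i => n (π (j, i))) (hπ j)).trans <|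
    blockEquiv m hm

lemma basePerm_apply (j : Fin k) (i : Fin r) (a : Fin (n (π (j, i)))) :
    basePerm hm hn hπ (blockEquiv n hn ⟨π (j, i), a⟩) =
      blockEquiv m hm ⟨j, blockEquiv (fun i => n (π (j, i))) (hπ j) ⟨i, a⟩⟩ := by
  have h : ((Equiv.sigmaAssocProd (γ := fun j i => Fin (n (π (j, i))))).symm.trans
      (Equiv.sigmaCongrLeft (β := fun b => Fin (n b)) π)).symm ⟨π (j, i), a⟩ = ⟨j, ⟨i, a⟩⟩ := by
    rw [Equiv.symm_apply_eq]; rfl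
  simp only [basePerm, Equiv.trans_apply, Equiv.symm_apply_apply]
  rw [h]
  rfl

lemma exists_blockEquiv (i : Fin d) : ∃ (j : Fin k) (b : Fin r) (a : Fin (n (π (j, b)))),
    i = blockEquiv n hn ⟨π (j, b), a⟩ := by
  obtain ⟨⟨b, a⟩, rfl⟩ := (blockEquiv n hn).surjective i
  obtain ⟨⟨j, b⟩, rfl⟩ := π.surjective b
  exact ⟨j, b, a, rfl⟩

lemma refines_basePerm : Refines hm hn π (basePerm hm hn hπ) := by
  intro i
  obtain ⟨j, b, a, rfl⟩ := exists_blockEquiv hn (π := π) i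
  rw [basePerm_apply, blockWord_blockEquiv, blockWord_blockEquiv, Equiv.symm_apply_apply]

/-- The refining permutations form a coset of the Young subgroup of `m`. -/
lemma refines_iff (g : Equiv.Perm (Fin d)) :
    Refines hm hn π g ↔ ∃ u, g = blockPerm m hm u * basePerm hm hn hπ := by
  constructor
  · intro h
    obtain ⟨u, hu⟩ := exists_blockPerm hm (w := g * (basePerm hm hn hπ)⁻¹) fun i => by
      have h1 := refines_basePerm hm hn hπ ((basePerm hm hn hπ)⁻¹ i)
      have h2 : basePerm hm hn hπ ((basePerm hm hn hπ)⁻¹ i) = i :=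
        (basePerm hm hn hπ).apply_symm_apply i
      rw [h2] at h1
      rw [Equiv.Perm.mul_apply, h, h1]
    exact ⟨u, by rw [hu, inv_mul_cancel_right]⟩
  · rintro ⟨u, rfl⟩
    exact (Refines.blockPerm_mul u).2 (refines_basePerm hm hn hπ)

/-- The standard permutation conjugates the Young subgroup of `n` into a product of Young subgroups
of the blocks of `m`. -/
lemma basePerm_mul_blockPerm (u : ∀ b, Equiv.Perm (Fin (n b))) :
    basePerm hm hn hπ * blockPerm n hn u =
      blockPerm m hm (fun j => blockPerm (fun i => n (π (j, i))) (hπ j) fun i => u (π (j, i))) *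
        basePerm hm hn hπ := by
  ext i
  obtain ⟨j, b, a, rfl⟩ := exists_blockEquiv hn (π := π) i
  simp only [Equiv.Perm.mul_apply, blockPerm_apply, basePerm_apply]

variable {F : Type*} [Field F]

lemma basePerm_mul_blockAlg (f : ∀ b, MonoidAlgebra F (Equiv.Perm (Fin (n b)))) :
    MonoidAlgebra.single (basePerm hm hn hπ) 1 * blockAlg hn F (box F _ f) =
      blockAlg hm F (box F _ fun j => blockAlg (hπ j) F (box F _ fun i => f (π (j, i)))) *
        MonoidAlgebra.single (basePerm hm hn hπ) 1 := by
  have h1 : ∀ j, blockAlg (hπ j) F (box F _ fun i => f (π (j, i))) =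
      ∑ u : ∀ i, Equiv.Perm (Fin (n (π (j, i)))), (∏ i, (f (π (j, i))).coeff (u i)) •
        MonoidAlgebra.single (blockPerm (fun i => n (π (j, i))) (hπ j) u) 1 := fun j => by
    rw [box_apply, map_sum]
    refine Finset.sum_congr rfl fun u _ => ?_
    rw [blockAlg_single]
    simp
  simp only [h1]
  rw [MultilinearMap.map_sum, box_apply, map_sum, map_sum, Finset.mul_sum, Finset.sum_mul]
  refine Fintype.sum_bijective (fun u j i => u (π (j, i))) ?_ _ _ fun u => ?_
  · constructor
    · intro u v h
      funext b
      obtain ⟨⟨j, i⟩, rfl⟩ := π.surjective b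
      exact congrFun (congrFun h j) i
    · intro v
      refine ⟨fun b => cast ?_ (v (π.symm b).1 (π.symm b).2), ?_⟩
      · simp
      · funext j i
        have h : ∀ p : Fin k × Fin r, p = (j, i) →
            ∀ e, cast e (v p.1 p.2) = v j i := by
          rintro _ rfl e; rfl
        exact h _ (π.symm_apply_apply (j, i)) _
  · rw [blockAlg_single, MultilinearMap.map_smul_univ, box_single, map_smul, blockAlg_single,
      MonoidAlgebra.single_mul_single, smul_mul_assoc, MonoidAlgebra.single_mul_single,
      basePerm_mul_blockPerm, ← Equiv.prod_comp π, Fintype.prod_prod_type]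
    simp

variable (F) in
open Classical in
/-- The restriction of elements of a group algebra to a subset of the group. -/
def resOp {G : Type*} (P : G → Prop) : Module.End F (MonoidAlgebra F G) :=
  (grpBasis F G).constr F fun g => if P g then MonoidAlgebra.single g 1 else 0

open Classical in
lemma resOp_single {G : Type*} (P : G → Prop) (g : G) :
    resOp F P (MonoidAlgebra.single g 1) = if P g then MonoidAlgebra.single g 1 else 0 :=
  (grpBasis F G).constr_basis F _ g

lemma resOp_mul_resOp {G : Type*} (P : G → Prop) : resOp F P * resOp F P = resOp F P := by
  refine (grpBasis F G).ext fun g => ?_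
  change resOp F P (resOp F P (MonoidAlgebra.single g 1)) = resOp F P (MonoidAlgebra.single g 1)
  rw [resOp_single]
  split_ifs with h
  · rw [resOp_single, if_pos h]
  · rw [map_zero]

/-- Operators on a group algebra that agree on the group elements are equal. -/
lemma monoidAlgebra_end_ext {G : Type*} {M : Type*} [AddCommMonoid M] [Module F M]
    {S T : MonoidAlgebra F G →ₗ[F] M}
    (h : ∀ g, S (MonoidAlgebra.single g 1) = T (MonoidAlgebra.single g 1)) : S = T :=
  (grpBasis F G).ext h

lemma resOp_mul_mulLeft (x : MonoidAlgebra F (∀ j, Equiv.Perm (Fin (m j)))) :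
    resOp F (Refines hm hn π) * LinearMap.mulLeft F (blockAlg hm F x) =
      LinearMap.mulLeft F (blockAlg hm F x) * resOp F (Refines hm hn π) := by
  refine monoidAlgebra_end_ext fun g => ?_
  have h : resOp F (Refines hm hn π) ∘ₗ LinearMap.mulRight F (MonoidAlgebra.single g 1) ∘ₗ
      (blockAlg hm F).toLinearMap = LinearMap.mulRight F (resOp F (Refines hm hn π)
        (MonoidAlgebra.single g 1)) ∘ₗ (blockAlg hm F).toLinearMap := by
    refine monoidAlgebra_end_ext fun u => ?_
    have h1 : blockAlg hm F (MonoidAlgebra.single u 1) * MonoidAlgebra.single g 1 =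
        MonoidAlgebra.single (blockPerm m hm u * g) 1 := by
      rw [blockAlg_single, MonoidAlgebra.single_mul_single, one_mul]
    refine (congrArg (resOp F (Refines hm hn π)) h1).trans ?_
    refine Eq.trans ?_ (congrArg (blockAlg hm F (MonoidAlgebra.single u 1) * ·)
      (resOp_single (Refines hm hn π) g)).symm
    refine (resOp_single (Refines hm hn π) _).trans ?_
    by_cases hg : Refines hm hn π g
    · rw [if_pos hg, if_pos ((Refines.blockPerm_mul u).2 hg), h1]
    · rw [if_neg hg, if_neg fun h => hg ((Refines.blockPerm_mul u).1 h), mul_zero]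
  exact LinearMap.congr_fun h x

lemma resOp_mul_mulRight (x : MonoidAlgebra F (∀ j, Equiv.Perm (Fin (n j)))) :
    resOp F (Refines hm hn π) * LinearMap.mulRight F (blockAlg hn F x) =
      LinearMap.mulRight F (blockAlg hn F x) * resOp F (Refines hm hn π) := by
  refine monoidAlgebra_end_ext fun g => ?_
  have h : resOp F (Refines hm hn π) ∘ₗ LinearMap.mulLeft F (MonoidAlgebra.single g 1) ∘ₗ
      (blockAlg hn F).toLinearMap = LinearMap.mulLeft F (resOp F (Refines hm hn π)
        (MonoidAlgebra.single g 1)) ∘ₗ (blockAlg hn F).toLinearMap := by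
    refine monoidAlgebra_end_ext fun u => ?_
    have h1 : MonoidAlgebra.single g 1 * blockAlg hn F (MonoidAlgebra.single u 1) =
        MonoidAlgebra.single (g * blockPerm n hn u) 1 := by
      rw [blockAlg_single, MonoidAlgebra.single_mul_single, one_mul]
    refine (congrArg (resOp F (Refines hm hn π)) h1).trans ?_
    refine Eq.trans ?_ (congrArg (· * blockAlg hn F (MonoidAlgebra.single u 1))
      (resOp_single (Refines hm hn π) g)).symm
    refine (resOp_single (Refines hm hn π) _).trans ?_
    by_cases hg : Refines hm hn π g
    · rw [if_pos hg, if_pos ((Refines.mul_blockPerm u).2 hg), h1]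
    · rw [if_neg hg, if_neg fun h => hg ((Refines.mul_blockPerm u).1 h), zero_mul]
  exact LinearMap.congr_fun h x

/-- The projection `x ↦ e_λ x` on the span of the permutations that map the blocks of `n` into the
prescribed blocks of `m`. -/
def refOp (F : Type*) [Field F] {m : Fin k → ℕ} (hm : ∑ j, m j = d) {n : Fin K → ℕ}
    (hn : ∑ b, n b = d) (π : Fin k × Fin r ≃ Fin K) (lam : ∀ j, Shape (m j)) :
    Module.End F (MonoidAlgebra F (Equiv.Perm (Fin d))) :=
  LinearMap.mulLeft F (blockAlg hm F (famId F lam)) * resOp F (Refines hm hn π)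

/-- The right action of a Young subgroup on the group algebra, as a left action. -/
def rightRep (F : Type*) [Field F] {n : Fin K → ℕ} (hn : ∑ b, n b = d) :
    MonoidAlgebra F (∀ b, Equiv.Perm (Fin (n b))) →ₐ[F]
      Module.End F (MonoidAlgebra F (Equiv.Perm (Fin d))) :=
  AlgHom.ofLinearMap
    { toFun := fun x => LinearMap.mulRight F (invAlg (blockAlg hn F x))
      map_add' := fun x y => by ext; simp
      map_smul' := fun c x => by ext; simp }
    (LinearMap.ext fun y => by
      change y * invAlg (blockAlg hn F 1) = y
      rw [map_one, MonoidAlgebra.one_def, invAlg_single, inv_one]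
      exact mul_one y)
    (fun x x' => LinearMap.ext fun y => by
      change y * invAlg (blockAlg hn F (x * x')) =
        (y * invAlg (blockAlg hn F x')) * invAlg (blockAlg hn F x)
      rw [map_mul, invAlg_mul, mul_assoc])

lemma rightRep_apply (x : MonoidAlgebra F (∀ b, Equiv.Perm (Fin (n b))))
    (y : MonoidAlgebra F (Equiv.Perm (Fin d))) :
    rightRep F hn x y = y * invAlg (blockAlg hn F x) := rfl

lemma refOp_mul_rightRep (lam : ∀ j, Shape (m j))
    (x : MonoidAlgebra F (∀ b, Equiv.Perm (Fin (n b)))) :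
    refOp F hm hn π lam * rightRep F hn x = rightRep F hn x * refOp F hm hn π lam := by
  have h : rightRep F hn x = LinearMap.mulRight F (blockAlg hn F (invAlg x)) := by
    rw [← invAlg_blockAlg]; rfl
  rw [h, refOp, mul_assoc, resOp_mul_mulRight, ← mul_assoc, ← mul_assoc]
  congr 1
  exact LinearMap.ext fun y => (mul_assoc _ y _).symm

lemma refOp_mul_refOp (hF : ∀ j, ((m j).factorial : F) ≠ 0) (lam : ∀ j, Shape (m j)) :
    refOp F hm hn π lam * refOp F hm hn π lam = refOp F hm hn π lam := by
  have h : LinearMap.mulLeft F (blockAlg hm F (famId F lam)) *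
      LinearMap.mulLeft F (blockAlg hm F (famId F lam)) =
      LinearMap.mulLeft F (blockAlg hm F (famId F lam)) := by
    refine LinearMap.ext fun y => ?_
    change _ * (_ * y) = _ * y
    rw [← mul_assoc, ← map_mul, famId_idem _ _ hF]
  rw [refOp, mul_assoc, ← mul_assoc (resOp F _), resOp_mul_mulLeft, mul_assoc, resOp_mul_resOp,
    ← mul_assoc, h]

include hπ in
/-- The ranks of the primitive idempotents of a Young subgroup on the span of the permutations
that refine blocks: a product of Littlewood–Richardson coefficients. -/
lemma finrank_refOp (hF : ∀ j, ((m j).factorial : F) ≠ 0) (lam : ∀ j, Shape (m j))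
    (nu : ∀ b, Shape (n b)) :
    Module.finrank F (LinearMap.range (rightRep F hn (famId F nu) * refOp F hm hn π lam)) =
      ∏ j, lrNum (hπ j) F (fun i => nu (π (j, i))) (lam j) := by
  set y := basePerm hm hn hπ with hy
  -- `κ` identifies the group algebra of the Young subgroup of `m` with the span of the refining
  -- permutations, which form a single coset; the operator becomes an outer tensor product.
  let κ : MonoidAlgebra F (∀ j, Equiv.Perm (Fin (m j))) →ₗ[F]
      MonoidAlgebra F (Equiv.Perm (Fin d)) :=
    LinearMap.mulRight F (MonoidAlgebra.single y 1) ∘ₗ (blockAlg hm F).toLinearMap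
  have hκ : ∀ f, κ f = blockAlg hm F f * MonoidAlgebra.single y 1 := fun _ => rfl
  have hyy : (MonoidAlgebra.single y 1 * MonoidAlgebra.single y⁻¹ 1 :
      MonoidAlgebra F (Equiv.Perm (Fin d))) = 1 := by
    rw [MonoidAlgebra.single_mul_single, mul_inv_cancel, one_mul]; rfl
  have hinj : Function.Injective κ := by
    intro f f' h
    have h1 := congrArg (· * MonoidAlgebra.single y⁻¹ (1 : F)) h
    simp only [hκ, mul_assoc, hyy, mul_one] at h1
    exact blockAlg_injective hm h1
  let a : ∀ j, MonoidAlgebra F (Equiv.Perm (Fin (m j))) := fun j =>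
    invAlg (blockAlg (hπ j) F (famId F fun i => nu (π (j, i))))
  have ha : (MonoidAlgebra.single y 1 : MonoidAlgebra F (Equiv.Perm (Fin d))) *
      invAlg (blockAlg hn F (famId F nu)) =
      blockAlg hm F (box F _ a) * MonoidAlgebra.single y 1 := by
    rw [famId, invAlg_blockAlg, invAlg_box, hy, basePerm_mul_blockAlg hm hn hπ]
    simp only [a, famId, invAlg_blockAlg, invAlg_box]
  let T : Module.End F (MonoidAlgebra F (∀ j, Equiv.Perm (Fin (m j)))) :=
    LinearMap.mulLeft F (famId F lam) ∘ₗ LinearMap.mulRight F (box F _ a)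
  have hT : ∀ f, (rightRep F hn (famId F nu) * refOp F hm hn π lam) (κ f) = κ (T f) := by
    intro f
    have h1 : resOp F (Refines hm hn π) (κ f) = κ f := by
      rw [hκ, ← sum_coeff_smul f]
      simp only [map_sum, Finset.sum_mul, map_smul, smul_mul_assoc, blockAlg_single,
        MonoidAlgebra.single_mul_single, one_mul, resOp_single]
      exact Finset.sum_congr rfl fun u _ => by
        rw [if_pos ((refines_iff hm hn hπ _).2 ⟨u, rfl⟩)]
    change (blockAlg hm F (famId F lam) * resOp F (Refines hm hn π) (κ f)) *
      invAlg (blockAlg hn F (famId F nu)) = κ (famId F lam * (f * box F _ a))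
    rw [h1, hκ, hκ, map_mul, map_mul]
    simp only [mul_assoc, ha]
  have hres : ∀ x, ∃ f, resOp F (Refines hm hn π) x = κ f := by
    intro x
    rw [← sum_coeff_smul x]
    have hex : ∀ g, ∃ f, resOp F (Refines hm hn π) (MonoidAlgebra.single g 1) = κ f := by
      intro g
      rw [resOp_single]
      split_ifs with h
      · obtain ⟨u, rfl⟩ := (refines_iff hm hn hπ g).1 h
        refine ⟨MonoidAlgebra.single u 1, ?_⟩
        rw [hκ, blockAlg_single, MonoidAlgebra.single_mul_single, one_mul]
      · exact ⟨0, (map_zero κ).symm⟩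
    choose f hf using hex
    refine ⟨∑ g, x.coeff g • f g, ?_⟩
    simp only [map_sum, map_smul, hf]
  have hrange : LinearMap.range (rightRep F hn (famId F nu) * refOp F hm hn π lam) =
      (LinearMap.range T).map κ := by
    ext z
    constructor
    · rintro ⟨x, rfl⟩
      obtain ⟨f, hf⟩ := hres x
      refine ⟨T f, ⟨f, rfl⟩, ?_⟩
      rw [← hT]
      change (rightRep F hn (famId F nu)) (blockAlg hm F (famId F lam) * resOp F _ (κ f)) =
        (rightRep F hn (famId F nu)) (blockAlg hm F (famId F lam) * resOp F _ x)
      rw [← hf]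
      have := LinearMap.congr_fun (resOp_mul_resOp (F := F) (Refines hm hn π)) x
      rw [Module.End.mul_apply] at this
      rw [this]
    · rintro ⟨_, ⟨f, rfl⟩, rfl⟩
      exact ⟨κ f, hT f⟩
  rw [hrange, (Submodule.equivMapOfInjective κ hinj _).finrank_eq.symm]
  rw [finrank_range_box (t := fun j => LinearMap.mulLeft F (yId F (lam j)) ∘ₗ
    LinearMap.mulRight F (a j)) fun f => by
      change famId F lam * (box F _ f * box F _ a) = _
      rw [famId, box_mul, box_mul]
      rfl]
  exact Finset.prod_congr rfl fun j _ => finrank_range_inv (hπ j) (hF j) _ _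

/-- If the sizes do not match, no permutation refines the blocks. -/
lemma finrank_refOp_eq_zero (h : ¬ ∀ j, ∑ i, n (π (j, i)) = m j) (lam : ∀ j, Shape (m j))
    (T : Module.End F (MonoidAlgebra F (Equiv.Perm (Fin d)))) :
    Module.finrank F (LinearMap.range (T * refOp F hm hn π lam)) = 0 := by
  have h1 : resOp F (Refines hm hn π) = 0 := by
    refine monoidAlgebra_end_ext fun g => ?_
    rw [resOp_single, if_neg fun hg => h hg.sum_eq]
    rfl
  rw [refOp, h1, mul_zero, mul_zero, LinearMap.range_zero, finrank_bot]

end Refine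

/-! ### Signs of inversions -/

section Signs

variable {F : Type*} [Field F]

lemma invExp_zero {n : ℕ} (w : Equiv.Perm (Fin n)) : invExp w 0 = 0 := by simp [invExp]

lemma sg_ne_zero (x : ZMod 2) : sg F x ≠ 0 := fun h => by
  simpa [h] using sg_mul_self (F := F) x

lemma sg_sum {ι : Type*} (s : Finset ι) (f : ι → ZMod 2) :
    sg F (∑ i ∈ s, f i) = ∏ i ∈ s, sg F (f i) := by
  classical
  induction s using Finset.induction_on with
  | empty => simp
  | insert i s hi ih => rw [Finset.sum_insert hi, Finset.prod_insert hi, sg_add, ih]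

/-- On words of odd letters, the sign rule for permutations is the sign character. -/
lemma sg_invExp_one {n : ℕ} (w : Equiv.Perm (Fin n)) :
    sg F (invExp w 1) = (((Equiv.Perm.sign w : ℤˣ) : ℤ) : F) := by
  rw [Equiv.Perm.sign_eq_prod_prod_Ioi, invExp, sg_sum]
  push_cast
  refine Finset.prod_congr rfl fun a _ => ?_
  rw [sg_sum, ← Finset.prod_subset (Finset.subset_univ (Finset.Ioi a))]
  · refine Finset.prod_congr rfl fun c hc => ?_
    have hac := Finset.mem_Ioi.1 hc
    rcases lt_or_gt_of_ne (fun h => hac.ne (w.injective h)) with h | h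
    · simp [h, h.not_gt]
    · simp [h, hac, h.not_gt, sg]
  · intro c _ hc
    rw [if_neg fun h => hc (Finset.mem_Ioi.2 h.1), sg_zero]

end Signs

/-! ### The operators on the group algebra attached to a word -/

section KernelOp

variable {F : Type*} [Field F] {ℓ : ℕ} [NeZero ℓ] {d : ℕ}

/-- A word containing a label that is not a path stands for zero. -/
lemma wordElt_of_not_ok {c : Fin d → Slot ℓ} (h : ¬ ∀ i, (c i).Ok) (w : Equiv.Perm (Fin d)) :
    wordElt F c w = 0 := by
  obtain ⟨i, hi⟩ := not_forall.1 h
  exact wr_eq_zero _ i (path_of_not_ok hi) w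

/-- The words of paths times permutations span `W_d`. -/
lemma wr_word_induction {p : Wr F (BA F ℓ) d → Prop} (h0 : p 0)
    (ha : ∀ x y, p x → p y → p (x + y)) (hs : ∀ (r : F) x, p x → p (r • x))
    (h : ∀ (c : Fin d → Slot ℓ) (w : Equiv.Perm (Fin d)), (∀ i, (c i).Ok) → p (wordElt F c w))
    (x : Wr F (BA F ℓ) d) : p x := by
  have hx := mem_wordFil_zero x
  induction hx using Submodule.span_induction with
  | mem x hx =>
    obtain ⟨c, w, -, rfl⟩ := hx
    by_cases hc : ∀ i, (c i).Ok
    · exact h c w hc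
    · rw [wordElt_of_not_ok hc]; exact h0
  | zero => exact h0
  | add x y _ _ hx hy => exact ha x y hx hy
  | smul r x _ hx => exact hs r x hx

/-- The sign of the permutation `g` of the letters of the word `b`. -/
def wordSign (F : Type*) [Field F] (b : Fin d → Slot ℓ) (g : Equiv.Perm (Fin d)) : F :=
  sg F (invExp g fun i => (b i).par)

/-- The operator on the group algebra of `𝔖_d` attached to an element `z` of `W_d` and a word `b`.
Its matrix entry at `(g, h)` is, up to a sign, the coefficient in `z` of the basis element of `W_d`
given by the word `b ∘ g⁻¹` and the permutation `g h⁻¹`. -/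
def kernelOp (b : Fin d → Slot ℓ) :
    Wr F (BA F ℓ) d →ₗ[F] Module.End F (MonoidAlgebra F (Equiv.Perm (Fin d))) :=
  ((grpBasis F (Equiv.Perm (Fin d))).constr F).toLinearMap ∘ₗ LinearMap.pi fun h =>
    ∑ g : Equiv.Perm (Fin d), (wordCoord (fun i => b (g.symm i)) ∘ₗ
      wrCoeff F (BA F ℓ) d (g * h⁻¹)).smulRight (MonoidAlgebra.single g (wordSign F b g))

lemma kernelOp_single (b : Fin d → Slot ℓ) (z : Wr F (BA F ℓ) d) (h : Equiv.Perm (Fin d)) :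
    kernelOp b z (MonoidAlgebra.single h 1) = ∑ g : Equiv.Perm (Fin d),
      wordCoord (fun i => b (g.symm i)) (wrCoeff F (BA F ℓ) d (g * h⁻¹) z) •
        MonoidAlgebra.single g (wordSign F b g) := by
  refine ((grpBasis F (Equiv.Perm (Fin d))).constr_basis F _ h).trans ?_
  rw [LinearMap.pi_apply, LinearMap.sum_apply]
  rfl

lemma coeff_kernelOp (b : Fin d → Slot ℓ) (z : Wr F (BA F ℓ) d) (h g : Equiv.Perm (Fin d)) :
    (kernelOp b z (MonoidAlgebra.single h 1)).coeff g =
      wordCoord (fun i => b (g.symm i)) (wrCoeff F (BA F ℓ) d (g * h⁻¹) z) * wordSign F b g := by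
  rw [kernelOp_single, MonoidAlgebra.coeff_sum, Finset.sum_apply', Finset.sum_eq_single g]
  · simp
  · intro u _ hu
    simp [hu]
  · simp

/-- A basis element of `W_d` acts on the basis elements of the group algebra by left translations
and signs. -/
lemma kernelOp_wordElt (b : Fin d → Slot ℓ) {c : Fin d → Slot ℓ} (hc : ∀ i, (c i).Ok)
    (w h : Equiv.Perm (Fin d)) :
    kernelOp b (wordElt F c w) (MonoidAlgebra.single h 1) =
      if (fun i => b ((w * h).symm i)) = c then
        MonoidAlgebra.single (w * h) (wordSign F b (w * h)) else 0 := by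
  rw [kernelOp_single, Finset.sum_eq_single (w * h)]
  · rw [wordElt, wr, wrCoeff_single, if_pos (by group), wordCoord_path _ hc]
    split_ifs
    · rw [one_smul]
    · rw [zero_smul]
  · intro g _ hg
    rw [wordElt, wr, wrCoeff_single, if_neg, map_zero, zero_smul]
    rintro rfl
    exact hg (by group)
  · simp

lemma single_mul_wordElt (σ : Equiv.Perm (Fin d)) (c : Fin d → Slot ℓ) (w : Equiv.Perm (Fin d)) :
    SkewMonoidAlgebra.single σ 1 * wordElt F c w =
      wordSign F c σ • wordElt F (fun i => c (σ.symm i)) (σ * w) := by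
  rw [wordElt, wr, SkewMonoidAlgebra.single_mul_single, one_mul,
    perm_smul_pten σ fun i => pr_path (c i), wordElt, wr, SkewMonoidAlgebra.smul_single]
  rfl

lemma wordElt_mul_single (σ : Equiv.Perm (Fin d)) (c : Fin d → Slot ℓ) (w : Equiv.Perm (Fin d)) :
    wordElt F c w * SkewMonoidAlgebra.single σ 1 = wordElt F c (w * σ) := by
  rw [wordElt, wr, SkewMonoidAlgebra.single_mul_single, smul_one, mul_one]
  rfl

lemma wordSign_mul (b : Fin d → Slot ℓ) (w v : Equiv.Perm (Fin d)) :
    wordSign F b (w * v) = wordSign F b v * wordSign F (fun i => b (v.symm i)) w := by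
  rw [wordSign, invExp_mul, sg_add]; rfl

/-- The signs in `kernelOp` are chosen so that permutations act by left translation,
without signs. -/
lemma kernelOp_single_mul (b : Fin d → Slot ℓ) (σ : Equiv.Perm (Fin d)) (z : Wr F (BA F ℓ) d) :
    kernelOp b (SkewMonoidAlgebra.single σ 1 * z) =
      LinearMap.mulLeft F (MonoidAlgebra.single σ 1) * kernelOp b z := by
  induction z using wr_word_induction with
  | h0 => rw [mul_zero, map_zero, mul_zero]
  | ha x y hx hy => rw [mul_add, map_add, map_add, hx, hy, mul_add]
  | hs r x hx => rw [mul_smul_comm, map_smul, map_smul, hx, mul_smul_comm]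
  | h c w hc =>
  refine monoidAlgebra_end_ext fun h => ?_
  rw [Module.End.mul_apply, LinearMap.mulLeft_apply, single_mul_wordElt, map_smul,
    LinearMap.smul_apply, kernelOp_wordElt b (fun i => hc _), kernelOp_wordElt b hc]
  by_cases hbc : (fun i => b ((w * h).symm i)) = c
  · subst hbc
    rw [if_pos rfl, if_pos (by funext i; rfl), MonoidAlgebra.single_mul_single,
      MonoidAlgebra.smul_single, smul_eq_mul, one_mul, mul_assoc σ w h, wordSign_mul b σ, mul_comm,
      mul_assoc]
    rw [wordSign, wordSign, sg_mul_self, mul_one]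
  · rw [if_neg hbc, if_neg, smul_zero, mul_zero]
    intro h'
    refine hbc (funext fun i => ?_)
    have := congrFun h' (σ i)
    simpa [Equiv.Perm.mul_def] using this

lemma kernelOp_mul_single (b : Fin d → Slot ℓ) (σ : Equiv.Perm (Fin d)) (z : Wr F (BA F ℓ) d) :
    kernelOp b (z * SkewMonoidAlgebra.single σ 1) =
      kernelOp b z * LinearMap.mulLeft F (MonoidAlgebra.single σ 1) := by
  induction z using wr_word_induction with
  | h0 => rw [zero_mul, map_zero, zero_mul]
  | ha x y hx hy => rw [add_mul, map_add, map_add, hx, hy, add_mul]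
  | hs r x hx => rw [smul_mul_assoc, map_smul, map_smul, hx, smul_mul_assoc]
  | h c w hc =>
  refine monoidAlgebra_end_ext fun h => ?_
  rw [wordElt_mul_single, Module.End.mul_apply, LinearMap.mulLeft_apply,
    MonoidAlgebra.single_mul_single, one_mul, kernelOp_wordElt b hc, kernelOp_wordElt b hc,
    mul_assoc]

open Classical in
/-- Multiplying by `e_T` from the left restricts the values of the operators to the permutations `g`
that place the letters of `b` such that their end vertices form the word `T`. -/
lemma kernelOp_wordIdem_mul (b : Fin d → Slot ℓ) (T : Fin d → Fin ℓ) (z : Wr F (BA F ℓ) d) :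
    kernelOp b (wordIdem F T * z) =
      resOp F (fun g : Equiv.Perm (Fin d) => ∀ i, T (g i) = (b i).tgt) * kernelOp b z := by
  induction z using wr_word_induction with
  | h0 => rw [mul_zero, map_zero, mul_zero]
  | ha x y hx hy => rw [mul_add, map_add, map_add, hx, hy, mul_add]
  | hs r x hx => rw [mul_smul_comm, map_smul, map_smul, hx, mul_smul_comm]
  | h c w hc =>
  refine monoidAlgebra_end_ext fun h => ?_
  rw [Module.End.mul_apply, wordIdem_mul_wordElt, kernelOp_wordElt b hc]
  by_cases hbc : (fun i => b ((w * h).symm i)) = c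
  · have h1 : (MonoidAlgebra.single (w * h) (wordSign F b (w * h)) :
        MonoidAlgebra F (Equiv.Perm (Fin d))) =
        wordSign F b (w * h) • MonoidAlgebra.single (w * h) 1 := by simp
    have hiff : (∀ i, (c i).tgt = T i) ↔ ∀ i, T ((w * h) i) = (b i).tgt := by
      subst hbc
      constructor
      · intro hT i
        have := hT ((w * h) i)
        dsimp only at this
        rw [Equiv.symm_apply_apply] at this
        exact this.symm
      · intro hT i
        have := hT ((w * h).symm i)
        dsimp only
        rw [Equiv.apply_symm_apply] at this
        exact this.symm
    rw [if_pos hbc, h1, map_smul, resOp_single]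
    by_cases hT : ∀ i, (c i).tgt = T i
    · rw [if_pos hT, if_pos (hiff.1 hT), kernelOp_wordElt b hc, if_pos hbc, h1]
    · rw [if_neg hT, if_neg (hT ∘ hiff.2), map_zero, smul_zero, LinearMap.zero_apply]
  · rw [if_neg hbc, map_zero]
    split_ifs
    · rw [kernelOp_wordElt b hc, if_neg hbc]
    · rw [map_zero, LinearMap.zero_apply]

open Classical in
/-- Multiplying by `e_S` from the right restricts the operators to the permutations that place the
letters of `b` such that their start vertices form the word `S`. -/
lemma kernelOp_mul_wordIdem (b : Fin d → Slot ℓ) (S : Fin d → Fin ℓ) (z : Wr F (BA F ℓ) d) :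
    kernelOp b (z * wordIdem F S) =
      kernelOp b z * resOp F (fun h : Equiv.Perm (Fin d) => ∀ i, S (h i) = (b i).1) := by
  induction z using wr_word_induction with
  | h0 => rw [zero_mul, map_zero, zero_mul]
  | ha x y hx hy => rw [add_mul, map_add, map_add, hx, hy, add_mul]
  | hs r x hx => rw [smul_mul_assoc, map_smul, map_smul, hx, smul_mul_assoc]
  | h c w hc =>
  refine monoidAlgebra_end_ext fun h => ?_
  rw [Module.End.mul_apply, wordElt_mul_wordIdem, resOp_single]
  by_cases hbc : (fun i => b ((w * h).symm i)) = c
  · have hiff : (∀ i, (c i).1 = S (w.symm i)) ↔ ∀ i, S (h i) = (b i).1 := by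
      subst hbc
      constructor
      · intro h' i
        have := h' (w (h i))
        simpa [Equiv.Perm.mul_def, eq_comm] using this
      · intro h' i
        have := h' (h.symm (w.symm i))
        simpa [Equiv.Perm.mul_def, eq_comm] using this
    by_cases hT : ∀ i, (c i).1 = S (w.symm i)
    · rw [if_pos hT, if_pos (hiff.1 hT)]
    · rw [if_neg hT, if_neg (hT ∘ hiff.2), map_zero, map_zero, LinearMap.zero_apply]
  · have h0 : kernelOp b (wordElt F c w) (MonoidAlgebra.single h 1) = 0 := by
      rw [kernelOp_wordElt b hc, if_neg hbc]
    split_ifs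
    · rfl
    · rw [h0, map_zero]
    · rw [map_zero, LinearMap.zero_apply, h0]
    · rw [map_zero, map_zero, LinearMap.zero_apply]

lemma permAlg_eq_sum (x : MonoidAlgebra F (Equiv.Perm (Fin d))) :
    permAlg F (BA F ℓ) d x = ∑ w, x.coeff w • SkewMonoidAlgebra.single w 1 := by
  conv_lhs => rw [← sum_coeff_smul x, map_sum]
  refine Finset.sum_congr rfl fun w _ => ?_
  rw [map_smul, permAlg_single, one_smul]

lemma mulLeft_eq_sum (x : MonoidAlgebra F (Equiv.Perm (Fin d))) :
    LinearMap.mulLeft F x =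
      ∑ w, x.coeff w • LinearMap.mulLeft F (MonoidAlgebra.single w (1 : F)) := by
  refine LinearMap.ext fun y => ?_
  rw [LinearMap.sum_apply]
  change x * y = ∑ w, x.coeff w • (MonoidAlgebra.single w (1 : F) * y)
  conv_lhs => rw [← sum_coeff_smul x, Finset.sum_mul]
  exact Finset.sum_congr rfl fun w _ => smul_mul_assoc _ _ _

lemma kernelOp_permAlg_mul (b : Fin d → Slot ℓ) (x : MonoidAlgebra F (Equiv.Perm (Fin d)))
    (z : Wr F (BA F ℓ) d) :
    kernelOp b (permAlg F (BA F ℓ) d x * z) = LinearMap.mulLeft F x * kernelOp b z := by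
  rw [permAlg_eq_sum, mulLeft_eq_sum, Finset.sum_mul, Finset.sum_mul, map_sum]
  refine Finset.sum_congr rfl fun w _ => ?_
  rw [smul_mul_assoc, smul_mul_assoc, map_smul, kernelOp_single_mul]

lemma kernelOp_mul_permAlg (b : Fin d → Slot ℓ) (x : MonoidAlgebra F (Equiv.Perm (Fin d)))
    (z : Wr F (BA F ℓ) d) :
    kernelOp b (z * permAlg F (BA F ℓ) d x) = kernelOp b z * LinearMap.mulLeft F x := by
  rw [permAlg_eq_sum, mulLeft_eq_sum, Finset.mul_sum, Finset.mul_sum, map_sum]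
  refine Finset.sum_congr rfl fun w _ => ?_
  rw [mul_smul_comm, mul_smul_comm, map_smul, kernelOp_mul_single]

end KernelOp

/-! ### Sign twists on Young subgroups -/

section SignTwist

variable {F : Type*} [Field F] {ι : Type*} [Fintype ι] [DecidableEq ι] {n : ι → ℕ}
  (P : ι → Prop) [DecidablePred P]

/-- The sign character of the factors of a Young subgroup with index in `P`. -/
def partSign (F : Type*) [Field F] : (∀ j, Equiv.Perm (Fin (n j))) →* F where
  toFun u := ∏ j, if P j then (((Equiv.Perm.sign (u j) : ℤˣ) : ℤ) : F) else 1
  map_one' := by simp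
  map_mul' u v := by
    rw [← Finset.prod_mul_distrib]
    refine Finset.prod_congr rfl fun j _ => ?_
    split_ifs
    · simp
    · simp

/-- The automorphism of the group algebra of a Young subgroup that multiplies group elements by
the sign character of the factors with index in `P`. -/
def signTwist : MonoidAlgebra F (∀ j, Equiv.Perm (Fin (n j))) →ₐ[F]
    MonoidAlgebra F (∀ j, Equiv.Perm (Fin (n j))) :=
  MonoidAlgebra.lift F _ _
    { toFun := fun u => MonoidAlgebra.single u (partSign P F u)
      map_one' := by rw [map_one, MonoidAlgebra.one_def]
      map_mul' := fun u v => by rw [map_mul, MonoidAlgebra.single_mul_single] }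

lemma signTwist_single (u : ∀ j, Equiv.Perm (Fin (n j))) (r : F) :
    signTwist P (MonoidAlgebra.single u r) = MonoidAlgebra.single u (r * partSign P F u) := by
  rw [signTwist, MonoidAlgebra.lift_single]
  simp

lemma coeff_signTwist (x : MonoidAlgebra F (∀ j, Equiv.Perm (Fin (n j))))
    (u : ∀ j, Equiv.Perm (Fin (n j))) :
    (signTwist P x).coeff u = x.coeff u * partSign P F u := by
  conv_lhs => rw [← sum_coeff_smul x, map_sum, MonoidAlgebra.coeff_sum, Finset.sum_apply']
  rw [Finset.sum_eq_single u]
  · rw [map_smul, signTwist_single]; simp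
  · intro v _ hv
    rw [map_smul, signTwist_single]; simp [hv]
  · simp

lemma signTwist_box (f : ∀ j, MonoidAlgebra F (Equiv.Perm (Fin (n j)))) :
    signTwist P (box F _ f) = box F _ fun j => if P j then sgnAlg F _ (f j) else f j := by
  ext u
  rw [coeff_signTwist, coeff_box, coeff_box, partSign, MonoidHom.coe_mk, OneHom.coe_mk,
    ← Finset.prod_mul_distrib]
  refine Finset.prod_congr rfl fun j _ => ?_
  split_ifs
  · rw [coeff_sgnAlg]
  · rw [mul_one]

/-- Conjugation of the partitions with index in `P`. -/
def twistShape (nu : ∀ j, Shape (n j)) (j : ι) : Shape (n j) := if P j then (nu j).tr else nu j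

/-- Twisting by the sign characters of the factors in `P` conjugates their partitions. -/
lemma equivIdem_signTwist (nu : ∀ j, Shape (n j)) (hF : ∀ j, ((n j).factorial : F) ≠ 0) :
    EquivIdem (signTwist P (famId F nu)) (famId F (twistShape P nu)) := by
  rw [famId, signTwist_box]
  refine equivIdem_box fun j => ?_
  rw [twistShape]
  split_ifs
  · exact equivIdem_sgnAlg (nu j)
  · exact ⟨yId F (nu j), yId F (nu j), yId_idem (hF j) _, yId_idem (hF j) _⟩

end SignTwist

/-! ### Words and their types -/

section WordType

variable {F : Type*} [Field F] {ℓ : ℕ} [NeZero ℓ] {d : ℕ}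

/-- The word in which the letters are sorted and the `k`-th letter has multiplicity `n k`. -/
def letters {n : Fin (ℓ * 4) → ℕ} (hn : ∑ b, n b = d) (i : Fin d) : Slot ℓ :=
  finProdFinEquiv.symm (blockWord hn i)

/-- The letters that are odd paths. -/
abbrev OddLetter (b : Fin (ℓ * 4)) : Prop := (finProdFinEquiv.symm b : Slot ℓ) = (0, 1)

/-- Permuting equal letters costs the sign of the permutation of the odd letters: even letters
commute, and equal odd letters anticommute. -/
lemma wordSign_blockPerm {n : Fin (ℓ * 4) → ℕ} (hn : ∑ b, n b = d)
    (u : ∀ b, Equiv.Perm (Fin (n b))) :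
    wordSign F (letters (ℓ := ℓ) hn) (blockPerm n hn u) = partSign OddLetter F u := by
  rw [wordSign, invExp_block, sg_sum, partSign, MonoidHom.coe_mk, OneHom.coe_mk]
  refine Finset.prod_congr rfl fun b _ => ?_
  simp only [letters, blockWord_blockEquiv]
  split_ifs with h
  · rw [← sg_invExp_one]
    congr 2
    funext m
    rw [h]; simp [Slot.par]
  · rw [show (fun _ : Fin (n b) => Slot.par (finProdFinEquiv.symm b : Slot ℓ)) = 0 from
      funext fun _ => if_neg h, invExp_zero, sg_zero]

lemma letters_blockPerm {n : Fin (ℓ * 4) → ℕ} (hn : ∑ b, n b = d)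
    (u : ∀ b, Equiv.Perm (Fin (n b))) (i : Fin d) :
    letters (ℓ := ℓ) hn (blockPerm n hn u i) = letters hn i := by
  rw [letters, blockWord_blockPerm, letters]

lemma wordSign_mul_blockPerm {n : Fin (ℓ * 4) → ℕ} (hn : ∑ b, n b = d)
    (g : Equiv.Perm (Fin d)) (u : ∀ b, Equiv.Perm (Fin (n b))) :
    wordSign F (letters (ℓ := ℓ) hn) (g * blockPerm n hn u) =
      partSign OddLetter F u * wordSign F (letters hn) g := by
  rw [wordSign_mul, wordSign_blockPerm]
  congr 2
  funext i
  rw [← letters_blockPerm hn u, Equiv.apply_symm_apply]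

lemma partSign_inv {ι : Type*} [Fintype ι] {n : ι → ℕ} (P : ι → Prop) [DecidablePred P]
    (u : ∀ b, Equiv.Perm (Fin (n b))) : partSign P F u⁻¹ = partSign P F u := by
  simp [partSign]

lemma blockPerm_inv {k : ℕ} {n : Fin k → ℕ} (hn : ∑ b, n b = d)
    (u : ∀ b, Equiv.Perm (Fin (n b))) : blockPerm n hn u⁻¹ = (blockPerm n hn u)⁻¹ := by
  ext i
  obtain ⟨x, rfl⟩ := (blockEquiv n hn).surjective i
  rw [blockPerm_apply, Equiv.Perm.inv_def, blockPerm_symm_apply]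
  rfl

lemma rightRep_single {k : ℕ} {n : Fin k → ℕ} (hn : ∑ b, n b = d)
    (u : ∀ b, Equiv.Perm (Fin (n b))) (r s : F) (g : Equiv.Perm (Fin d)) :
    rightRep F hn (MonoidAlgebra.single u r) (MonoidAlgebra.single g s) =
      MonoidAlgebra.single (g * blockPerm n hn u⁻¹) (s * r) := by
  rw [rightRep_apply, blockAlg_single, invAlg_single, MonoidAlgebra.single_mul_single,
    blockPerm_inv]

/-- The operators attached to the sorted words commute with the right action of the Young subgroup
up to the sign of the permutation of the odd letters. -/
lemma kernelOp_mul_rightRep {n : Fin (ℓ * 4) → ℕ} (hn : ∑ b, n b = d) (z : Wr F (BA F ℓ) d)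
    (x : MonoidAlgebra F (∀ b, Equiv.Perm (Fin (n b)))) :
    kernelOp (letters hn) z * rightRep F hn x =
      rightRep F hn (signTwist OddLetter x) * kernelOp (letters hn) z := by
  rw [← sum_coeff_smul x]
  simp only [map_sum, map_smul, Finset.sum_mul, Finset.mul_sum, mul_smul_comm, smul_mul_assoc]
  refine Finset.sum_congr rfl fun u _ => congrArg (x.coeff u • ·) ?_
  induction z using wr_word_induction with
  | h0 => rw [map_zero, zero_mul, mul_zero]
  | ha x y hx hy => rw [map_add, add_mul, hx, hy, mul_add]
  | hs r x hx => rw [map_smul, smul_mul_assoc, hx, mul_smul_comm]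
  | h c w hc =>
  refine monoidAlgebra_end_ext fun h => ?_
  rw [Module.End.mul_apply, Module.End.mul_apply, rightRep_single, one_mul,
    kernelOp_wordElt _ hc, kernelOp_wordElt _ hc, signTwist_single, one_mul, ← mul_assoc w h,
    wordSign_mul_blockPerm, partSign_inv]
  have hiff : (fun i => letters (ℓ := ℓ) hn ((w * h * blockPerm n hn u⁻¹).symm i)) =
      fun i => letters hn ((w * h).symm i) := by
    funext i
    rw [← letters_blockPerm hn u⁻¹]
    congr 1
    rw [← Equiv.Perm.mul_apply, ← Equiv.Perm.inv_def, ← Equiv.Perm.inv_def, mul_inv_rev,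
      mul_inv_cancel_left]
  rw [hiff]
  split_ifs
  · rw [rightRep_single, mul_comm (partSign OddLetter F u)]
  · rw [map_zero]

variable (ℓ d) in
/-- The multiplicity functions of the letters of words of length `d` in the basis of `A_ℓ`: labels
that do not stand for a path have multiplicity `0`. -/
def WordType : Type :=
  {n : Fin (ℓ * 4) → ℕ //
    ∑ b, n b = d ∧ ∀ b, ¬ Slot.Ok (finProdFinEquiv.symm b) → n b = 0}

lemma WordType.sum_eq (t : WordType ℓ d) : ∑ b, t.1 b = d := t.2.1

lemma WordType.le (t : WordType ℓ d) (b : Fin (ℓ * 4)) : t.1 b ≤ d :=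
  (Finset.single_le_sum (fun _ _ => Nat.zero_le _) (Finset.mem_univ b)).trans t.sum_eq.le

instance : Fintype (WordType ℓ d) :=
  Fintype.ofInjective (β := Fin (ℓ * 4) → Fin (d + 1))
    (fun t b => ⟨t.1 b, Nat.lt_succ_of_le (t.le b)⟩) fun _ _ h =>
      Subtype.ext (funext fun b => congrArg Fin.val (congrFun h b))

lemma WordType.letters_ok (t : WordType ℓ d) (i : Fin d) : (letters t.sum_eq i).Ok := by
  by_contra h
  obtain ⟨⟨b, m⟩, rfl⟩ := (blockEquiv t.1 t.sum_eq).surjective i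
  rw [letters, blockWord_blockEquiv] at h
  have := t.2.2 b h
  exact (Fin.cast this m).elim0

/-- Every word is a rearrangement of a sorted one. -/
lemma WordType.exists_letters {c : Fin d → Slot ℓ} (hc : ∀ i, (c i).Ok) :
    ∃ (t : WordType ℓ d) (g : Equiv.Perm (Fin d)), (fun i => letters t.sum_eq (g.symm i)) = c := by
  classical
  let c' : Fin d → Fin (ℓ * 4) := fun i => finProdFinEquiv (c i)
  let n : Fin (ℓ * 4) → ℕ := fun b => Fintype.card {i // c' i = b}
  have hn : ∑ b, n b = d := by
    rw [← Fintype.card_sigma, Fintype.card_congr (Equiv.sigmaFiberEquiv c'), Fintype.card_fin]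
  refine ⟨⟨n, hn, fun b hb => Fintype.card_eq_zero_iff.2 ⟨fun i => hb ?_⟩⟩,
    (blockEquiv n hn).symm.trans ((Equiv.sigmaCongrRight fun b =>
      (Fintype.equivFin {i // c' i = b}).symm).trans (Equiv.sigmaFiberEquiv c')), ?_⟩
  · rw [← i.2]
    simpa [c'] using hc i.1
  · funext i
    change (finProdFinEquiv.symm (blockWord hn (blockEquiv n hn _)) : Slot ℓ) = c i
    rw [blockWord_blockEquiv]
    change (finProdFinEquiv.symm (c' i) : Slot ℓ) = c i
    simp [c']

/-- Rearrangements have the same type. -/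
lemma WordType.eq_of_letters {t t' : WordType ℓ d} {g g' : Equiv.Perm (Fin d)}
    (h : ∀ i, letters t.sum_eq (g.symm i) = letters t'.sum_eq (g'.symm i)) : t = t' := by
  classical
  refine Subtype.ext (funext fun b => ?_)
  have key : ∀ (t : WordType ℓ d) (g : Equiv.Perm (Fin d)),
      ∑ i, (if letters (ℓ := ℓ) t.sum_eq (g.symm i) = finProdFinEquiv.symm b then 1 else 0) =
        t.1 b := by
    intro t g
    rw [Equiv.sum_comp g.symm
      fun i => if letters (ℓ := ℓ) t.sum_eq i = finProdFinEquiv.symm b then 1 else 0]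
    simp only [letters, EmbeddingLike.apply_eq_iff_eq]
    rw [sum_blockWord t.sum_eq fun a => if a = b then 1 else 0]
    simp
  rw [← key t g, ← key t' g']
  simp only [h]

/-- The stabilizer of a sorted word is the Young subgroup of its type. -/
lemma WordType.exists_of_letters {t : WordType ℓ d} {g g' : Equiv.Perm (Fin d)}
    (h : ∀ i, letters t.sum_eq (g.symm i) = letters t.sum_eq (g'.symm i)) :
    ∃ u, g * blockPerm t.1 t.sum_eq u = g' := by
  have h1 : ∀ i, blockWord t.sum_eq ((g⁻¹ * g') i) = blockWord t.sum_eq i := fun i => by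
    have := finProdFinEquiv.symm.injective (h (g' i))
    rwa [Equiv.symm_apply_apply] at this
  obtain ⟨u, hu⟩ := exists_blockPerm t.sum_eq h1
  exact ⟨u, by rw [hu, mul_inv_cancel_left]⟩

end WordType

/-! ### The wreath product as a sum of spaces of equivariant operators -/

section RangeSum

variable {F : Type*} [Field F]

/-- If a jointly injective family of maps `K t` identifies `a W b` with a product of subspaces, then
its dimension is the sum of their dimensions. -/
lemma finrank_range_eq_sum {W ι : Type*} [Ring W] [Algebra F W] [Fintype ι]
    {V : ι → Type*} [∀ t, AddCommGroup (V t)] [∀ t, Module F (V t)]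
    [∀ t, FiniteDimensional F (V t)] (K : ∀ t, W →ₗ[F] V t) {a b : W}
    {p : ∀ t, Submodule F (V t)} (hinj : ∀ z, (∀ t, K t z = 0) → z = 0)
    (hmem : ∀ t z, K t (a * (z * b)) ∈ p t)
    (hsurj : ∀ Z : ∀ t, p t, ∃ z, ∀ t, K t (a * (z * b)) = Z t) :
    Module.finrank F (LinearMap.range (LinearMap.mulLeft F a ∘ₗ LinearMap.mulRight F b)) =
      ∑ t, Module.finrank F (p t) := by
  set E := LinearMap.mulLeft F a ∘ₗ LinearMap.mulRight F b
  let Φ : LinearMap.range E →ₗ[F] ∀ t, p t := LinearMap.pi fun t =>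
    LinearMap.codRestrict _ (K t ∘ₗ (LinearMap.range E).subtype)
      (by rintro ⟨_, z, rfl⟩; exact hmem t z)
  have hΦ : Function.Bijective Φ := by
    constructor
    · refine (injective_iff_map_eq_zero Φ).2 fun x hx => Subtype.ext ?_
      exact hinj _ fun t => congrArg Subtype.val (congrFun hx t)
    · intro Z
      obtain ⟨z, hz⟩ := hsurj Z
      exact ⟨⟨_, z, rfl⟩, funext fun t => Subtype.ext (hz t)⟩
  rw [LinearEquiv.finrank_eq (LinearEquiv.ofBijective Φ hΦ), Module.finrank_pi_fintype]

variable {G V : Type*} [Group G] [AddCommGroup V] [Module F V]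
  {ρ ρ' : MonoidAlgebra F G →ₐ[F] Module.End F V} {p p' Z Y : Module.End F V}

lemma mem_equivHom (h : ∀ x, Z * ρ x = ρ' x * Z) (hZ : Z = p' * (Y * p)) (hp : p * p = p)
    (hp' : p' * p' = p') : Z ∈ equivHom ρ ρ' p p' := by
  refine ⟨h, ?_, ?_⟩
  · change p' * Z = Z
    rw [hZ, ← mul_assoc, hp']
  · change Z * p = Z
    rw [hZ, mul_assoc, mul_assoc, hp]

lemma mul_eq_of_mem_equivHom (h : Z ∈ equivHom ρ ρ' p p') (x : MonoidAlgebra F G) :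
    Z * ρ x = ρ' x * Z :=
  h.1 x

lemma eq_of_mem_equivHom {X : Module.End F V} (h : Z ∈ equivHom ρ ρ' p p') (hY : Y = Z)
    (hX : X = p' * (Y * p)) : X = Z := by
  have h1 : Z * p = Z := h.2.2
  have h2 : p' * Z = Z := h.2.1
  rw [hX, hY, h1, h2]

end RangeSum

section Corner

variable {F : Type*} [Field F] {ℓ : ℕ} [NeZero ℓ] {d : ℕ}

/-- Every coefficient of `z` is, up to a sign, a matrix entry of the operator of a sorted word. -/
lemma eq_zero_of_kernelOp_eq_zero {z : Wr F (BA F ℓ) d}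
    (h : ∀ t : WordType ℓ d, kernelOp (letters t.sum_eq) z = 0) : z = 0 := by
  have h1 : ∀ (c : Fin d → Slot ℓ) (w : Equiv.Perm (Fin d)), (∀ i, (c i).Ok) →
      wordCoord c (wrCoeff F (BA F ℓ) d w z) = 0 := by
    intro c w hc
    obtain ⟨t, g, rfl⟩ := WordType.exists_letters hc
    have h2 := coeff_kernelOp (letters t.sum_eq) z (w⁻¹ * g) g
    rw [h t, LinearMap.zero_apply, mul_inv_rev, inv_inv, mul_inv_cancel_left] at h2
    exact (mul_eq_zero.1 h2.symm).resolve_right (sg_ne_zero _)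
  have h3 : ∀ w, wrCoeff F (BA F ℓ) d w z = 0 := by
    intro w
    rw [← sum_wordCoord (wrCoeff F (BA F ℓ) d w z)]
    refine Finset.sum_eq_zero fun c _ => ?_
    by_cases hc : ∀ i, (c i).Ok
    · rw [h1 c w hc, zero_smul]
    · obtain ⟨i, hi⟩ := not_forall.1 hc
      have h4 : pten F (fun i => path F (c i)) = 0 :=
        MultilinearMap.map_coord_zero (PiTensorProduct.tprod F) i (path_of_not_ok hi)
      rw [h4, smul_zero]
  rw [← sum_wrSingle_wrCoeff z]
  refine Finset.sum_eq_zero fun w _ => ?_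
  rw [h3, map_zero]

lemma wordSign_mul_self (b : Fin d → Slot ℓ) (g : Equiv.Perm (Fin d)) :
    wordSign F b g * wordSign F b g = 1 :=
  sg_mul_self _

/-- The matrix entries of an equivariant operator are determined by those at representatives of the
cosets of the Young subgroup. -/
lemma coeff_of_equivariant {t : WordType ℓ d}
    {Z : Module.End F (MonoidAlgebra F (Equiv.Perm (Fin d)))}
    (hZ : ∀ x, Z * rightRep F t.sum_eq x = rightRep F t.sum_eq (signTwist OddLetter x) * Z)
    (g h : Equiv.Perm (Fin d)) (u : ∀ b, Equiv.Perm (Fin (t.1 b))) :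
    (Z (MonoidAlgebra.single (h * blockPerm t.1 t.sum_eq u) 1)).coeff
      (g * blockPerm t.1 t.sum_eq u) =
        partSign OddLetter F u * (Z (MonoidAlgebra.single h 1)).coeff g := by
  have h1 := LinearMap.congr_fun (hZ (MonoidAlgebra.single u⁻¹ 1)) (MonoidAlgebra.single h 1)
  rw [Module.End.mul_apply, Module.End.mul_apply, rightRep_single, inv_inv, one_mul,
    signTwist_single, one_mul, partSign_inv, rightRep_apply, blockAlg_single, invAlg_single,
    ← blockPerm_inv, inv_inv] at h1
  rw [h1, MonoidAlgebra.coeff_mul_single_apply, mul_inv_cancel_right, mul_comm]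

/-- Every family of equivariant operators comes from an element of `W_d`: equivariance says that
the matrix entries at `(g, h)` depend only on the word `b ∘ g⁻¹` and on `g h⁻¹`. -/
lemma exists_kernelOp {Z : WordType ℓ d → Module.End F (MonoidAlgebra F (Equiv.Perm (Fin d)))}
    (hZ : ∀ t x, Z t * rightRep F t.sum_eq x =
      rightRep F t.sum_eq (signTwist OddLetter x) * Z t) :
    ∃ z : Wr F (BA F ℓ) d, ∀ t, kernelOp (letters t.sum_eq) z = Z t := by
  classical
  have hf : ∀ (c : Fin d → Slot ℓ) (w : Equiv.Perm (Fin d)), ∃ r : F,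
      ∀ (t : WordType ℓ d) (g : Equiv.Perm (Fin d)), (fun i => letters t.sum_eq (g.symm i)) = c →
        r = wordSign F (letters t.sum_eq) g * (Z t (MonoidAlgebra.single (w⁻¹ * g) 1)).coeff g := by
    intro c w
    by_cases hc : ∀ i, (c i).Ok
    · obtain ⟨t, g, hg⟩ := WordType.exists_letters hc
      -- Two permutations `g`, `g'` with `b ∘ g⁻¹ = c = b ∘ g'⁻¹` differ by an element of the Young
      -- subgroup, and its sign occurs twice.
      refine ⟨wordSign F (letters t.sum_eq) g *
        (Z t (MonoidAlgebra.single (w⁻¹ * g) 1)).coeff g, fun t' g' hg' => ?_⟩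
      obtain rfl := WordType.eq_of_letters (congrFun (hg.trans hg'.symm))
      obtain ⟨u, rfl⟩ := WordType.exists_of_letters (congrFun (hg.trans hg'.symm))
      rw [wordSign_mul_blockPerm, ← mul_assoc w⁻¹, coeff_of_equivariant (hZ t),
        mul_mul_mul_comm, ← wordSign_blockPerm t.sum_eq, wordSign_mul_self, one_mul]
    · refine ⟨0, fun t g hg => absurd (fun i => ?_) hc⟩
      rw [← hg]
      exact t.letters_ok _
  choose f hf using hf
  refine ⟨∑ c : {c : Fin d → Slot ℓ // ∀ i, (c i).Ok}, ∑ w, f c.1 w • wordElt F c.1 w,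
    fun t => monoidAlgebra_end_ext fun h => ?_⟩
  ext g
  rw [coeff_kernelOp]
  simp only [map_sum, map_smul]
  rw [Finset.sum_eq_single ⟨fun i => letters t.sum_eq (g.symm i), fun i => t.letters_ok _⟩,
    Finset.sum_eq_single (g * h⁻¹)]
  · rw [wordElt, wr, wrCoeff_single, if_pos rfl, wordCoord_path _ fun i => t.letters_ok _,
      if_pos rfl, hf _ _ t g rfl, smul_eq_mul, mul_one, mul_inv_rev, inv_inv,
      inv_mul_cancel_right, mul_comm, ← mul_assoc, wordSign_mul_self, one_mul]
  · intro w _ hw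
    rw [wordElt, wr, wrCoeff_single, if_neg hw, map_zero, smul_zero]
  · simp
  · intro c _ hc
    refine Finset.sum_eq_zero fun w _ => ?_
    rw [wordElt, wr, wrCoeff_single]
    split_ifs
    · rw [wordCoord_path _ c.2, if_neg fun h => hc (Subtype.ext h.symm), smul_zero]
    · rw [map_zero, smul_zero]
  · simp

/-- The permutation of the letters that sends `(j, i)` to the letter of the path ending at `j` that
is the idempotent, comes from `j + 1`, comes from `j - 1`, or has length two, for `i = 0, 1, 2, 3`.
The loop comes from `-1`, and the letter that is not a path takes the place of the missing path from
`ℓ` to `ℓ - 1`. -/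
def tgtFun (b : Slot ℓ) : Slot ℓ :=
  match b.2 with
  | 0 => (b.1, 0)
  | 1 => if h : (b.1 : ℕ) + 1 < ℓ then (⟨b.1 + 1, h⟩, 1) else (b.1, 2)
  | 2 => if (b.1 : ℕ) = 0 then (0, 1) else (⟨b.1 - 1, by omega⟩, 2)
  | 3 => (b.1, 3)

lemma tgt_tgtFun (b : Slot ℓ) : (tgtFun b).tgt = b.1 := by
  obtain ⟨j, i⟩ := b
  fin_cases i
  · rfl
  · simp only [tgtFun]
    split_ifs with h
    · simp [Slot.tgt, leftArrow_down, Arrow.tgt]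
    · simp [Slot.tgt, h]
  · simp only [tgtFun]
    split_ifs with h
    · simp only [Slot.tgt, leftArrow_zero, Arrow.tgt]
      exact Fin.ext (by simp [h])
    · have h1 : (j : ℕ) - 1 + 1 = j := by omega
      simp only [Slot.tgt]
      rw [dif_pos (by omega)]
      exact Fin.ext h1
  · rfl

/-- The inverse of `tgtFun`. -/
def tgtInv (b : Slot ℓ) : Slot ℓ :=
  match b.2 with
  | 0 => (b.1, 0)
  | 1 => if (b.1 : ℕ) = 0 then (b.1, 2) else (⟨b.1 - 1, by omega⟩, 1)
  | 2 => if h : (b.1 : ℕ) + 1 < ℓ then (⟨b.1 + 1, h⟩, 2) else (b.1, 1)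
  | 3 => (b.1, 3)

lemma tgtInv_tgtFun (b : Slot ℓ) : tgtInv (tgtFun b) = b := by
  obtain ⟨j, i⟩ := b
  fin_cases i
  · rfl
  · simp only [tgtFun]
    split_ifs with h
    · simp [tgtInv]
    · simp [tgtInv, h]
  · simp only [tgtFun]
    split_ifs with h
    · simp only [tgtInv]
      rw [if_pos (Fin.val_zero ℓ)]
      exact Prod.ext (Fin.ext (by simp [h])) rfl
    · have h1 : (j : ℕ) - 1 + 1 = j := by omega
      simp only [tgtInv]
      rw [dif_pos (by omega)]
      exact Prod.ext (Fin.ext h1) rfl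
  · rfl

/-- The map `tgtFun` as a permutation of the letters. -/
def tgtPerm : Slot ℓ ≃ Slot ℓ :=
  Equiv.ofBijective tgtFun
    (Finite.injective_iff_bijective.1 (Function.LeftInverse.injective tgtInv_tgtFun))

/-- The letters, sorted by the end vertex of the path. -/
def tgtIndex : Fin ℓ × Fin 4 ≃ Fin (ℓ * 4) := Equiv.trans tgtPerm finProdFinEquiv

lemma tgtIndex_symm_fst (b : Fin (ℓ * 4)) :
    (tgtIndex.symm b).1 = Slot.tgt (ℓ := ℓ) (finProdFinEquiv.symm b) := by
  obtain ⟨c, rfl⟩ := tgtIndex.surjective b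
  rw [Equiv.symm_apply_apply]
  change _ = Slot.tgt (finProdFinEquiv.symm (finProdFinEquiv (tgtFun c)))
  rw [Equiv.symm_apply_apply, tgt_tgtFun]

variable {m m' : Fin ℓ → ℕ} (hm : ∑ j, m j = d) (hm' : ∑ j, m' j = d)

lemma kernelOp_multiIdem_mul {n : Fin (ℓ * 4) → ℕ} (hn : ∑ b, n b = d) (mu : ∀ j, Shape (m j))
    (z : Wr F (BA F ℓ) d) :
    kernelOp (letters hn) (multiIdem F hm mu * z) =
      refOp F hm hn tgtIndex mu * kernelOp (letters hn) z := by
  have h1 : multiIdem F hm mu * z =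
      wordIdem F (blockWord hm) * (permAlg F (BA F ℓ) d (blockAlg hm F (famId F mu)) * z) :=
    mul_assoc _ _ _
  have h2 : (fun g : Equiv.Perm (Fin d) => ∀ i, blockWord hm (g i) = (letters hn i).tgt) =
      Refines hm hn (tgtIndex (ℓ := ℓ)) := by
    funext g
    simp only [Refines, tgtIndex_symm_fst]
    rfl
  rw [h1, kernelOp_wordIdem_mul, kernelOp_permAlg_mul, h2, refOp, ← mul_assoc, resOp_mul_mulLeft]

lemma kernelOp_mul_multiIdem {n : Fin (ℓ * 4) → ℕ} (hn : ∑ b, n b = d) (lam : ∀ j, Shape (m j))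
    (z : Wr F (BA F ℓ) d) :
    kernelOp (letters hn) (z * multiIdem F hm lam) =
      kernelOp (letters hn) z * refOp F hm hn finProdFinEquiv lam := by
  have h1 : z * multiIdem F hm lam =
      z * wordIdem F (blockWord hm) * permAlg F (BA F ℓ) d (blockAlg hm F (famId F lam)) :=
    (mul_assoc _ _ _).symm
  have h2 : (fun g : Equiv.Perm (Fin d) => ∀ i, blockWord hm (g i) = (letters (ℓ := ℓ) hn i).1) =
      Refines hm hn (finProdFinEquiv (m := ℓ) (n := 4)) := rfl
  rw [h1, kernelOp_mul_permAlg, kernelOp_mul_wordIdem, h2, refOp, mul_assoc, resOp_mul_mulLeft]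

/-- The spaces `ε_μ W_d ε_λ` decompose into spaces of equivariant operators. -/
lemma finrank_corner (hF : ∀ j, ((m j).factorial : F) ≠ 0) (hF' : ∀ j, ((m' j).factorial : F) ≠ 0)
    (mu : ∀ j, Shape (m j)) (lam : ∀ j, Shape (m' j)) :
    Module.finrank F (LinearMap.range (LinearMap.mulLeft F (multiIdem F hm mu) ∘ₗ
      LinearMap.mulRight F (multiIdem F hm' lam))) =
    ∑ t : WordType ℓ d, Module.finrank F (equivHom (rightRep F t.sum_eq)
      ((rightRep F t.sum_eq).comp (signTwist OddLetter))
      (refOp F hm' t.sum_eq finProdFinEquiv lam) (refOp F hm t.sum_eq tgtIndex mu)) := by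
  have hk : ∀ (t : WordType ℓ d) (z : Wr F (BA F ℓ) d),
      kernelOp (letters t.sum_eq) (multiIdem F hm mu * (z * multiIdem F hm' lam)) =
        refOp F hm t.sum_eq tgtIndex mu * (kernelOp (letters t.sum_eq) z *
          refOp F hm' t.sum_eq finProdFinEquiv lam) := fun t z => by
    rw [kernelOp_multiIdem_mul, kernelOp_mul_multiIdem]
  refine finrank_range_eq_sum (fun t : WordType ℓ d => kernelOp (letters t.sum_eq))
    (fun _ => eq_zero_of_kernelOp_eq_zero) (fun t z => ?_) fun Z => ?_
  · exact mem_equivHom (kernelOp_mul_rightRep _ _) (hk t z) (refOp_mul_refOp hm' t.sum_eq hF' lam)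
      (refOp_mul_refOp hm t.sum_eq hF mu)
  · obtain ⟨z, hz⟩ := exists_kernelOp (Z := fun t => (Z t).1) fun t x => by
      have h := mul_eq_of_mem_equivHom (Z t).2 x
      rwa [AlgHom.comp_apply] at h
    exact ⟨z, fun t => eq_of_mem_equivHom (Z t).2 (hz t) (hk t z)⟩

end Corner

/-! ### The Cartan numbers -/

section Cartan

variable {F : Type*} [Field F] {ℓ : ℕ} [NeZero ℓ] {d : ℕ}

/-- The rank of a primitive idempotent of the Young subgroup of `n` on the span of the refining
permutations is a product of Littlewood–Richardson coefficients. If the sizes do not match, both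
sides vanish. -/
lemma finrank_refOp_eq_prod_lr {k r K : ℕ} {m : Fin k → ℕ} (hm : ∑ j, m j = d) {n : Fin K → ℕ}
    (hn : ∑ b, n b = d) (π : Fin k × Fin r ≃ Fin K) (hF : ∀ k ≤ d, (k.factorial : F) ≠ 0)
    (lam : ∀ j, Shape (m j)) (nu : ∀ b, Shape (n b)) :
    Module.finrank F (LinearMap.range (rightRep F hn (famId F nu) * refOp F hm hn π lam)) =
      ∏ j, lr (lam j).1 fun i => (nu (π (j, i))).1 := by
  have hle : ∀ {N : ℕ} {s : Fin N → ℕ}, ∑ j, s j = d → ∀ j, s j ≤ d := fun h j =>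
    (Finset.single_le_sum (fun _ _ => Nat.zero_le _) (Finset.mem_univ j)).trans h.le
  by_cases hπ : ∀ j, ∑ i, n (π (j, i)) = m j
  · rw [finrank_refOp hm hn hπ fun j => hF _ (hle hm j)]
    exact Finset.prod_congr rfl fun j _ => (lr_eq_lrNum (hπ j) (fun i => nu (π (j, i))) (lam j)
      (fun i => hF _ (hle hn _)) (hF _ (hle hm j))).symm
  · rw [finrank_refOp_eq_zero hm hn hπ]
    obtain ⟨j, hj⟩ := not_forall.1 hπ
    refine (Finset.prod_eq_zero (Finset.mem_univ j) ?_).symm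
    rw [lr, dif_neg]
    intro h
    refine hj ?_
    rw [(lam j).2] at h
    exact (Finset.sum_congr rfl fun i _ => (nu (π (j, i))).2.symm).trans h

/-- The dimension of `ε_μ W_d ε_λ` as a sum over the types of words and the families of partitions
labelling the irreducible representations of their stabilizers. -/
lemma finrank_cartanIdem (h2 : (2 : F) ≠ 0) (hF : ∀ k ≤ d, (k.factorial : F) ≠ 0)
    (lam mu : Multipartition ℓ d) :
    Module.finrank F (LinearMap.range (LinearMap.mulLeft F (cartanIdem F mu) ∘ₗ
      LinearMap.mulRight F (cartanIdem F lam))) =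
    ∑ t : WordType ℓ d, ∑ nu : ∀ b, Shape (t.1 b),
      (∏ j, lr (lam.part j) fun i => (nu (finProdFinEquiv (j, i))).1) *
        ∏ j, lr (mu.part j) fun i => (twistShape OddLetter nu (tgtIndex (j, i))).1 := by
  have hle : ∀ {N : ℕ} {s : Fin N → ℕ}, ∑ j, s j = d → ∀ j, ((s j).factorial : F) ≠ 0 := fun h j =>
    hF _ ((Finset.single_le_sum (fun _ _ => Nat.zero_le _) (Finset.mem_univ j)).trans h.le)
  rw [cartanIdem, cartanIdem, finrank_corner _ _ (hle mu.sum_card) (hle lam.sum_card)]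
  refine Finset.sum_congr rfl fun t _ => ?_
  have : NeZero (ℓ * 4) := ⟨mul_ne_zero (NeZero.ne ℓ) (by norm_num)⟩
  have hcomm : ∀ x, refOp F mu.sum_card t.sum_eq tgtIndex mu.shape *
      ((rightRep F t.sum_eq).comp (signTwist OddLetter)) x =
        ((rightRep F t.sum_eq).comp (signTwist OddLetter)) x *
          refOp F mu.sum_card t.sum_eq tgtIndex mu.shape := fun x => by
    rw [AlgHom.comp_apply, refOp_mul_rightRep]
  rw [finrank_equivHom (splitFamily_famId h2 (hle t.sum_eq)) _ _
    (refOp_mul_refOp lam.sum_card t.sum_eq (hle lam.sum_card) lam.shape)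
    (refOp_mul_refOp mu.sum_card t.sum_eq (hle mu.sum_card) mu.shape)
    (refOp_mul_rightRep lam.sum_card t.sum_eq lam.shape) hcomm]
  refine Finset.sum_congr rfl fun nu _ => ?_
  have h3 := finrank_refOp_eq_prod_lr lam.sum_card t.sum_eq finProdFinEquiv hF lam.shape nu
  -- On the target side the action is twisted by signs, which conjugates the partition of the loop.
  have h4 := finrank_refOp_eq_prod_lr mu.sum_card t.sum_eq tgtIndex hF mu.shape
    (twistShape OddLetter nu)
  have h5 := (equivIdem_signTwist OddLetter nu (hle t.sum_eq)).finrank_eq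
    (by rw [← map_mul, famId_idem F nu (hle t.sum_eq)])
    (famId_idem F _ (hle t.sum_eq)) (rightRep F t.sum_eq)
    (refOp_mul_rightRep mu.sum_card t.sum_eq (π := tgtIndex) mu.shape)
  rw [AlgHom.comp_apply, h3, h5, h4]
  rfl

end Cartan

/-! ### The sum over quadruples of families of partitions -/

section QuadSum

variable {ℓ : ℕ} [NeZero ℓ] {d : ℕ}

lemma youngDiagram_eq_bot {lam : YoungDiagram} (h : lam.card = 0) : lam = ⊥ :=
  YoungDiagram.ext ((Finset.card_eq_zero.1 h).trans YoungDiagram.cells_bot.symm)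

/-- The partitions in a quadruple as a family indexed by the letters. -/
def Quad.parts (q : Quad ℓ) (b : Fin (ℓ * 4)) : YoungDiagram :=
  ![q.alpha (finProdFinEquiv.symm b).1, q.beta (finProdFinEquiv.symm b).1,
    q.gamma (finProdFinEquiv.symm b).1, q.delta (finProdFinEquiv.symm b).1]
    (finProdFinEquiv.symm b).2

lemma Quad.parts_apply (q : Quad ℓ) (j : Fin ℓ) (i : Fin 4) :
    q.parts (finProdFinEquiv (j, i)) = ![q.alpha j, q.beta j, q.gamma j, q.delta j] i := by
  rw [Quad.parts, Equiv.symm_apply_apply]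

/-- The quadruple given by a family of partitions indexed by the letters. -/
def toQuad (x : Σ t : WordType ℓ d, ∀ b, Shape (t.1 b)) : Quad ℓ where
  alpha j := (x.2 (finProdFinEquiv (j, 0))).1
  beta j := (x.2 (finProdFinEquiv (j, 1))).1
  gamma j := (x.2 (finProdFinEquiv (j, 2))).1
  delta j := (x.2 (finProdFinEquiv (j, 3))).1
  gamma_last j hj := youngDiagram_eq_bot <| (x.2 _).2.trans <| x.1.2.2 _ fun h => by
    rw [Equiv.symm_apply_apply] at h
    have := h rfl
    simp only at this
    omega

lemma vec_toQuad (x : Σ t : WordType ℓ d, ∀ b, Shape (t.1 b)) (j : Fin ℓ) :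
    ![(toQuad x).alpha j, (toQuad x).beta j, (toQuad x).gamma j, (toQuad x).delta j] =
      fun i => (x.2 (finProdFinEquiv (j, i))).1 := by
  funext i
  fin_cases i <;> rfl

lemma parts_toQuad (x : Σ t : WordType ℓ d, ∀ b, Shape (t.1 b)) (b : Fin (ℓ * 4)) :
    (toQuad x).parts b = (x.2 b).1 := by
  obtain ⟨⟨j, i⟩, rfl⟩ := finProdFinEquiv.surjective b
  rw [Quad.parts_apply, vec_toQuad]

lemma toQuad_injective : Function.Injective (toQuad (ℓ := ℓ) (d := d)) := by
  intro x y h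
  have h1 : ∀ b, (x.2 b).1 = (y.2 b).1 := fun b => by rw [← parts_toQuad, h, parts_toQuad]
  obtain ⟨t, nu⟩ := x
  obtain ⟨t', nu'⟩ := y
  obtain rfl : t = t' := Subtype.ext (funext fun b => by
    rw [← (nu b).2, ← (nu' b).2]
    exact congrArg YoungDiagram.card (h1 b))
  obtain rfl : nu = nu' := funext fun b => Subtype.ext (h1 b)
  rfl

/-- A quadruple of total size `d` comes from a type of words. The condition `γ^{(ℓ-1)} = ∅` matches
the missing arrow from `ℓ - 1` to `ℓ`. -/
lemma mem_range_toQuad {q : Quad ℓ} (h : ∑ b, (q.parts b).card = d) :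
    q ∈ Set.range (toQuad (ℓ := ℓ) (d := d)) := by
  refine ⟨⟨⟨fun b => (q.parts b).card, h, fun b hb => ?_⟩, fun b => ⟨q.parts b, rfl⟩⟩, ?_⟩
  · obtain ⟨⟨j, i⟩, rfl⟩ := finProdFinEquiv.surjective b
    rw [Equiv.symm_apply_apply] at hb
    obtain ⟨h2, h3⟩ := Classical.not_imp.1 hb
    simp only at h2 h3
    subst h2
    have h4 : (j : ℕ) + 1 = ℓ := by omega
    have h5 : q.parts (finProdFinEquiv (j, 2)) = q.gamma j := by rw [Quad.parts_apply]; rfl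
    simp only [h5, q.gamma_last j h4]
    rfl
  · obtain ⟨al, be, ga, de, hga⟩ := q
    simp only [toQuad, Quad.parts_apply, Quad.mk.injEq]
    exact ⟨rfl, rfl, rfl, rfl⟩

lemma twistShape_apply {n : Fin (ℓ * 4) → ℕ} (nu : ∀ b, Shape (n b)) (c : Slot ℓ) :
    (twistShape OddLetter nu (finProdFinEquiv c)).1 =
      if c = (0, 1) then (nu (finProdFinEquiv c)).1.transpose else (nu (finProdFinEquiv c)).1 := by
  rw [twistShape]
  have h : OddLetter (finProdFinEquiv c) ↔ c = (0, 1) := by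
    rw [OddLetter, Equiv.symm_apply_apply]
  by_cases hc : c = (0, 1)
  · rw [if_pos (h.2 hc), if_pos hc]; rfl
  · rw [if_neg (hc ∘ h.1), if_neg hc]

/-- The partitions attached to the paths ending at `j`: those ending at `j` come from `j` (for `α`
and `δ`), from `j + 1` (for `β`), and from `j - 1` (for `γ`); if `j = 0`, the last one is the loop,
whose partition is `β^{(0)}` and gets conjugated. -/
lemma vec_twist_toQuad (x : Σ t : WordType ℓ d, ∀ b, Shape (t.1 b)) (j : Fin ℓ) :
    ![(toQuad x).alpha j, nextPart (toQuad x).beta j,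
      prevPart (toQuad x).beta (toQuad x).gamma j, (toQuad x).delta j] =
      fun i => (twistShape OddLetter x.2 (tgtIndex (j, i))).1 := by
  have h0 : ∀ {i c}, tgtFun (j, i) = c → c ≠ (0, 1) →
      (x.2 (finProdFinEquiv c)).1 = (twistShape OddLetter x.2 (tgtIndex (j, i))).1 := by
    rintro i _ rfl hc
    exact ((twistShape_apply x.2 _).trans (if_neg hc)).symm
  have hne : ∀ {i i' : Fin 4} {j j' : Fin ℓ}, i ≠ i' → ((j, i) : Slot ℓ) ≠ (j', i') :=
    fun hi e => hi (congrArg Prod.snd e)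
  funext i
  fin_cases i
  · exact h0 rfl (hne (by decide))
  · change nextPart (toQuad x).beta j = _
    rw [nextPart]
    split_ifs with hj
    · exact h0 (dif_pos hj) fun h => Nat.succ_ne_zero j (congrArg (fun b => (b.1 : ℕ)) h)
    · exact ((toQuad x).gamma_last j (by omega)).symm.trans
        (h0 (dif_neg hj) (hne (by decide)))
  · change prevPart (toQuad x).beta (toQuad x).gamma j = _
    rw [prevPart]
    split_ifs with hj
    · have h1 : tgtFun (j, 2) = (0, 1) := if_pos (congrArg Fin.val hj)
      refine Eq.trans ?_ (twistShape_apply x.2 (tgtFun (j, 2))).symm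
      rw [h1, if_pos rfl]
      rfl
    · exact h0 (if_neg fun h => hj (Fin.ext h)) (hne (by decide))
  · exact h0 rfl (hne (by decide))

/-- In the sum over all quadruples, only those with the right total size contribute. -/
lemma finsum_quad (lam mu : Multipartition ℓ d) :
    ∑ᶠ q : Quad ℓ, ∏ j : Fin ℓ,
        lr (mu.part j) ![q.alpha j, nextPart q.beta j, prevPart q.beta q.gamma j, q.delta j] *
        lr (lam.part j) ![q.alpha j, q.beta j, q.gamma j, q.delta j] =
      ∑ t : WordType ℓ d, ∑ nu : ∀ b, Shape (t.1 b),
        (∏ j, lr (lam.part j) fun i => (nu (finProdFinEquiv (j, i))).1) *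
          ∏ j, lr (mu.part j) fun i => (twistShape OddLetter nu (tgtIndex (j, i))).1 := by
  set f : Quad ℓ → ℕ := fun q => ∏ j : Fin ℓ,
    lr (mu.part j) ![q.alpha j, nextPart q.beta j, prevPart q.beta q.gamma j, q.delta j] *
      lr (lam.part j) ![q.alpha j, q.beta j, q.gamma j, q.delta j] with hf
  have hsupp : Function.support f ⊆ Set.range (toQuad (ℓ := ℓ) (d := d)) := by
    intro q hq
    refine mem_range_toQuad ?_
    have h1 : ∀ j, ∑ i, (![q.alpha j, q.beta j, q.gamma j, q.delta j] i).card =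
        (lam.part j).card := by
      intro j
      by_contra h
      refine hq (Finset.prod_eq_zero (Finset.mem_univ j) ?_)
      rw [show lr (lam.part j) ![q.alpha j, q.beta j, q.gamma j, q.delta j] = 0 from dif_neg h,
        mul_zero]
    rw [← Equiv.sum_comp finProdFinEquiv, Fintype.sum_prod_type, ← lam.sum_card]
    simp only [Quad.parts_apply, h1]
  rw [← finsum_mem_univ f, ← finsum_mem_inter_support, Set.univ_inter,
    ← Set.inter_eq_self_of_subset_right hsupp, finsum_mem_inter_support,
    finsum_mem_range toQuad_injective, finsum_eq_sum_of_fintype, Fintype.sum_sigma]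
  refine Finset.sum_congr rfl fun t _ => Finset.sum_congr rfl fun nu _ => ?_
  rw [hf, ← Finset.prod_mul_distrib]
  refine Finset.prod_congr rfl fun j _ => ?_
  rw [vec_toQuad, vec_twist_toQuad, mul_comm]

end QuadSum

lemma factorial_ne_zero_of_lt {F : Type*} [Field F] (p : ℕ) [CharP F p] {d : ℕ}
    (hd : d < p ∨ p = 0) (k : ℕ) (hk : k ≤ d) : (k.factorial : F) ≠ 0 := by
  intro h
  have h1 := (CharP.cast_eq_zero_iff F p _).1 h
  rcases hd with hd | rfl
  · have hp : p.Prime := (CharP.char_is_prime_or_zero F p).resolve_right (by omega)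
    exact absurd ((hp.dvd_factorial).1 h1) (by omega)
  · exact k.factorial_ne_zero (Nat.eq_zero_of_zero_dvd h1)

lemma two_ne_zero_of_char {F : Type*} [Field F] (p : ℕ) [CharP F p] (hp : p ≠ 2) :
    (2 : F) ≠ 0 := by
  intro h
  have h1 := (CharP.cast_eq_zero_iff F p 2).1 (by exact_mod_cast h)
  rcases (Nat.dvd_prime Nat.prime_two).1 h1 with rfl | rfl
  · exact CharP.char_ne_one F 1 rfl
  · exact hp rfl

end WreathSuper

end

theorem mainTheorem3 (F : Type*) [Field F] [IsAlgClosed F] (p : ℕ) [CharP F p] (hp : p ≠ 2)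
    (ℓ : ℕ) [NeZero ℓ] (d : ℕ) (hd : d < p ∨ p = 0)
    (lam mu : WreathSuper.Multipartition ℓ d) :
    WreathSuper.HasMultiplicity F (WreathSuper.Wd F ℓ d)
      (WreathSuper.PP F lam) (WreathSuper.LL F mu)
      (∑ᶠ q : WreathSuper.Quad ℓ, ∏ j : Fin ℓ,
        WreathSuper.lr (mu.part j) ![q.alpha j, WreathSuper.nextPart q.beta j,
          WreathSuper.prevPart q.beta q.gamma j, q.delta j] *
        WreathSuper.lr (lam.part j) ![q.alpha j, q.beta j, q.gamma j, q.delta j]) := by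
  have h2 := WreathSuper.two_ne_zero_of_char (F := F) p hp
  have hF := WreathSuper.factorial_ne_zero_of_lt (F := F) p hd
  rw [WreathSuper.finsum_quad, ← WreathSuper.finrank_cartanIdem h2 hF]
  exact WreathSuper.hasMultiplicity_finrank mu h2 hF lam
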